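/- **Setting.** Let $H\neq 0$ be a complex Hilbert space with inner product $\langle\cdot,\cdot\rangle$ linear in the first argument, let $\gamma:\mathbb R\to U(H)$ be a strongly continuous unitary one-parameter group with self-adjoint generator $A$ (so $\gamma(t)=e^{itA}$), and assume $A\ge 0$ and $\ker A=0$. Let $V=C^\infty(A)$ be the space of $\gamma$-smooth vectors, $D=iA|_V$, and $$V^{\mathcal O}=\Big\{v\in V:\ q_n(v):=\sum_{k\ge 0}\tfrac{n^k}{k!}\|A^kv\|<\infty\ \text{ for all } n\in\mathbb N\Big\},$$ a Fréchet space for the $C^{\mathcal O}$-topology given by the norms $q_n$. Regard $V^{\mathcal O}$ as a real space, let $V^{\mathcal O}_{\mathbb C}=V^{\mathcal O}\oplus iV^{\mathcal O}$ be its complexification (with $\mathrm{Re},\mathrm{Im}:V^{\mathcal O}_{\mathbb C}\to V^{\mathcal O}$), $D_{\mathbb C}$ the complex-linear extension of $D$, $\omega_{\mathbb C}$ the complex bilinear extension of $\omega_A(x,y)=\mathrm{Im}\langle Ax,y\rangle$, and $\gamma_{\mathbb C}(z)v=\sum_{k\ge0}\frac{z^k}{k!}D_{\mathbb C}^kv$.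 Let $G_{A,\mathbb C}=\mathbb C\times V^{\mathcal O}_{\mathbb C}\times\mathbb C$ with multiplication $$(z,x,s)(z',x',s')=\big(z+z'+\tfrac12\omega_{\mathbb C}(x,\gamma_{\mathbb C}(s)x'),\ x+\gamma_{\mathbb C}(s)x',\ s+s'\big),$$ let $G_A^{\mathcal O}=\mathbb R\times V^{\mathcal O}\times\mathbb R\subset G_{A,\mathbb C}$ be its real subgroup, with Lie algebra $\mathfrak g_A^{\mathcal O}=\mathbb R\times V^{\mathcal O}\times\mathbb R$, and let $\exp_{\mathbb C}$ be the exponential map of $G_{A,\mathbb C}$. Put $W_\infty^{\mathcal O}=\mathbb R\times V^{\mathcal O}\times(0,\infty)\subset\mathfrak g_A^{\mathcal O}$ and $S_A=\{(z,x,s)\in G_{A,\mathbb C}:\mathrm{Im}\,s>0\}$. For $s\in\mathbb R$ define by functional calculus the bounded operators $$f_s(A)=\frac{2sA}{e^{sA}-e^{-sA}},\qquad g_s(A)=\frac{e^{sA}+e^{-sA}-2}{i\,(e^{sA}-e^{-sA})}\quad(s\ne0),\qquad f_0(A)=\mathrm{Id},\quad g_0(A)=0;$$ they leave $V^{\mathcal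 O}$ invariant. For $v\in V^{\mathcal O}$, $s\in\mathbb R$ define $\theta(v,s)\in G_{A,\mathbb C}$ by $$\theta(v,s)=\Big(\tfrac{i}{2s}\|f_s(A)v\|^2-\tfrac{i}{2s}\mathrm{Re}\langle f_s(A)v,v\rangle,\ -g_s(A)v-iv,\ 0\Big)\ (s\neq0),\qquad \theta(v,0)=(0,-iv,0),$$ where in $-g_s(A)v-iv$ the summand $-g_s(A)v$ is an element of $V^{\mathcal O}$ and $-iv\in iV^{\mathcal O}$. Smoothness is meant in the sense of Michal–Bastiani calculus in topological vector spaces. A map between open subsets of complex spaces is holomorphic if it is smooth with complex-linear differentials, and a map between open subsets of real spaces is analytic if locally it extends to a holomorphic map between open subsets of the complexifications. **Proposition.** Consider $\psi(g,w)=g\exp_{\mathbb C}(iw)$ for $g\in G_A^{\mathcal O}$, $w\in\mathfrak g_A^{\mathcal O}$. 1. The map $\psi:G_A^{\mathcal O}\times\mathfrak g_A^{\mathcal O}\to G_{A,\mathbb C}$ is a bijection, $\psi$ is analytic, and $\psi$ and $\psi^{-1}$ are smooth. If $A$ is not bounded, then $\psi^{-1}$ is not analytic on $G_{A,\mathbb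 C}$. 2. For $(z,y,r)\in G_{A,\mathbb C}$ one has $\psi^{-1}(z,y,r)=(g,(t,x,s))$ if and only if $$s=\mathrm{Im}(r),\qquad x=\gamma(-\mathrm{Re}(r))\,f_s(A)(\mathrm{Im}(y)),\qquad g\cdot(it,0,0)=(z,y,0)\cdot\theta(\mathrm{Im}(y),\mathrm{Im}(r))\cdot(0,0,\mathrm{Re}(r)).$$ 3. $\psi$ restricts to a diffeomorphism $G_A^{\mathcal O}\times W_\infty^{\mathcal O}\to S_A$, and both this restriction and its inverse are analytic; the inverse is given by the formulas in 2. 4. The map $\psi^{-1}:S_A\to G_A^{\mathcal O}\times W_\infty^{\mathcal O}$ is also analytic when both sides carry the topology induced by the $C^\infty$-topology on $V^{\mathcal O}$ (given by the seminorms $v\mapsto\|A^kv\|$, $k\ge0$), and it is analytic when $S_A$ carries the topology induced by the graph norm $\|v\|+\|Av\|$ on $V^{\mathcal O}$ and $G_A^{\mathcal O}\times W_\infty^{\mathcal O}$ carries the topology induced by the norm $\|v\|$ on $V^{\mathcal O}$. -/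

import Mathlib

open Filter Topology Set
open scoped ContDiff

noncomputable section

namespace OscPolar

universe u v

/-! ### Differential calculus in real and complex topological vector spaces

Differentiable maps are understood in the Michal–Bastiani sense: directional derivatives exist and
are jointly continuous.  A map is real analytic if it extends locally to a holomorphic map between
the complexifications. -/

section Calculus

/-- `d` is the directional derivative of `f` at `x` in direction `h`. -/
def HasDirDeriv {E : Type u} {F : Type v} [AddCommGroup E] [Module ℝ E]
    [AddCommGroup F] [Module ℝ F] [TopologicalSpace F] (f : E → F) (x h : E) (d : F) : Prop :=
  Tendsto (fun t : ℝ => t⁻¹ • (f (x + t • h) - f x)) (𝓝[≠] 0) (𝓝 d)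

/-- `f` is of class `C^n` on the (open) set `U`: the `C^0` maps are the continuous ones, and `f` is
`C^{n+1}` if all directional derivatives `df (x, h)` exist and `df` is `C^n` on `U × E`. -/
def IsCnOn : (n : ℕ) → {E : Type u} → {F : Type v} →
    [AddCommGroup E] → [Module ℝ E] → [TopologicalSpace E] →
    [AddCommGroup F] → [Module ℝ F] → [TopologicalSpace F] → (E → F) → Set E → Prop
  | 0, _, _, _, _, _, _, _, _, f, U => ContinuousOn f U
  | n + 1, E, F, _, _, _, _, _, _, f, U =>
      ContinuousOn f U ∧ ∃ df : E × E → F,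
        (∀ x ∈ U, ∀ h, HasDirDeriv f x h (df (x, h))) ∧ IsCnOn n df (U ×ˢ (univ : Set E))

/-- `f` is smooth on the open set `U`. -/
def SmoothOn {E : Type u} {F : Type v} [AddCommGroup E] [Module ℝ E] [TopologicalSpace E]
    [AddCommGroup F] [Module ℝ F] [TopologicalSpace F] (f : E → F) (U : Set E) : Prop :=
  IsOpen U ∧ ∀ n : ℕ, IsCnOn n f U

/-- `f` is holomorphic on the open set `U`: it is smooth and its differential at each point is
complex linear. -/
def HolomorphicOn {E : Type u} {F : Type v} [AddCommGroup E] [Module ℂ E] [TopologicalSpace E]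
    [AddCommGroup F] [Module ℂ F] [TopologicalSpace F] (f : E → F) (U : Set E) : Prop :=
  SmoothOn f U ∧ ∀ x ∈ U, ∃ L : E →ₗ[ℂ] F, ∀ h, HasDirDeriv f x h (L h)

/-- The complexification `E ⊕ iE` of a real vector space: the pair `(x, y)` stands for `x + iy`. -/
def Complexification (E : Type u) : Type u := E × E

namespace Complexification

variable {E : Type u}

/-- `x + iy` -/
def mk (x y : E) : Complexification E := (x, y)

/-- real part -/
def re (v : Complexification E) : E := v.1

/-- imaginary part -/
def im (v : Complexification E) : E := v.2

/-- the inclusion of the real vector space into its complexification -/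
def ofReal [Zero E] (x : E) : Complexification E := mk x 0

/-- the element `ix` -/
def ofImag [Zero E] (x : E) : Complexification E := mk 0 x

instance [AddCommGroup E] : AddCommGroup (Complexification E) :=
  inferInstanceAs (AddCommGroup (E × E))

instance [TopologicalSpace E] : TopologicalSpace (Complexification E) :=
  inferInstanceAs (TopologicalSpace (E × E))

@[ext] theorem ext {v w : Complexification E} (h₁ : v.re = w.re) (h₂ : v.im = w.im) : v = w :=
  Prod.ext h₁ h₂

variable [AddCommGroup E]

@[simp] theorem re_add (v w : Complexification E) : (v + w).re = v.re + w.re := rfl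
@[simp] theorem im_add (v w : Complexification E) : (v + w).im = v.im + w.im := rfl
@[simp] theorem re_zero : (0 : Complexification E).re = 0 := rfl
@[simp] theorem im_zero : (0 : Complexification E).im = 0 := rfl

variable [Module ℝ E]

instance : SMul ℂ (Complexification E) :=
  ⟨fun c v => mk (c.re • v.re - c.im • v.im) (c.re • v.im + c.im • v.re)⟩

@[simp] theorem re_smul (c : ℂ) (v : Complexification E) :
    (c • v).re = c.re • v.re - c.im • v.im := rfl
@[simp] theorem im_smul (c : ℂ) (v : Complexification E) :
    (c • v).im = c.re • v.im + c.im • v.re := rfl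

instance : Module ℂ (Complexification E) where
  one_smul v := by ext <;> simp
  mul_smul a b v := by
    ext
    · simp only [re_smul, im_smul, Complex.mul_re, Complex.mul_im]; module
    · simp only [re_smul, im_smul, Complex.mul_re, Complex.mul_im]; module
  smul_zero a := by ext <;> simp
  smul_add a v w := by
    ext
    · simp only [re_smul, re_add, im_add]; module
    · simp only [im_smul, re_add, im_add]; module
  add_smul a b v := by
    ext
    · simp only [re_smul, re_add, Complex.add_re, Complex.add_im]; module
    · simp only [im_smul, im_add, Complex.add_re, Complex.add_im]; module
  zero_smul v := by ext <;> simp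

/-- The complex-linear extension of a real-linear endomorphism, as a map. -/
def map (T : E → E) (v : Complexification E) : Complexification E := mk (T v.re) (T v.im)

end Complexification

/-- `f` is real analytic on the open set `U`: near every point of `U` it is the restriction of a
holomorphic map defined on an open subset of the complexification of `E`, with values in the
complexification of `F`. -/
def RealAnalyticOn {E : Type u} {F : Type v} [AddCommGroup E] [Module ℝ E] [TopologicalSpace E]
    [AddCommGroup F] [Module ℝ F] [TopologicalSpace F] (f : E → F) (U : Set E) : Prop :=
  IsOpen U ∧ ∀ x ∈ U, ∃ (W : Set (Complexification E))
    (fC : Complexification E → Complexification F),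
    Complexification.ofReal x ∈ W ∧ HolomorphicOn fC W ∧
    ∀ y ∈ U, Complexification.ofReal y ∈ W →
      fC (Complexification.ofReal y) = Complexification.ofReal (f y)

/-- Real analyticity with respect to prescribed topologies on source and target. -/
def RealAnalyticOnWrt {E : Type u} {F : Type v} [AddCommGroup E] [Module ℝ E]
    [AddCommGroup F] [Module ℝ F] (τE : TopologicalSpace E) (τF : TopologicalSpace F)
    (f : E → F) (U : Set E) : Prop :=
  @RealAnalyticOn E F _ _ τE _ _ τF f U

end Calculus

/-! ### Semidirect products of Heisenberg groups with one-parameter groups -/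

section Oscillator

variable {K : Type u} {V : Type v}

/-- The multiplication of `Heis(V, ω) ⋊_γ K = (K ×_ω V) ⋊_γ K`. -/
def oscMul [Field K] [AddCommGroup V] (om : V → V → K) (γ : K → V → V) (g h : K × V × K) :
    K × V × K :=
  (g.1 + h.1 + (1 / 2) * om g.2.1 (γ g.2.2 h.2.1), g.2.1 + γ g.2.2 h.2.1, g.2.2 + h.2.2)

/-- `α` is the smooth one-parameter subgroup, with respect to the multiplication `mul`, with initial
velocity `w`.  Here the underlying manifold is a vector space `G`. -/
def IsOneParameterSubgroup {G : Type v} [AddCommGroup G] [Module ℝ G] [TopologicalSpace G]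
    (mul : G → G → G) (w : G) (α : ℝ → G) : Prop :=
  (∀ s t : ℝ, α (s + t) = mul (α s) (α t)) ∧ SmoothOn α univ ∧ HasDirDeriv α 0 1 w

open Classical in
/-- The exponential map: `w` is sent to `α 1`, where `α` is the smooth one-parameter subgroup with
initial velocity `w` (the value is `0` if there is none). -/
def expMap {G : Type v} [AddCommGroup G] [Module ℝ G] [TopologicalSpace G]
    (mul : G → G → G) (w : G) : G :=
  if h : ∃ α : ℝ → G, IsOneParameterSubgroup mul w α then h.choose 1 else 0

end Oscillator

/-! ### Unitary one-parameter groups and their generators -/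

/-- A (strongly continuous) unitary one-parameter group on a complex Hilbert space. -/
structure UnitaryGroup (H : Type u) [NormedAddCommGroup H] [InnerProductSpace ℂ H] where
  /-- the unitary operators -/
  γ : ℝ → H ≃ₗᵢ[ℂ] H
  map_add : ∀ s t x, γ (s + t) x = γ s (γ t x)
  continuous_orbit : ∀ x, Continuous fun t => γ t x

namespace UnitaryGroup

variable {H : Type u} [NormedAddCommGroup H] [InnerProductSpace ℂ H] (S : UnitaryGroup H)

theorem map_zero (x : H) : S.γ 0 x = x := by
  have h := S.map_add 0 0 x
  rw [add_zero] at h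
  exact ((S.γ 0).injective h).symm

theorem hasDerivAt_orbit {x y : H} (h : HasDerivAt (fun t => S.γ t x) y 0) (t : ℝ) :
    HasDerivAt (fun t => S.γ t x) (S.γ t y) t := by
  have h2 : HasDerivAt (fun r : ℝ => S.γ (r - t) x) y t := by
    have := HasDerivAt.scomp (h := fun r : ℝ => r - t) (h' := (1 : ℝ)) t
      (g₁ := fun t => S.γ t x) (g₁' := y) (by simpa using h) ((hasDerivAt_id t).sub_const t)
    simpa [Function.comp_def] using this
  have h3 := ((S.γ t).toContinuousLinearEquiv.toContinuousLinearMap.restrictScalars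
    ℝ).hasFDerivAt.comp_hasDerivAt t h2
  refine h3.congr_of_eventuallyEq (Eventually.of_forall fun r => ?_)
  have := S.map_add t (r - t) x
  simpa using this

/-- The generator `A`, characterized by `γ t = e^{itA}`: its domain consists of the vectors with
differentiable orbit map, and `A x = -i (d/dt) γ(t) x` at `t = 0`. -/
def generator : H →ₗ.[ℂ] H where
  domain :=
    { carrier := {x | DifferentiableAt ℝ (fun t => S.γ t x) 0}
      zero_mem' := by simp
      add_mem' := by
        intro x y hx hy
        have := DifferentiableAt.fun_add hx hy
        simpa using this
      smul_mem' := by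
        intro c x hx
        have := DifferentiableAt.fun_const_smul hx c
        simpa using this }
  toFun :=
    { toFun := fun x => -Complex.I • deriv (fun t => S.γ t (x : H)) 0
      map_add' := by
        rintro ⟨x, hx⟩ ⟨y, hy⟩
        have := deriv_fun_add hx hy
        simp [this]
      map_smul' := by
        rintro c ⟨x, hx⟩
        have := deriv_fun_const_smul c hx
        simp [this, smul_comm c Complex.I] }

theorem hasDerivAt_generator (x : S.generator.domain) :
    HasDerivAt (fun t => S.γ t (x : H)) (Complex.I • S.generator x) 0 := by
  have h : HasDerivAt (fun t => S.γ t (x : H)) (deriv (fun t => S.γ t (x : H)) 0) 0 :=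
    DifferentiableAt.hasDerivAt x.2
  convert h using 1
  change Complex.I • (-Complex.I • deriv (fun t => S.γ t (x : H)) 0) = _
  rw [smul_smul]; simp

theorem generator_eq_of_hasDerivAt {x y : H} (h : HasDerivAt (fun t => S.γ t x) y 0) :
    ∃ hx : x ∈ S.generator.domain, S.generator ⟨x, hx⟩ = -Complex.I • y :=
  ⟨h.differentiableAt, congrArg (fun z => -Complex.I • z) h.deriv⟩

end UnitaryGroup

/-- The data of a standard oscillator group: a unitary one-parameter group whose self-adjoint
generator `A` satisfies `A ≥ 0` and `ker A = 0`. -/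
structure StandardOscillator (H : Type u) [NormedAddCommGroup H] [InnerProductSpace ℂ H] extends
    UnitaryGroup H where
  nonneg : ∀ x : toUnitaryGroup.generator.domain,
    0 ≤ (inner ℂ (x : H) (toUnitaryGroup.generator x)).re
  ker_eq_zero : ∀ x : toUnitaryGroup.generator.domain, toUnitaryGroup.generator x = 0 → x = 0

namespace StandardOscillator

variable {H : Type u} [NormedAddCommGroup H] [InnerProductSpace ℂ H] (S : StandardOscillator H)

/-- The operator `A`. -/
abbrev A : H →ₗ.[ℂ] H := S.toUnitaryGroup.generator

/-- `A` is a bounded operator. -/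
def IsBoundedGenerator : Prop := ∃ C : ℝ, ∀ x : S.A.domain, ‖S.A x‖ ≤ C * ‖(x : H)‖

/-! ### Smooth and holomorphic vectors -/

/-- The space `V = C^∞(A)` of vectors with smooth orbit map. -/
def smoothVec : Submodule ℂ H where
  carrier := {x | ContDiff ℝ ∞ fun t => S.γ t x}
  zero_mem' := by simpa using contDiff_const
  add_mem' := by
    intro x y hx hy
    have : ContDiff ℝ ∞ fun t => S.γ t x + S.γ t y := ContDiff.add hx hy
    simpa using this
  smul_mem' := by
    intro c x hx
    have : ContDiff ℝ ∞ fun t => c • S.γ t x := ContDiff.const_smul c hx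
    simpa using this

theorem smooth_domain (x : S.smoothVec) : (x : H) ∈ S.A.domain :=
  (ContDiff.differentiable (𝕜 := ℝ) (n := ∞) (f := fun t => S.γ t (x : H)) x.2
    (by simp)).differentiableAt

theorem smooth_A (x : S.smoothVec) : S.A ⟨x, S.smooth_domain x⟩ ∈ S.smoothVec := by
  have h1 := S.hasDerivAt_orbit (S.hasDerivAt_generator ⟨x, S.smooth_domain x⟩)
  have h2 : deriv (fun t => S.γ t (x : H)) =
      fun t => S.γ t (Complex.I • S.A ⟨x, S.smooth_domain x⟩) := funext fun t => (h1 t).deriv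
  have h3 : ContDiff ℝ ∞ (deriv fun t => S.γ t (x : H)) :=
    (contDiff_infty_iff_deriv.1 x.2).2
  rw [h2] at h3
  have h4 : Complex.I • S.A ⟨x, S.smooth_domain x⟩ ∈ S.smoothVec := h3
  have h5 := S.smoothVec.smul_mem (-Complex.I) h4
  rw [smul_smul] at h5
  simpa using h5

/-- `A` as an endomorphism of `C^∞(A)`. -/
def smoothA : S.smoothVec →ₗ[ℂ] S.smoothVec where
  toFun x := ⟨S.A ⟨x, S.smooth_domain x⟩, S.smooth_A x⟩
  map_add' x y := Subtype.ext
    (S.A.map_add ⟨x, S.smooth_domain x⟩ ⟨y, S.smooth_domain y⟩)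
  map_smul' c x := Subtype.ext (S.A.map_smul c ⟨x, S.smooth_domain x⟩)

/-- The terms of the series `q_n(v) = ∑_k (n^k / k!) ‖A^k v‖`. -/
def qTerm (n : ℕ) (v : S.smoothVec) (k : ℕ) : ℝ :=
  (n : ℝ) ^ k / (k.factorial : ℝ) * ‖(S.smoothA ^ k) v‖

theorem qTerm_nonneg (n : ℕ) (v : S.smoothVec) (k : ℕ) : 0 ≤ S.qTerm n v k := by
  unfold qTerm; positivity

theorem qTerm_add_le (n : ℕ) (v w : S.smoothVec) (k : ℕ) :
    S.qTerm n (v + w) k ≤ S.qTerm n v k + S.qTerm n w k := by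
  unfold qTerm
  rw [_root_.map_add, ← mul_add]
  gcongr
  exact norm_add_le _ _

theorem qTerm_smul (n : ℕ) (c : ℂ) (v : S.smoothVec) (k : ℕ) :
    S.qTerm n (c • v) k = ‖c‖ * S.qTerm n v k := by
  unfold qTerm
  rw [_root_.map_smul, norm_smul]
  ring

/-- The subspace of `γ`-holomorphic vectors of `V`: those `v` with `q_n(v) < ∞` for all `n`. -/
def holVec : Submodule ℂ S.smoothVec where
  carrier := {v | ∀ n : ℕ, Summable (S.qTerm n v)}
  zero_mem' := by
    intro n
    have : S.qTerm n 0 = 0 := by funext k; simp [qTerm]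
    rw [this]; exact summable_zero
  add_mem' := by
    intro v w hv hw n
    exact Summable.of_nonneg_of_le (S.qTerm_nonneg n _) (S.qTerm_add_le n v w)
      ((hv n).add (hw n))
  smul_mem' := by
    intro c v hv n
    have : S.qTerm n (c • v) = fun k => ‖c‖ * S.qTerm n v k := funext (S.qTerm_smul n c v)
    rw [this]; exact (hv n).mul_left _

/-- The space `V^𝒪` of `γ`-holomorphic vectors. -/
def VO : Type u := ↥S.holVec

instance : AddCommGroup S.VO := inferInstanceAs (AddCommGroup ↥S.holVec)
instance : Module ℂ S.VO := inferInstanceAs (Module ℂ ↥S.holVec)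

/-- The inclusion `V^𝒪 ⊆ V = C^∞(A)`. -/
def toV : S.VO →ₗ[ℂ] S.smoothVec := S.holVec.subtype

/-- The inclusion `V^𝒪 ⊆ H`. -/
def toH : S.VO →ₗ[ℂ] H := S.smoothVec.subtype ∘ₗ S.toV

theorem toV_mem (v : S.VO) : S.toV v ∈ S.holVec := (show ↥S.holVec from v).2

theorem smoothA_mem (v : S.smoothVec) (hv : v ∈ S.holVec) : S.smoothA v ∈ S.holVec := by
  intro n
  have h := (summable_nat_add_iff 1).2 (hv (2 * (n + 1)))
  refine Summable.of_nonneg_of_le (S.qTerm_nonneg n _) (fun k => ?_) h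
  have e : (S.smoothA ^ k) (S.smoothA v) = (S.smoothA ^ (k + 1)) v := by
    rw [pow_succ]; rfl
  unfold qTerm
  rw [e]
  refine mul_le_mul_of_nonneg_right ?_ (norm_nonneg _)
  rw [Nat.factorial_succ, div_le_div_iff₀ (by positivity) (by positivity)]
  have h1 : ((k : ℝ) + 1) ≤ 2 ^ (k + 1) := by
    exact_mod_cast (Nat.lt_two_pow_self (n := k + 1)).le
  have h2 : (n : ℝ) ^ k ≤ ((n : ℝ) + 1) ^ (k + 1) :=
    (pow_le_pow_left₀ (by positivity) (by linarith) k).trans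
      (pow_le_pow_right₀ (by linarith [(Nat.cast_nonneg n : (0 : ℝ) ≤ n)]) (Nat.le_succ k))
  push_cast
  rw [mul_pow]
  have h3 : (n : ℝ) ^ k * ((k : ℝ) + 1) ≤ 2 ^ (k + 1) * ((n : ℝ) + 1) ^ (k + 1) := by
    rw [mul_comm]
    exact mul_le_mul h1 h2 (by positivity) (by positivity)
  nlinarith [mul_le_mul_of_nonneg_right h3 (Nat.cast_nonneg k.factorial : (0 : ℝ) ≤ _)]

/-- `A` as an endomorphism of `V^𝒪`. -/
def AO : S.VO →ₗ[ℂ] S.VO := S.smoothA.restrict S.smoothA_mem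

/-- `D = iA` as an endomorphism of `V^𝒪`. -/
def DO (v : S.VO) : S.VO := Complex.I • S.AO v

/-! ### Topologies on `V^𝒪` -/

/-- The seminorms `q_n(v) = ∑_k (n^k / k!) ‖A^k v‖` on `V^𝒪`. -/
def qSeminorm : SeminormFamily ℝ S.VO ℕ := fun n =>
  Seminorm.of (fun v => ∑' k, S.qTerm n (S.toV v) k)
    (fun v w => by
      have hv := S.toV_mem v n
      have hw := S.toV_mem w n
      have hvw := S.toV_mem (v + w) n
      rw [← hv.tsum_add hw]
      refine Summable.tsum_le_tsum (fun k => ?_) hvw (hv.add hw)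
      rw [LinearMap.map_add]
      exact S.qTerm_add_le n _ _ k)
    (fun c v => by
      rw [← tsum_mul_left]
      refine tsum_congr fun k => ?_
      have e : S.toV (c • v) = (c : ℂ) • S.toV v := S.toV.map_smul (c : ℂ) v
      rw [e, S.qTerm_smul]
      simp)

/-- The seminorms `v ↦ ‖A^k v‖` on `V^𝒪`. -/
def powSeminorm : SeminormFamily ℝ S.VO ℕ := fun k =>
  Seminorm.of (fun v => ‖S.toH ((S.AO ^ k) v)‖)
    (fun v w => by
      rw [LinearMap.map_add, LinearMap.map_add]; exact norm_add_le _ _)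
    (fun c v => by
      have e : (S.AO ^ k) (c • v) = (c : ℂ) • (S.AO ^ k) v := (S.AO ^ k).map_smul (c : ℂ) v
      rw [e, LinearMap.map_smul, norm_smul]; simp)

/-- The `C^𝒪`-topology on `V^𝒪`, given by the seminorms `q_n`; it is the default one. -/
instance : TopologicalSpace S.VO := S.qSeminorm.moduleFilterBasis.topology

/-- The `C^∞`-topology on `V^𝒪`, given by the seminorms `v ↦ ‖A^k v‖`, `k ≥ 0`. -/
abbrev topSmooth : TopologicalSpace S.VO := S.powSeminorm.moduleFilterBasis.topology

/-- The topology on `V^𝒪` given by the norm `‖v‖` of `H`. -/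
abbrev topNorm : TopologicalSpace S.VO :=
  SeminormFamily.moduleFilterBasis (𝕜 := ℝ) (fun _ : Unit => S.powSeminorm 0) |>.topology

/-- The topology on `V^𝒪` given by the graph norm `‖v‖ + ‖A v‖`. -/
abbrev topGraph : TopologicalSpace S.VO :=
  SeminormFamily.moduleFilterBasis (𝕜 := ℝ)
    (fun _ : Unit => S.powSeminorm 0 + S.powSeminorm 1) |>.topology

/-! ### Operators commuting with the one-parameter group -/


theorem commuting_smooth (T : H →L[ℂ] H) (hT : ∀ t x, T (S.γ t x) = S.γ t (T x))
    (x : S.smoothVec) : T x ∈ S.smoothVec := by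
  have h : ContDiff ℝ ∞ fun t => T (S.γ t (x : H)) :=
    (T.restrictScalars ℝ).contDiff.comp x.2
  simp only [hT] at h
  exact h

theorem commuting_A (T : H →L[ℂ] H) (hT : ∀ t x, T (S.γ t x) = S.γ t (T x))
    (x : S.smoothVec) :
    S.smoothA ⟨T x, S.commuting_smooth T hT x⟩ =
      ⟨T (S.smoothA x), S.commuting_smooth T hT _⟩ := by
  have h1 := S.hasDerivAt_generator ⟨x, S.smooth_domain x⟩
  have h2 := (T.restrictScalars ℝ).hasFDerivAt.comp_hasDerivAt (0 : ℝ) h1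
  have h3 : HasDerivAt (fun t => S.γ t (T x)) (T (Complex.I • S.A ⟨x, S.smooth_domain x⟩)) 0 := by
    have e : (fun t => S.γ t (T x)) = (T.restrictScalars ℝ) ∘ fun t => S.γ t (x : H) := by
      funext t; simp [hT]
    rw [e]; exact h2
  obtain ⟨_, h4⟩ := S.generator_eq_of_hasDerivAt h3
  refine Subtype.ext ?_
  change S.A ⟨T x, _⟩ = T (S.A ⟨x, S.smooth_domain x⟩)
  rw [h4, _root_.map_smul, smul_smul]; simp

theorem commuting_A_pow (T : H →L[ℂ] H) (hT : ∀ t x, T (S.γ t x) = S.γ t (T x))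
    (k : ℕ) (x : S.smoothVec) :
    (((S.smoothA ^ k) ⟨T x, S.commuting_smooth T hT x⟩ : S.smoothVec) : H) =
      T ((S.smoothA ^ k) x : S.smoothVec) := by
  induction k generalizing x with
  | zero => rfl
  | succ k ih =>
    have e (y : S.smoothVec) : (S.smoothA ^ (k + 1)) y = (S.smoothA ^ k) (S.smoothA y) := by
      rw [pow_succ]; rfl
    rw [e, e, S.commuting_A T hT, ih]

theorem commuting_hol (T : H →L[ℂ] H) (hT : ∀ t x, T (S.γ t x) = S.γ t (T x))
    (v : S.holVec) :
    (⟨T v.1, S.commuting_smooth T hT v.1⟩ : S.smoothVec) ∈ S.holVec := by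
  intro n
  refine Summable.of_nonneg_of_le (S.qTerm_nonneg n _) (fun k => ?_) ((v.2 n).mul_left ‖T‖)
  have h : ‖(S.smoothA ^ k) (⟨T v.1, S.commuting_smooth T hT v.1⟩ : S.smoothVec)‖ ≤
      ‖T‖ * ‖(S.smoothA ^ k) v.1‖ := by
    rw [Submodule.coe_norm, S.commuting_A_pow T hT]
    exact T.le_opNorm _
  unfold qTerm
  calc _ ≤ (n : ℝ) ^ k / (k.factorial : ℝ) * (‖T‖ * ‖(S.smoothA ^ k) v.1‖) := by gcongr
    _ = _ := by ring

/-- The restriction to `V^𝒪` of a bounded operator that commutes with all `γ t`. -/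
def restrictVO (T : H →L[ℂ] H) (hT : ∀ t x, T (S.γ t x) = S.γ t (T x)) (v : S.VO) : S.VO :=
  (⟨⟨T (S.toH v), S.commuting_smooth T hT (S.toV v)⟩,
    S.commuting_hol T hT ⟨S.toV v, S.toV_mem v⟩⟩ : ↥S.holVec)


/-! ### Functional calculus of `A` -/

theorem eq_of_add_A_eq {y z : S.A.domain}
    (h : (y : H) + S.A y = (z : H) + S.A z) : y = z := by
  have h1 : ((y - z : S.A.domain) : H) + S.A (y - z) = 0 := by
    rw [LinearPMap.map_sub, Submodule.coe_sub, sub_add_sub_comm, h, sub_self]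
  have h2 := S.nonneg (y - z)
  have h3 : (inner ℂ ((y - z : S.A.domain) : H)
      (((y - z : S.A.domain) : H) + S.A (y - z))).re = 0 := by rw [h1]; simp
  rw [inner_add_right, Complex.add_re] at h3
  have h4 : (inner ℂ ((y - z : S.A.domain) : H) ((y - z : S.A.domain) : H)).re =
      ‖((y - z : S.A.domain) : H)‖ ^ 2 := inner_self_eq_norm_sq (𝕜 := ℂ) _
  have h5 : ‖((y - z : S.A.domain) : H)‖ ^ 2 ≤ 0 := by rw [← h4]; linarith
  have h6 : ((y - z : S.A.domain) : H) = 0 := by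
    rw [← norm_eq_zero]; exact pow_eq_zero_iff (two_ne_zero) |>.1 (le_antisymm h5 (sq_nonneg _))
  exact sub_eq_zero.1 (Subtype.ext h6)

/-- `R` is the bounded operator `(1 + A)⁻¹`. -/
def IsResolvent (R : H →L[ℂ] H) : Prop :=
  ∀ x, ∃ hx : R x ∈ S.A.domain, R x + S.A ⟨R x, hx⟩ = x

open Classical in
/-- The bounded operator `(1 + A)⁻¹`. -/
def resolvent : H →L[ℂ] H := if h : ∃ R : H →L[ℂ] H, S.IsResolvent R then h.choose else 0

theorem A_comm (t : ℝ) (y : S.A.domain) :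
    ∃ h : S.γ t y ∈ S.A.domain, S.A ⟨S.γ t y, h⟩ = S.γ t (S.A y) := by
  have h1 := S.hasDerivAt_generator y
  have h2 := ((S.γ t).toContinuousLinearEquiv.toContinuousLinearMap.restrictScalars
    ℝ).hasFDerivAt.comp_hasDerivAt (0 : ℝ) h1
  have h3 : HasDerivAt (fun r => S.γ r (S.γ t y)) (S.γ t (Complex.I • S.A y)) 0 := by
    refine h2.congr_of_eventuallyEq (Eventually.of_forall fun r => ?_)
    have := S.map_add r t y
    rw [add_comm, S.map_add] at this
    exact this.symm
  obtain ⟨h, h4⟩ := S.generator_eq_of_hasDerivAt h3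
  refine ⟨h, h4.trans ?_⟩
  rw [_root_.map_smul, smul_smul]; simp

theorem resolvent_comm (t : ℝ) (x : H) : S.resolvent (S.γ t x) = S.γ t (S.resolvent x) := by
  unfold resolvent
  split_ifs with h
  · obtain ⟨h1, e1⟩ := h.choose_spec x
    obtain ⟨h2, e2⟩ := h.choose_spec (S.γ t x)
    obtain ⟨h3, e3⟩ := S.A_comm t ⟨_, h1⟩
    have e4 := S.eq_of_add_A_eq (y := ⟨_, h2⟩) (z := ⟨_, h3⟩) (by
      rw [e2, e3]
      change S.γ t x = S.γ t (h.choose x) + _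
      rw [← _root_.map_add, e1])
    exact congrArg Subtype.val e4
  · simp

variable [CompleteSpace H]

/-- The functional calculus `φ(A)` of the operator `A ≥ 0`, for functions `φ` that are continuous
on `[0, ∞]` (i.e. continuous on `[0, ∞)` with a limit at `∞`).  Since `A = R⁻¹ - 1` with
`R = (1 + A)⁻¹` and `0 ≤ R ≤ 1`, it is the continuous functional calculus of `R` applied to the
function `r ↦ φ(r⁻¹ - 1)`, which extends continuously to `r = 0`. -/
def funCalc (φ : ℝ → ℂ) : H →L[ℂ] H :=
  cfc (fun r : ℂ => if r = 0 then limUnder atTop φ else φ (r.re⁻¹ - 1)) S.resolvent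

theorem funCalc_comm (φ : ℝ → ℂ) (t : ℝ) (x : H) :
    S.funCalc φ (S.γ t x) = S.γ t (S.funCalc φ x) := by
  let U (t : ℝ) : H →L[ℂ] H := (S.γ t).toContinuousLinearEquiv.toContinuousLinearMap
  have hU (t : ℝ) : Commute S.resolvent (U t) :=
    ContinuousLinearMap.ext fun x => S.resolvent_comm t x
  have hinv (x : H) : S.γ t (S.γ (-t) x) = x := by
    rw [← S.map_add, add_neg_cancel, S.map_zero]
  have hstar : star (U (-t)) = U t := by
    rw [ContinuousLinearMap.star_eq_adjoint]
    refine ((ContinuousLinearMap.eq_adjoint_iff (U t) (U (-t))).2 fun x y => ?_).symm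
    change inner ℂ (S.γ t x) y = inner ℂ x (S.γ (-t) y)
    conv_lhs => rw [← hinv y]
    exact (S.γ t).inner_map_map _ _
  have h2 : Commute (star S.resolvent) (U t) := by
    rw [← hstar]; exact (hU (-t)).star_star
  have := (hU t).cfc h2 (fun r : ℂ => if r = 0 then limUnder atTop φ else φ (r.re⁻¹ - 1))
  exact congrArg (fun T : H →L[ℂ] H => T x) this.eq

/-- `f_s(x) = 2sx / (e^{sx} - e^{-sx})`, with value `1` at `sx = 0`. -/
def fFun (s x : ℝ) : ℂ :=
  if s * x = 0 then 1
  else (2 * s * x) / (Complex.exp (s * x) - Complex.exp (-(s * x)))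

/-- `g_s(x) = (e^{sx} + e^{-sx} - 2) / (i (e^{sx} - e^{-sx}))`, with value `0` at `sx = 0`. -/
def gFun (s x : ℝ) : ℂ :=
  if s * x = 0 then 0
  else (Complex.exp (s * x) + Complex.exp (-(s * x)) - 2) /
    (Complex.I * (Complex.exp (s * x) - Complex.exp (-(s * x))))

/-- The operator `f_s(A)` on `V^𝒪`. -/
def fA (s : ℝ) : S.VO → S.VO := S.restrictVO (S.funCalc (fFun s)) (S.funCalc_comm (fFun s))

/-- The operator `g_s(A)` on `V^𝒪`. -/
def gA (s : ℝ) : S.VO → S.VO := S.restrictVO (S.funCalc (gFun s)) (S.funCalc_comm (gFun s))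

/-- The operator `γ(t)` on `V^𝒪`. -/
def γO (t : ℝ) : S.VO → S.VO :=
  S.restrictVO (S.γ t).toContinuousLinearEquiv.toContinuousLinearMap fun r x => by
    have h := S.map_add t r x
    rw [add_comm, S.map_add] at h
    exact h.symm

/-! ### The groups `G_A^𝒪` and `G_{A,ℂ}` -/

/-- `ω_A(x, y) = Im ⟨A x, y⟩`, where `⟨·,·⟩` is linear in its first argument (Mathlib's inner
product is linear in the second one). -/
def om (x y : S.VO) : ℝ := (inner ℂ (S.toH y) (S.toH (S.AO x))).im

/-- The complexification `V_ℂ^𝒪` of the real vector space `V^𝒪`. -/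
abbrev VC : Type u := Complexification S.VO

/-- The complex bilinear extension `ω_ℂ` of `ω_A`. -/
def omC (v w : S.VC) : ℂ :=
  ((S.om v.re w.re - S.om v.im w.im : ℝ) : ℂ) +
    ((S.om v.re w.im + S.om v.im w.re : ℝ) : ℂ) * Complex.I

/-- The complex-linear extension `D_ℂ` of `D`. -/
def DC : S.VC → S.VC := Complexification.map S.DO

/-- `γ_ℂ(z) v = ∑_k (z^k / k!) D_ℂ^k v`, a convergent series in the Fréchet space `V_ℂ^𝒪`. -/
def γC (z : ℂ) (v : S.VC) : S.VC := ∑' k : ℕ, (z ^ k / (k.factorial : ℂ)) • (S.DC^[k] v)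

/-- The underlying space `ℝ × V^𝒪 × ℝ` of the group `G_A^𝒪` and of its Lie algebra `𝔤_A^𝒪`. -/
abbrev GO : Type u := ℝ × S.VO × ℝ

/-- The underlying space `ℂ × V_ℂ^𝒪 × ℂ` of the group `G_{A,ℂ}` and of its Lie algebra. -/
abbrev GC : Type u := ℂ × S.VC × ℂ

/-- The multiplication of `G_A^𝒪 = Heis(V^𝒪, ω_A) ⋊_γ ℝ`. -/
def mulO : S.GO → S.GO → S.GO := oscMul S.om S.γO

/-- The multiplication of `G_{A,ℂ} = Heis_ℂ(V_ℂ^𝒪, ω_ℂ) ⋊_{γ_ℂ} ℂ`. -/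
def mulC : S.GC → S.GC → S.GC := oscMul S.omC S.γC

/-- The inclusion `G_A^𝒪 ⊆ G_{A,ℂ}`. -/
def incl (g : S.GO) : S.GC := ((g.1 : ℂ), Complexification.ofReal g.2.1, (g.2.2 : ℂ))

/-- The element `iw` of the complex Lie algebra, for `w ∈ 𝔤_A^𝒪`. -/
def imagIncl (w : S.GO) : S.GC :=
  (Complex.I * (w.1 : ℂ), Complexification.ofImag w.2.1, Complex.I * (w.2.2 : ℂ))

/-- The exponential map of `G_{A,ℂ}`. -/
def expC : S.GC → S.GC := expMap S.mulC

/-- The polar map `ψ(g, w) = g exp_ℂ(iw)`. -/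
def polarMap (p : S.GO × S.GO) : S.GC := S.mulC (S.incl p.1) (S.expC (S.imagIncl p.2))

/-- The cone `W_∞^𝒪 = ℝ × V^𝒪 × (0, ∞)`. -/
def cone : Set S.GO := {w | 0 < w.2.2}

/-- The semigroup `S_A = {(z, x, s) ∈ G_{A,ℂ} : Im s > 0}`. -/
def semigroup : Set S.GC := {q | 0 < q.2.2.im}

/-- The map `θ : V^𝒪 × ℝ → Heis(V_ℂ^𝒪, ω_ℂ) ⊆ G_{A,ℂ}`. -/
def theta (v : S.VO) (s : ℝ) : S.GC :=
  if s = 0 then (0, Complexification.mk 0 (-v), 0)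
  else
    (Complex.I / (2 * s) * ((‖S.toH (S.fA s v)‖ ^ 2 : ℝ) : ℂ) -
      Complex.I / (2 * s) * (((inner ℂ (S.toH (S.fA s v)) (S.toH v)).re : ℝ) : ℂ),
      Complexification.mk (-(S.gA s v)) (-v), 0)

/-- The topology on `(ℝ × V^𝒪 × ℝ) × (ℝ × V^𝒪 × ℝ)` induced by a topology on `V^𝒪`. -/
abbrev topPolar (τ : TopologicalSpace S.VO) : TopologicalSpace (S.GO × S.GO) :=
  letI := τ; inferInstance

/-- The topology on `ℂ × V_ℂ^𝒪 × ℂ` induced by a topology on `V^𝒪`. -/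
abbrev topC (τ : TopologicalSpace S.VO) : TopologicalSpace S.GC :=
  letI := τ; inferInstance

end StandardOscillator

end OscPolar

end

open OscPolar

open Filter Topology Set
open scoped ContDiff

noncomputable section

namespace OscPolar

universe u v w

/-! ### Strict directional derivatives -/

section Strict

section

variable {E : Type u} [TopologicalSpace E]

/-! The proof rests on a closed formula for the exponential map. With e_j(z) = ∑ z^k/(k+j)!, one has
exp_ℂ(ζ,ξ,σ) = (ζ + ½ω_ℂ(ξ, e_2(σD_ℂ)ξ), e_1(σD_ℂ)ξ, σ), see `expE` and `expC_eq`. The homomorphism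
property comes down to two scalar identities, `ent_one_add` and `ent_two_add`; uniqueness of
one-parameter subgroups comes from the triangular shape of the left-invariant differential equation.
Since (z,v) ↦ e_j(zD_ℂ)v is holomorphic (`hol_serE`), ψ extends holomorphically, hence is analytic
and smooth.

Inserting i(t,x,s) shows that the V-component of ψ((z₀,v,r),(t,x,s)) has imaginary part b = γ(r)
(sinh(sA)/(sA)) x and real part v + g_s(A)b (`polarMap_mk`, `γO_chA`). As f_s(A) inverts
sinh(sA)/(sA), one reads off r and s, then x and v, then z₀ and t; this is `polarInv`, and it gives
bijectivity and the formulas. The scalar part of θ is the quadratic term of the exponential,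
rewritten by means of `mul_kap`.

Identities between operators, some of them unbounded in the norm of H, are reduced to identities
between functions. The bounded operator R = (1+A)⁻¹ exists by a Laplace transform and a Neumann
series (`exists_resolvent`), and its continuous functional calculus acts on V^𝒪. An operator on V^𝒪
has symbol h if it becomes multiplication by h after cutting off large spectral values (`IsSym`).
The symbol determines the operator (`IsSym.eq`), and power series in A that converge on V^𝒪 have the
expected symbol (`isSym_ser`). On the complexification the same is done on the two eigenspaces of
the original complex structure (`IsSymC`).

For smoothness of ψ⁻¹ the critical term is f_s(A), which is not an entire function of sA. It is the
inverse of a smooth family of linear maps, and its norm is at most 1 for all real s; hence it is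
jointly continuous, and the formula for the derivative of an inverse gives all orders
(`Cn.of_inverse_family`, `cn_fA`).

For s > 0 the parameter s may move into a complex sector. There f_s(A) and g_s(A) stay bounded and
depend holomorphically on s in the algebra of continuous functions on the spectrum of R; part of the
decay of f_s absorbs e^{-irA} with r slightly complex. Bounded functions of A do not increase any
seminorm ‖A^k v‖ by more than their sup norm, so a single argument covers all the topologies; only
ω_A requires control of ‖Av‖ (`realAnalyticOn_of_families`, `realAnalyticOnWrt_polarInv`).

If A is unbounded and ψ⁻¹ were analytic at 0, then σ ↦ f_σ(A)v would extend holomorphically, bounded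
by 1, to one fixed disc for all v small in some q_n. Applying sinh(τA)/(τA) to the extension returns
v on the whole disc by the identity theorem. However, at τ = iπ/x₀, which lies in the disc for a
large spectral value x₀, that operator nearly annihilates vectors localized near x₀: a contradiction
(`not_realAnalyticOn_polarInv`). -/

theorem eventually_ne_zero_dir (x h : E) :
    ∀ᶠ p : (E × E) × ℝ in (𝓝 x ×ˢ 𝓝 h) ×ˢ 𝓝[≠] 0, p.2 ≠ 0 :=
  (tendsto_snd (f := 𝓝 x ×ˢ 𝓝 h)).eventually eventually_mem_nhdsWithin

theorem tendsto_dir_fst (x h : E) :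
    Tendsto (fun p : (E × E) × ℝ => p.1.1) ((𝓝 x ×ˢ 𝓝 h) ×ˢ 𝓝[≠] 0) (𝓝 x) :=
  tendsto_fst.comp tendsto_fst

theorem tendsto_dir_snd (x h : E) :
    Tendsto (fun p : (E × E) × ℝ => p.1.2) ((𝓝 x ×ˢ 𝓝 h) ×ˢ 𝓝[≠] 0) (𝓝 h) :=
  tendsto_snd.comp tendsto_fst

theorem tendsto_dir_time (x h : E) :
    Tendsto (fun p : (E × E) × ℝ => p.2) ((𝓝 x ×ˢ 𝓝 h) ×ˢ 𝓝[≠] 0) (𝓝 0) :=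
  (tendsto_nhdsWithin_iff.1 tendsto_snd).1

end

variable {E : Type u} {F : Type v} {G : Type w}
  [AddCommGroup E] [Module ℝ E] [TopologicalSpace E]
  [AddCommGroup F] [Module ℝ F] [TopologicalSpace F]
  [AddCommGroup G] [Module ℝ G] [TopologicalSpace G]

/-- The difference quotients `t⁻¹ (f (x' + t h') - f x')` converge to `d` jointly for
`x' → x`, `h' → h`, `t → 0`. -/
def SDir (f : E → F) (x h : E) (d : F) : Prop :=
  Tendsto (fun p : (E × E) × ℝ => p.2⁻¹ • (f (p.1.1 + p.2 • p.1.2) - f p.1.1))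
    ((𝓝 x ×ˢ 𝓝 h) ×ˢ 𝓝[≠] 0) (𝓝 d)

theorem SDir.hasDirDeriv {f : E → F} {x h : E} {d : F} (hf : SDir f x h d) :
    HasDirDeriv f x h d := by
  have : Tendsto (fun t : ℝ => ((x, h), t)) (𝓝[≠] 0) ((𝓝 x ×ˢ 𝓝 h) ×ˢ 𝓝[≠] 0) :=
    ((tendsto_pure_nhds (fun _ => x) ()).comp tendsto_const_pure |>.prodMk
      ((tendsto_pure_nhds (fun _ => h) ()).comp tendsto_const_pure)).prodMk tendsto_id
  exact hf.comp this

theorem tendsto_dir_add [ContinuousAdd E] [ContinuousSMul ℝ E] (x h : E) :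
    Tendsto (fun p : (E × E) × ℝ => p.1.1 + p.2 • p.1.2) ((𝓝 x ×ˢ 𝓝 h) ×ˢ 𝓝[≠] 0) (𝓝 x) := by
  have := (tendsto_dir_fst x h).add ((tendsto_dir_time x h).smul (tendsto_dir_snd x h))
  simpa using this

/-- With joint limits the chain rule is a composition of limits: the quotient of `f ∘ g` is the
quotient of `f` taken at the base point `g x'` in the direction of the quotient of `g`. No mean
value theorem, hence no local convexity, is involved. -/
theorem SDir.comp {f : F → G} {g : E → F} {x h : E} {k : F} {d : G}
    (hf : SDir f (g x) k d) (hg : SDir g x h k) (hc : ContinuousAt g x) :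
    SDir (f ∘ g) x h d := by
  have h1 : Tendsto (fun p : (E × E) × ℝ =>
      ((g p.1.1, p.2⁻¹ • (g (p.1.1 + p.2 • p.1.2) - g p.1.1)), p.2))
      ((𝓝 x ×ˢ 𝓝 h) ×ˢ 𝓝[≠] 0) ((𝓝 (g x) ×ˢ 𝓝 k) ×ˢ 𝓝[≠] 0) :=
    ((hc.tendsto.comp (tendsto_dir_fst x h)).prodMk hg).prodMk tendsto_snd
  refine (Tendsto.comp hf h1).congr' ?_
  filter_upwards [eventually_ne_zero_dir x h] with p hp
  simp only [Function.comp]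
  rw [smul_inv_smul₀ hp, add_sub_cancel]

theorem SDir.prodMk {f : E → F} {g : E → G} {x h : E} {d : F} {e : G}
    (hf : SDir f x h d) (hg : SDir g x h e) : SDir (fun y => (f y, g y)) x h (d, e) := by
  have := (Tendsto.prodMk_nhds hf hg)
  exact this

theorem SDir.linear (L : E →ₗ[ℝ] F) (hL : Continuous L) (x h : E) : SDir L x h (L h) := by
  refine ((hL.tendsto h).comp (tendsto_dir_snd x h)).congr' ?_
  filter_upwards [eventually_ne_zero_dir x h] with p hp
  simp [inv_smul_smul₀ hp]

theorem SDir.const (c : F) (x h : E) : SDir (fun _ : E => c) x h 0 := by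
  refine tendsto_const_nhds.congr fun p => ?_
  simp

theorem SDir.congr [ContinuousAdd E] [ContinuousSMul ℝ E] {f g : E → F} {U : Set E}
    (hU : IsOpen U) {x h : E} {d : F} (hx : x ∈ U) (hfg : EqOn f g U) (hf : SDir f x h d) :
    SDir g x h d := by
  refine Tendsto.congr' ?_ hf
  filter_upwards [(tendsto_dir_fst x h).eventually (hU.mem_nhds hx),
    (tendsto_dir_add x h).eventually (hU.mem_nhds hx)] with p h1 h2
  rw [hfg h1, hfg h2]

theorem SDir.bilinear [ContinuousAdd G] [ContinuousSMul ℝ G] (B : E →ₗ[ℝ] F →ₗ[ℝ] G)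
    (hB : Continuous fun p : E × F => B p.1 p.2) (x h : E × F) :
    SDir (fun p : E × F => B p.1 p.2) x h (B x.1 h.2 + B h.1 x.2) := by
  have t1 := (tendsto_dir_fst x h)
  have t2 := (tendsto_dir_snd x h)
  have s1 := (continuous_fst.tendsto x).comp t1
  have s2 := (continuous_snd.tendsto x).comp t1
  have s3 := (continuous_fst.tendsto h).comp t2
  have s4 := (continuous_snd.tendsto h).comp t2
  have a1 := (hB.tendsto (x.1, h.2)).comp (s1.prodMk_nhds s4)
  have a2 := (hB.tendsto (h.1, x.2)).comp (s3.prodMk_nhds s2)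
  have a3 := (hB.tendsto (h.1, h.2)).comp (s3.prodMk_nhds s4)
  have := (a1.add a2).add ((tendsto_dir_time x h).smul a3)
  rw [zero_smul, add_zero] at this
  refine this.congr' ?_
  filter_upwards [eventually_ne_zero_dir x h] with p hp
  simp only [Function.comp, Prod.fst_add, Prod.snd_add, Prod.smul_fst, Prod.smul_snd, map_add,
    map_smul, LinearMap.add_apply, LinearMap.smul_apply]
  have : p.2⁻¹ * p.2 = 1 := inv_mul_cancel₀ hp
  calc _ = (p.2⁻¹ * p.2) • (B p.1.1.1 p.1.2.2 + B p.1.2.1 p.1.1.2 + p.2 • B p.1.2.1 p.1.2.2) := by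
        rw [this, one_smul]
    _ = _ := by module

end Strict

/-! ### Strictly `C^n` maps -/

/-- `C^n` maps in terms of strict directional derivatives. -/
def Cn : (n : ℕ) → {E : Type u} → {F : Type v} →
    [AddCommGroup E] → [Module ℝ E] → [TopologicalSpace E] →
    [AddCommGroup F] → [Module ℝ F] → [TopologicalSpace F] → (E → F) → Set E → Prop
  | 0, _, _, _, _, _, _, _, _, f, U => ContinuousOn f U
  | n + 1, E, F, _, _, _, _, _, _, f, U =>
      ContinuousOn f U ∧ ∃ df : E × E → F,
        (∀ x ∈ U, ∀ h, SDir f x h (df (x, h))) ∧ Cn n df (U ×ˢ (univ : Set E))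

section Cn

/-- Freezing `x'` and `h'` gives the ordinary directional derivative. Only this implication is used:
smoothness is always established in the strict sense, where composition is easy. -/
theorem Cn.isCnOn (n : ℕ) : ∀ {E : Type u} {F : Type v}
    [AddCommGroup E] [Module ℝ E] [TopologicalSpace E]
    [AddCommGroup F] [Module ℝ F] [TopologicalSpace F] {f : E → F} {U : Set E},
    Cn n f U → IsCnOn n f U := by
  induction n with
  | zero => intro E F _ _ _ _ _ _ f U h; exact h
  | succ n ih =>
    intro E F _ _ _ _ _ _ f U h
    obtain ⟨h1, df, h2, h3⟩ := h
    exact ⟨h1, df, fun x hx k => (h2 x hx k).hasDirDeriv, ih h3⟩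

variable {E : Type u} {F : Type v} {G : Type w}
  [AddCommGroup E] [Module ℝ E] [TopologicalSpace E]
  [AddCommGroup F] [Module ℝ F] [TopologicalSpace F]
  [AddCommGroup G] [Module ℝ G] [TopologicalSpace G]

theorem Cn.continuousOn {n : ℕ} {f : E → F} {U : Set E} (h : Cn n f U) : ContinuousOn f U := by
  cases n with
  | zero => exact h
  | succ n => exact h.1

theorem Cn.mono (n : ℕ) : ∀ {E : Type u} {F : Type v}
    [AddCommGroup E] [Module ℝ E] [TopologicalSpace E]
    [AddCommGroup F] [Module ℝ F] [TopologicalSpace F] {f : E → F} {U V : Set E},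
    Cn n f U → V ⊆ U → Cn n f V := by
  induction n with
  | zero => intro E F _ _ _ _ _ _ f U V h hV; exact ContinuousOn.mono h hV
  | succ n ih =>
    intro E F _ _ _ _ _ _ f U V h hV
    obtain ⟨h1, df, h2, h3⟩ := h
    exact ⟨h1.mono hV, df, fun x hx k => h2 x (hV hx) k, ih h3 (prod_mono hV le_rfl)⟩

theorem Cn.of_succ (n : ℕ) : ∀ {E : Type u} {F : Type v}
    [AddCommGroup E] [Module ℝ E] [TopologicalSpace E]
    [AddCommGroup F] [Module ℝ F] [TopologicalSpace F] {f : E → F} {U : Set E},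
    Cn (n + 1) f U → Cn n f U := by
  induction n with
  | zero => intro E F _ _ _ _ _ _ f U h; exact h.1
  | succ n ih =>
    intro E F _ _ _ _ _ _ f U h
    obtain ⟨h1, df, h2, h3⟩ := h
    exact ⟨h1, df, h2, ih h3⟩

theorem Cn.const (n : ℕ) : ∀ {E : Type u} {F : Type v}
    [AddCommGroup E] [Module ℝ E] [TopologicalSpace E]
    [AddCommGroup F] [Module ℝ F] [TopologicalSpace F] (c : F) (U : Set E),
    Cn n (fun _ : E => c) U := by
  induction n with
  | zero => intro E F _ _ _ _ _ _ c U; exact continuousOn_const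
  | succ n ih =>
    intro E F _ _ _ _ _ _ c U
    exact ⟨continuousOn_const, fun _ => 0, fun x _ h => SDir.const c x h, ih 0 _⟩

theorem Cn.linear (n : ℕ) : ∀ {E : Type u} {F : Type v}
    [AddCommGroup E] [Module ℝ E] [TopologicalSpace E]
    [AddCommGroup F] [Module ℝ F] [TopologicalSpace F] (L : E →ₗ[ℝ] F) (_ : Continuous L)
    (U : Set E), Cn n L U := by
  induction n with
  | zero => intro E F _ _ _ _ _ _ L hL U; exact hL.continuousOn
  | succ n ih =>
    intro E F _ _ _ _ _ _ L hL U
    exact ⟨hL.continuousOn, fun p => L p.2, fun x _ h => SDir.linear L hL x h,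
      ih (L ∘ₗ LinearMap.snd ℝ E E) (hL.comp continuous_snd) _⟩

theorem Cn.prodMk (n : ℕ) : ∀ {E : Type u} {F : Type v} {G : Type w}
    [AddCommGroup E] [Module ℝ E] [TopologicalSpace E]
    [AddCommGroup F] [Module ℝ F] [TopologicalSpace F]
    [AddCommGroup G] [Module ℝ G] [TopologicalSpace G] {f : E → F} {g : E → G} {U : Set E},
    Cn n f U → Cn n g U → Cn n (fun x => (f x, g x)) U := by
  induction n with
  | zero => intro E F G _ _ _ _ _ _ _ _ _ f g U hf hg; exact ContinuousOn.prodMk hf hg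
  | succ n ih =>
    intro E F G _ _ _ _ _ _ _ _ _ f g U hf hg
    obtain ⟨h1, df, h2, h3⟩ := hf
    obtain ⟨k1, dg, k2, k3⟩ := hg
    exact ⟨h1.prodMk k1, fun p => (df p, dg p), fun x hx h => (h2 x hx h).prodMk (k2 x hx h),
      ih h3 k3⟩

/-- This supplies the term `g ∘ Prod.fst` in the derivative of a composite. -/
theorem Cn.comp_linear (n : ℕ) : ∀ {E : Type u} {F : Type v} {G : Type w}
    [AddCommGroup E] [Module ℝ E] [TopologicalSpace E]
    [AddCommGroup F] [Module ℝ F] [TopologicalSpace F]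
    [AddCommGroup G] [Module ℝ G] [TopologicalSpace G] {f : F → G} {V : Set F}
    (L : E →ₗ[ℝ] F), Continuous L → Cn n f V → Cn n (f ∘ L) (L ⁻¹' V) := by
  induction n with
  | zero =>
    intro E F G _ _ _ _ _ _ _ _ _ f V L hL hf
    exact ContinuousOn.comp hf hL.continuousOn fun x hx => hx
  | succ n ih =>
    intro E F G _ _ _ _ _ _ _ _ _ f V L hL hf
    obtain ⟨h1, df, h2, h3⟩ := hf
    refine ⟨h1.comp hL.continuousOn fun x hx => hx, df ∘ L.prodMap L, fun x hx h => ?_, ?_⟩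
    · exact (h2 (L x) hx _).comp (SDir.linear L hL x h) hL.continuousAt
    · exact ih (L.prodMap L) (hL.prodMap hL) h3

theorem Cn.comp (n : ℕ) : ∀ {E : Type u} {F : Type v} {G : Type w}
    [AddCommGroup E] [Module ℝ E] [TopologicalSpace E]
    [AddCommGroup F] [Module ℝ F] [TopologicalSpace F]
    [AddCommGroup G] [Module ℝ G] [TopologicalSpace G] {f : F → G} {g : E → F} {U : Set E}
    {V : Set F}, IsOpen U → Cn n f V → Cn n g U → MapsTo g U V → Cn n (f ∘ g) U := by
  induction n with
  | zero => intro E F G _ _ _ _ _ _ _ _ _ f g U V _ hf hg hm; exact ContinuousOn.comp hf hg hm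
  | succ n ih =>
    intro E F G _ _ _ _ _ _ _ _ _ f g U V hU hf hg hm
    have hg' := hg
    obtain ⟨h1, df, h2, h3⟩ := hf
    obtain ⟨k1, dg, k2, k3⟩ := hg
    have hUo : IsOpen (U ×ˢ (univ : Set E)) := hU.prod isOpen_univ
    have hfst : Cn n (g ∘ Prod.fst) (U ×ˢ (univ : Set E)) :=
      (Cn.comp_linear n (LinearMap.fst ℝ E E) continuous_fst (Cn.of_succ n hg')).mono n
        fun p hp => hp.1
    refine ⟨h1.comp k1 hm, df ∘ fun p => (g p.1, dg p), fun x hx h => ?_, ?_⟩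
    · exact (h2 (g x) (hm hx) _).comp (k2 x hx h) (k1.continuousAt (hU.mem_nhds hx))
    · exact ih hUo h3 (Cn.prodMk n hfst k3) fun p hp => ⟨hm hp.1, mem_univ _⟩

/-- The derivative is a sum of two copies of `B` precomposed with linear maps, so the induction
closes on itself. -/
theorem Cn.bilinear (n : ℕ) [ContinuousAdd G] [ContinuousSMul ℝ G] (B : E →ₗ[ℝ] F →ₗ[ℝ] G)
    (hB : Continuous fun p : E × F => B p.1 p.2) (U : Set (E × F)) :
    Cn n (fun p : E × F => B p.1 p.2) U := by
  refine Cn.mono n (U := univ) ?_ (subset_univ _)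
  induction n with
  | zero => exact hB.continuousOn
  | succ n ih =>
    refine ⟨hB.continuousOn, fun p => B p.1.1 p.2.2 + B p.2.1 p.1.2,
      fun x _ h => SDir.bilinear B hB x h, ?_⟩
    rw [univ_prod_univ]
    let L1 : (E × F) × (E × F) →ₗ[ℝ] E × F :=
      ((LinearMap.fst ℝ E F).comp (LinearMap.fst ℝ (E × F) (E × F))).prod
        ((LinearMap.snd ℝ E F).comp (LinearMap.snd ℝ (E × F) (E × F)))
    let L2 : (E × F) × (E × F) →ₗ[ℝ] E × F :=
      ((LinearMap.fst ℝ E F).comp (LinearMap.snd ℝ (E × F) (E × F))).prod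
        ((LinearMap.snd ℝ E F).comp (LinearMap.fst ℝ (E × F) (E × F)))
    have c1 : Continuous L1 := by
      change Continuous fun p : (E × F) × (E × F) => (p.1.1, p.2.2); fun_prop
    have c2 : Continuous L2 := by
      change Continuous fun p : (E × F) × (E × F) => (p.2.1, p.1.2); fun_prop
    have e1 := Cn.comp n isOpen_univ ih (Cn.linear n L1 c1 univ) (mapsTo_univ _ _)
    have e2 := Cn.comp n isOpen_univ ih (Cn.linear n L2 c2 univ) (mapsTo_univ _ _)
    let A : G × G →ₗ[ℝ] G := LinearMap.fst ℝ G G + LinearMap.snd ℝ G G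
    have cA : Continuous A := by
      change Continuous fun p : G × G => p.1 + p.2; fun_prop
    exact Cn.comp n isOpen_univ (Cn.linear n A cA univ) (Cn.prodMk n e1 e2) (mapsTo_univ _ _)

theorem Cn.congr (n : ℕ) : ∀ {E : Type u} {F : Type v}
    [AddCommGroup E] [Module ℝ E] [TopologicalSpace E] [ContinuousAdd E] [ContinuousSMul ℝ E]
    [AddCommGroup F] [Module ℝ F] [TopologicalSpace F] {f g : E → F} {U : Set E},
    IsOpen U → Cn n f U → EqOn f g U → Cn n g U := by
  induction n with
  | zero =>
    intro E F _ _ _ _ _ _ _ _ f g U hU hf hfg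
    exact ContinuousOn.congr (f := f) hf hfg.symm
  | succ n ih =>
    intro E F _ _ _ _ _ _ _ _ f g U hU hf hfg
    obtain ⟨h1, df, h2, h3⟩ := hf
    exact ⟨h1.congr hfg.symm, df, fun x hx h => (h2 x hx h).congr hU hx hfg, h3⟩

theorem SDir.unique [T2Space F] {f : E → F} {x h : E} {d e : F} (hd : SDir f x h d)
    (he : SDir f x h e) : d = e :=
  tendsto_nhds_unique (hd.hasDirDeriv : Tendsto _ _ _) he.hasDirDeriv

/-- Smoothness is local: in a Hausdorff target the strict derivative is unique, so local choices of
`df` glue. -/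
theorem Cn.iUnion {ι : Type*} (n : ℕ) : ∀ {E : Type u} {F : Type v}
    [AddCommGroup E] [Module ℝ E] [TopologicalSpace E] [ContinuousAdd E] [ContinuousSMul ℝ E]
    [AddCommGroup F] [Module ℝ F] [TopologicalSpace F] [T2Space F] {f : E → F} {U : ι → Set E},
    (∀ i, IsOpen (U i)) → (∀ i, Cn n f (U i)) → Cn n f (⋃ i, U i) := by
  induction n with
  | zero =>
    intro E F _ _ _ _ _ _ _ _ _ f U hU hf
    exact ContinuousOn.iUnion_of_isOpen hf hU
  | succ n ih =>
    intro E F _ _ _ _ _ _ _ _ _ f U hU hf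
    choose h1 df h2 h3 using hf
    classical
    let dg : E × E → F := fun p => if h : ∃ i, p.1 ∈ U i then df h.choose p else 0
    have key : ∀ i, ∀ x ∈ U i, ∀ k, dg (x, k) = df i (x, k) := by
      intro i x hx k
      have h : ∃ i, (x, k).1 ∈ U i := ⟨i, hx⟩
      simp only [dg, dif_pos h]
      exact (h2 _ x h.choose_spec k).unique (h2 i x hx k)
    refine ⟨ContinuousOn.iUnion_of_isOpen h1 hU, dg, fun x hx k => ?_, ?_⟩
    · obtain ⟨i, hi⟩ := mem_iUnion.1 hx
      rw [key i x hi]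
      exact h2 i x hi k
    · rw [iUnion_prod_const]
      refine ih (fun i => (hU i).prod isOpen_univ) fun i => ?_
      exact Cn.congr n ((hU i).prod isOpen_univ) (h3 i) fun p hp => (key i p.1 hp.1 p.2).symm

/-- Strict Fréchet differentiability controls differences of values at two nearby points. Applied to
`x' + t h'` and `x'`, and divided by `t`, it leaves an error `o(h')` with `h'` bounded, which is the
joint limit. -/
theorem Cn.of_contDiffOn (n : ℕ) : ∀ {E : Type u} {F : Type v}
    [NormedAddCommGroup E] [NormedSpace ℝ E] [NormedAddCommGroup F] [NormedSpace ℝ F]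
    {f : E → F} {U : Set E}, IsOpen U → ContDiffOn ℝ ∞ f U → Cn n f U := by
  induction n with
  | zero => intro E F _ _ _ _ f U hU hf; exact hf.continuousOn
  | succ n ih =>
    intro E F _ _ _ _ f U hU hf
    refine ⟨hf.continuousOn, fun p => fderiv ℝ f p.1 p.2, fun x hx h => ?_, ?_⟩
    · have h1 : HasStrictFDerivAt f (fderiv ℝ f x) x :=
        (hf.contDiffAt (hU.mem_nhds hx)).hasStrictFDerivAt (by simp)
      have h2 := h1.isLittleO
      have h3 : Tendsto (fun p : (E × E) × ℝ => (p.1.1 + p.2 • p.1.2, p.1.1))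
          ((𝓝 x ×ˢ 𝓝 h) ×ˢ 𝓝[≠] 0) (𝓝 (x, x)) :=
        (tendsto_dir_add x h).prodMk_nhds (tendsto_dir_fst x h)
      have h4 := h2.comp_tendsto h3
      have h5 : (fun p : (E × E) × ℝ => p.2⁻¹ • (f (p.1.1 + p.2 • p.1.2) - f p.1.1) -
          fderiv ℝ f x p.1.2) =o[(𝓝 x ×ˢ 𝓝 h) ×ˢ 𝓝[≠] 0] fun p : (E × E) × ℝ => p.1.2 := by
        have := (Asymptotics.isBigO_refl (fun p : (E × E) × ℝ => p.2⁻¹)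
          ((𝓝 x ×ˢ 𝓝 h) ×ˢ 𝓝[≠] 0)).smul_isLittleO h4
        refine this.congr' ?_ ?_
        · filter_upwards [eventually_ne_zero_dir x h] with p hp
          simp [smul_sub, inv_smul_smul₀ hp]
        · filter_upwards [eventually_ne_zero_dir x h] with p hp
          simp [inv_smul_smul₀ hp]
      have h6 := h5.trans_isBigO ((tendsto_dir_snd x h).isBigO_one ℝ)
      rw [Asymptotics.isLittleO_one_iff] at h6
      have h7 := h6.add (((fderiv ℝ f x).continuous.tendsto h).comp (tendsto_dir_snd x h))
      simpa [SDir, Function.comp_def] using h7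
    · refine ih (hU.prod isOpen_univ) ?_
      have h1 : ContDiffOn ℝ ∞ (fderiv ℝ f) U :=
        ((contDiffOn_infty_iff_fderiv_of_isOpen hU).1 hf).2
      exact (h1.comp contDiffOn_fst fun p hp => hp.1).clm_apply contDiffOn_snd

end Cn

/-! ### Holomorphic maps -/

section Hol

variable {E : Type u} {F : Type v} {G : Type w}
  [AddCommGroup E] [Module ℂ E] [TopologicalSpace E]
  [AddCommGroup F] [Module ℂ F] [TopologicalSpace F]
  [AddCommGroup G] [Module ℂ G] [TopologicalSpace G]

/-- `f` is strictly smooth on `U` with complex linear differentials. -/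
def Hol (f : E → F) (U : Set E) : Prop :=
  (∀ n, Cn n f U) ∧ ∀ x ∈ U, ∃ L : E →ₗ[ℂ] F, ∀ h, SDir f x h (L h)

theorem Hol.holomorphicOn {f : E → F} {U : Set E} (hU : IsOpen U) (h : Hol f U) :
    HolomorphicOn f U :=
  ⟨⟨hU, fun n => (h.1 n).isCnOn n⟩, fun x hx => by
    obtain ⟨L, hL⟩ := h.2 x hx
    exact ⟨L, fun k => (hL k).hasDirDeriv⟩⟩

theorem Hol.continuousOn {f : E → F} {U : Set E} (h : Hol f U) : ContinuousOn f U := h.1 0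

theorem Hol.mono {f : E → F} {U V : Set E} (h : Hol f U) (hV : V ⊆ U) : Hol f V :=
  ⟨fun n => (h.1 n).mono n hV, fun x hx => h.2 x (hV hx)⟩

theorem Hol.linear (L : E →ₗ[ℂ] F) (hL : Continuous L) (U : Set E) : Hol L U :=
  ⟨fun n => Cn.linear n (L.restrictScalars ℝ) hL U,
    fun x _ => ⟨L, fun h => SDir.linear (L.restrictScalars ℝ) hL x h⟩⟩

theorem Hol.prodMk {f : E → F} {g : E → G} {U : Set E} (hf : Hol f U) (hg : Hol g U) :
    Hol (fun x => (f x, g x)) U :=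
  ⟨fun n => Cn.prodMk n (hf.1 n) (hg.1 n), fun x hx => by
    obtain ⟨L, hL⟩ := hf.2 x hx
    obtain ⟨M, hM⟩ := hg.2 x hx
    exact ⟨L.prod M, fun h => (hL h).prodMk (hM h)⟩⟩

theorem Hol.comp {f : F → G} {g : E → F} {U : Set E} {V : Set F} (hU : IsOpen U)
    (hf : Hol f V) (hg : Hol g U) (hm : MapsTo g U V) : Hol (fun x => f (g x)) U :=
  ⟨fun n => Cn.comp n hU (hf.1 n) (hg.1 n) hm, fun x hx => by
    obtain ⟨L, hL⟩ := hg.2 x hx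
    obtain ⟨M, hM⟩ := hf.2 (g x) (hm hx)
    exact ⟨M ∘ₗ L, fun h => (hM (L h)).comp (hL h)
      (hg.continuousOn.continuousAt (hU.mem_nhds hx))⟩⟩

theorem Hol.linear_comp (L : F →ₗ[ℂ] G) (hL : Continuous L) {g : E → F} {U : Set E}
    (hU : IsOpen U) (hg : Hol g U) : Hol (fun x => L (g x)) U :=
  Hol.comp hU (Hol.linear L hL univ) hg (mapsTo_univ _ _)

theorem Hol.comp_linear {f : F → G} {V : Set F} (hf : Hol f V) (L : E →ₗ[ℂ] F)
    (hL : Continuous L) (hV : IsOpen V) : Hol (fun x => f (L x)) (L ⁻¹' V) :=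
  Hol.comp (hV.preimage hL) hf (Hol.linear L hL _) fun _ hx => hx

theorem Hol.bilinear [ContinuousAdd G] [ContinuousSMul ℝ G] (B : E →ₗ[ℂ] F →ₗ[ℂ] G)
    (hB : Continuous fun p : E × F => B p.1 p.2) (U : Set (E × F)) :
    Hol (fun p : E × F => B p.1 p.2) U := by
  let BR : E →ₗ[ℝ] F →ₗ[ℝ] G := LinearMap.mk₂ ℝ (fun x y => B x y)
    (by simp) (fun c x y => by
      have : B (c • x) = (c : ℂ) • B x := B.map_smul (c : ℂ) x
      rw [this]; rfl) (by simp) (fun c x y => (B x).map_smul (c : ℂ) y)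
  refine ⟨fun n => Cn.bilinear n BR hB U, fun x _ => ?_⟩
  exact ⟨(B x.1) ∘ₗ LinearMap.snd ℂ E F + (B.flip x.2) ∘ₗ LinearMap.fst ℂ E F,
    fun h => SDir.bilinear BR hB x h⟩

theorem Hol.bilinear_comp {E' : Type*} [AddCommGroup E'] [Module ℂ E'] [TopologicalSpace E']
    [ContinuousAdd G] [ContinuousSMul ℝ G] (B : E →ₗ[ℂ] F →ₗ[ℂ] G)
    (hB : Continuous fun p : E × F => B p.1 p.2) {U : Set E'} (hU : IsOpen U) {f : E' → E}
    {g : E' → F} (hf : Hol f U) (hg : Hol g U) : Hol (fun x => B (f x) (g x)) U :=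
  Hol.comp hU (Hol.bilinear B hB univ) (hf.prodMk hg) (mapsTo_univ _ _)

theorem Hol.add [ContinuousAdd F] {f g : E → F} {U : Set E} (hU : IsOpen U) (hf : Hol f U)
    (hg : Hol g U) : Hol (fun x => f x + g x) U :=
  Hol.linear_comp (LinearMap.fst ℂ F F + LinearMap.snd ℂ F F)
    (by change Continuous fun p : F × F => p.1 + p.2; fun_prop) hU (hf.prodMk hg)

theorem Hol.const_smul [ContinuousConstSMul ℂ F] {f : E → F} {U : Set E} (hU : IsOpen U) (c : ℂ)
    (hf : Hol f U) : Hol (fun x => c • f x) U :=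
  Hol.linear_comp (c • LinearMap.id)
    (by change Continuous fun p : F => c • p; fun_prop) hU hf

theorem Hol.neg [ContinuousConstSMul ℂ F] {f : E → F} {U : Set E} (hU : IsOpen U)
    (hf : Hol f U) : Hol (fun x => -f x) U := by
  simpa using hf.const_smul hU (-1)

theorem Hol.sub [ContinuousAdd F] [ContinuousConstSMul ℂ F] {f g : E → F} {U : Set E}
    (hU : IsOpen U) (hf : Hol f U) (hg : Hol g U) : Hol (fun x => f x - g x) U := by
  simpa [sub_eq_add_neg] using hf.add hU (hg.neg hU)

theorem Hol.mul {f g : E → ℂ} {U : Set E} (hU : IsOpen U) (hf : Hol f U) (hg : Hol g U) :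
    Hol (fun x => f x * g x) U :=
  Hol.bilinear_comp (LinearMap.mul ℂ ℂ) (by
    change Continuous fun p : ℂ × ℂ => p.1 * p.2; fun_prop) hU hf hg

theorem Hol.iUnion {ι : Type*} [ContinuousAdd E] [ContinuousSMul ℝ E] [T2Space F] {f : E → F}
    {U : ι → Set E} (hU : ∀ i, IsOpen (U i)) (hf : ∀ i, Hol f (U i)) : Hol f (⋃ i, U i) :=
  ⟨fun n => Cn.iUnion n hU fun i => (hf i).1 n, fun x hx => by
    obtain ⟨i, hi⟩ := mem_iUnion.1 hx
    exact (hf i).2 x hi⟩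

theorem Hol.congr [ContinuousAdd E] [ContinuousSMul ℝ E] {f g : E → F}
    {U : Set E} (hU : IsOpen U) (hf : Hol f U) (hfg : EqOn f g U) : Hol g U :=
  ⟨fun n => (hf.1 n).congr n hU hfg, fun x hx => by
    obtain ⟨L, hL⟩ := hf.2 x hx
    exact ⟨L, fun h => (hL h).congr hU hx hfg⟩⟩

end Hol

theorem Hol.of_contDiffOn {E : Type u} {F : Type v} [NormedAddCommGroup E] [NormedSpace ℂ E]
    [NormedAddCommGroup F] [NormedSpace ℂ F] {f : E → F} {U : Set E} (hU : IsOpen U)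
    (hf : ContDiffOn ℂ ∞ f U) : Hol f U := by
  refine ⟨fun n => Cn.of_contDiffOn n hU (hf.restrict_scalars ℝ), fun x hx => ?_⟩
  have h1 := Cn.of_contDiffOn 1 hU (hf.restrict_scalars ℝ)
  obtain ⟨-, df, h2, -⟩ := h1
  have h3 : HasStrictFDerivAt f (fderiv ℂ f x) x :=
    (hf.contDiffAt (hU.mem_nhds hx)).hasStrictFDerivAt (by simp)
  refine ⟨fderiv ℂ f x, fun h => ?_⟩
  -- The strict derivative supplied by the real theory must be the complex Fréchet derivative, since
  -- both are limits of the same quotients.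
  have h4 : df (x, h) = fderiv ℂ f x h := by
    refine tendsto_nhds_unique (h2 x hx h).hasDirDeriv ?_
    have := (h3.hasFDerivAt.restrictScalars ℝ).hasLineDerivAt h
    have := hasDerivAt_iff_tendsto_slope_zero.1 this
    simpa using this
  change SDir f x h (fderiv ℂ f x h)
  rw [← h4]
  exact h2 x hx h

/-! ### Complexifications -/

namespace Complexification

section Topology

variable {E : Type u} [TopologicalSpace E]

theorem continuous_re : Continuous (re : Complexification E → E) := continuous_fst

theorem continuous_im : Continuous (im : Complexification E → E) := continuous_snd

theorem continuous_mk {X : Type*} [TopologicalSpace X] {f g : X → E} (hf : Continuous f)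
    (hg : Continuous g) : Continuous fun x => mk (f x) (g x) := hf.prodMk hg

instance [T2Space E] : T2Space (Complexification E) := inferInstanceAs (T2Space (E × E))

variable [AddCommGroup E] [Module ℝ E]

instance [ContinuousAdd E] : ContinuousAdd (Complexification E) :=
  inferInstanceAs (ContinuousAdd (E × E))

instance [ContinuousAdd E] [ContinuousSMul ℝ E] : ContinuousSMul ℂ (Complexification E) where
  continuous_smul := by
    have h1 : Continuous fun p : ℂ × Complexification E => p.2.re := continuous_re.comp continuous_snd
    have h2 : Continuous fun p : ℂ × Complexification E => p.2.im := continuous_im.comp continuous_snd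
    have c1 : Continuous fun p : ℂ × Complexification E => p.1.re :=
      Complex.continuous_re.comp continuous_fst
    have c2 : Continuous fun p : ℂ × Complexification E => p.1.im :=
      Complex.continuous_im.comp continuous_fst
    refine continuous_mk ?_ ?_
    · have e : (fun p : ℂ × Complexification E => p.1.re • p.2.re - p.1.im • p.2.im) =
        fun p => p.1.re • p.2.re + (-p.1.im) • p.2.im := by
        funext p; rw [neg_smul, sub_eq_add_neg]
      rw [e]
      exact (c1.smul h1).add (c2.neg.smul h2)
    · exact (c1.smul h2).add (c2.smul h1)

instance [ContinuousAdd E] [ContinuousSMul ℝ E] : ContinuousSMul ℝ (Complexification E) where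
  continuous_smul := by
    have : Continuous fun p : ℝ × Complexification E => ((p.1 : ℂ), p.2) := by fun_prop
    exact (continuous_smul (M := ℂ) (X := Complexification E)).comp this

end Topology

section Linear

set_option linter.unusedSectionVars false

variable {E : Type u} {F : Type v} {G : Type w}
  [AddCommGroup E] [Module ℝ E] [AddCommGroup F] [Module ℝ F] [AddCommGroup G] [Module ℝ G]

@[simp] theorem re_mk (x y : E) : (mk x y).re = x := rfl
@[simp] theorem im_mk (x y : E) : (mk x y).im = y := rfl
@[simp] theorem re_ofReal (x : E) : (ofReal x).re = x := rfl
@[simp] theorem im_ofReal (x : E) : (ofReal x).im = 0 := rfl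
@[simp] theorem re_ofImag (x : E) : (ofImag x).re = 0 := rfl
@[simp] theorem im_ofImag (x : E) : (ofImag x).im = x := rfl
@[simp] theorem re_map (T : E → E) (v : Complexification E) : (map T v).re = T v.re := rfl
@[simp] theorem im_map (T : E → E) (v : Complexification E) : (map T v).im = T v.im := rfl
@[simp] theorem re_neg (v : Complexification E) : (-v).re = -v.re := rfl
@[simp] theorem im_neg (v : Complexification E) : (-v).im = -v.im := rfl
@[simp] theorem re_sub (v w : Complexification E) : (v - w).re = v.re - w.re := rfl
@[simp] theorem im_sub (v w : Complexification E) : (v - w).im = v.im - w.im := rfl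

theorem re_real_smul (c : ℝ) (v : Complexification E) : (c • v).re = c • v.re := by
  change ((c : ℂ) • v).re = _
  rw [re_smul]; simp

theorem im_real_smul (c : ℝ) (v : Complexification E) : (c • v).im = c • v.im := by
  change ((c : ℂ) • v).im = _
  rw [im_smul]; simp

/-- The real part, as a real linear map. -/
def reL : Complexification E →ₗ[ℝ] E where
  toFun := re
  map_add' _ _ := rfl
  map_smul' := re_real_smul

/-- The imaginary part, as a real linear map. -/
def imL : Complexification E →ₗ[ℝ] E where
  toFun := im
  map_add' _ _ := rfl
  map_smul' := im_real_smul

/-- The inclusion of the real points, as a real linear map. -/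
def ofRealL : E →ₗ[ℝ] Complexification E where
  toFun := ofReal
  map_add' x y := by ext <;> simp
  map_smul' c x := by ext <;> simp [re_real_smul, im_real_smul]

/-- The inclusion of the imaginary points, as a real linear map. -/
def ofImagL : E →ₗ[ℝ] Complexification E where
  toFun := ofImag
  map_add' x y := by ext <;> simp
  map_smul' c x := by ext <;> simp [re_real_smul, im_real_smul]

/-- The complex linear extension of a real linear map. -/
def lift (L : E →ₗ[ℝ] F) : Complexification E →ₗ[ℂ] Complexification F where
  toFun v := mk (L v.re) (L v.im)
  map_add' v w := by ext <;> simp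
  map_smul' c v := by ext <;> simp

@[simp] theorem re_lift (L : E →ₗ[ℝ] F) (v : Complexification E) : (lift L v).re = L v.re := rfl
@[simp] theorem im_lift (L : E →ₗ[ℝ] F) (v : Complexification E) : (lift L v).im = L v.im := rfl

theorem lift_ofReal (L : E →ₗ[ℝ] F) (x : E) : lift L (ofReal x) = ofReal (L x) := by
  ext <;> simp

theorem continuous_lift [TopologicalSpace E] [TopologicalSpace F] {L : E →ₗ[ℝ] F}
    (hL : Continuous L) : Continuous (lift L) :=
  continuous_mk (hL.comp continuous_re) (hL.comp continuous_im)

/-- The complex bilinear extension of a real bilinear map. -/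
def lift₂ (B : E →ₗ[ℝ] F →ₗ[ℝ] G) :
    Complexification E →ₗ[ℂ] Complexification F →ₗ[ℂ] Complexification G :=
  LinearMap.mk₂ ℂ
    (fun v w => mk (B v.re w.re - B v.im w.im) (B v.re w.im + B v.im w.re))
    (by intro v v' w; ext <;> simp <;> abel)
    (by
      intro c v w
      ext
      · simp; module
      · simp; module)
    (by intro v w w'; ext <;> simp <;> abel)
    (by
      intro c v w
      ext
      · simp; module
      · simp; module)

@[simp] theorem re_lift₂ (B : E →ₗ[ℝ] F →ₗ[ℝ] G) (v : Complexification E)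
    (w : Complexification F) : (lift₂ B v w).re = B v.re w.re - B v.im w.im := rfl
@[simp] theorem im_lift₂ (B : E →ₗ[ℝ] F →ₗ[ℝ] G) (v : Complexification E)
    (w : Complexification F) : (lift₂ B v w).im = B v.re w.im + B v.im w.re := rfl

theorem lift₂_ofReal (B : E →ₗ[ℝ] F →ₗ[ℝ] G) (x : E) (y : F) :
    lift₂ B (ofReal x) (ofReal y) = ofReal (B x y) := by
  ext <;> simp

theorem continuous_sub_of_smul [TopologicalSpace G] [ContinuousAdd G] [ContinuousSMul ℝ G]
    {X : Type*} [TopologicalSpace X] {f g : X → G} (hf : Continuous f) (hg : Continuous g) :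
    Continuous fun x => f x - g x := by
  have : (fun x => f x - g x) = fun x => f x + (-1 : ℝ) • g x := by
    funext x; rw [neg_one_smul, sub_eq_add_neg]
  rw [this]
  exact hf.add (hg.const_smul _)

theorem continuous_lift₂ [TopologicalSpace E] [TopologicalSpace F] [TopologicalSpace G]
    [ContinuousAdd G] [ContinuousSMul ℝ G] {B : E →ₗ[ℝ] F →ₗ[ℝ] G}
    (hB : Continuous fun p : E × F => B p.1 p.2) :
    Continuous fun p : Complexification E × Complexification F => lift₂ B p.1 p.2 := by
  have a1 := continuous_re.comp (continuous_fst (X := Complexification E) (Y := Complexification F))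
  have a2 := continuous_im.comp (continuous_fst (X := Complexification E) (Y := Complexification F))
  have b1 := continuous_re.comp (continuous_snd (X := Complexification E) (Y := Complexification F))
  have b2 := continuous_im.comp (continuous_snd (X := Complexification E) (Y := Complexification F))
  exact continuous_mk
    (continuous_sub_of_smul (hB.comp (a1.prodMk b1)) (hB.comp (a2.prodMk b2)))
    ((hB.comp (a1.prodMk b2)).add (hB.comp (a2.prodMk b1)))

/-- The identification of the complexification of `ℝ` with `ℂ`. -/
def toC : Complexification ℝ →ₗ[ℂ] ℂ where
  toFun v := ⟨v.re, v.im⟩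
  map_add' v w := by apply Complex.ext <;> simp
  map_smul' c v := by apply Complex.ext <;> simp

/-- The identification of `ℂ` with the complexification of `ℝ`. -/
def ofC : ℂ →ₗ[ℂ] Complexification ℝ where
  toFun z := mk z.re z.im
  map_add' v w := by ext <;> simp
  map_smul' c v := by ext <;> simp

theorem toC_ofReal (x : ℝ) : toC (ofReal x) = (x : ℂ) := by apply Complex.ext <;> simp [toC]

theorem ofC_ofReal (x : ℝ) : ofC (x : ℂ) = ofReal x := by ext <;> simp [ofC]

theorem continuous_toC : Continuous toC := by
  have h1 : Continuous fun v : Complexification ℝ => ((v.re : ℂ) + v.im * Complex.I) :=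
    (Complex.continuous_ofReal.comp continuous_re).add
      ((Complex.continuous_ofReal.comp continuous_im).mul continuous_const)
  convert h1 using 2 with v
  exact Complex.ext (by simp [toC]) (by simp [toC])

theorem continuous_ofC : Continuous ofC :=
  continuous_mk Complex.continuous_re Complex.continuous_im

/-- The complexification of a product. -/
def prodMk : Complexification E × Complexification F →ₗ[ℂ] Complexification (E × F) where
  toFun p := mk (p.1.re, p.2.re) (p.1.im, p.2.im)
  map_add' v w := by ext <;> simp
  map_smul' c v := by ext <;> simp

theorem prodMk_ofReal (x : E) (y : F) :
    prodMk (ofReal x, ofReal y) = ofReal (x, y) := by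
  ext <;> simp [prodMk]

theorem continuous_prodMk [TopologicalSpace E] [TopologicalSpace F] :
    Continuous (prodMk : Complexification E × Complexification F → Complexification (E × F)) := by
  have a1 := continuous_re.comp (continuous_fst (X := Complexification E) (Y := Complexification F))
  have a2 := continuous_im.comp (continuous_fst (X := Complexification E) (Y := Complexification F))
  have b1 := continuous_re.comp (continuous_snd (X := Complexification E) (Y := Complexification F))
  have b2 := continuous_im.comp (continuous_snd (X := Complexification E) (Y := Complexification F))
  exact continuous_mk (a1.prodMk b1) (a2.prodMk b2)

/-- The complex conjugation, as a real linear map. -/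
def conjL : Complexification E →ₗ[ℝ] Complexification E where
  toFun v := mk v.re (-v.im)
  map_add' v w := by
    ext
    · simp
    · simp; abel
  map_smul' c v := by ext <;> simp [re_real_smul, im_real_smul]

@[simp] theorem re_conjL (v : Complexification E) : (conjL v).re = v.re := rfl
@[simp] theorem im_conjL (v : Complexification E) : (conjL v).im = -v.im := rfl

theorem conjL_smul (c : ℂ) (v : Complexification E) :
    conjL (c • v) = (starRingEnd ℂ c) • conjL v := by
  ext
  · simp
  · simp; module

end Linear

/-- Let the real bilinear map `act : B × V → V` describe the action of the real parts of the
elements of the complex vector space `B`.  This is its complex bilinear extension to an action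
of `B` on the complexification of `V`. -/
def actC {B : Type u} {V : Type v} [AddCommGroup B] [Module ℂ B] [AddCommGroup V] [Module ℝ V]
    (act : B →ₗ[ℝ] V →ₗ[ℝ] V) : B →ₗ[ℂ] Complexification V →ₗ[ℂ] Complexification V :=
  LinearMap.mk₂ ℂ
    (fun c v => mk (act c v.re + act (Complex.I • c) v.im) (act c v.im - act (Complex.I • c) v.re))
    (by intro c c' v; ext <;> simp <;> abel)
    (by
      intro z c v
      have e (z : ℂ) (c : B) : z • c = z.re • c + z.im • (Complex.I • c) := by
        rw [← Complex.coe_smul, ← Complex.coe_smul, smul_smul, ← add_smul, Complex.re_add_im]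
      have e1 : act (z • c) = z.re • act c + z.im • act (Complex.I • c) := by
        rw [e z, map_add, map_smul act z.re, map_smul act z.im]
      have e2 : act (Complex.I • z • c) = z.re • act (Complex.I • c) - z.im • act c := by
        rw [smul_comm, e z, map_add, map_smul act z.re, map_smul act z.im,
          smul_smul Complex.I Complex.I]
        simp [sub_eq_add_neg]
      ext
      · simp [e1, e2]; module
      · simp [e1, e2]; module)
    (by intro v w w'; ext <;> simp <;> abel)
    (by
      intro z c v
      ext
      · simp; module
      · simp; module)

@[simp] theorem re_actC {B : Type u} {V : Type v} [AddCommGroup B] [Module ℂ B] [AddCommGroup V]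
    [Module ℝ V] (act : B →ₗ[ℝ] V →ₗ[ℝ] V) (c : B) (v : Complexification V) :
    (actC act c v).re = act c v.re + act (Complex.I • c) v.im := rfl

@[simp] theorem im_actC {B : Type u} {V : Type v} [AddCommGroup B] [Module ℂ B] [AddCommGroup V]
    [Module ℝ V] (act : B →ₗ[ℝ] V →ₗ[ℝ] V) (c : B) (v : Complexification V) :
    (actC act c v).im = act c v.im - act (Complex.I • c) v.re := rfl

theorem continuous_actC {B : Type u} {V : Type v} [AddCommGroup B] [Module ℂ B]
    [TopologicalSpace B] [ContinuousConstSMul ℂ B] [AddCommGroup V] [Module ℝ V]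
    [TopologicalSpace V] [ContinuousAdd V] [ContinuousSMul ℝ V] {act : B →ₗ[ℝ] V →ₗ[ℝ] V}
    (h : Continuous fun p : B × V => act p.1 p.2) :
    Continuous fun p : B × Complexification V => actC act p.1 p.2 := by
  have a := continuous_fst (X := B) (Y := Complexification V)
  have a' : Continuous fun p : B × Complexification V => Complex.I • p.1 := a.const_smul Complex.I
  have b1 := continuous_re.comp (continuous_snd (X := B) (Y := Complexification V))
  have b2 := continuous_im.comp (continuous_snd (X := B) (Y := Complexification V))
  exact continuous_mk ((h.comp (a.prodMk b1)).add (h.comp (a'.prodMk b2)))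
    (continuous_sub_of_smul (h.comp (a.prodMk b2)) (h.comp (a'.prodMk b1)))

end Complexification

/-! ### Real analytic maps -/

section Analytic

open Complexification

variable {E : Type u} {F : Type v} [AddCommGroup E] [Module ℝ E] [TopologicalSpace E]
  [AddCommGroup F]

theorem RealAnalyticOn.of_hol [Module ℝ F] [TopologicalSpace F] {f : E → F} {U : Set E}
    (hU : IsOpen U) {W : Set (Complexification E)} (hW : IsOpen W)
    {fC : Complexification E → Complexification F} (hf : Hol fC W)
    (hUW : ∀ x ∈ U, ofReal x ∈ W ∧ fC (ofReal x) = ofReal (f x)) : RealAnalyticOn f U :=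
  ⟨hU, fun x hx => ⟨W, fC, (hUW x hx).1, hf.holomorphicOn hW, fun y hy _ => (hUW y hy).2⟩⟩

theorem RealAnalyticOn.mono [Module ℝ F] [TopologicalSpace F] {f : E → F} {U V : Set E}
    (h : RealAnalyticOn f U) (hV : IsOpen V) (hVU : V ⊆ U) : RealAnalyticOn f V :=
  ⟨hV, fun x hx => by
    obtain ⟨W, fC, h1, h2, h3⟩ := h.2 x (hVU hx)
    exact ⟨W, fC, h1, h2, fun y hy => h3 y (hVU hy)⟩⟩

/-- The complexification of a complex space `F` is `F` plus its conjugate, via x + iy ↦ (x + Iy, x -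
Iy); `T` is the inverse of this map. The first component of the extension is `g`, the second is `g`
after conjugation, whose conjugate-linear differential becomes complex linear in the conjugate
space. -/
theorem RealAnalyticOn.of_hol_complex [Module ℂ F] [TopologicalSpace F] [ContinuousAdd F]
    [ContinuousConstSMul ℂ F] [ContinuousConstSMul ℝ E] {f : E → F}
    {g : Complexification E → F} (hg : Hol g univ) (hfg : ∀ x, g (ofReal x) = f x) :
    RealAnalyticOn f univ := by
  let T : F × F →ₗ[ℝ] Complexification F :=
    { toFun := fun p => Complexification.mk ((2⁻¹ : ℂ) • (p.1 + p.2))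
        ((-(Complex.I / 2)) • (p.1 - p.2))
      map_add' := fun p q => by
        ext
        · simp; module
        · simp; module
      map_smul' := fun c p => by
        ext
        · simp only [Prod.smul_fst, Prod.smul_snd, re_mk, re_real_smul, RingHom.id_apply]
          simp only [← Complex.coe_smul]
          module
        · simp only [Prod.smul_fst, Prod.smul_snd, im_mk, im_real_smul, RingHom.id_apply]
          simp only [← Complex.coe_smul]
          module }
  have hT : Continuous T := by
    refine continuous_mk (by fun_prop) ?_
    have : (fun p : F × F => (-(Complex.I / 2)) • (p.1 - p.2)) =
        fun p : F × F => (-(Complex.I / 2)) • (p.1 + (-1 : ℂ) • p.2) := by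
      funext p; rw [neg_one_smul, sub_eq_add_neg]
    rw [this]; fun_prop
  have hconj : Continuous (conjL : Complexification E →ₗ[ℝ] Complexification E) := by
    refine continuous_mk continuous_re ?_
    have : (fun v : Complexification E => -v.im) = fun v => (-1 : ℝ) • v.im := by
      funext v; rw [neg_one_smul]
    rw [this]
    exact continuous_im.const_smul _
  let gC : Complexification E → Complexification F := fun v => T (g v, g (conjL v))
  have hgC : Hol gC univ := by
    constructor
    · intro n
      have h1 : Cn n (fun v => g (conjL v)) univ :=
        (Cn.comp_linear n conjL hconj (hg.1 n)).mono n (subset_univ _)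
      exact Cn.comp n isOpen_univ (Cn.linear n T hT univ) ((hg.1 n).prodMk n h1) (mapsTo_univ _ _)
    · intro x _
      obtain ⟨L, hL⟩ := hg.2 x (mem_univ _)
      obtain ⟨M, hM⟩ := hg.2 (conjL x) (mem_univ _)
      have h2 (h : Complexification E) : SDir gC x h (T (L h, M (conjL h))) := by
        have h3 : SDir (g ∘ conjL) x h (M (conjL h)) :=
          (hM (conjL h)).comp (SDir.linear conjL hconj x h) hconj.continuousAt
        refine SDir.comp (f := T) (g := fun v => (g v, g (conjL v))) (k := (L h, M (conjL h)))
          (SDir.linear T hT _ _) ((hL h).prodMk h3) ?_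
        have hc := hg.continuousOn.continuousAt (x := x) univ_mem
        have hc' := hg.continuousOn.continuousAt (x := conjL x) univ_mem
        exact hc.prodMk (ContinuousAt.comp hc' hconj.continuousAt)
      refine ⟨{ toFun := fun h => T (L h, M (conjL h)), map_add' := ?_, map_smul' := ?_ }, h2⟩
      · intro h k
        rw [map_add, map_add, map_add, ← Prod.mk_add_mk, map_add]
      · intro c h
        rw [conjL_smul, map_smul, map_smul]
        have hc : (starRingEnd ℂ) c = (c.re : ℂ) - c.im * Complex.I := by
          apply Complex.ext <;> simp
        have hc2 : c = (c.re : ℂ) + c.im * Complex.I := (Complex.re_add_im c).symm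
        ext
        · simp only [T, LinearMap.coe_mk, AddHom.coe_mk, re_mk, re_smul, im_mk, RingHom.id_apply,
            ← Complex.coe_smul]
          rw [hc]; nth_rewrite 1 [hc2]
          match_scalars <;> ring
        · simp only [T, LinearMap.coe_mk, AddHom.coe_mk, re_mk, im_smul, im_mk, RingHom.id_apply,
            ← Complex.coe_smul]
          rw [hc]; nth_rewrite 1 [hc2]
          match_scalars
          · linear_combination (-(c.im : ℂ) / 2) * Complex.I_sq
          · linear_combination (-(c.im : ℂ) / 2) * Complex.I_sq
  refine RealAnalyticOn.of_hol isOpen_univ isOpen_univ hgC fun x _ => ⟨mem_univ _, ?_⟩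
  have e : conjL (ofReal x) = ofReal x := by ext <;> simp
  change T (g (ofReal x), g (conjL (ofReal x))) = _
  rw [e, hfg]
  ext
  · simp only [T, LinearMap.coe_mk, AddHom.coe_mk, re_mk, re_ofReal]; module
  · simp [T]

end Analytic

/-! ### The resolvent -/

namespace UnitaryGroup

variable {H : Type u} [NormedAddCommGroup H] [InnerProductSpace ℂ H] (S : UnitaryGroup H)

/-- Differentiate the constant function ⟨γ(t)x, γ(t)y⟩ at t = 0. -/
theorem inner_generator (x y : S.generator.domain) :
    inner ℂ (S.generator x) (y : H) = inner ℂ (x : H) (S.generator y) := by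
  have h1 := (S.hasDerivAt_generator x).inner ℂ (S.hasDerivAt_generator y)
  have h2 : (fun t => inner ℂ (S.γ t (x : H)) (S.γ t (y : H))) =
      fun _ => inner ℂ (x : H) (y : H) := by
    funext t; exact (S.γ t).inner_map_map _ _
  rw [h2] at h1
  have h3 := h1.unique (hasDerivAt_const (0 : ℝ) _)
  rw [S.map_zero, S.map_zero, inner_smul_right, inner_smul_left] at h3
  simp only [Complex.conj_I] at h3
  have : Complex.I * (inner ℂ (x : H) (S.generator y) - inner ℂ (S.generator x) (y : H)) = 0 := by
    linear_combination h3
  rcases mul_eq_zero.1 this with h | h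
  · exact absurd h Complex.I_ne_zero
  · exact (sub_eq_zero.1 h).symm

open MeasureTheory in
-- The resolvent as a Laplace transform: y = ∫₀^∞ e^{ct} γ(t)x dt satisfies γ(h)y = e^{-ch}(y - ∫₀^h
-- e^{ct} γ(t)x dt), so y lies in the domain and iAy = -cy - x.
theorem exists_generator_add_smul_eq [CompleteSpace H] (x : H) :
    ∃ y : S.generator.domain, S.generator y + (1 + Complex.I / 2) • (y : H) = x := by
  -- Convergence needs Re c < 0, which corresponds to a non-real spectral parameter; c = -(1 +
  -- i/2)(-i) yields the shift 1 + i/2, close enough to 1 for a Neumann series.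
  set c : ℂ := -1 / 2 + Complex.I with hc
  let w : ℝ → H := fun t => Complex.exp (c * t) • S.γ t x
  have hw : Continuous w := by
    have := S.continuous_orbit x
    fun_prop
  have hn (t : ℝ) : ‖w t‖ = Real.exp (-(1 / 2) * t) * ‖x‖ := by
    simp only [w, norm_smul, LinearIsometryEquiv.norm_map, Complex.norm_exp]
    congr 2
    simp [hc]; ring
  have hint : IntegrableOn w (Ioi 0) := by
    have h1 : IntegrableOn (fun t : ℝ => Real.exp (-(1 / 2) * t) * ‖x‖) (Ioi 0) :=
      (integrableOn_exp_mul_Ioi (by norm_num) 0).mul_const _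
    exact h1.mono' hw.aestronglyMeasurable.restrict
      (Eventually.of_forall fun t => (hn t).le)
  set y : H := ∫ t in Ioi 0, w t with hy
  have key (h : ℝ) : S.γ h y = Complex.exp (-c * h) • (y - ∫ t in (0 : ℝ)..h, w t) := by
    have e1 : S.γ h y = ∫ t in Ioi 0, S.γ h (w t) :=
      ((S.γ h).toContinuousLinearEquiv.toContinuousLinearMap.integral_comp_comm hint).symm
    have e2 (t : ℝ) : S.γ h (w t) = Complex.exp (-c * h) • w (t + h) := by
      simp only [w, map_smul, smul_smul, ← Complex.exp_add]
      rw [← S.map_add, add_comm h t]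
      congr 2; push_cast; ring
    have e3 : (∫ t in Ioi 0, w (t + h)) = ∫ t in Ioi h, w t := by
      have h1 := (measurePreserving_add_right volume h).setIntegral_preimage_emb
        (measurableEmbedding_addRight h) w (Ioi h)
      simpa using h1
    have e4 : IntegrableOn w (Ioi h) := by
      have h2 := (hw.integrableOn_Icc (a := min 0 h) (b := max 0 h) (μ := volume)).union hint
      refine h2.mono_set fun t ht => ?_
      by_cases h0 : 0 < t
      · exact Or.inr h0
      · exact Or.inl ⟨(min_le_right _ _).trans (le_of_lt ht), (not_lt.1 h0).trans (le_max_left _ _)⟩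
    have e5 : (∫ t in Ioi h, w t) = y - ∫ t in (0 : ℝ)..h, w t := by
      rw [eq_sub_iff_add_eq, add_comm, hy]
      exact intervalIntegral.integral_interval_add_Ioi hint e4
    rw [e1, ← e5, ← e3, ← integral_smul]
    simp_rw [e2]
  have hd : HasDerivAt (fun h : ℝ => S.γ h y) (-c • y - x) 0 := by
    have h1 : HasDerivAt (fun h : ℝ => ∫ t in (0 : ℝ)..h, w t) (w 0) 0 :=
      intervalIntegral.integral_hasDerivAt_right (hw.intervalIntegrable _ _)
        (hw.stronglyMeasurableAtFilter _ _) hw.continuousAt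
    have h2 : HasDerivAt (fun h : ℝ => Complex.exp (-c * h)) (-c) 0 := by
      have : HasDerivAt (fun h : ℝ => -c * (h : ℂ)) (-c) 0 := by
        simpa using (Complex.ofRealCLM.hasDerivAt (x := (0 : ℝ))).const_mul (-c)
      simpa using this.cexp
    have h3 := h2.smul (h1.const_sub y)
    have e0 : w 0 = x := by simp [w, S.map_zero]
    have := h3.congr_of_eventuallyEq (Eventually.of_forall key)
    convert this using 1
    simp [e0]; abel
  obtain ⟨hyd, hA⟩ := S.generator_eq_of_hasDerivAt hd
  -- For -iy one has A(-iy) = cy + x, and (1 + i/2)(-iy) = -cy.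
  refine ⟨-Complex.I • ⟨y, hyd⟩, ?_⟩
  rw [LinearPMap.map_smul, hA]
  change -Complex.I • -Complex.I • (-c • y - x) + (1 + Complex.I / 2) • (-Complex.I • y) = x
  rw [hc]
  match_scalars
  · linear_combination -Complex.I * Complex.I_sq
  · linear_combination -Complex.I_sq

end UnitaryGroup

namespace StandardOscillator

variable {H : Type u} [NormedAddCommGroup H] [InnerProductSpace ℂ H] (S : StandardOscillator H)

/-- Since A ≥ 0, Re⟨y, (A + c)y⟩ ≥ ‖y‖²; then Cauchy–Schwarz. This is both the uniqueness statement
and the norm bound for the inverse. -/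
theorem norm_le_norm_add_A (c : ℂ) (hc : c.re = 1) (y : S.A.domain) :
    ‖(y : H)‖ ≤ ‖S.A y + c • (y : H)‖ := by
  by_cases h0 : ‖(y : H)‖ = 0
  · rw [h0]; exact norm_nonneg _
  have h1 : ‖(y : H)‖ * ‖(y : H)‖ ≤ ‖(y : H)‖ * ‖S.A y + c • (y : H)‖ := by
    have h2 := (Complex.re_le_norm _).trans (norm_inner_le_norm (𝕜 := ℂ) (y : H) (S.A y + c • (y : H)))
    refine le_trans ?_ h2
    rw [inner_add_right, inner_smul_right, inner_self_eq_norm_sq_to_K, Complex.add_re,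
      Complex.mul_re, hc]
    have h3 := S.nonneg y
    have h4 : (((‖(y : H)‖ : ℂ)) ^ 2).re = ‖(y : H)‖ * ‖(y : H)‖ := by
      rw [← Complex.ofReal_pow, Complex.ofReal_re, sq]
    have h5 : (((‖(y : H)‖ : ℂ)) ^ 2).im = 0 := by
      rw [← Complex.ofReal_pow, Complex.ofReal_im]
    have h6 : ((RCLike.ofReal ‖(y : H)‖ : ℂ)) = (‖(y : H)‖ : ℂ) := rfl
    rw [h6, h4, h5]
    simpa using h3
  exact le_of_mul_le_mul_left h1 (lt_of_le_of_ne (norm_nonneg _) (Ne.symm h0))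

variable [CompleteSpace H]

/-- With G = (A + 1 + i/2)⁻¹ one has 1 + A = (1 - (i/2)G)(A + 1 + i/2), and ‖G‖ ≤ 1 makes the first
factor invertible. -/
theorem exists_resolvent : ∃ R : H →L[ℂ] H, S.IsResolvent R := by
  set c : ℂ := 1 + Complex.I / 2 with hc
  have hcre : c.re = 1 := by simp [hc]
  choose G hG using S.toUnitaryGroup.exists_generator_add_smul_eq
  have huniq (y z : S.A.domain) (h : S.A y + c • (y : H) = S.A z + c • (z : H)) : y = z := by
    have h1 := S.norm_le_norm_add_A c hcre (y - z)
    rw [LinearPMap.map_sub, Submodule.coe_sub, smul_sub, sub_add_sub_comm, h, sub_self,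
      norm_zero] at h1
    exact sub_eq_zero.1 (Subtype.ext (norm_le_zero_iff.1 h1))
  let Gl : H →ₗ[ℂ] H :=
    { toFun := fun x => (G x : H)
      map_add' := fun x y => by
        rw [← Submodule.coe_add]
        refine congrArg _ (huniq _ _ ?_)
        rw [hG, LinearPMap.map_add, Submodule.coe_add, smul_add, add_add_add_comm, hG, hG]
      map_smul' := fun a x => by
        rw [RingHom.id_apply, ← Submodule.coe_smul]
        refine congrArg _ (huniq _ _ ?_)
        rw [hG, LinearPMap.map_smul, Submodule.coe_smul, smul_comm, ← smul_add, hG] }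
  let GC : H →L[ℂ] H := Gl.mkContinuous 1 fun x => by
    have := S.norm_le_norm_add_A c hcre (G x)
    rw [hG] at this
    rw [one_mul]
    exact this
  have hnorm : ‖(Complex.I / 2) • GC‖ < 1 := by
    have h1 : ‖GC‖ ≤ 1 := Gl.mkContinuous_norm_le zero_le_one _
    rw [norm_smul]
    simp
    linarith
  obtain ⟨U, hU⟩ := isUnit_one_sub_of_norm_lt_one hnorm
  refine ⟨GC * (↑U⁻¹ : H →L[ℂ] H), fun x => ?_⟩
  set z := (↑U⁻¹ : H →L[ℂ] H) x with hz
  have h1 : z - (Complex.I / 2) • (G z : H) = x := by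
    have : ((U : H →L[ℂ] H) * (↑U⁻¹ : H →L[ℂ] H)) x = x := by rw [Units.mul_inv]; rfl
    rw [hU] at this
    exact this
  refine ⟨(G z).2, ?_⟩
  change (G z : H) + S.A (G z) = x
  have h2 := hG z
  rw [show S.A (G z) = z - (1 + Complex.I / 2) • (G z : H) from eq_sub_of_add_eq h2, ← h1]
  module

theorem isResolvent : S.IsResolvent S.resolvent := by
  unfold resolvent
  rw [dif_pos S.exists_resolvent]
  exact S.exists_resolvent.choose_spec

theorem resolvent_mem (x : H) : S.resolvent x ∈ S.A.domain := (S.isResolvent x).1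

theorem A_resolvent (x : H) : S.A ⟨S.resolvent x, S.resolvent_mem x⟩ = x - S.resolvent x := by
  rw [eq_sub_iff_add_eq, add_comm]
  exact (S.isResolvent x).2

theorem resolvent_add_A (y : S.A.domain) : S.resolvent ((y : H) + S.A y) = y := by
  obtain ⟨h1, h⟩ := S.isResolvent ((y : H) + S.A y)
  exact congrArg Subtype.val (S.eq_of_add_A_eq (y := ⟨_, h1⟩) (z := y) h)

theorem resolvent_injective : Function.Injective S.resolvent := by
  rw [injective_iff_map_eq_zero]
  intro x hx
  have h := S.A_resolvent x
  have : S.A ⟨S.resolvent x, S.resolvent_mem x⟩ = 0 := by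
    have e : (⟨S.resolvent x, S.resolvent_mem x⟩ : S.A.domain) = 0 := Subtype.ext hx
    rw [e, LinearPMap.map_zero]
  rw [this, hx, sub_zero] at h
  exact h.symm

/-- The unbounded equation Ax = y is encoded by a bounded operator, so that it survives passage to
limits of series. -/
theorem mem_domain_of_eq_resolvent {x y : H} (h : x = S.resolvent (x + y)) :
    ∃ hx : x ∈ S.A.domain, S.A ⟨x, hx⟩ = y := by
  have hx : x ∈ S.A.domain := by rw [h]; exact S.resolvent_mem _
  refine ⟨hx, ?_⟩
  have e : (⟨x, hx⟩ : S.A.domain) = ⟨S.resolvent (x + y), S.resolvent_mem _⟩ := Subtype.ext h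
  rw [e, A_resolvent, ← h]; abel

theorem inner_resolvent (x y : H) :
    inner ℂ (S.resolvent x) y = inner ℂ x (S.resolvent y) := by
  obtain ⟨h1, hx⟩ := S.isResolvent x
  obtain ⟨h2, hy⟩ := S.isResolvent y
  have h := S.toUnitaryGroup.inner_generator ⟨_, h1⟩ ⟨_, h2⟩
  calc inner ℂ (S.resolvent x) y
      = inner ℂ (S.resolvent x) (S.resolvent y + S.A ⟨S.resolvent y, h2⟩) := by rw [hy]
    _ = inner ℂ (S.resolvent x + S.A ⟨S.resolvent x, h1⟩) (S.resolvent y) := by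
        rw [inner_add_right, inner_add_left]; exact congrArg _ h.symm
    _ = inner ℂ x (S.resolvent y) := by rw [hx]

theorem isSelfAdjoint_resolvent : IsSelfAdjoint S.resolvent := by
  rw [ContinuousLinearMap.isSelfAdjoint_iff_isSymmetric]
  exact fun x y => S.inner_resolvent x y

theorem norm_resolvent_le : ‖S.resolvent‖ ≤ 1 := by
  refine ContinuousLinearMap.opNorm_le_bound _ zero_le_one fun x => ?_
  have := S.norm_le_norm_add_A 1 (by simp) ⟨_, S.resolvent_mem x⟩
  rw [A_resolvent] at this
  simpa using this

theorem resolvent_nonneg : 0 ≤ S.resolvent := by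
  rw [ContinuousLinearMap.nonneg_iff_isPositive, ContinuousLinearMap.isPositive_def']
  refine ⟨S.isSelfAdjoint_resolvent, fun x => ?_⟩
  obtain ⟨h1, hx⟩ := S.isResolvent x
  have h2 := S.nonneg ⟨_, h1⟩
  change 0 ≤ (inner ℂ (S.resolvent x) x).re
  have h3 : inner ℂ (S.resolvent x) x = inner ℂ (S.resolvent x) (S.resolvent x) +
      inner ℂ (S.resolvent x) (S.A ⟨S.resolvent x, h1⟩) := by rw [← inner_add_right, hx]
  rw [h3, Complex.add_re]
  exact add_nonneg (inner_self_nonneg (𝕜 := ℂ)) h2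

theorem spectrum_resolvent {r : ℂ} (hr : r ∈ spectrum ℂ S.resolvent) :
    r = (r.re : ℂ) ∧ 0 ≤ r.re ∧ r.re ≤ 1 := by
  have h1 : r = (r.re : ℂ) := S.isSelfAdjoint_resolvent.mem_spectrum_eq_re hr
  have h2 : r.re ∈ spectrum ℝ S.resolvent := by
    rw [← spectrum.preimage_algebraMap ℂ]
    change (r.re : ℂ) ∈ spectrum ℂ S.resolvent
    rwa [← h1]
  refine ⟨h1, spectrum_nonneg_of_nonneg S.resolvent_nonneg h2, ?_⟩
  rcases subsingleton_or_nontrivial H with h | h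
  · have : (0 : H →L[ℂ] H) = 1 := Subsingleton.elim _ _
    exact absurd hr (by rw [spectrum.of_subsingleton]; exact notMem_empty _)
  · exact (Complex.re_le_norm r).trans ((spectrum.norm_le_norm_of_mem hr).trans S.norm_resolvent_le)

end StandardOscillator

namespace StandardOscillator

/-! ### The space of holomorphic vectors -/

section Basic

variable {H : Type u} [NormedAddCommGroup H] [InnerProductSpace ℂ H] (S : StandardOscillator H)

theorem toH_injective : Function.Injective S.toH := fun _ _ h =>
  Subtype.ext (Subtype.ext h)

theorem toV_AO (v : S.VO) : S.toV (S.AO v) = S.smoothA (S.toV v) := rfl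

theorem toV_AO_pow (k : ℕ) (v : S.VO) : S.toV ((S.AO ^ k) v) = (S.smoothA ^ k) (S.toV v) := by
  induction k generalizing v with
  | zero => rfl
  | succ k ih =>
    rw [pow_succ, pow_succ, Module.End.mul_apply, Module.End.mul_apply, ih, toV_AO]

/-- The sequence `k ↦ A^k v` in `H`. -/
def orb (v : S.VO) (k : ℕ) : H := S.toH ((S.AO ^ k) v)

@[simp] theorem orb_zero (v : S.VO) : S.orb v 0 = S.toH v := rfl

theorem orb_AO (v : S.VO) (k : ℕ) : S.orb (S.AO v) k = S.orb v (k + 1) := by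
  simp only [orb]; rw [pow_succ, Module.End.mul_apply]

theorem orb_AO_pow (v : S.VO) (j k : ℕ) : S.orb ((S.AO ^ j) v) k = S.orb v (k + j) := by
  simp only [orb]; rw [pow_add, Module.End.mul_apply]

theorem orb_add (v w : S.VO) (k : ℕ) : S.orb (v + w) k = S.orb v k + S.orb w k := by
  simp [orb]

theorem orb_smul (c : ℂ) (v : S.VO) (k : ℕ) : S.orb (c • v) k = c • S.orb v k := by
  simp [orb]

theorem qTerm_eq (n : ℕ) (v : S.VO) (k : ℕ) :
    S.qTerm n (S.toV v) k = (n : ℝ) ^ k / (k.factorial : ℝ) * ‖S.orb v k‖ := by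
  unfold qTerm orb
  rw [← toV_AO_pow]; rfl

/-- The norm `q_n(v) = ∑_k (n^k / k!) ‖A^k v‖`. -/
def q (n : ℕ) (v : S.VO) : ℝ := S.qSeminorm n v

theorem summable_q (n : ℕ) (v : S.VO) :
    Summable fun k => (n : ℝ) ^ k / (k.factorial : ℝ) * ‖S.orb v k‖ := by
  have := S.toV_mem v n
  exact this.congr fun k => S.qTerm_eq n v k

theorem q_eq (n : ℕ) (v : S.VO) :
    S.q n v = ∑' k, (n : ℝ) ^ k / (k.factorial : ℝ) * ‖S.orb v k‖ :=
  tsum_congr fun k => S.qTerm_eq n v k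

theorem q_nonneg (n : ℕ) (v : S.VO) : 0 ≤ S.q n v := apply_nonneg _ _

theorem le_q (n k : ℕ) (v : S.VO) :
    (n : ℝ) ^ k / (k.factorial : ℝ) * ‖S.orb v k‖ ≤ S.q n v := by
  rw [q_eq]
  exact (S.summable_q n v).le_tsum k fun j _ => by positivity

theorem norm_toH_le_q (n : ℕ) (v : S.VO) : ‖S.toH v‖ ≤ S.q n v := by
  simpa using S.le_q n 0 v

/-- From (j+k)! ≤ 2^{j+k} j! k! the weight (2M)^{j+k}/(j+k)! dominates the product of M^j/j! and
M^k/k!. Powers of A thus cost a factorial, which entire coefficient sequences can pay. -/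
theorem q_AO_pow_le (n M k : ℕ) (hM : 1 ≤ M) (hn : n ≤ M) (v : S.VO) :
    S.q n ((S.AO ^ k) v) ≤ (k.factorial / (M : ℝ) ^ k) * S.q (2 * M) v := by
  have hM' : (0 : ℝ) < M := by exact_mod_cast hM
  rw [q_eq, q_eq, ← tsum_mul_left]
  have hs := S.summable_q (2 * M) v
  refine le_trans (Summable.tsum_le_tsum (g := fun j =>
    (k.factorial / (M : ℝ) ^ k) * (((2 * M : ℕ) : ℝ) ^ (j + k) / ((j + k).factorial : ℝ) *
      ‖S.orb v (j + k)‖)) (fun j => ?_) (S.summable_q n _)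
    (((summable_nat_add_iff k).2 hs).mul_left _)) ?_
  · rw [orb_AO_pow, ← mul_assoc]
    refine mul_le_mul_of_nonneg_right ?_ (norm_nonneg _)
    have h1 : ((j + k).factorial : ℝ) ≤ 2 ^ (j + k) * (j.factorial * k.factorial) := by
      have e : (j + k).factorial = (j + k).choose j * (j.factorial * k.factorial) := by
        rw [← Nat.add_choose_mul_factorial_mul_factorial, mul_assoc, Nat.choose_symm_add]
      have h2 : (j + k).choose j ≤ 2 ^ (j + k) := Nat.choose_le_two_pow _ _
      rw [e]; push_cast
      gcongr
      exact_mod_cast h2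
    have h3 : (n : ℝ) ^ j ≤ (M : ℝ) ^ j := by gcongr
    rw [div_mul_div_comm, div_le_div_iff₀ (by positivity) (by positivity)]
    push_cast
    rw [mul_pow, pow_add (M : ℝ)]
    calc (n : ℝ) ^ j * ((M : ℝ) ^ k * ((j + k).factorial : ℝ))
        ≤ (M : ℝ) ^ j * ((M : ℝ) ^ k * (2 ^ (j + k) * (j.factorial * k.factorial))) := by gcongr
      _ = _ := by ring
  · refine (((summable_nat_add_iff k).2 hs).mul_left
      ((k.factorial : ℝ) / (M : ℝ) ^ k)).tsum_le_tsum_of_inj (fun j => j + k) (add_left_injective k)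
      (fun j _ => by positivity) (fun j => le_rfl) (hs.mul_left _)

theorem q_mono {n m : ℕ} (h : n ≤ m) (v : S.VO) : S.q n v ≤ S.q m v := by
  rw [q_eq, q_eq]
  refine Summable.tsum_le_tsum (fun k => ?_) (S.summable_q n v) (S.summable_q m v)
  gcongr

theorem q_smul (n : ℕ) (c : ℂ) (v : S.VO) : S.q n (c • v) = ‖c‖ * S.q n v := by
  rw [q_eq, q_eq, ← tsum_mul_left]
  refine tsum_congr fun k => ?_
  rw [orb_smul, norm_smul]; ring

theorem withSeminorms_q : WithSeminorms S.qSeminorm := ⟨rfl⟩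

instance : IsTopologicalAddGroup S.VO := S.withSeminorms_q.topologicalAddGroup

instance : ContinuousSMul ℝ S.VO := S.withSeminorms_q.continuousSMul

theorem continuous_q (n : ℕ) : Continuous (S.q n) := S.withSeminorms_q.continuous_seminorm n

theorem tendsto_VO_iff {ι : Type*} {l : Filter ι} {f : ι → S.VO} {v : S.VO} :
    Tendsto f l (𝓝 v) ↔ ∀ n, Tendsto (fun i => S.q n (f i - v)) l (𝓝 0) := by
  rw [S.withSeminorms_q.tendsto_nhds]
  constructor
  · intro h n
    rw [Metric.tendsto_nhds]
    intro ε hε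
    filter_upwards [h n ε hε] with i hi
    rw [Real.dist_eq, sub_zero, abs_of_nonneg (S.q_nonneg n _)]
    exact hi
  · intro h n ε hε
    exact (h n).eventually (gt_mem_nhds hε)

theorem continuous_toH : Continuous S.toH := by
  rw [continuous_iff_continuousAt]
  intro v
  have h := (S.tendsto_VO_iff (l := 𝓝 v) (f := id) (v := v)).1 tendsto_id 0
  rw [ContinuousAt, tendsto_iff_norm_sub_tendsto_zero]
  refine squeeze_zero (fun _ => norm_nonneg _) (fun w => ?_) h
  rw [← map_sub]
  exact S.norm_toH_le_q 0 _

instance : T2Space S.VO := T2Space.of_injective_continuous S.toH_injective S.continuous_toH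

/-- A linear map that is bounded with respect to the norms `q_n` is continuous. -/
theorem continuous_of_q_le (T : S.VO →ₗ[ℝ] S.VO)
    (h : ∀ n, ∃ (m : ℕ) (C : ℝ), ∀ v, S.q n (T v) ≤ C * S.q m v) : Continuous T := by
  rw [continuous_iff_continuousAt]
  intro v
  rw [ContinuousAt, tendsto_VO_iff]
  intro n
  obtain ⟨m, C, hC⟩ := h n
  have h1 := ((S.tendsto_VO_iff (l := 𝓝 v) (f := id) (v := v)).1 tendsto_id m).const_mul C
  rw [mul_zero] at h1
  refine squeeze_zero (fun _ => S.q_nonneg n _) (fun w => ?_) h1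
  rw [← map_sub]
  exact hC _

theorem continuous_AO : Continuous S.AO := by
  refine S.continuous_of_q_le (S.AO.restrictScalars ℝ) fun n => ⟨2 * (n + 1), 1, fun v => ?_⟩
  have h := S.q_AO_pow_le n (n + 1) 1 (by omega) (by omega) v
  rw [pow_one] at h
  refine h.trans (mul_le_mul_of_nonneg_right ?_ (S.q_nonneg _ _))
  rw [div_le_one (by positivity)]
  push_cast; simp

theorem hasDerivAt_toH (v : S.VO) :
    HasDerivAt (fun t => S.γ t (S.toH v)) (Complex.I • S.toH (S.AO v)) 0 :=
  S.hasDerivAt_generator ⟨S.toH v, S.smooth_domain (S.toV v)⟩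

end Basic

/-! ### Holomorphic vectors from sequences, and power series in `A` -/

section Complete

set_option linter.unusedSectionVars false

variable {H : Type u} [NormedAddCommGroup H] [InnerProductSpace ℂ H] (S : StandardOscillator H)
  [CompleteSpace H]

theorem resolvent_toH (v : S.VO) : S.resolvent (S.toH v + S.toH (S.AO v)) = S.toH v :=
  S.resolvent_add_A ⟨S.toH v, S.smooth_domain (S.toV v)⟩

theorem resolvent_orb (v : S.VO) (k : ℕ) :
    S.resolvent (S.orb v k + S.orb v (k + 1)) = S.orb v k := by
  have := S.resolvent_toH ((S.AO ^ k) v)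
  rw [← orb_AO]
  have e : S.orb (S.AO v) k = S.toH (S.AO ((S.AO ^ k) v)) := by
    simp only [orb]
    rw [← Module.End.mul_apply, ← Module.End.mul_apply, ← pow_succ, ← pow_succ']
  rw [e]; exact this

/-- The recursion says A(a k) = a (k+1). So the orbit of a k has derivative iγ(t)a (k+1), and
differentiability of all orders follows by bootstrapping in k; the summability is the finiteness of
the q_n. -/
theorem exists_VO_of_seq (a : ℕ → H) (h : ∀ k, S.resolvent (a k + a (k + 1)) = a k)
    (hs : ∀ n : ℕ, Summable fun k => (n : ℝ) ^ k / (k.factorial : ℝ) * ‖a k‖) :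
    ∃ v : S.VO, ∀ k, S.orb v k = a k := by
  choose hd hA using fun k => S.mem_domain_of_eq_resolvent (h k).symm
  have hder (k : ℕ) (t : ℝ) :
      HasDerivAt (fun t => S.γ t (a k)) (Complex.I • S.γ t (a (k + 1))) t := by
    have := S.hasDerivAt_orbit (S.hasDerivAt_generator ⟨a k, hd k⟩) t
    rw [map_smul] at this
    convert this using 2
    rw [← hA k]
  have hsm (n : ℕ) : ∀ k, ContDiff ℝ n fun t => S.γ t (a k) := by
    induction n with
    | zero => intro k; exact contDiff_zero.2 (S.continuous_orbit _)
    | succ n ih =>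
      intro k
      have : ((n + 1 : ℕ) : WithTop ℕ∞) = (n : WithTop ℕ∞) + 1 := by push_cast; rfl
      rw [this, contDiff_succ_iff_deriv]
      refine ⟨fun t => (hder k t).differentiableAt, by simp, ?_⟩
      rw [show deriv (fun t => S.γ t (a k)) = fun t => Complex.I • S.γ t (a (k + 1)) from
        funext fun t => (hder k t).deriv]
      exact (ih (k + 1)).const_smul Complex.I
  have hmem (k : ℕ) : a k ∈ S.smoothVec := contDiff_infty.2 fun n => hsm n k
  have hAk (k : ℕ) : S.smoothA ⟨a k, hmem k⟩ = ⟨a (k + 1), hmem (k + 1)⟩ := Subtype.ext (hA k)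
  have hpow (k : ℕ) : (S.smoothA ^ k) ⟨a 0, hmem 0⟩ = ⟨a k, hmem k⟩ := by
    induction k with
    | zero => rfl
    | succ k ih => rw [pow_succ', Module.End.mul_apply, ih, hAk]
  have hv : (⟨a 0, hmem 0⟩ : S.smoothVec) ∈ S.holVec := fun n => by
    refine (hs n).congr fun k => ?_
    unfold qTerm
    rw [hpow]; rfl
  let w : S.VO := (⟨_, hv⟩ : ↥S.holVec)
  refine ⟨w, fun k => ?_⟩
  have h1 : S.toV ((S.AO ^ k) w) = ⟨a k, hmem k⟩ := (S.toV_AO_pow k w).trans (hpow k)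
  exact congrArg Subtype.val h1

/-! ### Power series in `A` -/

/-- The coefficient sequences of entire functions of exponential type less than `M`, in a weighted
`ℓ¹`-sense. -/
def ExpSummable (M : ℕ) (c : ℕ → ℂ) : Prop :=
  1 ≤ M ∧ Summable fun k => ‖c k‖ * (k.factorial / (M : ℝ) ^ k)

/-- The weighted `ℓ¹`-norm. -/
def expNorm (M : ℕ) (c : ℕ → ℂ) : ℝ := ∑' k, ‖c k‖ * (k.factorial / (M : ℝ) ^ k)

variable {M : ℕ} {c d : ℕ → ℂ}

theorem orb_norm_le (hM : 1 ≤ M) (v : S.VO) (j k : ℕ) :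
    ‖S.orb v (k + j)‖ ≤ (k.factorial / (M : ℝ) ^ k) * S.q (2 * M) ((S.AO ^ j) v) := by
  have h1 := S.norm_toH_le_q 0 ((S.AO ^ k) ((S.AO ^ j) v))
  have h2 := S.q_AO_pow_le 0 M k hM (Nat.zero_le _) ((S.AO ^ j) v)
  have e : S.toH ((S.AO ^ k) ((S.AO ^ j) v)) = S.orb v (k + j) := by
    rw [← orb_AO_pow]; rfl
  rw [e] at h1
  exact h1.trans h2

theorem norm_ser_term_le (hM : 1 ≤ M) (v : S.VO) (j k : ℕ) :
    ‖c k • S.orb v (k + j)‖ ≤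
      ‖c k‖ * (k.factorial / (M : ℝ) ^ k) * S.q (2 * M) ((S.AO ^ j) v) := by
  rw [norm_smul, mul_assoc]
  exact mul_le_mul_of_nonneg_left (S.orb_norm_le hM v j k) (norm_nonneg _)

theorem summable_ser (hc : ExpSummable M c) (v : S.VO) (j : ℕ) :
    Summable fun k => c k • S.orb v (k + j) :=
  Summable.of_norm_bounded (hc.2.mul_right _) fun k => S.norm_ser_term_le hc.1 v j k

theorem summable_ser_zero (hc : ExpSummable M c) (v : S.VO) :
    Summable fun k => c k • S.orb v k := S.summable_ser hc v 0

theorem norm_tsum_ser_le (hc : ExpSummable M c) (v : S.VO) (j : ℕ) :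
    ‖∑' k, c k • S.orb v (k + j)‖ ≤ expNorm M c * S.q (2 * M) ((S.AO ^ j) v) := by
  unfold expNorm
  rw [← tsum_mul_right]
  exact tsum_of_norm_bounded (hc.2.mul_right _).hasSum fun k => S.norm_ser_term_le hc.1 v j k

theorem expNorm_nonneg : 0 ≤ expNorm M c := tsum_nonneg fun k => by positivity

theorem q_term_le_of_norm_le (hM : 1 ≤ M) {C : ℝ} (hC : 0 ≤ C) {v : S.VO} {a : ℕ → H}
    (h : ∀ j, ‖a j‖ ≤ C * S.q (2 * M) ((S.AO ^ j) v)) (n j : ℕ) :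
    (n : ℝ) ^ j / (j.factorial : ℝ) * ‖a j‖ ≤
      C * S.q (2 * (2 * M + 2 * n)) v * (1 / 2) ^ j := by
  -- This choice satisfies N ≥ 2M, so that the estimate for powers of A applies, and n/N ≤ 1/2, so
  -- that the terms decay geometrically.
  set N := 2 * M + 2 * n with hN
  have hN0 : (0 : ℝ) < N := by have : 1 ≤ N := by omega
                               exact_mod_cast this
  have h1 := S.q_AO_pow_le (2 * M) N j (by omega) (by omega) v
  have h2 : ((n : ℝ) / N) ^ j ≤ (1 / 2) ^ j := by
    refine pow_le_pow_left₀ (by positivity) ?_ j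
    rw [div_le_div_iff₀ hN0 (by norm_num), hN]; push_cast
    have : (0 : ℝ) ≤ M := by positivity
    linarith
  have hq := S.q_nonneg (2 * N) v
  calc (n : ℝ) ^ j / (j.factorial : ℝ) * ‖a j‖
      ≤ (n : ℝ) ^ j / (j.factorial : ℝ) * (C * ((j.factorial / (N : ℝ) ^ j) * S.q (2 * N) v)) := by
        gcongr
        exact (h j).trans (mul_le_mul_of_nonneg_left h1 hC)
    _ = C * S.q (2 * N) v * ((n : ℝ) / N) ^ j := by
        have : (j.factorial : ℝ) ≠ 0 := by positivity
        rw [div_pow]; field_simp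
    _ ≤ _ := mul_le_mul_of_nonneg_left h2 (by positivity)

/-- The bounded operator R may be applied term by term, so the shifted series inherit the recursion
that characterizes sequences A^j w. -/
theorem exists_ser (hc : ExpSummable M c) (v : S.VO) :
    ∃ w : S.VO, ∀ j, S.orb w j = ∑' k, c k • S.orb v (k + j) := by
  refine S.exists_VO_of_seq _ (fun j => ?_) fun n => ?_
  · have h1 := S.summable_ser hc v j
    have h2 := S.summable_ser hc v (j + 1)
    rw [← h1.tsum_add h2, S.resolvent.map_tsum (h1.add h2)]
    refine tsum_congr fun k => ?_
    rw [← smul_add, map_smul, ← add_assoc, resolvent_orb]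
  · refine Summable.of_nonneg_of_le (fun j => by positivity)
      (S.q_term_le_of_norm_le hc.1 expNorm_nonneg (S.norm_tsum_ser_le hc v) n)
      (summable_geometric_two.mul_left _)

open Classical in
/-- The operator `∑_k c_k A^k` on `V^𝒪`. -/
def ser (c : ℕ → ℂ) (v : S.VO) : S.VO :=
  if h : ∃ w : S.VO, ∀ j, S.orb w j = ∑' k, c k • S.orb v (k + j) then h.choose else 0

theorem orb_ser (hc : ExpSummable M c) (v : S.VO) (j : ℕ) :
    S.orb (S.ser c v) j = ∑' k, c k • S.orb v (k + j) := by
  unfold ser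
  rw [dif_pos (S.exists_ser hc v)]
  exact (S.exists_ser hc v).choose_spec j

theorem toH_ser (hc : ExpSummable M c) (v : S.VO) :
    S.toH (S.ser c v) = ∑' k, c k • S.orb v k := S.orb_ser hc v 0

theorem q_ser_le (hc : ExpSummable M c) (n : ℕ) (v : S.VO) :
    S.q n (S.ser c v) ≤ 2 * expNorm M c * S.q (2 * (2 * M + 2 * n)) v := by
  rw [q_eq]
  have h1 := S.q_term_le_of_norm_le (a := S.orb (S.ser c v)) hc.1 expNorm_nonneg
    (fun j => by rw [S.orb_ser hc]; exact S.norm_tsum_ser_le hc v j) n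
  refine (Summable.tsum_le_tsum h1 (S.summable_q n _) (summable_geometric_two.mul_left _)).trans ?_
  rw [tsum_mul_left, tsum_geometric_two]
  exact le_of_eq (by ring)

theorem ExpSummable.add (hc : ExpSummable M c) (hd : ExpSummable M d) :
    ExpSummable M (c + d) :=
  ⟨hc.1, Summable.of_nonneg_of_le (fun k => by positivity) (fun k => by
    rw [← add_mul]; gcongr; exact norm_add_le _ _) (hc.2.add hd.2)⟩

theorem ExpSummable.smul (a : ℂ) (hc : ExpSummable M c) : ExpSummable M (a • c) :=
  ⟨hc.1, (hc.2.mul_left ‖a‖).congr fun k => by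
    rw [Pi.smul_apply, smul_eq_mul, norm_mul, mul_assoc]⟩

theorem ser_add_left (hc : ExpSummable M c) (hd : ExpSummable M d) (v : S.VO) :
    S.ser (c + d) v = S.ser c v + S.ser d v := by
  apply S.toH_injective
  rw [map_add, S.toH_ser (hc.add hd), S.toH_ser hc, S.toH_ser hd,
    ← (S.summable_ser_zero hc v).tsum_add (S.summable_ser_zero hd v)]
  exact tsum_congr fun k => add_smul _ _ _

theorem ser_smul_left (a : ℂ) (hc : ExpSummable M c) (v : S.VO) :
    S.ser (a • c) v = a • S.ser c v := by
  apply S.toH_injective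
  rw [map_smul, S.toH_ser (hc.smul a), S.toH_ser hc, ← (S.summable_ser_zero hc v).tsum_const_smul]
  exact tsum_congr fun k => by rw [Pi.smul_apply, smul_assoc]

theorem ser_add_right (hc : ExpSummable M c) (v w : S.VO) :
    S.ser c (v + w) = S.ser c v + S.ser c w := by
  apply S.toH_injective
  rw [map_add, S.toH_ser hc, S.toH_ser hc, S.toH_ser hc,
    ← (S.summable_ser_zero hc v).tsum_add (S.summable_ser_zero hc w)]
  exact tsum_congr fun k => by rw [orb_add, smul_add]

theorem ser_smul_right (a : ℂ) (hc : ExpSummable M c) (v : S.VO) :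
    S.ser c (a • v) = a • S.ser c v := by
  apply S.toH_injective
  rw [map_smul, S.toH_ser hc, S.toH_ser hc, ← (S.summable_ser_zero hc v).tsum_const_smul]
  exact tsum_congr fun k => by rw [orb_smul, smul_comm]

theorem ser_sub_sum (hc : ExpSummable M c) (v : S.VO) (s : Finset ℕ) :
    (∑ k ∈ s, c k • (S.AO ^ k) v) - S.ser c v =
      S.ser (fun k => if k ∈ s then 0 else -c k) v ∧
    ExpSummable M (fun k => if k ∈ s then 0 else -c k) := by
  have hd : ExpSummable M (fun k => if k ∈ s then 0 else -c k) :=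
    ⟨hc.1, Summable.of_nonneg_of_le (fun k => by positivity) (fun k => by
      by_cases hk : k ∈ s
      · simp only [hk, if_true, norm_zero, zero_mul]; positivity
      · simp [hk]) hc.2⟩
  refine ⟨?_, hd⟩
  apply S.toH_injective
  rw [map_sub, map_sum, S.toH_ser hc, S.toH_ser hd, sub_eq_iff_eq_add,
    ← (S.summable_ser_zero hd v).tsum_add (S.summable_ser_zero hc v), tsum_eq_sum (s := s)]
  · refine Finset.sum_congr rfl fun k hk => ?_
    simp [hk, orb]
  · intro k hk
    simp [hk]

/-- The remainder after a finite set of terms is again a power series in A, and its weighted ℓ¹-norm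
is a tail of a convergent series. -/
theorem hasSum_ser (hc : ExpSummable M c) (v : S.VO) :
    HasSum (fun k => c k • (S.AO ^ k) v) (S.ser c v) := by
  rw [HasSum, tendsto_VO_iff]
  intro n
  have h1 : Tendsto (fun s : Finset ℕ => expNorm M (fun k => if k ∈ s then 0 else -c k))
      atTop (𝓝 0) := by
    have := tendsto_tsum_compl_atTop_zero fun k => ‖c k‖ * (k.factorial / (M : ℝ) ^ k)
    refine this.congr fun s => ?_
    unfold expNorm
    refine (tsum_subtype {x | x ∉ s} fun k => ‖c k‖ * (k.factorial / (M : ℝ) ^ k)).trans ?_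
    refine tsum_congr fun k => ?_
    by_cases hk : k ∈ s <;> simp [hk]
  have h2 := (h1.const_mul 2).mul_const (S.q (2 * (2 * M + 2 * n)) v)
  rw [mul_zero, zero_mul] at h2
  refine squeeze_zero (fun _ => S.q_nonneg n _) (fun s => ?_) h2
  obtain ⟨e, hd⟩ := S.ser_sub_sum hc v s
  change S.q n ((∑ k ∈ s, c k • (S.AO ^ k) v) - S.ser c v) ≤ _
  rw [e]
  exact S.q_ser_le hd n v

end Complete

end StandardOscillator

namespace StandardOscillator

/-! ### Bounded functions of `A` acting on holomorphic vectors -/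

section Calculus

set_option linter.unusedSectionVars false

variable {H : Type u} [NormedAddCommGroup H] [InnerProductSpace ℂ H] (S : StandardOscillator H)
  [CompleteSpace H]

/-- The continuous functions on the spectrum of `(1 + A)⁻¹`. -/
abbrev Alg : Type := C(spectrum ℂ S.resolvent, ℂ)

/-- The functional calculus of `(1 + A)⁻¹`. -/
def Phi : S.Alg →⋆ₐ[ℂ] (H →L[ℂ] H) :=
  cfcHom (show IsStarNormal S.resolvent from S.isSelfAdjoint_resolvent.isStarNormal)

/-- The spectral variable `r = (1 + x)⁻¹`. -/
def rad (p : spectrum ℂ S.resolvent) : ℝ := (p : ℂ).re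

/-- The spectral variable `x` of `A`. -/
def var (p : spectrum ℂ S.resolvent) : ℝ := (S.rad p)⁻¹ - 1

theorem rad_nonneg (p : spectrum ℂ S.resolvent) : 0 ≤ S.rad p := (S.spectrum_resolvent p.2).2.1

theorem rad_le_one (p : spectrum ℂ S.resolvent) : S.rad p ≤ 1 := (S.spectrum_resolvent p.2).2.2

theorem coe_rad (p : spectrum ℂ S.resolvent) : (S.rad p : ℂ) = p :=
  (S.spectrum_resolvent p.2).1.symm

theorem continuous_rad : Continuous S.rad := Complex.continuous_re.comp continuous_subtype_val

theorem var_nonneg {p : spectrum ℂ S.resolvent} (hp : 0 < S.rad p) : 0 ≤ S.var p :=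
  sub_nonneg.2 ((one_le_inv₀ hp).2 (S.rad_le_one p))

/-- The function `r` on the spectrum. -/
def radAlg : S.Alg := ⟨fun p => (S.rad p : ℂ), Complex.continuous_ofReal.comp S.continuous_rad⟩

theorem Phi_radAlg : S.Phi S.radAlg = S.resolvent := by
  have h := cfcHom_id (R := ℂ) (a := S.resolvent)
    (show IsStarNormal S.resolvent from S.isSelfAdjoint_resolvent.isStarNormal)
  have e : S.radAlg = (ContinuousMap.id ℂ).restrict (spectrum ℂ S.resolvent) :=
    ContinuousMap.ext fun p => S.coe_rad p
  unfold Phi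
  rw [e, h]

theorem norm_Phi (a : S.Alg) : ‖S.Phi a‖ = ‖a‖ :=
  norm_cfcHom S.resolvent a S.isSelfAdjoint_resolvent.isStarNormal

theorem Phi_comm (a : S.Alg) (t : ℝ) (x : H) : S.Phi a (S.γ t x) = S.γ t (S.Phi a x) := by
  let U : H →L[ℂ] H := (S.γ t).toContinuousLinearEquiv.toContinuousLinearMap
  have hU : Commute S.resolvent U := ContinuousLinearMap.ext fun x => S.resolvent_comm t x
  have h := S.isSelfAdjoint_resolvent.commute_cfcHom (𝕜 := ℂ)
    (show IsStarNormal S.resolvent from S.isSelfAdjoint_resolvent.isStarNormal) hU a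
  exact congrArg (fun T : H →L[ℂ] H => T x) h.eq

/-- The operator `a(A)` on `V^𝒪`. -/
def act (a : S.Alg) (v : S.VO) : S.VO := S.restrictVO (S.Phi a) (S.Phi_comm a) v

@[simp] theorem toH_act (a : S.Alg) (v : S.VO) : S.toH (S.act a v) = S.Phi a (S.toH v) := rfl

theorem act_add_left (a b : S.Alg) (v : S.VO) : S.act (a + b) v = S.act a v + S.act b v := by
  apply S.toH_injective; simp

theorem act_smul_left (c : ℂ) (a : S.Alg) (v : S.VO) : S.act (c • a) v = c • S.act a v := by
  apply S.toH_injective; simp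

theorem act_add_right (a : S.Alg) (v w : S.VO) : S.act a (v + w) = S.act a v + S.act a w := by
  apply S.toH_injective; simp

theorem act_smul_right (c : ℂ) (a : S.Alg) (v : S.VO) : S.act a (c • v) = c • S.act a v := by
  apply S.toH_injective; simp

theorem act_mul (a b : S.Alg) (v : S.VO) : S.act (a * b) v = S.act a (S.act b v) := by
  apply S.toH_injective; simp

theorem orb_restrictVO (T : H →L[ℂ] H) (hT : ∀ t x, T (S.γ t x) = S.γ t (T x)) (v : S.VO)
    (k : ℕ) : S.orb (S.restrictVO T hT v) k = T (S.orb v k) := by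
  have h := S.commuting_A_pow T hT k (S.toV v)
  have e1 : S.orb (S.restrictVO T hT v) k = ((S.smoothA ^ k) (S.toV (S.restrictVO T hT v)) : H) := by
    rw [← toV_AO_pow]; rfl
  have e2 : S.orb v k = ((S.smoothA ^ k) (S.toV v) : H) := by
    rw [← toV_AO_pow]; rfl
  rw [e1, e2, ← h]; rfl

theorem orb_act (a : S.Alg) (v : S.VO) (k : ℕ) : S.orb (S.act a v) k = S.Phi a (S.orb v k) :=
  S.orb_restrictVO _ _ v k

theorem q_restrictVO_le (T : H →L[ℂ] H) (hT : ∀ t x, T (S.γ t x) = S.γ t (T x)) (v : S.VO)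
    (n : ℕ) : S.q n (S.restrictVO T hT v) ≤ ‖T‖ * S.q n v := by
  rw [q_eq, q_eq, ← tsum_mul_left]
  refine Summable.tsum_le_tsum (fun k => ?_) (S.summable_q n _) ((S.summable_q n v).mul_left _)
  rw [orb_restrictVO, ← mul_assoc, mul_comm ‖T‖, mul_assoc]
  exact mul_le_mul_of_nonneg_left (T.le_opNorm _) (by positivity)

theorem q_act_le (a : S.Alg) (v : S.VO) (n : ℕ) : S.q n (S.act a v) ≤ ‖a‖ * S.q n v := by
  rw [← S.norm_Phi]
  exact S.q_restrictVO_le _ _ v n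

theorem resolvent_Phi (a : S.Alg) (x : H) : S.resolvent (S.Phi a x) = S.Phi a (S.resolvent x) := by
  have h := congrArg (fun b => S.Phi b x) (mul_comm S.radAlg a)
  simp only [map_mul, Phi_radAlg] at h
  exact h

/-- If `l = x k` then `l(A) v = k(A) A v`. -/
theorem act_AO_of_mul (k l : S.Alg) (h : ∀ p, (S.rad p : ℂ) * l p = (1 - S.rad p) * k p)
    (v : S.VO) : S.act k (S.AO v) = S.act l v := by
  apply S.toH_injective
  apply S.resolvent_injective
  have e : S.radAlg * l = k - S.radAlg * k := ContinuousMap.ext fun p => by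
    have := h p
    change (S.rad p : ℂ) * l p = k p - (S.rad p : ℂ) * k p
    rw [this]; ring
  have e1 := congrArg (fun b => S.Phi b (S.toH v)) e
  simp only [map_mul, map_sub, Phi_radAlg] at e1
  change S.resolvent (S.Phi l (S.toH v)) =
    S.Phi k (S.toH v) - S.resolvent (S.Phi k (S.toH v)) at e1
  have e3 : S.resolvent (S.toH (S.AO v)) = S.toH v - S.resolvent (S.toH v) := by
    rw [eq_sub_iff_add_eq, add_comm, ← map_add, resolvent_toH]
  rw [toH_act, toH_act, e1, resolvent_Phi, resolvent_Phi, e3, map_sub]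

/-- A function on the spectrum that vanishes for large values of `x`. -/
def IsCut (k : S.Alg) : Prop := ∃ δ : ℝ, 0 < δ ∧ ∀ p, S.rad p ≤ δ → k p = 0

/-- The operator `T` is the multiplication with the function `h` of the spectral variable of `A`. -/
def IsSym (T : S.VO → S.VO) (h : ℝ → ℂ) : Prop :=
  ∀ k l : S.Alg, S.IsCut k → (∀ p, l p = h (S.var p) * k p) → ∀ v, S.act k (T v) = S.act l v

theorem IsCut.mul_of_eq {k l : S.Alg} (hk : S.IsCut k) {h : ℝ → ℂ}
    (hl : ∀ p, l p = h (S.var p) * k p) : S.IsCut l := by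
  obtain ⟨δ, h0, h1⟩ := hk
  exact ⟨δ, h0, fun p hp => by rw [hl, h1 p hp, mul_zero]⟩

/-- The spectral variable x = r⁻¹ - 1 is discontinuous only at r = 0, where a cut function vanishes
identically nearby. The truncation `max 0` places the argument in the range where `h` is continuous.
-/
theorem exists_mul_cut {k : S.Alg} (hk : S.IsCut k) {h : ℝ → ℂ} (hh : ContinuousOn h (Ici 0)) :
    ∃ l : S.Alg, ∀ p, l p = h (S.var p) * k p := by
  obtain ⟨δ, h0, h1⟩ := hk
  let g : spectrum ℂ S.resolvent → ℂ := fun p => h (max 0 (S.var p)) * k p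
  have hg : Continuous g := by
    rw [continuous_iff_continuousAt]
    intro p
    by_cases hp : S.rad p < δ
    · have : g =ᶠ[𝓝 p] fun _ => 0 := by
        filter_upwards [S.continuous_rad.continuousAt.eventually (gt_mem_nhds hp)] with p' hp'
        simp [g, h1 p' hp'.le]
      exact continuousAt_const.congr this.symm
    · have hp0 : S.rad p ≠ 0 := by
        intro h; rw [h] at hp; exact hp h0
      have h2 : ContinuousAt S.var p := by
        refine ContinuousAt.sub (S.continuous_rad.continuousAt.inv₀ hp0) continuousAt_const
      have h3 : Continuous fun x : ℝ => h (max 0 x) :=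
        hh.comp_continuous (by fun_prop) fun x => mem_Ici.2 (le_max_left _ _)
      exact (ContinuousAt.comp h3.continuousAt h2).mul k.continuous.continuousAt
  refine ⟨⟨g, hg⟩, fun p => ?_⟩
  change h (max 0 (S.var p)) * k p = _
  by_cases hp : S.rad p ≤ δ
  · rw [h1 p hp, mul_zero, mul_zero]
  · rw [max_eq_right (S.var_nonneg (h0.trans (not_le.1 hp)))]

/-- The cutoff function `max(r - δ, 0)`. -/
def cutoff (δ : ℝ) : S.Alg :=
  ⟨fun p => ((max (S.rad p - δ) 0 : ℝ) : ℂ),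
    Complex.continuous_ofReal.comp ((S.continuous_rad.sub continuous_const).max continuous_const)⟩

theorem isCut_cutoff {δ : ℝ} (hδ : 0 < δ) : S.IsCut (S.cutoff δ) :=
  ⟨δ, hδ, fun p hp => by
    change ((max (S.rad p - δ) 0 : ℝ) : ℂ) = 0
    rw [max_eq_right (by linarith)]; simp⟩

/-- The functions max(r - δ, 0) tend to r uniformly as δ → 0, so R kills the difference of the two
vectors, and R is injective. -/
theorem eq_of_cutoff {v w : S.VO} (h : ∀ k, S.IsCut k → S.act k v = S.act k w) : v = w := by
  apply S.toH_injective
  apply S.resolvent_injective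
  rw [← sub_eq_zero, ← map_sub]
  set y := S.toH v - S.toH w
  have h1 (δ : ℝ) (hδ : 0 < δ) : ‖S.resolvent y‖ ≤ δ * ‖y‖ := by
    have h2 : S.Phi (S.cutoff δ) y = 0 := by
      have := congrArg S.toH (h _ (S.isCut_cutoff hδ))
      rw [toH_act, toH_act] at this
      rw [map_sub, this, sub_self]
    have h3 : S.resolvent y = S.Phi (S.radAlg - S.cutoff δ) y := by
      rw [map_sub S.Phi, Phi_radAlg, sub_apply, h2, sub_zero]
    rw [h3]
    refine ((S.Phi _).le_opNorm _).trans (mul_le_mul_of_nonneg_right ?_ (norm_nonneg _))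
    rw [norm_Phi, ContinuousMap.norm_le _ hδ.le]
    intro p
    change ‖((S.rad p : ℝ) : ℂ) - ((max (S.rad p - δ) 0 : ℝ) : ℂ)‖ ≤ δ
    rw [← Complex.ofReal_sub, Complex.norm_real, Real.norm_eq_abs, abs_le]
    have := S.rad_nonneg p
    rcases le_total (S.rad p - δ) 0 with hp | hp
    · rw [max_eq_right hp]; constructor <;> linarith
    · rw [max_eq_left hp]; constructor <;> linarith
  have h4 : ‖S.resolvent y‖ ≤ 0 := by
    refine le_of_forall_pos_le_add fun ε hε => ?_
    have := h1 (ε / (‖y‖ + 1)) (by positivity)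
    refine this.trans ?_
    rw [zero_add, div_mul_eq_mul_div, div_le_iff₀ (by positivity)]
    nlinarith [norm_nonneg y]
  exact norm_le_zero_iff.1 h4

variable {S} in
-- The workhorse of the calculus: identities between possibly unbounded operators become identities
-- of functions on [0,∞).
theorem IsSym.eq {T T' : S.VO → S.VO} {h h' : ℝ → ℂ} (hT : S.IsSym T h) (hT' : S.IsSym T' h')
    (hc : ContinuousOn h (Ici 0)) (hh : ∀ x, 0 ≤ x → h x = h' x) (v : S.VO) : T v = T' v := by
  refine S.eq_of_cutoff fun k hk => ?_
  obtain ⟨l, hl⟩ := S.exists_mul_cut hk hc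
  rw [hT k l hk hl, hT' k l hk fun p => ?_]
  obtain ⟨δ, h0, h1⟩ := hk
  rw [hl]
  by_cases hp : S.rad p ≤ δ
  · rw [h1 p hp, mul_zero, mul_zero]
  · rw [hh _ (S.var_nonneg (h0.trans (not_le.1 hp)))]

variable {S} in
-- After testing `T` against a cut function `k`, the product `h k` is continuous and again cut, so
-- it may be used to test `T'`.
theorem IsSym.comp {T T' : S.VO → S.VO} {h h' : ℝ → ℂ} (hT : S.IsSym T h) (hT' : S.IsSym T' h')
    (hc : ContinuousOn h (Ici 0)) : S.IsSym (fun v => T (T' v)) (fun x => h' x * h x) := by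
  intro k l hk hl v
  obtain ⟨m, hm⟩ := S.exists_mul_cut hk hc
  rw [hT k m hk hm, hT' m l (IsCut.mul_of_eq S hk hm) fun p => ?_]
  rw [hl, hm]; ring

variable {S} in
theorem IsSym.add {T T' : S.VO → S.VO} {h h' : ℝ → ℂ} (hT : S.IsSym T h) (hT' : S.IsSym T' h')
    (hc : ContinuousOn h (Ici 0)) : S.IsSym (fun v => T v + T' v) (fun x => h x + h' x) := by
  intro k l hk hl v
  obtain ⟨m, hm⟩ := S.exists_mul_cut hk hc
  rw [act_add_right, hT k m hk hm, hT' k (l - m) hk fun p => ?_, ← act_add_left]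
  · congr 1; abel
  · rw [ContinuousMap.sub_apply, hl, hm]; ring

variable {S} in
theorem IsSym.const_smul {T : S.VO → S.VO} {h : ℝ → ℂ} (hT : S.IsSym T h) (c : ℂ)
    (hc : ContinuousOn h (Ici 0)) : S.IsSym (fun v => c • T v) (fun x => c * h x) := by
  intro k l hk hl v
  obtain ⟨m, hm⟩ := S.exists_mul_cut hk hc
  rw [act_smul_right, hT k m hk hm, ← act_smul_left]
  congr 1
  ext p
  rw [ContinuousMap.smul_apply, hl, hm, smul_eq_mul]; ring

theorem isSym_id : S.IsSym (fun v => v) (fun _ => 1) := by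
  intro k l _ hl v
  congr 1
  ext p
  rw [hl, one_mul]

theorem isSym_act (a : S.Alg) (h : ℝ → ℂ) (ha : ∀ p, 0 < S.rad p → a p = h (S.var p)) :
    S.IsSym (S.act a) h := by
  intro k l hk hl v
  rw [← act_mul]
  congr 1
  ext p
  rw [hl, ContinuousMap.mul_apply, mul_comm]
  obtain ⟨δ, h0, h1⟩ := hk
  by_cases hp : S.rad p ≤ δ
  · rw [h1 p hp, mul_zero, mul_zero]
  · rw [ha p (h0.trans (not_le.1 hp))]

theorem isSym_AO : S.IsSym S.AO (fun x => (x : ℂ)) := by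
  intro k l hk hl v
  refine S.act_AO_of_mul k l (fun p => ?_) v
  obtain ⟨δ, h0, h1⟩ := hk
  rw [hl]
  by_cases hp : S.rad p ≤ δ
  · rw [h1 p hp]; simp
  · have : (S.rad p : ℂ) ≠ 0 := by
      rw [Complex.ofReal_ne_zero]; exact (h0.trans (not_le.1 hp)).ne'
    unfold var
    push_cast
    field_simp

theorem isSym_AO_pow (j : ℕ) : S.IsSym (fun v => (S.AO ^ j) v) (fun x => (x : ℂ) ^ j) := by
  induction j with
  | zero => simpa using S.isSym_id
  | succ j ih =>
    have h := ih.comp S.isSym_AO (by fun_prop)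
    have e : (fun v => (S.AO ^ j) (S.AO v)) = fun v => (S.AO ^ (j + 1)) v := by
      funext v; rw [pow_succ, Module.End.mul_apply]
    rw [e] at h
    simpa [pow_succ'] using h

theorem summable_mul_pow {M : ℕ} {c : ℕ → ℂ} (hc : ExpSummable M c) (X : ℝ) :
    Summable fun j => ‖c j‖ * |X| ^ j := by
  have hM : (0 : ℝ) < M := by exact_mod_cast hc.1
  have h1 : ∃ W, ∀ j, ‖c j‖ * (j.factorial / (M : ℝ) ^ j) ≤ W :=
    ⟨_, fun j => hc.2.le_tsum j fun _ _ => by positivity⟩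
  obtain ⟨W, hW⟩ := h1
  refine Summable.of_nonneg_of_le (fun j => by positivity) (fun j => ?_)
    ((Real.summable_pow_div_factorial (M * |X|)).mul_left W)
  calc ‖c j‖ * |X| ^ j = (‖c j‖ * (j.factorial / (M : ℝ) ^ j)) * ((M * |X|) ^ j / j.factorial) := by
        rw [mul_pow]; field_simp
    _ ≤ _ := mul_le_mul_of_nonneg_right (hW j) (by positivity)

/-- On the support of a cut function x is at most δ⁻¹, so the series of symbols converges in sup
norm there, and the functional calculus is continuous. -/
theorem isSym_ser {M : ℕ} {c : ℕ → ℂ} (hc : ExpSummable M c) {h : ℝ → ℂ}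
    (hh : ∀ x : ℝ, 0 ≤ x → HasSum (fun j => c j * (x : ℂ) ^ j) (h x)) : S.IsSym (S.ser c) h := by
  intro k l hk hl v
  have hpow (j : ℕ) : ∃ m : S.Alg, ∀ p, m p = (S.var p : ℂ) ^ j * k p :=
    S.exists_mul_cut (h := fun x => (x : ℂ) ^ j) hk (by fun_prop)
  choose m hm using hpow
  obtain ⟨δ, h0, h1⟩ := id hk
  have hn (j : ℕ) : ‖c j • m j‖ ≤ ‖c j‖ * |δ⁻¹| ^ j * ‖k‖ := by
    rw [norm_smul, mul_assoc]
    refine mul_le_mul_of_nonneg_left ?_ (norm_nonneg _)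
    rw [ContinuousMap.norm_le _ (by positivity)]
    intro p
    rw [hm, norm_mul, norm_pow]
    by_cases hp : S.rad p ≤ δ
    · rw [h1 p hp, norm_zero, mul_zero]; positivity
    · have hp' := not_le.1 hp
      have hv : ‖(S.var p : ℂ)‖ ≤ |δ⁻¹| := by
        rw [Complex.norm_real, Real.norm_eq_abs, abs_of_nonneg (S.var_nonneg (h0.trans hp')),
          abs_of_pos (by positivity)]
        unfold var
        have : (S.rad p)⁻¹ ≤ δ⁻¹ := inv_anti₀ h0 hp'.le
        linarith
      gcongr
      exact k.norm_coe_le_norm p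
  have hsum : Summable fun j => c j • m j :=
    Summable.of_norm_bounded ((summable_mul_pow hc δ⁻¹).mul_right _) hn
  have hl' : ∑' j, c j • m j = l := by
    ext p
    have h2 : HasSum (fun j => (c j • m j) p) ((∑' j, c j • m j) p) :=
      hsum.hasSum.map (ContinuousMap.evalCLM ℂ p) (ContinuousMap.evalCLM ℂ p).continuous
    refine h2.unique ?_
    rw [hl]
    by_cases hp : S.rad p ≤ δ
    · simp [hm, h1 p hp, hasSum_zero]
    · have := (hh _ (S.var_nonneg (h0.trans (not_le.1 hp)))).mul_right (k p)
      simpa [hm, mul_assoc] using this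
  apply S.toH_injective
  rw [toH_act, toH_act, S.toH_ser hc, (S.Phi k).map_tsum (S.summable_ser_zero hc v), ← hl']
  have h3 : HasSum (fun j => S.Phi (c j • m j) (S.toH v)) (S.Phi (∑' j, c j • m j) (S.toH v)) := by
    have hcont : Continuous fun a : S.Alg => S.Phi a (S.toH v) :=
      ((ContinuousLinearMap.apply ℂ H (S.toH v)).continuous).comp
        (isometry_cfcHom S.resolvent S.isSelfAdjoint_resolvent.isStarNormal).continuous
    exact hsum.hasSum.map (((LinearMap.applyₗ (S.toH v) : (H →ₗ[ℂ] H) →ₗ[ℂ] H).comp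
      (ContinuousLinearMap.coeLM ℂ)).comp (S.Phi.toAlgHom.toLinearMap)) hcont
  rw [← h3.tsum_eq]
  refine tsum_congr fun j => ?_
  have h4 := congrArg S.toH (S.isSym_AO_pow j k (m j) hk (hm j) v)
  rw [toH_act, toH_act] at h4
  rw [map_smul, map_smul]
  change c j • S.Phi k (S.toH ((S.AO ^ j) v)) = c j • S.Phi (m j) (S.toH v)
  rw [h4]

end Calculus

end StandardOscillator

open Complexification

/-! ### Bilinear actions of normed spaces -/

section Action

variable {B : Type u} {V : Type v} [NormedAddCommGroup B] [NormedSpace ℂ B] [AddCommGroup V]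
  [Module ℝ V]

/-- A real bilinear action of a complex normed space. -/
def mkAct (T : B → V → V) (h₁ : ∀ b c v, T (b + c) v = T b v + T c v)
    (h₂ : ∀ (r : ℝ) b v, T ((r : ℂ) • b) v = r • T b v)
    (h₃ : ∀ b v w, T b (v + w) = T b v + T b w)
    (h₄ : ∀ (r : ℝ) b v, T b (r • v) = r • T b v) : B →ₗ[ℝ] V →ₗ[ℝ] V :=
  LinearMap.mk₂ ℝ T h₁ (fun r b v => h₂ r b v) h₃ h₄

theorem continuous_act_of_seminorm [TopologicalSpace V] {ι : Type*}
    {p : SeminormFamily ℝ V ι} (hp : WithSeminorms p) (T : B →ₗ[ℝ] V →ₗ[ℝ] V)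
    (h : ∀ i, ∃ (j : ι) (C : ℝ), ∀ b v, p i (T b v) ≤ C * ‖b‖ * p j v) :
    Continuous fun x : B × V => T x.1 x.2 := by
  have := hp.topologicalAddGroup
  rw [continuous_iff_continuousAt]
  rintro ⟨b₀, v₀⟩
  rw [ContinuousAt, hp.tendsto_nhds]
  intro i ε hε
  obtain ⟨j, C, hC⟩ := h i
  have h1 : Tendsto (fun x : B × V => C * ‖x.1‖ * p j (x.2 - v₀) + C * ‖x.1 - b₀‖ * p j v₀)
      (𝓝 (b₀, v₀)) (𝓝 (C * ‖b₀‖ * p j (v₀ - v₀) + C * ‖b₀ - b₀‖ * p j v₀)) := by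
    have hj := hp.continuous_seminorm j
    refine Continuous.tendsto ?_ (b₀, v₀)
    have h2 : Continuous fun x : B × V => p j (x.2 - v₀) :=
      hj.comp (continuous_snd.sub continuous_const)
    fun_prop
  simp only [sub_self, map_zero, norm_zero, mul_zero, zero_mul, add_zero] at h1
  filter_upwards [h1.eventually (gt_mem_nhds hε)] with x hx
  have e : T x.1 x.2 - T b₀ v₀ = T x.1 (x.2 - v₀) + T (x.1 - b₀) v₀ := by
    rw [map_sub, map_sub, LinearMap.sub_apply]; abel
  rw [e]
  exact ((map_add_le_add (p i) _ _).trans (add_le_add (hC _ _) (hC _ _))).trans_lt hx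

end Action

/-- The Banach space of absolutely summable sequences. -/
abbrev Ell : Type := lp (fun _ : ℕ => ℂ) 1

theorem Ell.summable (x : Ell) : Summable fun k => ‖x k‖ := by
  have := lp.memℓp x
  rw [memℓp_gen_iff (by norm_num)] at this
  simpa using this

theorem Ell.norm_eq (x : Ell) : ‖x‖ = ∑' k, ‖x k‖ := by
  have := lp.norm_eq_tsum_rpow (p := 1) (by norm_num) x
  simpa using this

/-- The curve `z ↦ (c_k k! (z / M)^k)_k` in `ℓ¹`. -/
def coefCurve (c : ℕ → ℂ) (M : ℕ) (z : ℂ) : Ell :=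
  ∑' k, z ^ k • (lp.single 1 k (c k * (k.factorial / (M : ℂ) ^ k)) : Ell)

section Curve

variable {c : ℕ → ℂ} {M : ℕ}

/-- The bound 1/k! on the coefficients cancels the weight k!, and |z| < M/2 leaves a geometric
series. -/
theorem norm_coefCurve_term_le (hc : ∀ k, ‖c k‖ ≤ 1 / k.factorial) (k : ℕ) {z : ℂ}
    (hz : z ∈ Metric.ball (0 : ℂ) (M / 2)) :
    ‖z ^ k • (lp.single 1 k (c k * (k.factorial / (M : ℂ) ^ k)) : Ell)‖ ≤ (1 / 2) ^ k := by
  rw [mem_ball_zero_iff] at hz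
  have hM : (0 : ℝ) < M := by linarith [norm_nonneg z]
  rw [norm_smul, lp.norm_single (by norm_num), norm_pow, norm_mul, norm_div, norm_pow]
  simp only [Complex.norm_natCast]
  have h1 : ‖c k‖ * (k.factorial / (M : ℝ) ^ k) ≤ 1 / (M : ℝ) ^ k := by
    calc _ ≤ 1 / (k.factorial : ℝ) * (k.factorial / (M : ℝ) ^ k) := by gcongr; exact hc k
      _ = _ := by field_simp
  calc ‖z‖ ^ k * (‖c k‖ * (k.factorial / (M : ℝ) ^ k)) ≤ (M / 2) ^ k * (1 / (M : ℝ) ^ k) := by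
        gcongr
    _ = _ := by rw [div_pow, div_pow, one_pow]; field_simp

theorem differentiableOn_coefCurve (hc : ∀ k, ‖c k‖ ≤ 1 / k.factorial) :
    DifferentiableOn ℂ (coefCurve c M) (Metric.ball 0 (M / 2)) := by
  refine Complex.differentiableOn_tsum_of_summable_norm summable_geometric_two
    (fun k => ?_) Metric.isOpen_ball fun k z hz => norm_coefCurve_term_le hc k hz
  exact (differentiable_id.pow k).differentiableOn.smul_const _

theorem coefCurve_apply (hc : ∀ k, ‖c k‖ ≤ 1 / k.factorial) {z : ℂ}
    (hz : z ∈ Metric.ball (0 : ℂ) (M / 2)) (j : ℕ) :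
    coefCurve c M z j = z ^ j * (c j * (j.factorial / (M : ℂ) ^ j)) := by
  have h1 : Summable fun k => z ^ k • (lp.single 1 k (c k * (k.factorial / (M : ℂ) ^ k)) : Ell) :=
    Summable.of_norm_bounded summable_geometric_two fun k => norm_coefCurve_term_le hc k hz
  have h2 := h1.hasSum.map (lp.evalCLM ℂ (fun _ : ℕ => ℂ) (p := 1) j)
    (lp.evalCLM ℂ (fun _ : ℕ => ℂ) (p := 1) j).continuous
  refine h2.unique ?_
  have h3 := hasSum_single (f := fun k => (lp.evalCLM ℂ (fun _ : ℕ => ℂ) (p := 1) j)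
    (z ^ k • (lp.single 1 k (c k * (k.factorial / (M : ℂ) ^ k)) : Ell))) j fun k hk => by
      rw [map_smul]
      change z ^ k • (lp.single 1 k (c k * (k.factorial / (M : ℂ) ^ k)) : Ell) j = 0
      rw [lp.single_apply_ne _ _ _ hk.symm, smul_zero]
  have h4 : (lp.evalCLM ℂ (fun _ : ℕ => ℂ) (p := 1) j)
      (z ^ j • (lp.single 1 j (c j * (j.factorial / (M : ℂ) ^ j)) : Ell)) =
      z ^ j * (c j * (j.factorial / (M : ℂ) ^ j)) := by
    rw [map_smul]
    change z ^ j • (lp.single 1 j (c j * (j.factorial / (M : ℂ) ^ j)) : Ell) j = _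
    rw [lp.single_apply_self, smul_eq_mul]
  rw [h4] at h3
  exact h3

end Curve

namespace StandardOscillator

variable {H : Type u} [NormedAddCommGroup H] [InnerProductSpace ℂ H] (S : StandardOscillator H)
  [CompleteSpace H]

set_option linter.unusedSectionVars false

/-! ### Power series in `D_ℂ` -/

theorem ExpSummable.of_norm_le {M : ℕ} {c d : ℕ → ℂ} (hc : ExpSummable M c)
    (h : ∀ k, ‖d k‖ ≤ ‖c k‖) : ExpSummable M d :=
  ⟨hc.1, Summable.of_nonneg_of_le (fun k => by positivity)
    (fun k => mul_le_mul_of_nonneg_right (h k) (by positivity)) hc.2⟩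

/-- The coefficients of `∑_k a_k D^k` as a power series in `A`. -/
def dCoef (a : ℕ → ℝ) (k : ℕ) : ℂ := a k * Complex.I ^ k

/-- The operator `∑_k c_k D_ℂ^k`. -/
def serC (c : ℕ → ℂ) (v : S.VC) : S.VC :=
  Complexification.mk
    (S.ser (dCoef fun k => (c k).re) v.re - S.ser (dCoef fun k => (c k).im) v.im)
    (S.ser (dCoef fun k => (c k).re) v.im + S.ser (dCoef fun k => (c k).im) v.re)

theorem norm_dCoef (a : ℕ → ℝ) (k : ℕ) : ‖dCoef a k‖ = |a k| := by
  simp [dCoef]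

theorem ExpSummable.re {M : ℕ} {c : ℕ → ℂ} (hc : ExpSummable M c) :
    ExpSummable M (dCoef fun k => (c k).re) :=
  hc.of_norm_le fun k => by rw [norm_dCoef]; exact Complex.abs_re_le_norm _

theorem ExpSummable.im {M : ℕ} {c : ℕ → ℂ} (hc : ExpSummable M c) :
    ExpSummable M (dCoef fun k => (c k).im) :=
  hc.of_norm_le fun k => by rw [norm_dCoef]; exact Complex.abs_im_le_norm _

theorem DC_iterate (k : ℕ) (v : S.VC) : S.DC^[k] v =
    Complexification.mk (Complex.I ^ k • (S.AO ^ k) v.re) (Complex.I ^ k • (S.AO ^ k) v.im) := by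
  induction k with
  | zero => simp; rfl
  | succ k ih =>
    rw [Function.iterate_succ_apply', ih, pow_succ', pow_succ' S.AO]
    ext <;> simp [DC, DO, mul_smul]

theorem hasSum_serC {M : ℕ} {c : ℕ → ℂ} (hc : ExpSummable M c) (v : S.VC) :
    HasSum (fun k => c k • S.DC^[k] v) (S.serC c v) := by
  have e (a : ℕ → ℝ) (x : S.VO) (k : ℕ) :
      dCoef a k • (S.AO ^ k) x = a k • (Complex.I ^ k • (S.AO ^ k) x) := by
    rw [dCoef, mul_smul, Complex.coe_smul]
  have h1 := (S.hasSum_ser hc.re v.re).sub (S.hasSum_ser hc.im v.im)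
  have h2 := (S.hasSum_ser hc.re v.im).add (S.hasSum_ser hc.im v.re)
  have c1 : Continuous (ofRealL (E := S.VO)) := continuous_mk continuous_id continuous_const
  have c2 : Continuous (ofImagL (E := S.VO)) := continuous_mk continuous_const continuous_id
  have h3 := (h1.map (ofRealL (E := S.VO)).toAddMonoidHom c1).add
    (h2.map (ofImagL (E := S.VO)).toAddMonoidHom c2)
  have e1 : S.serC c v = ofReal (S.ser (dCoef fun k => (c k).re) v.re -
      S.ser (dCoef fun k => (c k).im) v.im) + ofImag (S.ser (dCoef fun k => (c k).re) v.im +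
        S.ser (dCoef fun k => (c k).im) v.re) := by
    ext <;> simp [serC]
  rw [e1]
  refine h3.congr_fun fun k => ?_
  rw [DC_iterate]
  simp only [Function.comp, e]
  ext
  · simp [ofRealL, ofImagL]
  · simp [ofRealL, ofImagL]

end StandardOscillator

namespace StandardOscillator

variable {H : Type u} [NormedAddCommGroup H] [InnerProductSpace ℂ H] (S : StandardOscillator H)
  [CompleteSpace H]

set_option linter.unusedSectionVars false

/-! ### Holomorphy of power series -/

theorem expSummable_ell {M : ℕ} (hM : 1 ≤ M) (x : Ell) :
    ExpSummable M (fun k => x k * ((M : ℂ) ^ k / k.factorial)) ∧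
      expNorm M (fun k => x k * ((M : ℂ) ^ k / k.factorial)) = ‖x‖ := by
  have hM' : (M : ℝ) ≠ 0 := by positivity
  have e (k : ℕ) : ‖x k * ((M : ℂ) ^ k / k.factorial)‖ * (k.factorial / (M : ℝ) ^ k) = ‖x k‖ := by
    rw [norm_mul, norm_div, norm_pow, Complex.norm_natCast, Complex.norm_natCast]
    field_simp
  refine ⟨⟨hM, (Ell.summable x).congr fun k => (e k).symm⟩, ?_⟩
  rw [Ell.norm_eq]
  exact tsum_congr e

theorem expNorm_mono {M : ℕ} {c d : ℕ → ℂ} (hc : ExpSummable M c) (h : ∀ k, ‖d k‖ ≤ ‖c k‖) :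
    expNorm M d ≤ expNorm M c :=
  Summable.tsum_le_tsum (fun k => mul_le_mul_of_nonneg_right (h k) (by positivity))
    (hc.of_norm_le h).2 hc.2

/-- The coefficients of a power series in `A` given by the real parts of a sequence in `ℓ¹`. -/
def ellCoef (M : ℕ) (x : Ell) : ℕ → ℂ := dCoef fun k => (x k * ((M : ℂ) ^ k / k.factorial)).re

theorem expSummable_ellCoef {M : ℕ} (hM : 1 ≤ M) (x : Ell) : ExpSummable M (ellCoef M x) :=
  (expSummable_ell hM x).1.re

theorem expNorm_ellCoef_le {M : ℕ} (hM : 1 ≤ M) (x : Ell) : expNorm M (ellCoef M x) ≤ ‖x‖ := by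
  rw [← (expSummable_ell hM x).2]
  exact expNorm_mono (expSummable_ell hM x).1 fun k => by
    rw [ellCoef, norm_dCoef]; exact Complex.abs_re_le_norm _

theorem ellCoef_add (M : ℕ) (x y : Ell) : ellCoef M (x + y) = ellCoef M x + ellCoef M y := by
  funext k
  simp only [ellCoef, dCoef, lp.coeFn_add, Pi.add_apply, add_mul, Complex.add_re]
  push_cast; ring

theorem ellCoef_smul (M : ℕ) (r : ℝ) (x : Ell) :
    ellCoef M ((r : ℂ) • x) = (r : ℂ) • ellCoef M x := by
  funext k
  simp only [ellCoef, dCoef, lp.coeFn_smul, Pi.smul_apply, smul_eq_mul, mul_assoc,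
    Complex.re_ofReal_mul]
  push_cast; ring

/-- The action of `ℓ¹` on `V^𝒪` by power series. -/
def ellAct (M : ℕ) (hM : 1 ≤ M) : Ell →ₗ[ℝ] S.VO →ₗ[ℝ] S.VO :=
  mkAct (fun x v => S.ser (ellCoef M x) v)
    (fun x y v => by
      rw [ellCoef_add, S.ser_add_left (expSummable_ellCoef hM x) (expSummable_ellCoef hM y)])
    (fun r x v => by
      rw [ellCoef_smul, S.ser_smul_left _ (expSummable_ellCoef hM x), Complex.coe_smul])
    (fun x v w => S.ser_add_right (expSummable_ellCoef hM x) v w)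
    (fun r x v => by
      rw [← Complex.coe_smul, S.ser_smul_right _ (expSummable_ellCoef hM x), Complex.coe_smul])

theorem ellAct_apply (M : ℕ) (hM : 1 ≤ M) (x : Ell) (v : S.VO) :
    S.ellAct M hM x v = S.ser (ellCoef M x) v := rfl

theorem continuous_ellAct (M : ℕ) (hM : 1 ≤ M) :
    Continuous fun p : Ell × S.VO => S.ellAct M hM p.1 p.2 := by
  refine continuous_act_of_seminorm S.withSeminorms_q _ fun n => ⟨2 * (2 * M + 2 * n), 2, ?_⟩
  intro x v
  refine (S.q_ser_le (expSummable_ellCoef hM x) n v).trans ?_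
  have := expNorm_ellCoef_le hM x
  have h2 := S.q_nonneg (2 * (2 * M + 2 * n)) v
  change _ ≤ 2 * ‖x‖ * S.q (2 * (2 * M + 2 * n)) v
  gcongr

/-- This moves the dependence on z into a curve in the Banach space ℓ¹, acting bilinearly on a fixed
Fréchet space. -/
theorem serC_eq_actC {c : ℕ → ℂ} (hc : ∀ k, ‖c k‖ ≤ 1 / k.factorial) {M : ℕ} (hM : 1 ≤ M) {z : ℂ}
    (hz : z ∈ Metric.ball (0 : ℂ) (M / 2)) (v : S.VC) :
    S.serC (fun k => c k * z ^ k) v = actC (S.ellAct M hM) (coefCurve c M z) v := by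
  have hM' : (M : ℂ) ≠ 0 := by exact_mod_cast (by omega : M ≠ 0)
  have e (k : ℕ) : coefCurve c M z k * ((M : ℂ) ^ k / k.factorial) = c k * z ^ k := by
    rw [coefCurve_apply hc hz]
    have : (k.factorial : ℂ) ≠ 0 := by exact_mod_cast k.factorial_ne_zero
    field_simp
  have e1 : ellCoef M (coefCurve c M z) = dCoef fun k => (c k * z ^ k).re := by
    unfold ellCoef
    simp_rw [e]
  have e2 : ellCoef M (Complex.I • coefCurve c M z) = -(dCoef fun k => (c k * z ^ k).im) := by
    unfold ellCoef
    funext k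
    simp only [dCoef, lp.coeFn_smul, Pi.smul_apply, smul_eq_mul, mul_assoc, e, Pi.neg_apply,
      Complex.I_mul_re]
    push_cast; ring
  have hI : ExpSummable M (dCoef fun k => (c k * z ^ k).im) := by
    have := (expSummable_ellCoef hM (Complex.I • coefCurve c M z)).smul (-1)
    rw [e2] at this
    simpa using this
  have e3 (x : S.VO) : S.ser (-(dCoef fun k => (c k * z ^ k).im)) x =
      -S.ser (dCoef fun k => (c k * z ^ k).im) x := by
    have := S.ser_smul_left (-1) hI x
    simpa using this
  ext
  · refine Eq.trans ?_ (re_actC (S.ellAct M hM) _ _).symm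
    change _ = S.ellAct M hM (coefCurve c M z) v.re +
      S.ellAct M hM (Complex.I • coefCurve c M z) v.im
    rw [ellAct_apply, ellAct_apply, e1, e2, e3, ← sub_eq_add_neg]; rfl
  · refine Eq.trans ?_ (im_actC (S.ellAct M hM) _ _).symm
    change _ = S.ellAct M hM (coefCurve c M z) v.im -
      S.ellAct M hM (Complex.I • coefCurve c M z) v.re
    rw [ellAct_apply, ellAct_apply, e1, e2, e3, sub_neg_eq_add]; rfl

theorem expSummable_mul_pow {c : ℕ → ℂ} (hc : ∀ k, ‖c k‖ ≤ 1 / k.factorial) (z : ℂ) :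
    ∃ M, ExpSummable M (fun k => c k * z ^ k) := by
  obtain ⟨M, hM⟩ := exists_nat_gt (2 * ‖z‖)
  have hM0 : (0 : ℝ) < M := lt_of_le_of_lt (by positivity) hM
  refine ⟨M, by exact_mod_cast hM0, Summable.of_nonneg_of_le (fun k => by positivity)
    (fun k => ?_) summable_geometric_two⟩
  rw [norm_mul, norm_pow]
  have h1 : ‖z‖ ≤ M / 2 := by linarith
  calc ‖c k‖ * ‖z‖ ^ k * (k.factorial / (M : ℝ) ^ k)
      ≤ 1 / (k.factorial : ℝ) * (M / 2) ^ k * (k.factorial / (M : ℝ) ^ k) := by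
        gcongr; exact hc k
    _ = (1 / 2) ^ k := by rw [div_pow, div_pow, one_pow]; field_simp

/-- On each disc of radius (M+1)/2 the map is a continuous bilinear action composed with a
holomorphic ℓ¹-valued curve. The discs exhaust ℂ, and holomorphy is local. -/
theorem hol_serC {c : ℕ → ℂ} (hc : ∀ k, ‖c k‖ ≤ 1 / k.factorial) :
    Hol (fun p : ℂ × S.VC => S.serC (fun k => c k * p.1 ^ k) p.2) univ := by
  have hcover : (⋃ M : ℕ, (Metric.ball (0 : ℂ) ((M + 1 : ℕ) / 2)) ×ˢ (univ : Set S.VC)) = univ := by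
    refine eq_univ_of_forall fun p => mem_iUnion.2 ?_
    obtain ⟨M, hM⟩ := exists_nat_gt (2 * ‖p.1‖)
    refine ⟨M, ?_, mem_univ _⟩
    rw [mem_ball_zero_iff]; push_cast; linarith
  rw [← hcover]
  refine Hol.iUnion (fun M => Metric.isOpen_ball.prod isOpen_univ) fun M => ?_
  have hU : IsOpen ((Metric.ball (0 : ℂ) ((M + 1 : ℕ) / 2)) ×ˢ (univ : Set S.VC)) :=
    Metric.isOpen_ball.prod isOpen_univ
  have h1 : Hol (coefCurve c (M + 1)) (Metric.ball 0 ((M + 1 : ℕ) / 2)) :=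
    Hol.of_contDiffOn Metric.isOpen_ball
      ((differentiableOn_coefCurve hc).contDiffOn Metric.isOpen_ball)
  have h2 : Hol (fun p : ℂ × S.VC => coefCurve c (M + 1) p.1)
      ((Metric.ball (0 : ℂ) ((M + 1 : ℕ) / 2)) ×ˢ (univ : Set S.VC)) :=
    Hol.comp hU h1 (Hol.linear (LinearMap.fst ℂ ℂ S.VC) continuous_fst _) fun p hp => hp.1
  have h3 := Hol.bilinear_comp (actC (S.ellAct (M + 1) (by omega)))
    (continuous_actC (S.continuous_ellAct (M + 1) (by omega))) hU h2
    (Hol.linear (LinearMap.snd ℂ ℂ S.VC) continuous_snd _)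
  refine h3.congr hU fun p hp => ?_
  exact (S.serC_eq_actC hc (by omega) hp.1 p.2).symm

/-- The operators `∑_k z^k / (k+j)! D_ℂ^k`. -/
def serE (j : ℕ) (z : ℂ) (v : S.VC) : S.VC :=
  S.serC (fun k => ((k + j).factorial : ℂ)⁻¹ * z ^ k) v

theorem serE_eq (j : ℕ) (z : ℂ) : S.serE j z =
    S.serC (fun k => ((k + j).factorial : ℂ)⁻¹ * z ^ k) := rfl

theorem norm_inv_factorial_le (j k : ℕ) :
    ‖((k + j).factorial : ℂ)⁻¹‖ ≤ 1 / k.factorial := by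
  rw [norm_inv, Complex.norm_natCast, one_div]
  exact inv_anti₀ (by positivity) (by exact_mod_cast Nat.factorial_le (by omega))

theorem hol_serE (j : ℕ) : Hol (fun p : ℂ × S.VC => S.serE j p.1 p.2) univ :=
  S.hol_serC (norm_inv_factorial_le j)

theorem γC_eq (z : ℂ) (v : S.VC) : S.γC z v = S.serE 0 z v := by
  obtain ⟨M, hM⟩ := expSummable_mul_pow (norm_inv_factorial_le 0) z
  rw [serE_eq]
  refine Eq.trans ?_ (S.hasSum_serC hM v).tsum_eq
  refine tsum_congr fun k => ?_
  rw [div_eq_mul_inv, mul_comm]; rfl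

attribute [irreducible] serE

/-! ### Symbols of operators on the complexification -/

/-- The map `x + iy ↦ x + I y` to `V^𝒪`, where `I` is the complex structure of `V^𝒪`. -/
def pl (v : S.VC) : S.VO := v.re + Complex.I • v.im

/-- The map `x + iy ↦ x - I y` to `V^𝒪`, where `I` is the complex structure of `V^𝒪`. -/
def mi (v : S.VC) : S.VO := v.re - Complex.I • v.im

/-- The complexification of a complex vector space splits into the space and its conjugate; `pl` and
`mi` are the two coordinates. -/
theorem ext_pl_mi {v w : S.VC} (h₁ : S.pl v = S.pl w) (h₂ : S.mi v = S.mi w) : v = w := by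
  have hre (v : S.VC) : v.re = (2⁻¹ : ℂ) • (S.pl v + S.mi v) := by
    simp only [pl, mi]; module
  have him (v : S.VC) : v.im = (-(Complex.I / 2) : ℂ) • (S.pl v - S.mi v) := by
    simp only [pl, mi]
    match_scalars
    · linear_combination Complex.I_sq
    · ring
  ext
  · rw [hre, h₁, h₂, ← hre]
  · rw [him, h₁, h₂, ← him]

theorem pl_smul (c : ℂ) (v : S.VC) : S.pl (c • v) = c • S.pl v := by
  simp only [pl, re_smul, im_smul, ← Complex.coe_smul]
  nth_rewrite 5 [← Complex.re_add_im c]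
  match_scalars
  · ring
  · linear_combination (-(c.im : ℂ)) * Complex.I_sq

theorem mi_smul (c : ℂ) (v : S.VC) : S.mi (c • v) = (starRingEnd ℂ c) • S.mi v := by
  have hc : (starRingEnd ℂ) c = (c.re : ℂ) - c.im * Complex.I := by
    apply Complex.ext <;> simp
  rw [hc]
  simp only [mi, re_smul, im_smul, ← Complex.coe_smul]
  match_scalars
  · ring
  · linear_combination (-(c.im : ℂ)) * Complex.I_sq

theorem pl_add (v w : S.VC) : S.pl (v + w) = S.pl v + S.pl w := by
  simp only [pl, re_add, im_add]; module

theorem mi_add (v w : S.VC) : S.mi (v + w) = S.mi v + S.mi w := by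
  simp only [mi, re_add, im_add]; module

/-- The operator `T` is a function `C(D_ℂ)`, in the sense that it is given by the functions
`C(ix)` and `conj C(-ix)` of the spectral variable `x` of `A` on the two eigenspaces of the complex
structure. -/
def IsSymC (T : S.VC → S.VC) (C : ℂ → ℂ) : Prop :=
  Continuous C ∧ ∃ Tp Tm : S.VO → S.VO,
    (∀ v, S.pl (T v) = Tp (S.pl v)) ∧ (∀ v, S.mi (T v) = Tm (S.mi v)) ∧
    S.IsSym Tp (fun x => C (Complex.I * x)) ∧
    S.IsSym Tm (fun x => starRingEnd ℂ (C (-(Complex.I * x))))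

variable {S} in
theorem IsSymC.comp {T T' : S.VC → S.VC} {C C' : ℂ → ℂ} (h : S.IsSymC T C) (h' : S.IsSymC T' C') :
    S.IsSymC (fun v => T (T' v)) (fun u => C' u * C u) := by
  obtain ⟨hc, Tp, Tm, h1, h2, h3, h4⟩ := h
  obtain ⟨hc', Tp', Tm', h1', h2', h3', h4'⟩ := h'
  refine ⟨hc'.mul hc, fun v => Tp (Tp' v), fun v => Tm (Tm' v), fun v => by rw [h1, h1'],
    fun v => by rw [h2, h2'], h3.comp h3' (by fun_prop), ?_⟩
  simp only [map_mul]
  exact h4.comp h4' (by fun_prop)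

variable {S} in
theorem IsSymC.add {T T' : S.VC → S.VC} {C C' : ℂ → ℂ} (h : S.IsSymC T C) (h' : S.IsSymC T' C') :
    S.IsSymC (fun v => T v + T' v) (fun u => C u + C' u) := by
  obtain ⟨hc, Tp, Tm, h1, h2, h3, h4⟩ := h
  obtain ⟨hc', Tp', Tm', h1', h2', h3', h4'⟩ := h'
  refine ⟨hc.add hc', fun v => Tp v + Tp' v, fun v => Tm v + Tm' v,
    fun v => by rw [pl_add, h1, h1'], fun v => by rw [mi_add, h2, h2'],
    h3.add h3' (by fun_prop), ?_⟩
  simp only [map_add]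
  exact h4.add h4' (by fun_prop)

variable {S} in
theorem IsSymC.const_smul {T : S.VC → S.VC} {C : ℂ → ℂ} (h : S.IsSymC T C) (a : ℂ) :
    S.IsSymC (fun v => a • T v) (fun u => a * C u) := by
  obtain ⟨hc, Tp, Tm, h1, h2, h3, h4⟩ := h
  refine ⟨hc.const_mul a, fun v => a • Tp v, fun v => starRingEnd ℂ a • Tm v,
    fun v => by rw [pl_smul, h1], fun v => by rw [mi_smul, h2],
    h3.const_smul a (by fun_prop), ?_⟩
  simp only [map_mul]
  exact h4.const_smul _ (by fun_prop)

variable {S} in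
theorem IsSymC.eq {T T' : S.VC → S.VC} {C C' : ℂ → ℂ} (h : S.IsSymC T C) (h' : S.IsSymC T' C')
    (hC : ∀ u, C u = C' u) (v : S.VC) : T v = T' v := by
  obtain ⟨hc, Tp, Tm, h1, h2, h3, h4⟩ := h
  obtain ⟨hc', Tp', Tm', h1', h2', h3', h4'⟩ := h'
  refine S.ext_pl_mi ?_ ?_
  · rw [h1, h1']
    exact h3.eq h3' (by fun_prop) (fun x _ => hC _) _
  · rw [h2, h2']
    exact h4.eq h4' (by fun_prop) (fun x _ => by rw [hC]) _

theorem isSymC_id : S.IsSymC (fun v => v) (fun _ => 1) := by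
  refine ⟨continuous_const, fun v => v, fun v => v, fun _ => rfl, fun _ => rfl, S.isSym_id, ?_⟩
  simp only [map_one]
  exact S.isSym_id

/-- Both `pl` and `mi` intertwine D_ℂ with iA, but `mi` is conjugate linear, so there the
coefficients c_k are replaced by their conjugates. -/
theorem isSymC_serC {M : ℕ} {c : ℕ → ℂ} (hc : ExpSummable M c) {C : ℂ → ℂ} (hC : Continuous C)
    (h : ∀ u, HasSum (fun k => c k * u ^ k) (C u)) : S.IsSymC (S.serC c) C := by
  let cp : ℕ → ℂ := (dCoef fun k => (c k).re) + Complex.I • dCoef fun k => (c k).im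
  let cm : ℕ → ℂ := (dCoef fun k => (c k).re) + (-Complex.I) • dCoef fun k => (c k).im
  have hcp : ExpSummable M cp := hc.re.add (hc.im.smul _)
  have hcm : ExpSummable M cm := hc.re.add (hc.im.smul _)
  have ecp (k : ℕ) : cp k = c k * Complex.I ^ k := by
    simp only [cp, dCoef, Pi.add_apply, Pi.smul_apply, smul_eq_mul]
    nth_rewrite 3 [← Complex.re_add_im (c k)]
    ring
  have ecm (k : ℕ) : cm k = starRingEnd ℂ (c k) * Complex.I ^ k := by
    have : (starRingEnd ℂ) (c k) = ((c k).re : ℂ) - (c k).im * Complex.I := by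
      apply Complex.ext <;> simp
    simp only [cm, dCoef, Pi.add_apply, Pi.smul_apply, smul_eq_mul]
    rw [this]; ring
  refine ⟨hC, S.ser cp, S.ser cm, fun v => ?_, fun v => ?_, ?_, ?_⟩
  · simp only [pl, serC, re_mk, im_mk]
    rw [S.ser_add_right hcp, S.ser_smul_right _ hcp, S.ser_add_left hc.re (hc.im.smul _),
      S.ser_add_left hc.re (hc.im.smul _), S.ser_smul_left _ hc.im, S.ser_smul_left _ hc.im]
    match_scalars
    · ring
    · linear_combination -Complex.I_sq
    · ring
    · ring
  · simp only [mi, serC, re_mk, im_mk]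
    rw [sub_eq_add_neg v.re, ← neg_smul, S.ser_add_right hcm, S.ser_smul_right _ hcm,
      S.ser_add_left hc.re (hc.im.smul _),
      S.ser_add_left hc.re (hc.im.smul _), S.ser_smul_left _ hc.im, S.ser_smul_left _ hc.im]
    match_scalars
    · ring
    · linear_combination -Complex.I_sq
    · ring
    · ring
  · refine S.isSym_ser hcp fun x _ => (h (Complex.I * x)).congr_fun fun k => ?_
    rw [ecp, mul_pow]; ring
  · refine S.isSym_ser hcm fun x _ => ?_
    have h1 := (h (-(Complex.I * x))).map (starRingEnd ℂ) Complex.continuous_conj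
    refine h1.congr_fun fun k => ?_
    simp only [Function.comp, map_mul, map_pow, map_neg, Complex.conj_I, Complex.conj_ofReal]
    rw [ecm, show -(-Complex.I * (x : ℂ)) = Complex.I * x by ring, mul_pow]; ring

end StandardOscillator

/-! ### The entire functions `∑_k u^k / (k+j)!` -/

/-- The entire function `∑_k u^k / (k+j)!`. -/
def ent (j : ℕ) (z : ℂ) : ℂ := ∑' k : ℕ, ((k + j).factorial : ℂ)⁻¹ * z ^ k

theorem norm_ent_term_le (j k : ℕ) {R : ℝ} {z : ℂ} (hz : ‖z‖ ≤ R) :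
    ‖((k + j).factorial : ℂ)⁻¹ * z ^ k‖ ≤ R ^ k / k.factorial := by
  rw [norm_mul, norm_inv, norm_pow, Complex.norm_natCast, inv_mul_eq_div]
  have hR : 0 ≤ R := (norm_nonneg z).trans hz
  gcongr
  omega

theorem hasSum_ent (j : ℕ) (z : ℂ) :
    HasSum (fun k : ℕ => ((k + j).factorial : ℂ)⁻¹ * z ^ k) (ent j z) :=
  (Summable.of_norm_bounded (Real.summable_pow_div_factorial ‖z‖)
    fun k => norm_ent_term_le j k le_rfl).hasSum

theorem differentiable_ent (j : ℕ) : Differentiable ℂ (ent j) := by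
  intro z
  have h : DifferentiableOn ℂ (ent j) (Metric.ball 0 (‖z‖ + 1)) := by
    refine Complex.differentiableOn_tsum_of_summable_norm
      (Real.summable_pow_div_factorial (‖z‖ + 1)) (fun k => by fun_prop) Metric.isOpen_ball
      fun k w hw => norm_ent_term_le j k (mem_ball_zero_iff.1 hw).le
  exact (h z (by simp)).differentiableAt (Metric.isOpen_ball.mem_nhds (by simp))

theorem continuous_ent (j : ℕ) : Continuous (ent j) := (differentiable_ent j).continuous

theorem ent_zero (z : ℂ) : ent 0 z = Complex.exp z := by
  have h := NormedSpace.expSeries_div_hasSum_exp z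
  rw [← Complex.exp_eq_exp_ℂ] at h
  refine (hasSum_ent 0 z).unique (h.congr_fun fun k => ?_)
  rw [add_zero, inv_mul_eq_div]

theorem ent_rec (j : ℕ) (z : ℂ) : z * ent (j + 1) z = ent j z - ((j.factorial : ℂ))⁻¹ := by
  have h1 := (hasSum_nat_add_iff' 1).2 (hasSum_ent j z)
  have h2 := (hasSum_ent (j + 1) z).mul_left z
  simp only [Finset.range_one, Finset.sum_singleton, pow_zero, mul_one, zero_add] at h1
  refine h2.unique (h1.congr_fun fun k => ?_)
  rw [show k + 1 + j = k + (j + 1) by ring]; ring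

theorem mul_ent_one (z : ℂ) : z * ent 1 z = Complex.exp z - 1 := by
  have := ent_rec 0 z
  rw [ent_zero] at this
  simpa using this

theorem mul_ent_two (z : ℂ) : z * ent 2 z = ent 1 z - 1 := by
  simpa using ent_rec 1 z

theorem ent_at_zero (j : ℕ) : ent j 0 = (j.factorial : ℂ)⁻¹ := by
  have := ent_rec j 0
  rw [zero_mul] at this
  exact sub_eq_zero.1 this.symm

/-- After multiplication by z this is e^{(s+t)z} - 1 = (e^{sz} - 1) + e^{sz}(e^{tz} - 1). It encodes
the homomorphism property in the V-component of the exponential. -/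
theorem ent_one_add (s t z : ℂ) :
    (s + t) * ent 1 ((s + t) * z) = s * ent 1 (s * z) + t * (ent 1 (t * z) * ent 0 (s * z)) := by
  rcases eq_or_ne z 0 with rfl | hz
  · simp [ent_at_zero]
  · refine mul_left_cancel₀ hz ?_
    have h1 := mul_ent_one ((s + t) * z)
    have h2 := mul_ent_one (s * z)
    have h3 := mul_ent_one (t * z)
    have e1 : Complex.exp ((s + t) * z) = Complex.exp (s * z) * Complex.exp (t * z) := by
      rw [← Complex.exp_add]; congr 1; ring
    rw [e1] at h1
    rw [ent_zero]
    linear_combination h1 - h2 - Complex.exp (s * z) * h3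

/-- This encodes the homomorphism property in the central component; the mixed term is the cocycle,
with one operator moved across the skew form, which is the origin of the sign in e_1(-sz). -/
theorem ent_two_add (s t z : ℂ) :
    (s + t) * (s + t) * ent 2 ((s + t) * z) = s * s * ent 2 (s * z) + t * t * ent 2 (t * z) +
      s * t * (ent 1 (t * z) * ent 0 (s * z) * ent 1 (-s * z)) := by
  rcases eq_or_ne z 0 with rfl | hz
  · simp [ent_at_zero]; ring
  · refine mul_left_cancel₀ (pow_ne_zero 2 hz) ?_
    have h1 := mul_ent_one ((s + t) * z)
    have h2 := mul_ent_one (s * z)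
    have h3 := mul_ent_one (t * z)
    have h4 := mul_ent_one (-s * z)
    have k1 := mul_ent_two ((s + t) * z)
    have k2 := mul_ent_two (s * z)
    have k3 := mul_ent_two (t * z)
    rw [ent_zero]
    have e1 : Complex.exp ((s + t) * z) = Complex.exp (s * z) * Complex.exp (t * z) := by
      rw [← Complex.exp_add]; congr 1; ring
    have e2 : Complex.exp (-s * z) * Complex.exp (s * z) = 1 := by
      rw [← Complex.exp_add]; simp
    rw [e1] at h1
    have h5 : s * z * ent 1 (-s * z) * Complex.exp (s * z) = Complex.exp (s * z) - 1 := by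
      linear_combination (-Complex.exp (s * z)) * h4 - e2
    linear_combination ((s + t) * z) * k1 - (s * z) * k2 - (t * z) * k3 + h1 - h2 - h3 -
      (t * z * ent 1 (t * z)) * h5 - (Complex.exp (s * z) - 1) * h3

/-! ### Linearity and symbols of the entire functions of `D_ℂ` -/

namespace StandardOscillator

variable {H : Type u} [NormedAddCommGroup H] [InnerProductSpace ℂ H] (S : StandardOscillator H)
  [CompleteSpace H]

set_option linter.unusedSectionVars false

theorem serC_add {M : ℕ} {c : ℕ → ℂ} (hc : ExpSummable M c) (v w : S.VC) :
    S.serC c (v + w) = S.serC c v + S.serC c w := by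
  ext
  · simp only [serC, re_mk, re_add, im_add, S.ser_add_right hc.re, S.ser_add_right hc.im]; abel
  · simp only [serC, im_mk, re_add, im_add, S.ser_add_right hc.re, S.ser_add_right hc.im]; abel

theorem serC_smul {M : ℕ} {c : ℕ → ℂ} (hc : ExpSummable M c) (a : ℂ) (v : S.VC) :
    S.serC c (a • v) = a • S.serC c v := by
  ext
  · simp only [serC, re_mk, im_mk, re_smul, im_smul, ← Complex.coe_smul, sub_eq_add_neg, ← neg_smul,
      S.ser_add_right hc.re, S.ser_add_right hc.im, S.ser_smul_right _ hc.re,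
      S.ser_smul_right _ hc.im]
    module
  · simp only [serC, re_mk, im_mk, re_smul, im_smul, ← Complex.coe_smul, sub_eq_add_neg, ← neg_smul,
      S.ser_add_right hc.re, S.ser_add_right hc.im, S.ser_smul_right _ hc.re,
      S.ser_smul_right _ hc.im]
    module

/-- The operator `∑_k z^k / (k+j)! D_ℂ^k` as a linear map. -/
def serEL (j : ℕ) (z : ℂ) : S.VC →ₗ[ℂ] S.VC where
  toFun := S.serE j z
  map_add' v w := by
    rw [serE_eq]
    obtain ⟨M, hM⟩ := expSummable_mul_pow (norm_inv_factorial_le j) z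
    exact S.serC_add hM v w
  map_smul' a v := by
    rw [serE_eq]
    obtain ⟨M, hM⟩ := expSummable_mul_pow (norm_inv_factorial_le j) z
    exact S.serC_smul hM a v

theorem serE_add (j : ℕ) (z : ℂ) (v w : S.VC) :
    S.serE j z (v + w) = S.serE j z v + S.serE j z w := (S.serEL j z).map_add v w

theorem serE_smul (j : ℕ) (z a : ℂ) (v : S.VC) : S.serE j z (a • v) = a • S.serE j z v :=
  (S.serEL j z).map_smul a v

@[simp] theorem serE_zero_right (j : ℕ) (z : ℂ) : S.serE j z 0 = 0 := (S.serEL j z).map_zero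

theorem hasSum_serE (j : ℕ) (z : ℂ) (v : S.VC) :
    HasSum (fun k => (((k + j).factorial : ℂ)⁻¹ * z ^ k) • S.DC^[k] v) (S.serE j z v) := by
  obtain ⟨M, hM⟩ := expSummable_mul_pow (norm_inv_factorial_le j) z
  rw [serE_eq]
  exact S.hasSum_serC hM v

theorem isSymC_serE (j : ℕ) (z : ℂ) : S.IsSymC (S.serE j z) (fun u => ent j (z * u)) := by
  obtain ⟨M, hM⟩ := expSummable_mul_pow (norm_inv_factorial_le j) z
  rw [serE_eq]
  refine S.isSymC_serC hM (by have := continuous_ent j; fun_prop) fun u => ?_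
  refine (hasSum_ent j (z * u)).congr_fun fun k => ?_
  rw [mul_pow, mul_assoc]

theorem serE_zero_left (j : ℕ) (v : S.VC) : S.serE j 0 v = (j.factorial : ℂ)⁻¹ • v :=
  (S.isSymC_serE j 0).eq (S.isSymC_id.const_smul (j.factorial : ℂ)⁻¹)
    (fun u => by simp [ent_at_zero]) v

theorem serE_zero_zero (v : S.VC) : S.serE 0 0 v = v := by
  rw [serE_zero_left]; simp

theorem continuous_serE (j : ℕ) : Continuous fun p : ℂ × S.VC => S.serE j p.1 p.2 :=
  continuousOn_univ.1 (S.hol_serE j).continuousOn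

theorem continuous_serE_right (j : ℕ) (z : ℂ) : Continuous (S.serE j z) :=
  (S.continuous_serE j).comp (continuous_const.prodMk continuous_id)

/-! ### The symplectic form -/

theorem inner_AO (x y : S.VO) :
    inner ℂ (S.toH (S.AO x)) (S.toH y) = inner ℂ (S.toH x) (S.toH (S.AO y)) :=
  S.toUnitaryGroup.inner_generator ⟨S.toH x, S.smooth_domain (S.toV x)⟩
    ⟨S.toH y, S.smooth_domain (S.toV y)⟩

/-- The symplectic form as a bilinear map. -/
def omL : S.VO →ₗ[ℝ] S.VO →ₗ[ℝ] ℝ :=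
  LinearMap.mk₂ ℝ S.om
    (fun x y z => by simp [om])
    (fun c x y => by
      simp only [om, ← Complex.coe_smul, _root_.map_smul, inner_smul_right]; simp)
    (fun x y z => by simp [om])
    (fun c x y => by
      simp only [om, ← Complex.coe_smul, _root_.map_smul, inner_smul_left]; simp)

@[simp] theorem omL_apply (x y : S.VO) : S.omL x y = S.om x y := rfl

theorem continuous_om : Continuous fun p : S.VO × S.VO => S.om p.1 p.2 :=
  Complex.continuous_im.comp (((S.continuous_toH.comp continuous_snd).inner
    (S.continuous_toH.comp (S.continuous_AO.comp continuous_fst))))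

theorem om_swap (x y : S.VO) : S.om y x = -S.om x y := by
  simp only [om]
  rw [← inner_AO, ← inner_conj_symm, Complex.conj_im]

theorem om_DO (x y : S.VO) : S.om (S.DO x) y = -S.om x (S.DO y) := by
  simp only [om, DO, _root_.map_smul, inner_smul_right, inner_smul_left]
  rw [← inner_AO]; simp

/-- The form `ω_ℂ` as a complex bilinear map. -/
def omCL : S.VC →ₗ[ℂ] S.VC →ₗ[ℂ] ℂ := (lift₂ S.omL).compr₂ toC

theorem omCL_apply (v w : S.VC) : S.omCL v w = S.omC v w := by
  apply Complex.ext <;> simp [omCL, omC, toC]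

theorem continuous_omC : Continuous fun p : S.VC × S.VC => S.omC p.1 p.2 := by
  simp only [← omCL_apply]
  exact continuous_toC.comp (continuous_lift₂ (B := S.omL) S.continuous_om)

theorem continuous_omCL : Continuous fun p : S.VC × S.VC => S.omCL p.1 p.2 := by
  simp only [omCL_apply]; exact S.continuous_omC

theorem omC_add_right (a b c : S.VC) : S.omC a (b + c) = S.omC a b + S.omC a c := by
  simp [← omCL_apply]

theorem omC_smul_left (z : ℂ) (a b : S.VC) : S.omC (z • a) b = z * S.omC a b := by
  simp [← omCL_apply]

theorem omC_smul_right (z : ℂ) (a b : S.VC) : S.omC a (z • b) = z * S.omC a b := by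
  simp [← omCL_apply]

@[simp] theorem omC_zero_right (a : S.VC) : S.omC a 0 = 0 := by simp [← omCL_apply]

theorem omC_swap (a b : S.VC) : S.omC b a = -S.omC a b := by
  simp only [omC]
  rw [S.om_swap a.re b.re, S.om_swap a.im b.im, S.om_swap a.im b.re, S.om_swap a.re b.im]
  push_cast; ring

theorem omC_DC (a b : S.VC) : S.omC (S.DC a) b = -S.omC a (S.DC b) := by
  simp only [omC, DC, re_map, im_map, om_DO]
  push_cast; ring

theorem omC_DC_iterate (k : ℕ) (a b : S.VC) :
    S.omC (S.DC^[k] a) b = (-1) ^ k * S.omC a (S.DC^[k] b) := by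
  induction k generalizing b with
  | zero => simp
  | succ k ih =>
    rw [Function.iterate_succ_apply', omC_DC, ih, ← Function.iterate_succ_apply]
    ring

/-- D_ℂ is skew for the form, so D_ℂ^k contributes (-1)^k, which is absorbed by z ↦ -z; continuity
of the form allows summation. -/
theorem omC_serE (j : ℕ) (z : ℂ) (a b : S.VC) :
    S.omC (S.serE j z a) b = S.omC a (S.serE j (-z) b) := by
  have c1 : Continuous fun x => S.omCL x b :=
    Continuous.comp (f := fun x : S.VC => (x, b)) S.continuous_omCL (by fun_prop)
  have c2 : Continuous fun x => S.omCL a x :=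
    Continuous.comp (f := fun x : S.VC => (a, x)) S.continuous_omCL (by fun_prop)
  have h1 := (S.hasSum_serE j z a).map (S.omCL.flip b).toAddMonoidHom c1
  have h2 := (S.hasSum_serE j (-z) b).map (S.omCL a).toAddMonoidHom c2
  have h3 := h1.unique (h2.congr_fun fun k => ?_)
  · simpa [omCL_apply] using h3
  · simp only [Function.comp, LinearMap.toAddMonoidHom_coe, LinearMap.flip_apply, omCL_apply,
      omC_smul_left, omC_smul_right, omC_DC_iterate]
    rw [neg_pow]; ring

/-! ### The complex group -/

theorem mulC_eq (g h : S.GC) : S.mulC g h = (g.1 + h.1 + (1 / 2) * S.omC g.2.1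
    (S.serE 0 g.2.2 h.2.1), g.2.1 + S.serE 0 g.2.2 h.2.1, g.2.2 + h.2.2) := by
  simp only [mulC, oscMul, γC_eq]

section HolMaps

variable {E : Type*} [AddCommGroup E] [Module ℂ E] [TopologicalSpace E] {U : Set E}

theorem hol_omC (hU : IsOpen U) {f g : E → S.VC} (hf : Hol f U) (hg : Hol g U) :
    Hol (fun x => S.omC (f x) (g x)) U := by
  simp only [← omCL_apply]
  exact Hol.bilinear_comp S.omCL S.continuous_omCL hU hf hg

theorem hol_serE_comp (hU : IsOpen U) (j : ℕ) {f : E → ℂ} {g : E → S.VC} (hf : Hol f U)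
    (hg : Hol g U) : Hol (fun x => S.serE j (f x) (g x)) U :=
  Hol.comp hU (S.hol_serE j) (hf.prodMk hg) (mapsTo_univ _ _)

theorem hol_mulC (hU : IsOpen U) {f g : E → S.GC} (hf : Hol f U) (hg : Hol g U) :
    Hol (fun x => S.mulC (f x) (g x)) U := by
  have l1 := Hol.linear (LinearMap.fst ℂ ℂ (S.VC × ℂ)) continuous_fst univ
  have l2 := Hol.linear (LinearMap.fst ℂ S.VC ℂ ∘ₗ LinearMap.snd ℂ ℂ (S.VC × ℂ))
    (continuous_fst.comp continuous_snd) univ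
  have l3 := Hol.linear (LinearMap.snd ℂ S.VC ℂ ∘ₗ LinearMap.snd ℂ ℂ (S.VC × ℂ))
    (continuous_snd.comp continuous_snd) univ
  have f1 := Hol.comp hU l1 hf (mapsTo_univ _ _)
  have f2 := Hol.comp hU l2 hf (mapsTo_univ _ _)
  have f3 := Hol.comp hU l3 hf (mapsTo_univ _ _)
  have g1 := Hol.comp hU l1 hg (mapsTo_univ _ _)
  have g2 := Hol.comp hU l2 hg (mapsTo_univ _ _)
  have g3 := Hol.comp hU l3 hg (mapsTo_univ _ _)
  have h := S.hol_serE_comp hU 0 f3 g2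
  simp only [mulC_eq]
  exact ((f1.add hU g1).add hU ((S.hol_omC hU f2 h).const_smul hU (1 / 2 : ℂ))).prodMk
    ((f2.add hU h).prodMk (f3.add hU g3))

end HolMaps

/-- The explicit form of the exponential map of the complex group. -/
def expE (w : S.GC) : S.GC :=
  (w.1 + (1 / 2) * S.omC w.2.1 (S.serE 2 w.2.2 w.2.1), S.serE 1 w.2.2 w.2.1, w.2.2)

theorem hol_expE : Hol S.expE univ := by
  have l1 := Hol.linear (LinearMap.fst ℂ ℂ (S.VC × ℂ)) continuous_fst univ
  have l2 := Hol.linear (LinearMap.fst ℂ S.VC ℂ ∘ₗ LinearMap.snd ℂ ℂ (S.VC × ℂ))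
    (continuous_fst.comp continuous_snd) univ
  have l3 := Hol.linear (LinearMap.snd ℂ S.VC ℂ ∘ₗ LinearMap.snd ℂ ℂ (S.VC × ℂ))
    (continuous_snd.comp continuous_snd) univ
  exact (l1.add isOpen_univ ((S.hol_omC isOpen_univ l2
    (S.hol_serE_comp isOpen_univ 2 l3 l2)).const_smul isOpen_univ (1 / 2 : ℂ))).prodMk
    ((S.hol_serE_comp isOpen_univ 1 l3 l2).prodMk l3)

/-- The two scalar identities for e_1 and e_2 lift to vector identities through symbols. Once all
operators are moved to the right argument of the form, the central components agree by pairing the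
second identity with ξ. -/
theorem expE_add (s t : ℂ) (w : S.GC) :
    S.expE ((s + t) • w) = S.mulC (S.expE (s • w)) (S.expE (t • w)) := by
  obtain ⟨ζ, ξ, σ⟩ := w
  have h1 : (s + t) • S.serE 1 ((s + t) * σ) ξ = s • S.serE 1 (s * σ) ξ +
      t • S.serE 0 (s * σ) (S.serE 1 (t * σ) ξ) :=
    ((S.isSymC_serE 1 _).const_smul (s + t)).eq (((S.isSymC_serE 1 _).const_smul s).add
      (((S.isSymC_serE 0 (s * σ)).comp (S.isSymC_serE 1 (t * σ))).const_smul t))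
      (fun u => by
        have := ent_one_add s t (σ * u)
        simpa only [mul_assoc] using this) ξ
  have h2 : ((s + t) * (s + t)) • S.serE 2 ((s + t) * σ) ξ = (s * s) • S.serE 2 (s * σ) ξ +
      (t * t) • S.serE 2 (t * σ) ξ +
        (s * t) • S.serE 1 (-(s * σ)) (S.serE 0 (s * σ) (S.serE 1 (t * σ) ξ)) :=
    ((S.isSymC_serE 2 _).const_smul ((s + t) * (s + t))).eq
      ((((S.isSymC_serE 2 _).const_smul (s * s)).add
      ((S.isSymC_serE 2 _).const_smul (t * t))).add (((S.isSymC_serE 1 (-(s * σ))).comp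
        ((S.isSymC_serE 0 (s * σ)).comp (S.isSymC_serE 1 (t * σ)))).const_smul (s * t)))
      (fun u => by
        have := ent_two_add s t (σ * u)
        simpa only [mul_assoc, neg_mul] using this) ξ
  rw [mulC_eq]
  simp only [expE, Prod.smul_mk, smul_eq_mul]
  simp only [serE_smul, omC_smul_left, omC_smul_right, omC_serE]
  have h3 := congrArg (S.omC ξ) h2
  simp only [omC_add_right, omC_smul_right] at h3
  refine Prod.ext ?_ (Prod.ext h1 (add_mul s t σ))
  simp only
  linear_combination (1 / 2) * h3

theorem isOneParameterSubgroup_expE (w : S.GC) :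
    IsOneParameterSubgroup S.mulC w (fun t : ℝ => S.expE ((t : ℂ) • w)) := by
  have hL : Continuous fun t : ℝ => (t : ℂ) • w := by fun_prop
  refine ⟨fun s t => ?_, ⟨isOpen_univ, fun n => ?_⟩, ?_⟩
  · change S.expE (((s + t : ℝ) : ℂ) • w) = _
    rw [Complex.ofReal_add, expE_add]
  · have h := Cn.comp_linear n (LinearMap.toSpanSingleton ℝ S.GC w) (by
      change Continuous fun t : ℝ => (t : ℂ) • w; exact hL) (S.hol_expE.1 n)
    exact Cn.isCnOn n h
  -- For t ≠ 0, dividing by t cancels exactly one factor and leaves an expression that is continuous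
  -- up to t = 0, so the derivative is a value of that expression.
  · have hc : Continuous fun t : ℝ => ((w.1 + (1 / 2) * ((t : ℂ) * S.omC w.2.1
        (S.serE 2 ((t : ℂ) * w.2.2) w.2.1)), S.serE 1 ((t : ℂ) * w.2.2) w.2.1, w.2.2) : S.GC) := by
      have a1 : Continuous fun t : ℝ => S.serE 2 ((t : ℂ) * w.2.2) w.2.1 :=
        (S.continuous_serE 2).comp (by fun_prop : Continuous fun t : ℝ => ((t : ℂ) * w.2.2, w.2.1))
      have a2 : Continuous fun t : ℝ => S.serE 1 ((t : ℂ) * w.2.2) w.2.1 :=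
        (S.continuous_serE 1).comp (by fun_prop : Continuous fun t : ℝ => ((t : ℂ) * w.2.2, w.2.1))
      have a3 : Continuous fun t : ℝ => S.omC w.2.1 (S.serE 2 ((t : ℂ) * w.2.2) w.2.1) :=
        S.continuous_omC.comp (continuous_const.prodMk a1)
      fun_prop
    have h0 := hc.tendsto 0
    have e0 : ((w.1 + (1 / 2) * (((0 : ℝ) : ℂ) * S.omC w.2.1
        (S.serE 2 (((0 : ℝ) : ℂ) * w.2.2) w.2.1)), S.serE 1 (((0 : ℝ) : ℂ) * w.2.2) w.2.1,
          w.2.2) : S.GC) = w := by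
      simp [serE_zero_left]
    rw [e0] at h0
    refine (h0.mono_left nhdsWithin_le_nhds).congr' ?_
    filter_upwards [self_mem_nhdsWithin] with t ht
    have ht' : (t : ℂ) ≠ 0 := by exact_mod_cast ht
    change _ = t⁻¹ • (S.expE (((0 + t • (1 : ℝ) : ℝ) : ℂ) • w) - S.expE (((0 : ℝ) : ℂ) • w))
    have e1 : S.expE (((0 : ℝ) : ℂ) • w) = 0 := by simp [expE]
    have e2 : ((0 + t • (1 : ℝ) : ℝ) : ℂ) = t := by simp
    rw [e1, e2, sub_zero, ← Complex.coe_smul]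
    simp only [expE, Prod.smul_fst, Prod.smul_snd, Prod.smul_mk, smul_eq_mul, serE_smul,
      omC_smul_left, omC_smul_right]
    have e3 : ((t⁻¹ : ℝ) : ℂ) = (t : ℂ)⁻¹ := Complex.ofReal_inv t
    rw [e3, smul_smul, inv_mul_cancel₀ ht', one_smul, inv_mul_cancel_left₀ ht']
    refine Prod.ext ?_ rfl
    change _ = (t : ℂ)⁻¹ * _
    field_simp

end StandardOscillator

/-! ### Complex linear extensions and equality of curves from equal slopes -/

namespace Complexification

variable {E : Type u} {F : Type v} [AddCommGroup E] [Module ℝ E] [AddCommGroup F] [Module ℂ F]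

/-- The complex linear extension of a real linear map into a complex vector space. -/
def extend (L : E →ₗ[ℝ] F) : Complexification E →ₗ[ℂ] F where
  toFun v := L v.re + Complex.I • L v.im
  map_add' v w := by simp only [re_add, im_add, map_add]; module
  map_smul' c v := by
    simp only [re_smul, im_smul, map_add, map_sub, map_smul, ← Complex.coe_smul, RingHom.id_apply]
    nth_rewrite 5 [← Complex.re_add_im c]
    match_scalars
    · ring
    · linear_combination (-(c.im : ℂ)) * Complex.I_sq

theorem extend_ofReal (L : E →ₗ[ℝ] F) (x : E) : extend L (ofReal x) = L x := by
  simp [extend]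

theorem continuous_extend [TopologicalSpace E] [TopologicalSpace F] [ContinuousAdd F]
    [ContinuousConstSMul ℂ F] {L : E →ₗ[ℝ] F} (hL : Continuous L) : Continuous (extend L) :=
  (hL.comp continuous_re).add ((hL.comp continuous_im).const_smul Complex.I)

end Complexification

theorem eq_of_slope_tendsto {E : Type*} [NormedAddCommGroup E] [NormedSpace ℝ E] {f g d : ℝ → E}
    (hf : ∀ s, Tendsto (fun h : ℝ => h⁻¹ • (f (s + h) - f s)) (𝓝[≠] 0) (𝓝 (d s)))
    (hg : ∀ s, Tendsto (fun h : ℝ => h⁻¹ • (g (s + h) - g s)) (𝓝[≠] 0) (𝓝 (d s)))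
    (h0 : f 0 = g 0) : f = g := by
  have h (s : ℝ) : HasDerivAt (fun t => f t - g t) 0 s := by
    have := (hasDerivAt_iff_tendsto_slope_zero.2 (hf s)).sub
      (hasDerivAt_iff_tendsto_slope_zero.2 (hg s))
    rwa [sub_self] at this
  funext t
  have := is_const_of_deriv_eq_zero (fun s => (h s).differentiableAt) (fun s => (h s).deriv) t 0
  simp only [h0, sub_self] at this
  exact sub_eq_zero.1 this

namespace StandardOscillator

variable {H : Type u} [NormedAddCommGroup H] [InnerProductSpace ℂ H] (S : StandardOscillator H)
  [CompleteSpace H]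

set_option linter.unusedSectionVars false

/-! ### Uniqueness of one-parameter subgroups -/

/-- The differential of the left translation by `g` at the unit. -/
def leftDiff (g w : S.GC) : S.GC :=
  (w.1 + (1 / 2) * S.omC g.2.1 (S.serE 0 g.2.2 w.2.1), S.serE 0 g.2.2 w.2.1, w.2.2)

theorem continuous_leftDiff (g : S.GC) : Continuous (S.leftDiff g) := by
  have a1 : Continuous fun w : S.GC => S.serE 0 g.2.2 w.2.1 :=
    (S.continuous_serE_right 0 g.2.2).comp (continuous_fst.comp continuous_snd)
  have a2 : Continuous fun w : S.GC => S.omC g.2.1 (S.serE 0 g.2.2 w.2.1) :=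
    Continuous.comp (f := fun w : S.GC => (g.2.1, S.serE 0 g.2.2 w.2.1)) S.continuous_omC
      (continuous_const.prodMk a1)
  unfold leftDiff
  fun_prop

theorem leftDiff_smul (g : S.GC) (t : ℝ) (w : S.GC) :
    S.leftDiff g (t • w) = t • S.leftDiff g w := by
  have e (v : S.GC) : t • v = ((t : ℂ) • v.1, (t : ℂ) • v.2.1, (t : ℂ) • v.2.2) := rfl
  rw [e, e]
  simp only [leftDiff, serE_smul, omC_smul_right, smul_eq_mul]
  refine Prod.ext ?_ rfl
  simp only
  ring

end StandardOscillator

open StandardOscillator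

section OneParameter

variable {H : Type u} [NormedAddCommGroup H] [InnerProductSpace ℂ H] {S : StandardOscillator H}
  [CompleteSpace H]

theorem IsOneParameterSubgroup.map_zero {w : S.GC} {α : ℝ → S.GC}
    (h : IsOneParameterSubgroup S.mulC w α) : α 0 = 0 := by
  have h1 := h.1 0 0
  rw [add_zero, mulC_eq] at h1
  have h3 : (α 0).2.2 = 0 := by
    have := congrArg (fun g : S.GC => g.2.2) h1
    simpa using this
  have h2 : (α 0).2.1 = 0 := by
    have := congrArg (fun g : S.GC => g.2.1) h1
    simpa [h3, serE_zero_zero] using this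
  have h4 : (α 0).1 = 0 := by
    have := congrArg (fun g : S.GC => g.1) h1
    simpa [h2] using this
  exact Prod.ext h4 (Prod.ext h2 h3)

/-- Left multiplication is affine, so α(s+t) - α(s) is exactly `leftDiff (α s)` applied to α(t); the
slope at 0 is then transported by continuity. -/
theorem IsOneParameterSubgroup.slope {w : S.GC} {α : ℝ → S.GC}
    (h : IsOneParameterSubgroup S.mulC w α) (s : ℝ) :
    Tendsto (fun t : ℝ => t⁻¹ • (α (s + t) - α s)) (𝓝[≠] 0) (𝓝 (S.leftDiff (α s) w)) := by
  have h1 : Tendsto (fun t : ℝ => t⁻¹ • α t) (𝓝[≠] 0) (𝓝 w) := by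
    have := h.2.2
    simpa [HasDirDeriv, h.map_zero] using this
  refine (((S.continuous_leftDiff (α s)).tendsto w).comp h1).congr fun t => ?_
  rw [Function.comp_apply, leftDiff_smul]
  congr 1
  rw [h.1, mulC_eq]
  refine Prod.ext ?_ (Prod.ext ?_ ?_)
  · change _ = _ - _
    simp only [leftDiff]; ring
  · change _ = _ - _
    simp only [leftDiff, add_sub_cancel_left]
  · change _ = _ - _
    simp only [leftDiff, add_sub_cancel_left]

theorem IsOneParameterSubgroup.linear_eq {w : S.GC} {α β : ℝ → S.GC}
    (hα : IsOneParameterSubgroup S.mulC w α) (hβ : IsOneParameterSubgroup S.mulC w β)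
    {E : Type*} [NormedAddCommGroup E] [NormedSpace ℝ E] (L : S.GC →ₗ[ℝ] E)
    (hL : Continuous L) (hd : ∀ s, L (S.leftDiff (α s) w) = L (S.leftDiff (β s) w)) (t : ℝ) :
    L (α t) = L (β t) := by
  have h1 {α : ℝ → S.GC} (hα : IsOneParameterSubgroup S.mulC w α) (s : ℝ) :
      Tendsto (fun h : ℝ => h⁻¹ • (L (α (s + h)) - L (α s))) (𝓝[≠] 0)
        (𝓝 (L (S.leftDiff (α s) w))) := by
    refine ((hL.tendsto _).comp (hα.slope s)).congr fun h => ?_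
    simp
  have h2 := h1 hβ
  simp only [← hd] at h2
  exact congrFun (eq_of_slope_tendsto (f := fun t => L (α t)) (g := fun t => L (β t)) (h1 hα) h2
    (by rw [hα.map_zero, hβ.map_zero])) t

/-- The left-invariant equation is triangular: the velocity of the last coordinate is constant, that
of the middle one depends only on the last, that of the first only on the other two. So no fixed
point theorem is needed, and equality can be tested after continuous linear maps into normed spaces.
-/
theorem IsOneParameterSubgroup.eq {w : S.GC} {α β : ℝ → S.GC}
    (hα : IsOneParameterSubgroup S.mulC w α) (hβ : IsOneParameterSubgroup S.mulC w β) : α = β := by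
  let L2 : S.GC →ₗ[ℝ] S.VC := LinearMap.fst ℝ S.VC ℂ ∘ₗ LinearMap.snd ℝ ℂ (S.VC × ℂ)
  have hL2 : Continuous L2 := continuous_fst.comp continuous_snd
  let L3 : S.GC →ₗ[ℝ] ℂ := LinearMap.snd ℝ S.VC ℂ ∘ₗ LinearMap.snd ℝ ℂ (S.VC × ℂ)
  have h3 (t : ℝ) : (α t).2.2 = (β t).2.2 :=
    hα.linear_eq hβ L3 (continuous_snd.comp continuous_snd) (fun s => rfl) t
  have hd2 (s : ℝ) : (S.leftDiff (α s) w).2.1 = (S.leftDiff (β s) w).2.1 := by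
    simp only [leftDiff, h3]
  have h2 (t : ℝ) : (α t).2.1 = (β t).2.1 := by
    ext
    · refine S.toH_injective (hα.linear_eq hβ
        ((S.toH.restrictScalars ℝ) ∘ₗ reL ∘ₗ L2)
        (S.continuous_toH.comp (continuous_re.comp hL2)) (fun s => ?_) t)
      exact congrArg (fun v : S.VC => S.toH v.re) (hd2 s)
    · refine S.toH_injective (hα.linear_eq hβ
        ((S.toH.restrictScalars ℝ) ∘ₗ imL ∘ₗ L2)
        (S.continuous_toH.comp (continuous_im.comp hL2)) (fun s => ?_) t)
      exact congrArg (fun v : S.VC => S.toH v.im) (hd2 s)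
  have h1 (t : ℝ) : (α t).1 = (β t).1 := by
    refine hα.linear_eq hβ (LinearMap.fst ℝ ℂ (S.VC × ℂ)) continuous_fst (fun s => ?_) t
    change (S.leftDiff (α s) w).1 = (S.leftDiff (β s) w).1
    simp only [leftDiff, h3, h2]
  funext t
  exact Prod.ext (h1 t) (Prod.ext (h2 t) (h3 t))

end OneParameter

namespace StandardOscillator

variable {H : Type u} [NormedAddCommGroup H] [InnerProductSpace ℂ H] (S : StandardOscillator H)
  [CompleteSpace H]

set_option linter.unusedSectionVars false

theorem expC_eq (w : S.GC) : S.expC w = S.expE w := by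
  have h : ∃ α : ℝ → S.GC, IsOneParameterSubgroup S.mulC w α :=
    ⟨_, S.isOneParameterSubgroup_expE w⟩
  unfold expC expMap
  rw [dif_pos h, h.choose_spec.eq (S.isOneParameterSubgroup_expE w)]
  simp

/-! ### The one-parameter group on `V^𝒪` -/

theorem isSymC_DC : S.IsSymC S.DC (fun u => u) := by
  refine ⟨continuous_id, fun v => Complex.I • S.AO v, fun v => Complex.I • S.AO v, fun v => ?_,
    fun v => ?_, S.isSym_AO.const_smul Complex.I (by fun_prop), ?_⟩
  · simp only [pl, DC, re_map, im_map, DO, _root_.map_add, _root_.map_smul]; module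
  · simp only [mi, DC, re_map, im_map, DO, _root_.map_sub, _root_.map_smul]; module
  · have := S.isSym_AO.const_smul Complex.I (by fun_prop)
    simpa using this

/-- An exact formula for the increment, from e^{hu} - 1 = hu e_1(hu), which reduces
differentiability to continuity of e_1(hD_ℂ). -/
theorem serE_add_sub (z h : ℂ) (x : S.VC) :
    S.serE 0 (z + h) x - S.serE 0 z x = h • S.serE 1 h (S.DC (S.serE 0 z x)) := by
  rw [sub_eq_iff_eq_add]
  refine (S.isSymC_serE 0 (z + h)).eq ((((S.isSymC_serE 1 h).comp
    (S.isSymC_DC.comp (S.isSymC_serE 0 z))).const_smul h).add (S.isSymC_serE 0 z)) (fun u => ?_) x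
  have := mul_ent_one (h * u)
  simp only [ent_zero]
  rw [add_mul, Complex.exp_add]
  linear_combination (-Complex.exp (z * u)) * this

theorem slope_serE (x : S.VC) (s : ℝ) :
    Tendsto (fun h : ℝ => h⁻¹ • (S.serE 0 ((s + h : ℝ) : ℂ) x - S.serE 0 s x)) (𝓝[≠] 0)
      (𝓝 (S.DC (S.serE 0 s x))) := by
  have h1 : Continuous fun h : ℝ => S.serE 1 h (S.DC (S.serE 0 s x)) :=
    Continuous.comp (f := fun h : ℝ => ((h : ℂ), S.DC (S.serE 0 s x))) (S.continuous_serE 1)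
      (by fun_prop)
  have h2 := (h1.tendsto 0).mono_left (nhdsWithin_le_nhds (s := {0}ᶜ))
  rw [Complex.ofReal_zero, serE_zero_left, Nat.factorial_one, Nat.cast_one, inv_one, one_smul] at h2
  refine h2.congr' ?_
  filter_upwards [self_mem_nhdsWithin] with h hh
  rw [Complex.ofReal_add, serE_add_sub, ← Complex.coe_smul, smul_smul, Complex.ofReal_inv,
    inv_mul_cancel₀ (by exact_mod_cast hh), one_smul]

/-- D = iA is skew-adjoint, so the norm of a solution is constant. -/
theorem eq_zero_of_hasDerivAt {W : ℝ → S.VO}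
    (h : ∀ t, HasDerivAt (fun t => S.toH (W t)) (S.toH (S.DO (W t))) t) (h0 : W 0 = 0) (t : ℝ) :
    W t = 0 := by
  have h1 (t : ℝ) : HasDerivAt (fun t => inner ℂ (S.toH (W t)) (S.toH (W t))) 0 t := by
    refine ((h t).inner ℂ (h t)).congr_deriv ?_
    simp only [DO, _root_.map_smul, inner_smul_left, inner_smul_right, Complex.conj_I]
    rw [S.inner_AO (W t) (W t)]; ring
  have h2 := is_const_of_deriv_eq_zero (fun s => (h1 s).differentiableAt)
    (fun s => (h1 s).deriv) t 0
  rw [h0, _root_.map_zero, inner_zero_left] at h2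
  exact S.toH_injective ((inner_self_eq_zero.1 h2).trans (_root_.map_zero _).symm)

theorem toH_γO (t : ℝ) (v : S.VO) : S.toH (S.γO t v) = S.γ t (S.toH v) := rfl

theorem AO_γO (t : ℝ) (v : S.VO) : S.AO (S.γO t v) = S.γO t (S.AO v) := by
  apply S.toH_injective
  have h := S.orb_restrictVO (S.γ t).toContinuousLinearEquiv.toContinuousLinearMap (fun r x => by
    have h := S.map_add t r x
    rw [add_comm, S.map_add] at h
    exact h.symm) v 1
  exact h

/-- Real and imaginary parts of the exponential series satisfy u' = Du, as does the orbit; initial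
values coincide, and solutions are unique. -/
theorem ofReal_γO (t : ℝ) (v : S.VO) : ofReal (S.γO t v) = S.serE 0 t (ofReal v) := by
  have hs (L : S.VC →ₗ[ℝ] S.VO) (hL : Continuous L) (hLD : ∀ v, L (S.DC v) = S.DO (L v)) (s : ℝ) :
      HasDerivAt (fun t : ℝ => S.toH (L (S.serE 0 t (ofReal v))))
        (S.toH (S.DO (L (S.serE 0 s (ofReal v))))) s := by
    rw [hasDerivAt_iff_tendsto_slope_zero, ← hLD]
    refine (((S.continuous_toH.comp hL).tendsto _).comp (S.slope_serE (ofReal v) s)).congr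
      fun h => ?_
    simp only [Function.comp_apply, _root_.map_smul, _root_.map_sub]
    rw [← Complex.coe_smul, ← Complex.coe_smul, _root_.map_smul, _root_.map_sub]
  have hγ (s : ℝ) : HasDerivAt (fun t => S.toH (S.γO t v)) (S.toH (S.DO (S.γO s v))) s := by
    refine HasDerivAt.congr_deriv (f := fun t => S.toH (S.γO t v))
      (S.hasDerivAt_orbit (S.hasDerivAt_toH v) s) (Eq.symm ?_)
    change S.toH (Complex.I • S.AO (S.γO s v)) = _
    rw [AO_γO, _root_.map_smul, _root_.map_smul, toH_γO]
  have e0 : S.γO 0 v = v := S.toH_injective (S.map_zero _)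
  ext
  · have := S.eq_zero_of_hasDerivAt (W := fun t => S.γO t v - reL (S.serE 0 t (ofReal v)))
      (fun s => by
        have := (hγ s).fun_sub (hs reL continuous_re (fun _ => rfl) s)
        simpa only [DO, _root_.map_sub, smul_sub] using this)
      (by
        simp only [e0, Complex.ofReal_zero, serE_zero_zero]
        exact sub_self v) t
    exact sub_eq_zero.1 this
  · exact (S.eq_zero_of_hasDerivAt (W := fun t => imL (S.serE 0 t (ofReal v)))
      (hs imL continuous_im (fun _ => rfl))
      (by simp only [Complex.ofReal_zero, serE_zero_zero]; rfl) t).symm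

/-! ### Analyticity of the polar map -/

/-- The inclusion `G_A^𝒪 ⊆ G_{A,ℂ}` as a linear map. -/
def inclL : S.GO →ₗ[ℝ] S.GC where
  toFun := S.incl
  map_add' v w := by
    refine Prod.ext ?_ (Prod.ext ?_ ?_)
    · simp [incl]
    · exact (ofRealL (E := S.VO)).map_add _ _
    · simp [incl]
  map_smul' c v := by
    refine Prod.ext ?_ (Prod.ext ?_ ?_)
    · simp [incl]
    · exact (ofRealL (E := S.VO)).map_smul _ _
    · simp [incl]

theorem continuous_inclL : Continuous S.inclL := by
  have h : Continuous fun v : S.VO => (ofReal v : S.VC) :=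
    continuous_mk continuous_id continuous_const
  exact (Complex.continuous_ofReal.comp continuous_fst).prodMk
    ((h.comp (continuous_fst.comp continuous_snd)).prodMk
      (Complex.continuous_ofReal.comp (continuous_snd.comp continuous_snd)))

theorem imagIncl_eq (w : S.GO) : S.imagIncl w = Complex.I • S.incl w := by
  refine Prod.ext rfl (Prod.ext ?_ rfl)
  ext <;> simp [imagIncl, incl]

/-- The holomorphic extension of the polar map. -/
def polarExt (p : Complexification (S.GO × S.GO)) : S.GC :=
  S.mulC (extend (S.inclL ∘ₗ LinearMap.fst ℝ _ _) p)
    (S.expE (Complex.I • extend (S.inclL ∘ₗ LinearMap.snd ℝ _ _) p))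

theorem hol_polarExt : Hol S.polarExt univ := by
  have h1 := Hol.linear (extend (S.inclL ∘ₗ LinearMap.fst ℝ S.GO S.GO))
    (continuous_extend (S.continuous_inclL.comp continuous_fst)) univ
  have h2 := Hol.linear (Complex.I • extend (S.inclL ∘ₗ LinearMap.snd ℝ S.GO S.GO))
    ((continuous_extend (L := S.inclL ∘ₗ LinearMap.snd ℝ S.GO S.GO)
      (S.continuous_inclL.comp continuous_snd)).const_smul Complex.I) univ
  exact S.hol_mulC isOpen_univ h1 (Hol.comp isOpen_univ S.hol_expE h2 (mapsTo_univ _ _))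

theorem polarMap_eq (p : S.GO × S.GO) :
    S.polarMap p = S.mulC (S.incl p.1) (S.expE (S.imagIncl p.2)) := by
  rw [polarMap, expC_eq]

theorem polarExt_ofReal (p : S.GO × S.GO) : S.polarExt (ofReal p) = S.polarMap p := by
  rw [polarMap_eq, imagIncl_eq, polarExt, extend_ofReal, extend_ofReal]; rfl

theorem realAnalyticOn_polarMap : RealAnalyticOn S.polarMap univ :=
  RealAnalyticOn.of_hol_complex S.hol_polarExt S.polarExt_ofReal

theorem smoothOn_polarMap {U : Set (S.GO × S.GO)} (hU : IsOpen U) : SmoothOn S.polarMap U := by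
  refine ⟨hU, fun n => Cn.isCnOn n ?_⟩
  have h := Cn.comp_linear n (ofRealL (E := S.GO × S.GO))
    (continuous_mk continuous_id continuous_const) (S.hol_polarExt.1 n)
  have e : S.polarExt ∘ (ofRealL (E := S.GO × S.GO)) = S.polarMap := funext S.polarExt_ofReal
  rw [e] at h
  exact h.mono n (subset_univ _)

end StandardOscillator

/-! ### The functions `f_s` and `g_s` -/

/-- The entire function `sinh u / u`. -/
def shc (u : ℂ) : ℂ := (1 / 2) * (ent 1 (-u) + ent 1 u)

/-- The entire function `(cosh u - 1) / u`. -/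
def chc (u : ℂ) : ℂ := (1 / 2) * (ent 1 u + (-1) * ent 1 (-u))

theorem continuous_shc : Continuous shc := by
  have := continuous_ent 1
  unfold shc
  fun_prop

theorem continuous_chc : Continuous chc := by
  have := continuous_ent 1
  unfold chc
  fun_prop

theorem mul_shc (u : ℂ) : u * shc u = (Complex.exp u - Complex.exp (-u)) / 2 := by
  have h1 := mul_ent_one u
  have h2 := mul_ent_one (-u)
  unfold shc
  linear_combination (1 / 2) * h1 - (1 / 2) * h2

theorem mul_chc (u : ℂ) : u * chc u = (Complex.exp u + Complex.exp (-u) - 2) / 2 := by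
  have h1 := mul_ent_one u
  have h2 := mul_ent_one (-u)
  unfold chc
  linear_combination (1 / 2) * h1 + (1 / 2) * h2

theorem shc_zero : shc 0 = 1 := by simp [shc, ent_at_zero]; norm_num

theorem shc_neg (u : ℂ) : shc (-u) = shc u := by
  unfold shc; rw [neg_neg]; ring

theorem chc_neg (u : ℂ) : chc (-u) = -chc u := by
  unfold chc; rw [neg_neg]; ring

theorem shc_ofReal {u : ℝ} (hu : u ≠ 0) : shc u = ((Real.sinh u / u : ℝ) : ℂ) := by
  have hu' : (u : ℂ) ≠ 0 := by exact_mod_cast hu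
  have h := mul_shc u
  push_cast
  rw [eq_div_iff hu', mul_comm, h, Complex.sinh]

theorem one_le_sinh_div {u : ℝ} (hu : u ≠ 0) : 1 ≤ Real.sinh u / u := by
  rcases lt_or_gt_of_ne hu with h | h
  · rw [le_div_iff_of_neg h, one_mul]
    have := Real.self_le_sinh_iff.2 (by linarith : 0 ≤ -u)
    rw [Real.sinh_neg] at this
    linarith
  · rw [le_div_iff₀ h, one_mul]
    exact Real.self_le_sinh_iff.2 h.le

/-- From |sinh u| ≥ |u|. This yields both the existence of f_s and the bound |f_s| ≤ 1, uniform in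
s. -/
theorem one_le_norm_shc (u : ℝ) : 1 ≤ ‖shc u‖ := by
  rcases eq_or_ne u 0 with rfl | hu
  · simp [shc_zero]
  · rw [shc_ofReal hu, Complex.norm_real]
    exact (one_le_sinh_div hu).trans (le_abs_self _)

theorem shc_ne_zero (u : ℝ) : shc u ≠ 0 := by
  have := one_le_norm_shc u
  intro h
  rw [h, norm_zero] at this
  linarith

namespace StandardOscillator

theorem fFun_eq (s x : ℝ) : fFun s x = (shc ((s : ℂ) * x))⁻¹ := by
  unfold fFun
  split_ifs with h
  · rw [← Complex.ofReal_mul, h]; simp [shc_zero]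
  · have h' : (s : ℂ) * x ≠ 0 := by exact_mod_cast h
    have h1 := mul_shc ((s : ℂ) * x)
    have h2 : shc ((s : ℂ) * x) ≠ 0 := by
      rw [← Complex.ofReal_mul]; exact shc_ne_zero _
    have h3 : Complex.exp (s * x) - Complex.exp (-(s * x)) ≠ 0 := by
      intro h0
      rw [h0, zero_div] at h1
      exact mul_ne_zero h' h2 h1
    rw [div_eq_iff h3, eq_comm, inv_mul_eq_iff_eq_mul₀ h2]
    linear_combination (-2) * h1

/-- This is -i tanh(sx/2), written with decaying exponentials only; in this form it extends to
complex s in a sector and has a visible limit as x → ∞. -/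
theorem gFun_eq (s x : ℝ) : gFun s x =
    -Complex.I * ((1 - Complex.exp (-(s * x))) / (1 + Complex.exp (-(s * x)))) := by
  unfold gFun
  have h4 : 1 + Complex.exp (-((s : ℂ) * x)) ≠ 0 := by
    have : Complex.exp (-((s : ℂ) * x)) = ((Real.exp (-(s * x)) : ℝ) : ℂ) := by push_cast; rfl
    rw [this, ← Complex.ofReal_one, ← Complex.ofReal_add]
    exact_mod_cast (by positivity : (1 + Real.exp (-(s * x))) ≠ 0)
  split_ifs with h
  · rw [← Complex.ofReal_mul, h]; simp
  · have h3 : Complex.exp (s * x) - Complex.exp (-(s * x)) ≠ 0 := by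
      have h1 := mul_shc ((s : ℂ) * x)
      intro h0
      rw [h0, zero_div, ← Complex.ofReal_mul] at h1
      exact mul_ne_zero (by exact_mod_cast h) (shc_ne_zero _) h1
    have e : Complex.exp (s * x) * Complex.exp (-(s * x)) = 1 := by
      rw [← Complex.exp_add]; simp
    rw [div_eq_iff (mul_ne_zero Complex.I_ne_zero h3), ← mul_div_assoc, div_mul_eq_mul_div,
      eq_comm, div_eq_iff h4]
    linear_combination (-(1 - Complex.exp (-(s * x))) *
      (Complex.exp (s * x) - Complex.exp (-(s * x)))) * Complex.I_sq - 2 * e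

theorem gFun_eq_chc (s x : ℝ) : gFun s x = -Complex.I * (chc ((s : ℂ) * x) * fFun s x) := by
  unfold gFun fFun
  split_ifs with h
  · rw [← Complex.ofReal_mul, h]; simp [chc, ent_at_zero]
  · have h3 : Complex.exp (s * x) - Complex.exp (-(s * x)) ≠ 0 := by
      have h1 := mul_shc ((s : ℂ) * x)
      intro h0
      rw [h0, zero_div, ← Complex.ofReal_mul] at h1
      exact mul_ne_zero (by exact_mod_cast h) (shc_ne_zero _) h1
    have h1 := mul_chc ((s : ℂ) * x)
    have h2 : Complex.exp (s * x) + Complex.exp (-(s * x)) - 2 = 2 * ((s : ℂ) * x * chc (s * x)) := by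
      rw [h1]; ring
    rw [h2]
    field_simp
    rw [Complex.I_sq]; ring

theorem norm_fFun_le (s x : ℝ) : ‖fFun s x‖ ≤ 1 := by
  rw [fFun_eq, norm_inv, ← Complex.ofReal_mul]
  exact inv_le_one_of_one_le₀ (one_le_norm_shc _)

theorem continuous_fFun (s : ℝ) : Continuous (fFun s) := by
  have h : fFun s = fun x : ℝ => (shc ((s : ℂ) * x))⁻¹ := funext (fFun_eq s)
  rw [h]
  refine Continuous.inv₀ (continuous_shc.comp (by fun_prop)) fun x => ?_
  rw [← Complex.ofReal_mul]; exact shc_ne_zero _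

theorem continuous_gFun (s : ℝ) : Continuous (gFun s) := by
  have h : gFun s = fun x : ℝ => -Complex.I * (chc ((s : ℂ) * x) * fFun s x) :=
    funext (gFun_eq_chc s)
  rw [h]
  have := continuous_fFun s
  have := continuous_chc
  fun_prop

theorem tendsto_fFun (s : ℝ) : ∃ l, Tendsto (fFun s) atTop (𝓝 l) := by
  rcases eq_or_ne s 0 with rfl | hs
  · exact ⟨1, tendsto_const_nhds.congr fun x => by simp [fFun]⟩
  · refine ⟨0, squeeze_zero_norm' (a := fun x => (2 / |s|) * x⁻¹) ?_ ?_⟩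
    · filter_upwards [eventually_gt_atTop 0] with x hx
      have hne : s * x ≠ 0 := mul_ne_zero hs hx.ne'
      rw [fFun_eq, norm_inv, ← Complex.ofReal_mul, shc_ofReal hne, Complex.norm_real, norm_div,
        inv_div, Real.norm_eq_abs, Real.norm_eq_abs, Real.abs_sinh, abs_mul, abs_of_pos hx]
      set u := |s| * x with hu
      have hu0 : 0 < u := by positivity
      -- Doubling the argument gives 2 sinh(u/2) cosh(u/2), and both factors are at least u/2. The
      -- quadratic growth forces u / sinh u → 0.
      have h1 : u * u / 2 ≤ Real.sinh u := by
        have e : Real.sinh u = 2 * Real.sinh (u / 2) * Real.cosh (u / 2) := by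
          rw [← Real.sinh_two_mul]; congr 1; ring
        have h2 := Real.self_le_sinh_iff.2 (by positivity : 0 ≤ u / 2)
        have h3 : u / 2 ≤ Real.cosh (u / 2) := h2.trans (Real.sinh_lt_cosh _).le
        rw [e]
        nlinarith [mul_le_mul h2 h3 (by positivity) (by linarith)]
      rw [div_le_iff₀ (by nlinarith)]
      have e2 : 2 / |s| * x⁻¹ = 2 / u := by rw [hu]; field_simp
      rw [e2, div_mul_eq_mul_div, le_div_iff₀ hu0]
      linarith
    · simpa using tendsto_inv_atTop_zero.const_mul (2 / |s|)

theorem gFun_neg (s x : ℝ) : gFun (-s) x = -gFun s x := by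
  rw [gFun_eq_chc, gFun_eq_chc, fFun_eq, fFun_eq]
  push_cast
  rw [neg_mul (s : ℂ) (x : ℂ), chc_neg, shc_neg]; ring

theorem tendsto_gFun (s : ℝ) : ∃ l, Tendsto (gFun s) atTop (𝓝 l) := by
  have key {s : ℝ} (hs : 0 < s) : Tendsto (gFun s) atTop (𝓝 (-Complex.I)) := by
    have h1 : Tendsto (fun x : ℝ => Real.exp (-(s * x))) atTop (𝓝 0) :=
      Real.tendsto_exp_neg_atTop_nhds_zero.comp (tendsto_id.const_mul_atTop hs)
    have h2 : Tendsto (fun x : ℝ => Complex.exp (-((s : ℂ) * x))) atTop (𝓝 0) := by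
      have := (Complex.continuous_ofReal.tendsto 0).comp h1
      simpa [Function.comp_def] using this
    have h3 := ((tendsto_const_nhds (x := (1 : ℂ))).sub h2).div
      ((tendsto_const_nhds (x := (1 : ℂ))).add h2) (by simp)
    have h4 := h3.const_mul (-Complex.I)
    simp only [sub_zero, add_zero, div_one, mul_one] at h4
    exact h4.congr fun x => (gFun_eq s x).symm
  rcases lt_trichotomy s 0 with hs | rfl | hs
  · refine ⟨Complex.I, ?_⟩
    have := (key (s := -s) (by linarith)).neg
    rw [neg_neg] at this
    exact this.congr fun x => by rw [gFun_neg, neg_neg]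
  · exact ⟨0, tendsto_const_nhds.congr fun x => by simp [gFun]⟩
  · exact ⟨_, key hs⟩

variable {H : Type u} [NormedAddCommGroup H] [InnerProductSpace ℂ H] (S : StandardOscillator H)
  [CompleteSpace H]

set_option linter.unusedSectionVars false

/-! ### The functional calculus -/

/-- The function `φ` extends continuously to `[0, ∞]`. -/
def ContExt (φ : ℝ → ℂ) : Prop := ContinuousOn φ (Ici 0) ∧ ∃ l, Tendsto φ atTop (𝓝 l)

theorem contExt_fFun (s : ℝ) : ContExt (fFun s) := ⟨(continuous_fFun s).continuousOn, tendsto_fFun s⟩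

theorem contExt_gFun (s : ℝ) : ContExt (gFun s) := ⟨(continuous_gFun s).continuousOn, tendsto_gFun s⟩

/-- In the variable r = (1 + x)⁻¹ the point x = ∞ becomes r = 0, so a function with a limit at
infinity is continuous on the compact spectrum. -/
theorem ContExt.continuous {φ : ℝ → ℂ} (h : ContExt φ) :
    Continuous fun p => if S.rad p = 0 then limUnder atTop φ else φ (S.var p) := by
  obtain ⟨hc, l, hl⟩ := h
  rw [hl.limUnder_eq]
  have h1 : ContinuousOn (fun r : ℝ => if r = 0 then l else φ (r⁻¹ - 1)) (Icc 0 1) := by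
    intro r hr
    rcases hr.1.eq_or_lt with rfl | h0
    · rw [ContinuousWithinAt]
      simp only [if_true]
      have h2 : Tendsto (fun r : ℝ => φ (r⁻¹ - 1)) (𝓝[>] 0) (𝓝 l) :=
        hl.comp (tendsto_atTop_add_const_right _ (-1) tendsto_inv_nhdsGT_zero)
      have h3 : Tendsto (fun r : ℝ => if r = 0 then l else φ (r⁻¹ - 1)) (𝓝[>] 0) (𝓝 l) := by
        refine h2.congr' ?_
        filter_upwards [self_mem_nhdsWithin] with r hr
        rw [if_neg (ne_of_gt hr)]
      have h4 : Tendsto (fun r : ℝ => if r = 0 then l else φ (r⁻¹ - 1)) (pure 0) (𝓝 l) := by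
        rw [tendsto_pure_left]; intro s hs; simpa using mem_of_mem_nhds hs
      refine (h4.sup h3).mono_left ?_
      rw [← nhdsWithin_insert]
      exact nhdsWithin_mono _ fun x hx => by
        rcases hx.1.eq_or_lt with h | h
        · exact Or.inl h.symm
        · exact Or.inr h
    · have h2 : ContinuousWithinAt (fun r : ℝ => φ (r⁻¹ - 1)) (Icc 0 1 ∩ Ioi 0) r := by
        refine ContinuousWithinAt.comp (t := Ici 0) (hc _ ?_) ?_ fun x hx => ?_
        · exact sub_nonneg.2 ((one_le_inv₀ h0).2 hr.2)
        · exact ((continuousAt_inv₀ h0.ne').sub continuousAt_const).continuousWithinAt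
        · exact sub_nonneg.2 ((one_le_inv₀ hx.2).2 hx.1.2)
      have h3 : ContinuousWithinAt (fun r : ℝ => φ (r⁻¹ - 1)) (Icc 0 1) r := by
        refine h2.mono_of_mem_nhdsWithin (inter_mem self_mem_nhdsWithin
          (mem_nhdsWithin_of_mem_nhds (Ioi_mem_nhds h0)))
      refine h3.congr_of_eventuallyEq ?_ (if_neg h0.ne')
      filter_upwards [mem_nhdsWithin_of_mem_nhds (Ioi_mem_nhds h0)] with x hx
      exact if_neg (ne_of_gt hx)
  have h2 : Continuous fun p => (⟨S.rad p, S.rad_nonneg p, S.rad_le_one p⟩ : Icc (0 : ℝ) 1) :=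
    S.continuous_rad.subtype_mk _
  exact (continuousOn_iff_continuous_domRestrict.1 h1).comp h2

open Classical in
/-- The element of the algebra of continuous functions on the spectrum that is given by a function
of the spectral variable of `A`. -/
def symAlg (φ : ℝ → ℂ) : S.Alg :=
  if h : Continuous fun p => if S.rad p = 0 then limUnder atTop φ else φ (S.var p) then ⟨_, h⟩
  else 0

variable {S} in
theorem ContExt.symAlg_apply {φ : ℝ → ℂ} (h : ContExt φ) (p : spectrum ℂ S.resolvent) :
    S.symAlg φ p = if S.rad p = 0 then limUnder atTop φ else φ (S.var p) := by
  rw [symAlg, dif_pos (h.continuous S)]; rfl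

theorem ContExt.funCalc_eq {φ : ℝ → ℂ} (h : ContExt φ) : S.funCalc φ = S.Phi (S.symAlg φ) := by
  have hc : ContinuousOn (fun r : ℂ => if r = 0 then limUnder atTop φ else φ (r.re⁻¹ - 1))
      (spectrum ℂ S.resolvent) := by
    rw [continuousOn_iff_continuous_domRestrict]
    refine (h.continuous S).congr fun p => ?_
    have e : S.rad p = 0 ↔ (p : ℂ) = 0 := by rw [← S.coe_rad]; simp
    simp only [e]; rfl
  rw [funCalc, cfc_apply _ _ S.isSelfAdjoint_resolvent.isStarNormal hc, Phi]
  congr 1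
  ext p
  have e : S.rad p = 0 ↔ (p : ℂ) = 0 := by rw [← S.coe_rad]; simp
  rw [h.symAlg_apply]
  simp only [e]; rfl

theorem ContExt.norm_symAlg_le {φ : ℝ → ℂ} (h : ContExt φ) {C : ℝ} (hC : ∀ x, 0 ≤ x → ‖φ x‖ ≤ C) :
    ‖S.symAlg φ‖ ≤ C := by
  have hC0 : 0 ≤ C := (norm_nonneg _).trans (hC 0 le_rfl)
  refine (ContinuousMap.norm_le _ hC0).2 fun p => ?_
  rw [h.symAlg_apply]
  split_ifs with h0
  · obtain ⟨-, l, hl⟩ := h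
    rw [hl.limUnder_eq]
    exact le_of_tendsto hl.norm ((eventually_ge_atTop 0).mono hC)
  · exact hC _ (S.var_nonneg ((S.rad_nonneg p).lt_of_ne' h0))

theorem ContExt.isSym {φ : ℝ → ℂ} (h : ContExt φ) : S.IsSym (S.act (S.symAlg φ)) φ :=
  S.isSym_act _ _ fun p hp => by rw [h.symAlg_apply, if_neg hp.ne']

theorem fA_eq (s : ℝ) (v : S.VO) : S.fA s v = S.act (S.symAlg (fFun s)) v := by
  apply S.toH_injective
  rw [toH_act, ← ContExt.funCalc_eq S (contExt_fFun s)]; rfl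

theorem gA_eq (s : ℝ) (v : S.VO) : S.gA s v = S.act (S.symAlg (gFun s)) v := by
  apply S.toH_injective
  rw [toH_act, ← ContExt.funCalc_eq S (contExt_gFun s)]; rfl

theorem isSym_fA (s : ℝ) : S.IsSym (S.fA s) (fFun s) := by
  rw [show S.fA s = S.act (S.symAlg (fFun s)) from funext (S.fA_eq s)]
  exact (contExt_fFun s).isSym S

theorem isSym_gA (s : ℝ) : S.IsSym (S.gA s) (gFun s) := by
  rw [show S.gA s = S.act (S.symAlg (gFun s)) from funext (S.gA_eq s)]
  exact (contExt_gFun s).isSym S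

end StandardOscillator

namespace StandardOscillator

variable {H : Type u} [NormedAddCommGroup H] [InnerProductSpace ℂ H] (S : StandardOscillator H)
  [CompleteSpace H]

set_option linter.unusedSectionVars false

/-! ### Operators on `V^𝒪` -/

/-- The operator `∑_k z^k / (k+j)! A^k` on `V^𝒪`. -/
def serO (j : ℕ) (z : ℂ) (v : S.VO) : S.VO := S.ser (fun k => ((k + j).factorial : ℂ)⁻¹ * z ^ k) v

theorem isSym_serO (j : ℕ) (z : ℂ) : S.IsSym (S.serO j z) (fun x => ent j (z * x)) := by
  obtain ⟨M, hM⟩ := expSummable_mul_pow (norm_inv_factorial_le j) z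
  refine S.isSym_ser hM fun x _ => ?_
  refine (hasSum_ent j (z * x)).congr_fun fun k => ?_
  rw [mul_pow, mul_assoc]

theorem serO_smul (j : ℕ) (z c : ℂ) (v : S.VO) : S.serO j z (c • v) = c • S.serO j z v := by
  obtain ⟨M, hM⟩ := expSummable_mul_pow (norm_inv_factorial_le j) z
  exact S.ser_smul_right c hM v

theorem continuous_ent_mul (j : ℕ) (z : ℂ) : Continuous fun x : ℝ => ent j (z * x) :=
  (continuous_ent j).comp (by fun_prop)

/-- The operator `sinh(sA) / (sA)`. -/
def shA (s : ℝ) (v : S.VO) : S.VO := (1 / 2 : ℂ) • (S.serO 1 (-s) v + S.serO 1 s v)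

/-- The operator `(cosh(sA) - 1) / (sA)`. -/
def chA (s : ℝ) (v : S.VO) : S.VO := (1 / 2 : ℂ) • (S.serO 1 s v + (-1 : ℂ) • S.serO 1 (-s) v)

theorem isSym_shA (s : ℝ) : S.IsSym (S.shA s) (fun x => shc ((s : ℂ) * x)) := by
  have := ((S.isSym_serO 1 (-s)).add (S.isSym_serO 1 s)
    (continuous_ent_mul 1 _).continuousOn).const_smul (1 / 2)
    ((continuous_ent_mul 1 _).add (continuous_ent_mul 1 _)).continuousOn
  simp only [shc, ← neg_mul]
  exact this

theorem isSym_chA (s : ℝ) : S.IsSym (S.chA s) (fun x => chc ((s : ℂ) * x)) := by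
  have := ((S.isSym_serO 1 s).add ((S.isSym_serO 1 (-s)).const_smul (-1)
    (continuous_ent_mul 1 _).continuousOn)
    (continuous_ent_mul 1 _).continuousOn).const_smul (1 / 2)
    ((continuous_ent_mul 1 _).add ((continuous_ent_mul 1 _).const_mul (-1))).continuousOn
  simp only [chc, ← neg_mul]
  exact this

theorem continuous_shc_mul (s : ℝ) : Continuous fun x : ℝ => shc ((s : ℂ) * x) :=
  continuous_shc.comp (by fun_prop)

theorem continuous_chc_mul (s : ℝ) : Continuous fun x : ℝ => chc ((s : ℂ) * x) :=
  continuous_chc.comp (by fun_prop)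

theorem pl_ofImag (x : S.VO) : S.pl (ofImag x) = Complex.I • x := by simp [pl]

theorem mi_ofImag (x : S.VO) : S.mi (ofImag x) = -Complex.I • x := by simp [mi]

theorem pl_mk (x y : S.VO) : S.pl (Complexification.mk x y) = x + Complex.I • y := rfl

theorem mi_mk (x y : S.VO) : S.mi (Complexification.mk x y) = x - Complex.I • y := rfl

/-- The coordinates of ix in the splitting are Ix and -Ix, and e_j(isD_ℂ) acts on them as e_j(-sA)
and e_j(sA). Recombining gives the odd and even parts in s. -/
theorem serE_ofImag (j : ℕ) (s : ℝ) (x : S.VO) :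
    S.serE j (Complex.I * s) (ofImag x) =
      Complexification.mk
        (-Complex.I • ((1 / 2 : ℂ) • (S.serO j s x + (-1 : ℂ) • S.serO j (-s) x)))
        ((1 / 2 : ℂ) • (S.serO j (-s) x + S.serO j s x)) := by
  obtain ⟨-, Tp, Tm, h1, h2, h3, h4⟩ := S.isSymC_serE j (Complex.I * s)
  refine S.ext_pl_mi ?_ ?_
  · rw [h1, pl_ofImag, h3.eq (S.isSym_serO j (-s)) ((continuous_ent j).comp (by fun_prop) :
      Continuous fun x : ℝ => ent j (Complex.I * s * (Complex.I * x))).continuousOn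
      (fun x _ => by
        refine congrArg (ent j) ?_
        linear_combination ((s : ℂ) * x) * Complex.I_sq), serO_smul, pl_mk]
    module
  · rw [h2, mi_ofImag, h4.eq (S.isSym_serO j s) (Complex.continuous_conj.comp
      ((continuous_ent j).comp (by fun_prop)) :
      Continuous fun x : ℝ => starRingEnd ℂ
        (ent j (Complex.I * s * (-(Complex.I * x))))).continuousOn
      (fun x _ => by
        have e : Complex.I * s * (-(Complex.I * x)) = ((s * x : ℝ) : ℂ) := by
          push_cast; linear_combination (-(s : ℂ) * x) * Complex.I_sq
        simp only [e]
        rw [← Complex.ofReal_mul]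
        have h := (hasSum_ent j ((s * x : ℝ) : ℂ)).map (starRingEnd ℂ) Complex.continuous_conj
        refine h.unique ((hasSum_ent j _).congr_fun fun k => ?_)
        simp), serO_smul, mi_mk]
    module

theorem serE_one_ofImag (s : ℝ) (x : S.VO) : S.serE 1 (Complex.I * s) (ofImag x) =
    Complexification.mk (-Complex.I • S.chA s x) (S.shA s x) := S.serE_ofImag 1 s x

theorem shA_fA (s : ℝ) (v : S.VO) : S.shA s (S.fA s v) = v :=
  ((S.isSym_shA s).comp (S.isSym_fA s) (continuous_shc_mul s).continuousOn).eq S.isSym_id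
    ((continuous_fFun s).mul (continuous_shc_mul s)).continuousOn (fun x _ => by
      rw [fFun_eq, ← Complex.ofReal_mul, inv_mul_cancel₀ (shc_ne_zero _)]) v

theorem fA_shA (s : ℝ) (v : S.VO) : S.fA s (S.shA s v) = v :=
  ((S.isSym_fA s).comp (S.isSym_shA s) (continuous_fFun s).continuousOn).eq S.isSym_id
    ((continuous_shc_mul s).mul (continuous_fFun s)).continuousOn (fun x _ => by
      rw [fFun_eq, ← Complex.ofReal_mul, mul_inv_cancel₀ (shc_ne_zero _)]) v

theorem gA_eq_chA (s : ℝ) (v : S.VO) : S.gA s v = -Complex.I • S.chA s (S.fA s v) :=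
  (S.isSym_gA s).eq (((S.isSym_chA s).comp (S.isSym_fA s)
    (continuous_chc_mul s).continuousOn).const_smul (-Complex.I)
    ((continuous_fFun s).mul (continuous_chc_mul s)).continuousOn)
    (continuous_gFun s).continuousOn (fun x _ => by
      rw [gFun_eq_chc]; ring) v

theorem isSym_γO (t : ℝ) : S.IsSym (S.γO t) (fun x => Complex.exp (t * (Complex.I * x))) := by
  obtain ⟨-, Tp, Tm, h1, -, h3, -⟩ := S.isSymC_serE 0 t
  have e (v : S.VO) : S.γO t v = Tp v := by
    have h := h1 (ofReal v)
    rw [← ofReal_γO] at h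
    simpa [pl] using h
  rw [show S.γO t = Tp from funext e]
  simpa only [ent_zero] using h3

theorem γO_comm {T : S.VO → S.VO} {h : ℝ → ℂ} (hT : S.IsSym T h) (hc : Continuous h) (t : ℝ)
    (v : S.VO) : T (S.γO t v) = S.γO t (T v) :=
  (hT.comp (S.isSym_γO t) hc.continuousOn).eq
    ((S.isSym_γO t).comp hT (by fun_prop)) (by fun_prop) (fun x _ => mul_comm _ _) v

theorem γO_neg_γO (t : ℝ) (v : S.VO) : S.γO (-t) (S.γO t v) = v := by
  apply S.toH_injective
  rw [toH_γO, toH_γO, ← S.map_add, neg_add_cancel, S.map_zero]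

theorem γO_γO_neg (t : ℝ) (v : S.VO) : S.γO t (S.γO (-t) v) = v := by
  apply S.toH_injective
  rw [toH_γO, toH_γO, ← S.map_add, add_neg_cancel, S.map_zero]

theorem γO_smul (t : ℝ) (c : ℂ) (v : S.VO) : S.γO t (c • v) = c • S.γO t v := by
  apply S.toH_injective
  simp only [toH_γO, _root_.map_smul]

theorem serE_zero_mk (t : ℝ) (x y : S.VO) : S.serE 0 t (Complexification.mk x y) =
    Complexification.mk (S.γO t x) (S.γO t y) := by
  have e (x y : S.VO) : Complexification.mk x y = ofReal x + Complex.I • ofReal y := by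
    ext <;> simp
  rw [e, serE_add, serE_smul, ← ofReal_γO, ← ofReal_γO, ← e]

/-! ### The first component of the polar map -/

/-- The quadratic function of `x` that occurs in the first component of the exponential map. -/
def kap (s : ℝ) (x : S.VO) : ℝ := S.om x (S.serE 2 (Complex.I * s) (ofImag x)).re

theorem om_self (x : S.VO) : S.om x x = 0 := by
  have := S.om_swap x x
  linarith

theorem om_neg_right (x y : S.VO) : S.om x (-y) = -S.om x y := (S.omL x).map_neg y

theorem om_sub_left (x y z : S.VO) : S.om (x - y) z = S.om x z - S.om y z := S.omL.map_sub₂ x y z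

/-- The real part vanishes by parity... moving the operator across the form and swapping the
arguments changes the sign of the pairing and of s, whereas the imaginary component of
e_2(isD_ℂ)(ix) is even in s, so its pairing with x is zero. -/
theorem omC_ofImag_serE (s : ℝ) (x : S.VO) :
    S.omC (ofImag x) (S.serE 2 (Complex.I * s) (ofImag x)) = Complex.I * S.kap s x := by
  set X : S.VC := ofImag x with hX
  have h1 : S.omC X (S.serE 2 (Complex.I * s) X) = -S.omC X (S.serE 2 (Complex.I * (-s : ℝ)) X) := by
    rw [← omC_swap, omC_serE]
    congr 2
    push_cast; ring
  have h2 : (S.serE 2 (Complex.I * (-s : ℝ)) X).im = (S.serE 2 (Complex.I * s) X).im := by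
    rw [hX, serE_ofImag, serE_ofImag, im_mk, im_mk]
    push_cast
    rw [neg_neg, add_comm]
  have h3 := congrArg Complex.re h1
  simp only [omC, hX, re_ofImag, im_ofImag] at h3
  rw [← hX, h2] at h3
  have e0 (y : S.VO) : S.om 0 y = 0 := S.omL.map_zero₂ y
  simp only [e0] at h3
  have h4 : S.om x (S.serE 2 (Complex.I * s) X).im = 0 := by
    simp at h3
    linarith
  simp only [omC, kap, hX, re_ofImag, im_ofImag, e0]
  rw [← hX, h4]
  push_cast; ring

theorem kap_zero (x : S.VO) : S.kap 0 x = 0 := by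
  have h : S.serE 2 (Complex.I * (0 : ℝ)) (ofImag x) = (2⁻¹ : ℂ) • ofImag x := by
    rw [Complex.ofReal_zero, mul_zero, serE_zero_left]; simp
  rw [kap, h]
  have : ((2⁻¹ : ℂ) • ofImag x : S.VC).re = 0 := by simp
  rw [this]
  exact (S.omL x).map_zero

/-- The relation z e_2(z) = e_1(z) - 1 converts sA times the odd part of e_2 into sinh(sA)/(sA) - 1.
This explains the shape of θ, and the division by s in it. -/
theorem mul_kap (s : ℝ) (x : S.VO) :
    s * S.kap s x = (inner ℂ (S.toH (S.shA s x)) (S.toH x)).re - ‖S.toH x‖ ^ 2 := by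
  set T : S.VO := (1 / 2 : ℂ) • (S.serO 2 s x + (-1 : ℂ) • S.serO 2 (-s) x) with hT
  have h1 : S.kap s x = (inner ℂ (S.toH (S.AO T)) (S.toH x)).re := by
    rw [kap, serE_ofImag, re_mk, ← hT, om, _root_.map_smul, inner_smul_left, inner_AO]
    simp
  have h2 : (s : ℂ) • S.AO T = S.shA s x - x := by
    have c1 := (continuous_ent_mul 2 s)
    have c2 := (continuous_ent_mul 2 (-s))
    have hs := ((S.isSym_AO.comp (((S.isSym_serO 2 s).add ((S.isSym_serO 2 (-s)).const_smul (-1)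
      c2.continuousOn) c1.continuousOn).const_smul (1 / 2) (by fun_prop))
      (by fun_prop)).const_smul s (by fun_prop))
    have hr := (S.isSym_shA s).add (S.isSym_id.const_smul (-1) (by fun_prop))
      (continuous_shc_mul s).continuousOn
    have := hs.eq hr (by fun_prop) (fun y _ => by
      have k1 := mul_ent_two ((s : ℂ) * y)
      have k2 := mul_ent_two (-((s : ℂ) * y))
      rw [← neg_mul] at k2
      simp only [shc]
      rw [← neg_mul]
      linear_combination (1 / 2) * k1 + (1 / 2) * k2) x
    rw [sub_eq_add_neg, ← neg_one_smul ℂ x]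
    exact this
  have h3 := congrArg (fun v => (inner ℂ (S.toH v) (S.toH x)).re) h2
  simp only [_root_.map_smul, inner_smul_left, Complex.conj_ofReal, _root_.map_sub, inner_sub_left,
    Complex.sub_re, Complex.re_ofReal_mul] at h3
  rw [h1, h3]
  congr 1
  exact inner_self_eq_norm_sq (𝕜 := ℂ) _

theorem mul_kap_fA (r s : ℝ) (b : S.VO) : s * S.kap s (S.γO r (S.fA s b)) =
    (inner ℂ (S.toH (S.fA s b)) (S.toH b)).re - ‖S.toH (S.fA s b)‖ ^ 2 := by
  rw [mul_kap, S.γO_comm (S.isSym_shA s) (continuous_shc_mul s), shA_fA, toH_γO, toH_γO,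
    (S.γ r).inner_map_map, (S.γ r).norm_map, ← inner_conj_symm, Complex.conj_re]

/-! ### The inverse of the polar map -/

theorem polarMap_mk (z₀ r t s : ℝ) (v x : S.VO) :
    S.polarMap ((z₀, v, r), (t, x, s)) =
      (z₀ + Complex.I * t + (1 / 2) * (Complex.I * S.kap s x) +
        (1 / 2) * (S.om v (S.γO r (-Complex.I • S.chA s x)) + S.om v (S.γO r (S.shA s x)) * Complex.I),
        Complexification.mk (v + S.γO r (-Complex.I • S.chA s x)) (S.γO r (S.shA s x)),
        r + Complex.I * s) := by
  rw [polarMap_eq, mulC_eq]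
  simp only [expE, imagIncl, incl, omC_ofImag_serE, serE_one_ofImag, serE_zero_mk]
  refine Prod.ext ?_ (Prod.ext ?_ rfl)
  · have e : S.om 0 = fun _ => 0 := funext fun y => S.omL.map_zero₂ y
    simp only [omC, re_ofReal, im_ofReal, re_mk, im_mk, e]
    push_cast; ring
  · ext <;> simp

/-- The inverse of the polar map. -/
def polarInv (q : S.GC) : S.GO × S.GO :=
  ((q.1.re - (1 / 2) * S.om q.2.1.re (S.gA q.2.2.im q.2.1.im), q.2.1.re - S.gA q.2.2.im q.2.1.im,
      q.2.2.re),
    (q.1.im - (1 / 2) * S.kap q.2.2.im (S.γO (-q.2.2.re) (S.fA q.2.2.im q.2.1.im)) -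
      (1 / 2) * (S.om q.2.1.re q.2.1.im + S.om q.2.1.im (S.gA q.2.2.im q.2.1.im)),
      S.γO (-q.2.2.re) (S.fA q.2.2.im q.2.1.im), q.2.2.im))

/-- Expressed through b = γ(r)(sinh(sA)/(sA))x, the imaginary part of the product, the shift of the
real part is g_s(A)b. It can therefore be subtracted without knowing x. -/
theorem γO_chA (r s : ℝ) (x : S.VO) :
    S.γO r (-Complex.I • S.chA s x) = S.gA s (S.γO r (S.shA s x)) := by
  rw [gA_eq_chA, ← S.γO_comm (S.isSym_shA s) (continuous_shc_mul s), fA_shA,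
    S.γO_comm (S.isSym_chA s) (continuous_chc_mul s), γO_smul]

theorem polarMap_polarInv (q : S.GC) : S.polarMap (S.polarInv q) = q := by
  obtain ⟨z, y, r⟩ := q
  have h1 : S.γO r.re (S.shA r.im (S.γO (-r.re) (S.fA r.im y.im))) = y.im := by
    rw [S.γO_comm (S.isSym_shA r.im) (continuous_shc_mul r.im), shA_fA, γO_γO_neg]
  rw [polarInv, polarMap_mk, γO_chA, h1]
  simp only
  refine Prod.ext ?_ (Prod.ext ?_ ?_)
  · simp only [om_sub_left, om_self]
    rw [S.om_swap y.im (S.gA r.im y.im)]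
    apply Complex.ext
    · simp
    · simp; ring
  · ext <;> simp
  · simp only
    rw [mul_comm, Complex.re_add_im]

theorem polarInv_polarMap (p : S.GO × S.GO) : S.polarInv (S.polarMap p) = p := by
  obtain ⟨⟨z₀, v, r⟩, ⟨t, x, s⟩⟩ := p
  rw [polarMap_mk, γO_chA]
  have e1 : ((r : ℂ) + Complex.I * s).re = r := by simp
  have e2 : ((r : ℂ) + Complex.I * s).im = s := by simp
  have h1 : S.γO (-r) (S.fA s (S.γO r (S.shA s x))) = x := by
    rw [← S.γO_comm (S.isSym_shA s) (continuous_shc_mul s), fA_shA, γO_neg_γO]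
  simp only [polarInv, re_mk, im_mk, e1, e2, h1]
  set b := S.γO r (S.shA s x)
  have h2 : S.om (v + S.gA s b) (S.gA s b) = S.om v (S.gA s b) := by
    have := S.omL.map_add₂ v (S.gA s b) (S.gA s b)
    simp only [omL_apply, om_self, add_zero] at this
    exact this
  have h3 : S.om (v + S.gA s b) b = S.om v b + S.om (S.gA s b) b := S.omL.map_add₂ _ _ _
  refine Prod.ext (Prod.ext ?_ (Prod.ext ?_ rfl)) (Prod.ext ?_ rfl)
  · simp only [h2]; simp
  · simp
  · simp only [h3]
    rw [S.om_swap (S.gA s b) b]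
    simp; ring

theorem gA_zero (v : S.VO) : S.gA 0 v = 0 := by
  have h : S.chA 0 (S.fA 0 v) = 0 := by simp [chA]
  rw [gA_eq_chA, h, smul_zero]

/-- The parameter `r` is free because γ(r) is unitary and commutes with functions of A, so the
quadratic term does not see it. The value at s = 0 matches since that term vanishes there. -/
theorem theta_eq (r : ℝ) (b : S.VO) (s : ℝ) :
    S.theta b s = (-(Complex.I / 2) * S.kap s (S.γO r (S.fA s b)),
      Complexification.mk (-(S.gA s b)) (-b), 0) := by
  unfold theta
  split_ifs with hs
  · subst hs
    rw [kap_zero, gA_zero]; simp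
  · have h := S.mul_kap_fA r s b
    have hs' : (s : ℂ) ≠ 0 := by exact_mod_cast hs
    have h2 : S.kap s (S.γO r (S.fA s b)) = ((inner ℂ (S.toH (S.fA s b)) (S.toH b)).re -
        ‖S.toH (S.fA s b)‖ ^ 2) / s := by
      rw [eq_div_iff hs, mul_comm, h]
    refine Prod.ext ?_ rfl
    rw [h2]
    push_cast
    field_simp
    ring

theorem polarInv_eq_iff (z : ℂ) (y : S.VC) (r : ℂ) (g : S.GO) (t : ℝ) (x : S.VO) (s : ℝ) :
    S.polarInv (z, y, r) = (g, (t, x, s)) ↔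
      s = r.im ∧ x = S.γO (-r.re) (S.fA s y.im) ∧
      S.mulC (S.incl g) (Complex.I * (t : ℂ), 0, 0) =
        S.mulC (S.mulC (z, y, 0) (S.theta y.im r.im)) (0, 0, (r.re : ℂ)) := by
  obtain ⟨g₀, gv, gr⟩ := g
  have e0 : S.om 0 = fun _ => 0 := funext fun y => S.omL.map_zero₂ y
  have hl : S.mulC (S.incl (g₀, gv, gr)) (Complex.I * (t : ℂ), 0, 0) =
      (g₀ + Complex.I * t, ofReal gv, (gr : ℂ)) := by
    rw [mulC_eq]; simp [incl]
  have hr : S.mulC (S.mulC (z, y, 0) (S.theta y.im r.im)) (0, 0, (r.re : ℂ)) =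
      ((z.re - (1 / 2) * S.om y.re (S.gA r.im y.im) : ℝ) + Complex.I *
        (z.im - (1 / 2) * S.kap r.im (S.γO (-r.re) (S.fA r.im y.im)) -
          (1 / 2) * (S.om y.re y.im + S.om y.im (S.gA r.im y.im)) : ℝ),
        ofReal (y.re - S.gA r.im y.im), (r.re : ℂ)) := by
    rw [S.theta_eq (-r.re), mulC_eq, mulC_eq]
    simp only [serE_zero_zero, serE_zero_right, omC_zero_right]
    refine Prod.ext ?_ (Prod.ext ?_ ?_)
    · simp only [omC, re_mk, im_mk, om_neg_right, om_self]
      conv_lhs => rw [← Complex.re_add_im z]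
      push_cast
      ring
    · ext
      · simp [sub_eq_add_neg]
      · simp
    · simp
  rw [hl, hr, polarInv]
  simp only [Prod.mk.injEq]
  constructor
  · rintro ⟨⟨rfl, rfl, rfl⟩, rfl, rfl, rfl⟩
    exact ⟨rfl, rfl, rfl, rfl, rfl⟩
  · rintro ⟨rfl, rfl, h1, h2, h3⟩
    have h4 := congrArg Complex.re h1
    have h5 := congrArg Complex.im h1
    have h6 := congrArg (re (E := S.VO)) h2
    have h7 : gr = r.re := by exact_mod_cast h3
    simp only [re_ofReal] at h6
    refine ⟨⟨?_, h6.symm, h7.symm⟩, ?_, rfl, rfl⟩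
    · simpa using h4.symm
    · simpa using h5.symm

theorem bijOn_polarMap : BijOn S.polarMap (univ ×ˢ S.cone) S.semigroup := by
  refine ⟨fun p hp => ?_, fun p _ q _ h => ?_, fun q hq => ⟨S.polarInv q, ⟨mem_univ _, hq⟩,
    S.polarMap_polarInv q⟩⟩
  · obtain ⟨⟨z₀, v, r⟩, ⟨t, x, s⟩⟩ := p
    have hs : 0 < s := hp.2
    rw [polarMap_mk]
    change 0 < ((r : ℂ) + Complex.I * s).im
    simpa using hs
  · rw [← S.polarInv_polarMap p, h, S.polarInv_polarMap]

theorem bijOn_polarInv : BijOn S.polarInv S.semigroup (univ ×ˢ S.cone) := by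
  refine ⟨fun q hq => ⟨mem_univ _, hq⟩, fun p _ q _ h => ?_, fun p hp =>
    ⟨S.polarMap p, S.bijOn_polarMap.mapsTo hp, S.polarInv_polarMap p⟩⟩
  rw [← S.polarMap_polarInv p, h, S.polarMap_polarInv]

end StandardOscillator

/-! ### Operations on `Cn` maps and inversion of families of automorphisms -/

section CnLemmas

variable {E : Type u} {F : Type v} {G : Type w} {G' : Type*}
  [AddCommGroup E] [Module ℝ E] [TopologicalSpace E]
  [AddCommGroup F] [Module ℝ F] [TopologicalSpace F]
  [AddCommGroup G] [Module ℝ G] [TopologicalSpace G]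
  [AddCommGroup G'] [Module ℝ G'] [TopologicalSpace G']

theorem Cn.linear_comp (n : ℕ) (L : F →ₗ[ℝ] G) (hL : Continuous L) {g : E → F} {U : Set E}
    (hU : IsOpen U) (hg : Cn n g U) : Cn n (fun x => L (g x)) U :=
  Cn.comp n hU (Cn.linear n L hL univ) hg (mapsTo_univ _ _)

theorem Cn.bilinear_comp (n : ℕ) [ContinuousAdd G] [ContinuousSMul ℝ G] (B : F →ₗ[ℝ] G' →ₗ[ℝ] G)
    (hB : Continuous fun p : F × G' => B p.1 p.2) {U : Set E} (hU : IsOpen U) {f : E → F}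
    {g : E → G'} (hf : Cn n f U) (hg : Cn n g U) : Cn n (fun x => B (f x) (g x)) U :=
  Cn.comp n hU (Cn.bilinear n B hB univ) (Cn.prodMk n hf hg) (mapsTo_univ _ _)

theorem Cn.add (n : ℕ) [ContinuousAdd F] {f g : E → F} {U : Set E} (hU : IsOpen U)
    (hf : Cn n f U) (hg : Cn n g U) : Cn n (fun x => f x + g x) U :=
  Cn.linear_comp n (LinearMap.fst ℝ F F + LinearMap.snd ℝ F F)
    (by change Continuous fun p : F × F => p.1 + p.2; fun_prop) hU (Cn.prodMk n hf hg)

theorem Cn.const_smul (n : ℕ) [ContinuousConstSMul ℝ F] (c : ℝ) {f : E → F} {U : Set E}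
    (hU : IsOpen U) (hf : Cn n f U) : Cn n (fun x => c • f x) U :=
  Cn.linear_comp n (c • LinearMap.id) (by change Continuous fun p : F => c • p; fun_prop) hU hf

theorem Cn.sub (n : ℕ) [ContinuousAdd F] [ContinuousConstSMul ℝ F] {f g : E → F} {U : Set E}
    (hU : IsOpen U) (hf : Cn n f U) (hg : Cn n g U) : Cn n (fun x => f x - g x) U := by
  simpa [sub_eq_add_neg] using Cn.add n hU hf (Cn.const_smul n (-1) hU hg)

/-- The inverses of a smooth family of linear automorphisms depend smoothly on the parameter if they
depend continuously on it. -/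
theorem Cn.of_inverse_family {V : Type u} [AddCommGroup V] [Module ℝ V] [TopologicalSpace V]
    [IsTopologicalAddGroup V] [ContinuousSMul ℝ V] {S : ℝ × V → V} (hS : ∀ n, Cn n S univ)
    (f : ℝ → V →ₗ[ℝ] V) (hf : Continuous fun p : ℝ × V => f p.1 p.2)
    (h₁ : ∀ s v, S (s, f s v) = v) (h₂ : ∀ s v, f s (S (s, v)) = v) (n : ℕ) :
    Cn n (fun p : ℝ × V => f p.1 p.2) univ := by
  induction n with
  | zero => exact hf.continuousOn
  | succ n ih =>
    obtain ⟨-, dS, hdS, hdSn⟩ := hS (n + 1)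
    rw [univ_prod_univ] at hdSn
    -- The derivative is found by differentiating S(s, f_s b) = b; it involves only `f` and the
    -- derivative of `S`, so smoothness of one order implies the next.
    refine ⟨hf.continuousOn, fun p => f p.1.1 (p.2.2 - dS ((p.1.1, f p.1.1 p.1.2), (p.2.1, 0))),
      fun x _ h => ?_, ?_⟩
    · obtain ⟨s, b⟩ := x
      obtain ⟨σ, β⟩ := h
      have t1 := tendsto_dir_fst (s, b) (σ, β)
      have t2 := tendsto_dir_snd (s, b) (σ, β)
      have t3 : Tendsto (fun p : ((ℝ × V) × (ℝ × V)) × ℝ => (p.1.1.1, f p.1.1.1 p.1.1.2))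
          ((𝓝 (s, b) ×ˢ 𝓝 (σ, β)) ×ˢ 𝓝[≠] 0) (𝓝 (s, f s b)) :=
        ((continuous_fst.prodMk hf).tendsto (s, b)).comp t1
      have t4 : Tendsto (fun p : ((ℝ × V) × (ℝ × V)) × ℝ => (p.1.2.1, (0 : V)))
          ((𝓝 (s, b) ×ˢ 𝓝 (σ, β)) ×ˢ 𝓝[≠] 0) (𝓝 (σ, 0)) :=
        ((continuous_fst.prodMk continuous_const).tendsto (σ, β)).comp t2
      have t5 := Tendsto.comp (hdS (s, f s b) (mem_univ _) (σ, 0))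
        ((t3.prodMk t4).prodMk (tendsto_snd (f := 𝓝 (s, b) ×ˢ 𝓝 (σ, β)) (g := 𝓝[≠] (0 : ℝ))))
      have t6 := ((continuous_snd.tendsto (σ, β)).comp t2).sub t5
      have t7 := ((continuous_fst.tendsto (s, b)).comp (tendsto_dir_add (s, b) (σ, β)))
      refine ((hf.tendsto _).comp (t7.prodMk_nhds t6)).congr' ?_
      filter_upwards [eventually_ne_zero_dir (s, b) (σ, β)] with p hp
      obtain ⟨⟨⟨s', b'⟩, ⟨σ', β'⟩⟩, t⟩ := p
      have hp' : t ≠ 0 := hp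
      simp only [Function.comp, Prod.mk_add_mk, Prod.smul_mk, smul_zero, add_zero, h₁]
      -- Writing the old value as a value of f at the new parameter turns the difference quotient
      -- into f at s' + tσ' applied to the direction minus a difference quotient of `S`.
      have e : f s' b' = f (s' + t • σ') (S (s' + t • σ', f s' b')) := (h₂ _ _).symm
      nth_rewrite 2 [e]
      rw [← map_sub, ← map_smul]
      congr 1
      rw [add_sub_right_comm, ← neg_sub (S _) b', smul_add, inv_smul_smul₀ hp', smul_neg]
      abel
    · rw [univ_prod_univ]
      let L : (ℝ × V) × (ℝ × V) →ₗ[ℝ] ℝ × V := LinearMap.fst ℝ (ℝ × V) (ℝ × V)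
      have a1 : Cn n (fun p : (ℝ × V) × (ℝ × V) => f p.1.1 p.1.2) univ :=
        Cn.comp n isOpen_univ ih (Cn.linear n L continuous_fst univ) (mapsTo_univ _ _)
      have a2 : Cn n (fun p : (ℝ × V) × (ℝ × V) => p.1.1) univ :=
        Cn.linear n (LinearMap.fst ℝ ℝ V ∘ₗ L) (continuous_fst.comp continuous_fst) univ
      have a3 : Cn n (fun p : (ℝ × V) × (ℝ × V) => p.2.2) univ :=
        Cn.linear n (LinearMap.snd ℝ ℝ V ∘ₗ LinearMap.snd ℝ (ℝ × V) (ℝ × V))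
          (continuous_snd.comp continuous_snd) univ
      have a4 : Cn n (fun p : (ℝ × V) × (ℝ × V) => p.2.1) univ :=
        Cn.linear n (LinearMap.fst ℝ ℝ V ∘ₗ LinearMap.snd ℝ (ℝ × V) (ℝ × V))
          (continuous_fst.comp continuous_snd) univ
      have a5 := Cn.comp n isOpen_univ hdSn (Cn.prodMk n (Cn.prodMk n a2 a1)
        (Cn.prodMk n a4 (Cn.const n (0 : V) univ))) (mapsTo_univ _ _)
      exact Cn.comp n isOpen_univ ih (Cn.prodMk n a2 (Cn.sub n isOpen_univ a3 a5)) (mapsTo_univ _ _)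

end CnLemmas

/-! ### Smoothness of the inverse polar map -/

namespace StandardOscillator

variable {H : Type u} [NormedAddCommGroup H] [InnerProductSpace ℂ H] (S : StandardOscillator H)
  [CompleteSpace H]

set_option linter.unusedSectionVars false

section Components

variable {E : Type v} [AddCommGroup E] [Module ℝ E] [TopologicalSpace E] {U : Set E}

theorem cn_serE (n : ℕ) (hU : IsOpen U) (j : ℕ) {f : E → ℂ} {g : E → S.VC} (hf : Cn n f U)
    (hg : Cn n g U) : Cn n (fun x => S.serE j (f x) (g x)) U :=
  Cn.comp n hU ((S.hol_serE j).1 n) (Cn.prodMk n hf hg) (mapsTo_univ _ _)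

theorem cn_om (n : ℕ) (hU : IsOpen U) {f g : E → S.VO} (hf : Cn n f U) (hg : Cn n g U) :
    Cn n (fun x => S.om (f x) (g x)) U :=
  Cn.bilinear_comp n S.omL S.continuous_om hU hf hg

theorem cn_re (n : ℕ) (hU : IsOpen U) {f : E → S.VC} (hf : Cn n f U) :
    Cn n (fun x => (f x).re) U := Cn.linear_comp n reL continuous_re hU hf

theorem cn_im (n : ℕ) (hU : IsOpen U) {f : E → S.VC} (hf : Cn n f U) :
    Cn n (fun x => (f x).im) U := Cn.linear_comp n imL continuous_im hU hf

theorem cn_ofReal (n : ℕ) (hU : IsOpen U) {f : E → S.VO} (hf : Cn n f U) :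
    Cn n (fun x => (ofReal (f x) : S.VC)) U :=
  Cn.linear_comp n ofRealL (continuous_mk continuous_id continuous_const) hU hf

theorem cn_ofImag (n : ℕ) (hU : IsOpen U) {f : E → S.VO} (hf : Cn n f U) :
    Cn n (fun x => (ofImag (f x) : S.VC)) U :=
  Cn.linear_comp n ofImagL (continuous_mk continuous_const continuous_id) hU hf

theorem cn_I_mul (n : ℕ) (hU : IsOpen U) {f : E → ℝ} (hf : Cn n f U) :
    Cn n (fun x => Complex.I * (f x : ℂ)) U :=
  Cn.linear_comp n (LinearMap.mulLeft ℝ Complex.I ∘ₗ Complex.ofRealCLM.toLinearMap)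
    (continuous_const.mul Complex.continuous_ofReal) hU hf

theorem cn_coe (n : ℕ) (hU : IsOpen U) {f : E → ℝ} (hf : Cn n f U) :
    Cn n (fun x => (f x : ℂ)) U :=
  Cn.linear_comp n Complex.ofRealCLM.toLinearMap Complex.continuous_ofReal hU hf

end Components

/-- The operator `f_s(A)` as a linear map. -/
def fAL (s : ℝ) : S.VO →ₗ[ℝ] S.VO where
  toFun := S.fA s
  map_add' v w := by simp only [fA_eq, act_add_right]
  map_smul' c v := by simp only [fA_eq, ← Complex.coe_smul, act_smul_right, RingHom.id_apply]

theorem q_fA_le (s : ℝ) (v : S.VO) (n : ℕ) : S.q n (S.fA s v) ≤ S.q n v := by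
  rw [fA_eq]
  refine (S.q_act_le _ _ n).trans (mul_le_of_le_one_left (S.q_nonneg n v) ?_)
  exact (contExt_fFun s).norm_symAlg_le S fun x _ => norm_fFun_le s x

theorem shA_eq_im (s : ℝ) (x : S.VO) : S.shA s x = (S.serE 1 (Complex.I * s) (ofImag x)).im := by
  rw [serE_one_ofImag, im_mk]

theorem cn_shA (n : ℕ) : Cn n (fun p : ℝ × S.VO => S.shA p.1 p.2) univ := by
  simp only [shA_eq_im]
  exact S.cn_im n isOpen_univ (S.cn_serE n isOpen_univ 1
    (cn_I_mul n isOpen_univ (Cn.linear n (LinearMap.fst ℝ ℝ S.VO) continuous_fst univ))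
    (S.cn_ofImag n isOpen_univ (Cn.linear n (LinearMap.snd ℝ ℝ S.VO) continuous_snd univ)))

/-- With S_s = sinh(sA)/(sA), f_{s'}b' - f_s b = f_{s'}((b' - b) + (S_s - S_{s'})f_s b). The
argument tends to 0 and f_{s'} contracts every q_n, uniformly in s'. -/
theorem continuous_fA : Continuous fun p : ℝ × S.VO => S.fA p.1 p.2 := by
  rw [continuous_iff_continuousAt]
  rintro ⟨s, b⟩
  rw [ContinuousAt, tendsto_VO_iff]
  intro n
  have hS : Continuous fun p : ℝ × S.VO => S.shA p.1 p.2 :=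
    continuousOn_univ.1 (S.cn_shA 0).continuousOn
  have h1 : Continuous fun p : ℝ × S.VO =>
      S.q n ((p.2 - b) + (S.shA s (S.fA s b) - S.shA p.1 (S.fA s b))) := by
    have := hS.comp (continuous_fst.prodMk (continuous_const (y := S.fA s b)) :
      Continuous fun p : ℝ × S.VO => (p.1, S.fA s b))
    exact (S.continuous_q n).comp ((continuous_snd.sub continuous_const).add
      (continuous_const.sub this))
  have h2 := h1.tendsto (s, b)
  have hq0 : S.q n 0 = 0 := map_zero (S.qSeminorm n)
  simp only [sub_self, add_zero, hq0] at h2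
  refine squeeze_zero (fun p => S.q_nonneg n _) (fun p => ?_) h2
  have e : S.fA p.1 p.2 - S.fA s b =
      S.fA p.1 ((p.2 - b) + (S.shA s (S.fA s b) - S.shA p.1 (S.fA s b))) := by
    have := (S.fAL p.1).map_sub p.2 (S.shA p.1 (S.fA s b))
    change S.fA p.1 _ = S.fA p.1 _ - S.fA p.1 _ at this
    rw [fA_shA] at this
    rw [← this, shA_fA]
    congr 1
    abel
  rw [e]
  exact S.q_fA_le _ _ n

theorem cn_fA (n : ℕ) : Cn n (fun p : ℝ × S.VO => S.fA p.1 p.2) univ :=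
  Cn.of_inverse_family (fun n => S.cn_shA n) S.fAL S.continuous_fA S.shA_fA S.fA_shA n

theorem gA_eq_re (s : ℝ) (b : S.VO) :
    S.gA s b = (S.serE 1 (Complex.I * s) (ofImag (S.fA s b))).re := by
  rw [serE_one_ofImag, re_mk, gA_eq_chA]

theorem γO_eq_re (t : ℝ) (b : S.VO) : S.γO t b = (S.serE 0 t (ofReal b)).re := by
  rw [← ofReal_γO, re_ofReal]

section Components

variable {E : Type v} [AddCommGroup E] [Module ℝ E] [TopologicalSpace E] {U : Set E}

theorem cn_fA_comp (n : ℕ) (hU : IsOpen U) {f : E → ℝ} {g : E → S.VO} (hf : Cn n f U)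
    (hg : Cn n g U) : Cn n (fun x => S.fA (f x) (g x)) U :=
  Cn.comp n (f := fun p : ℝ × S.VO => S.fA p.1 p.2) (g := fun x => (f x, g x)) hU (S.cn_fA n)
    (Cn.prodMk n hf hg) (mapsTo_univ _ _)

theorem cn_gA_comp (n : ℕ) (hU : IsOpen U) {f : E → ℝ} {g : E → S.VO} (hf : Cn n f U)
    (hg : Cn n g U) : Cn n (fun x => S.gA (f x) (g x)) U := by
  simp only [gA_eq_re]
  exact S.cn_re n hU (S.cn_serE n hU 1 (cn_I_mul n hU hf)
    (S.cn_ofImag n hU (S.cn_fA_comp n hU hf hg)))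

theorem cn_γO_comp (n : ℕ) (hU : IsOpen U) {f : E → ℝ} {g : E → S.VO} (hf : Cn n f U)
    (hg : Cn n g U) : Cn n (fun x => S.γO (f x) (g x)) U := by
  simp only [γO_eq_re]
  exact S.cn_re n hU (S.cn_serE n hU 0 (cn_coe n hU hf) (S.cn_ofReal n hU hg))

theorem cn_kap_comp (n : ℕ) (hU : IsOpen U) {f : E → ℝ} {g : E → S.VO} (hf : Cn n f U)
    (hg : Cn n g U) : Cn n (fun x => S.kap (f x) (g x)) U :=
  S.cn_om n hU hg (S.cn_re n hU (S.cn_serE n hU 2 (cn_I_mul n hU hf) (S.cn_ofImag n hU hg)))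

end Components

theorem cn_polarInv (n : ℕ) : Cn n S.polarInv univ := by
  have hU : IsOpen (univ : Set S.GC) := isOpen_univ
  have z0 : Cn n (fun q : S.GC => q.1) univ :=
    Cn.linear n (LinearMap.fst ℝ ℂ (S.VC × ℂ)) continuous_fst univ
  have z1 : Cn n (fun q : S.GC => q.1.re) univ :=
    Cn.linear_comp n Complex.reLm Complex.continuous_re hU z0
  have z2 : Cn n (fun q : S.GC => q.1.im) univ :=
    Cn.linear_comp n Complex.imLm Complex.continuous_im hU z0
  have y0 : Cn n (fun q : S.GC => q.2.1) univ :=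
    Cn.linear n (LinearMap.fst ℝ S.VC ℂ ∘ₗ LinearMap.snd ℝ ℂ (S.VC × ℂ))
      (continuous_fst.comp continuous_snd) univ
  have r0 : Cn n (fun q : S.GC => q.2.2) univ :=
    Cn.linear n (LinearMap.snd ℝ S.VC ℂ ∘ₗ LinearMap.snd ℝ ℂ (S.VC × ℂ))
      (continuous_snd.comp continuous_snd) univ
  have y1 := S.cn_re n hU y0
  have y2 := S.cn_im n hU y0
  have r1 : Cn n (fun q : S.GC => q.2.2.re) univ :=
    Cn.linear_comp n Complex.reLm Complex.continuous_re hU r0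
  have r2 : Cn n (fun q : S.GC => q.2.2.im) univ :=
    Cn.linear_comp n Complex.imLm Complex.continuous_im hU r0
  have r1' : Cn n (fun q : S.GC => -q.2.2.re) univ := by
    simpa using Cn.const_smul n (-1) hU r1
  have g1 := S.cn_gA_comp n hU r2 y2
  have x1 := S.cn_γO_comp n hU r1' (S.cn_fA_comp n hU r2 y2)
  have m {f : S.GC → ℝ} (hf : Cn n f univ) : Cn n (fun q => (1 / 2 : ℝ) * f q) univ :=
    Cn.const_smul n (1 / 2 : ℝ) hU hf
  exact Cn.prodMk n
    (Cn.prodMk n (Cn.sub n hU z1 (m (S.cn_om n hU y1 g1))) (Cn.prodMk n (Cn.sub n hU y1 g1) r1))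
    (Cn.prodMk n (Cn.sub n hU (Cn.sub n hU z2 (m (S.cn_kap_comp n hU r2 x1)))
      (m (Cn.add n hU (S.cn_om n hU y1 y2) (S.cn_om n hU y2 g1)))) (Cn.prodMk n x1 r2))

theorem smoothOn_polarInv {U : Set S.GC} (hU : IsOpen U) : SmoothOn S.polarInv U :=
  ⟨hU, fun n => Cn.isCnOn n ((S.cn_polarInv n).mono n (subset_univ _))⟩

theorem isOpen_semigroup : IsOpen S.semigroup :=
  isOpen_lt continuous_const
    (Complex.continuous_im.comp (continuous_snd.comp (continuous_snd (X := ℂ) (Y := S.VC × ℂ))))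

theorem isOpen_cone : IsOpen ((univ : Set S.GO) ×ˢ S.cone) :=
  isOpen_univ.prod (isOpen_lt continuous_const (continuous_snd.comp continuous_snd))

end StandardOscillator

/-! ### Holomorphic families of continuous functions -/

/-- A locally bounded family of continuous functions on a compact space that depends holomorphically
on the parameter at every point is holomorphic. -/
theorem differentiableOn_of_eval {X : Type*} [TopologicalSpace X] [CompactSpace X]
    {a : ℂ → C(X, ℂ)} {U : Set ℂ} (hU : IsOpen U)
    (ha : ∀ p, DifferentiableOn ℂ (fun w => a w p) U)
    (hb : ∀ w₀ ∈ U, ∃ C : ℝ, ∀ᶠ w in 𝓝 w₀, ‖a w‖ ≤ C) : DifferentiableOn ℂ a U := by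
  intro w₀ hw₀
  obtain ⟨C, hC⟩ := hb w₀ hw₀
  obtain ⟨R', hR', hball'⟩ := Metric.nhds_basis_closedBall.mem_iff.1 (inter_mem (hU.mem_nhds hw₀) hC)
  obtain ⟨R, hR, rfl⟩ : ∃ R : ℝ, 0 < R ∧ R' = 2 * R := ⟨R' / 2, by linarith, by ring⟩
  have hsub {w : ℂ} (hw : w ∈ Metric.ball w₀ R) : Metric.closedBall w R ⊆ Metric.closedBall w₀ (2 * R) := by
    refine Metric.closedBall_subset_closedBall' ?_
    have := Metric.mem_ball.1 hw
    linarith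
  have hC0 : 0 ≤ C := (norm_nonneg _).trans
    (hball' (Metric.mem_closedBall_self (by linarith))).2
  -- Cauchy estimates on circles of radius R inside the disc of radius 2R bound the derivatives at
  -- all points p by the same C/R; this uniformity gives norm continuity.
  have hlip {w w' : ℂ} (hw : w ∈ Metric.ball w₀ R) (hw' : w' ∈ Metric.ball w₀ R) :
      ‖a w - a w'‖ ≤ C / R * ‖w - w'‖ := by
    refine (ContinuousMap.norm_le _ (by positivity)).2 fun p => ?_
    refine Convex.norm_image_sub_le_of_norm_deriv_le (f := fun w => a w p) (𝕜 := ℂ)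
      (s := Metric.ball w₀ R) (fun x hx => ?_) (fun x hx => ?_) (convex_ball w₀ R) hw' hw
    · have hx' : x ∈ U := (hball' (hsub hx (Metric.mem_closedBall_self hR.le))).1
      exact (ha p x hx').differentiableAt (hU.mem_nhds hx')
    · refine Complex.norm_deriv_le_of_forall_mem_sphere_norm_le hR ?_ fun z hz => ?_
      · refine DifferentiableOn.diffContOnCl ?_
        rw [closure_ball _ hR.ne']
        exact (ha p).mono fun z hz => (hball' (hsub hx hz)).1
      · exact ((a z).norm_coe_le_norm p).trans (hball' (hsub hx (Metric.sphere_subset_closedBall hz))).2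
  have hcont : ContinuousOn a (Metric.ball w₀ R) := by
    intro w hw
    rw [ContinuousWithinAt, tendsto_iff_norm_sub_tendsto_zero]
    have h1 : Tendsto (fun x => C / R * ‖x - w‖) (𝓝[Metric.ball w₀ R] w) (𝓝 0) := by
      have : Tendsto (fun x => C / R * ‖x - w‖) (𝓝 w) (𝓝 (C / R * ‖w - w‖)) :=
        Continuous.tendsto (by fun_prop) w
      simp only [sub_self, norm_zero, mul_zero] at this
      exact this.mono_left nhdsWithin_le_nhds
    refine squeeze_zero' (Eventually.of_forall fun _ => norm_nonneg _) ?_ h1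
    filter_upwards [self_mem_nhdsWithin] with x hx
    exact hlip hx hw
  let ρ : NNReal := ⟨R / 2, by positivity⟩
  have hρ : 0 < ρ := by
    have : (0 : ℝ) < R / 2 := by positivity
    exact this
  have hρR : Metric.closedBall w₀ ρ ⊆ Metric.ball w₀ R :=
    Metric.closedBall_subset_ball (by change R / 2 < R; linarith)
  have hint : CircleIntegrable a w₀ ρ :=
    ContinuousOn.circleIntegrable ρ.2 (hcont.mono (Metric.sphere_subset_closedBall.trans hρR))
  have hD := (hasFPowerSeriesOn_cauchy_integral hint hρ).differentiableOn
  rw [Metric.eball_coe] at hD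
  -- Evaluation at p commutes with the circle integral, so the scalar Cauchy formulas assemble into
  -- one in the function space, which makes the family analytic.
  have heq : ∀ w ∈ Metric.ball w₀ (ρ : ℝ),
      a w = (2 * ↑Real.pi * Complex.I)⁻¹ • ∮ z in C(w₀, ρ), (z - w)⁻¹ • a z := by
    intro w hw
    ext p
    have hd : DiffContOnCl ℂ (fun w => a w p) (Metric.ball w₀ ρ) := by
      refine DifferentiableOn.diffContOnCl ?_
      rw [closure_ball _ (by exact_mod_cast hρ.ne')]
      exact (ha p).mono fun z hz =>
        (hball' (hsub (hρR hz) (Metric.mem_closedBall_self hR.le))).1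
    have h1 := hd.circleIntegral_sub_inv_smul hw
    have hci : CircleIntegrable (fun z => (z - w)⁻¹ • a z) w₀ ρ := by
      refine ContinuousOn.circleIntegrable ρ.2 ?_
      refine ContinuousOn.smul (ContinuousOn.inv₀ (f := fun z : ℂ => z - w)
        (continuous_id.sub continuous_const).continuousOn fun z hz => ?_)
        (hcont.mono (Metric.sphere_subset_closedBall.trans hρR))
      rw [sub_ne_zero]
      rintro rfl
      exact (Metric.mem_ball.1 hw).ne (Metric.mem_sphere.1 hz)
    have h2 : (∮ z in C(w₀, ρ), (z - w)⁻¹ • a z) p = ∮ z in C(w₀, ρ), (z - w)⁻¹ • a z p := by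
      have := ContinuousLinearMap.intervalIntegral_comp_comm
        (ContinuousMap.evalCLM ℂ p : C(X, ℂ) →L[ℂ] ℂ) hci.out
      exact this.symm
    rw [ContinuousMap.smul_apply, h2, h1, inv_smul_smul₀ Complex.two_pi_I_ne_zero]
  have hmem : Metric.ball w₀ (ρ : ℝ) ∈ 𝓝 w₀ := Metric.ball_mem_nhds _ hρ
  have := (hD w₀ (Metric.mem_ball_self hρ)).differentiableAt hmem
  refine DifferentiableAt.differentiableWithinAt ?_
  refine this.congr_of_eventuallyEq ?_
  filter_upwards [hmem] with w hw using heq w hw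

/-! ### Estimates in a sector -/

theorem differentiable_shc : Differentiable ℂ shc := by
  have := differentiable_ent 1
  unfold shc
  fun_prop

theorem shc_ne_zero_of_re {w : ℂ} (hw : w = 0 ∨ 0 < w.re) : shc w ≠ 0 := by
  rcases hw with rfl | hw
  · simp [shc_zero]
  · intro h
    have h1 := mul_shc w
    rw [h, mul_zero] at h1
    have h2 : Complex.exp w = Complex.exp (-w) := by linear_combination (-2) * h1
    have h3 := congrArg norm h2
    rw [Complex.norm_exp, Complex.norm_exp, Real.exp_eq_exp, Complex.neg_re] at h3
    linarith

/-- The function `e^{w/2} w / sinh w`. -/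
def hFun (w : ℂ) : ℂ := Complex.exp (w / 2) * (shc w)⁻¹

/-- The factor e^{w/2} uses up half of the exponential decay of w/sinh w; the other half remains. -/
theorem norm_hFun_le_of_one_le {w : ℂ} (h1 : |w.im| ≤ w.re) (h2 : 1 ≤ w.re) :
    ‖hFun w‖ ≤ 8 * (w.re * Real.exp (-(w.re / 2))) := by
  have hw0 : w ≠ 0 := by rintro rfl; simp at h2; linarith
  have hs : shc w = (Complex.exp w - Complex.exp (-w)) / 2 / w := by
    rw [eq_div_iff hw0, mul_comm, mul_shc]
  have hn : ‖w‖ ≤ 2 * w.re := by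
    have := Complex.norm_le_abs_re_add_abs_im w
    rw [abs_of_nonneg (by linarith)] at this
    linarith
  have he : Real.exp w.re / 2 ≤ ‖Complex.exp w - Complex.exp (-w)‖ := by
    have h3 := norm_sub_norm_le (Complex.exp w) (Complex.exp (-w))
    rw [Complex.norm_exp, Complex.norm_exp, Complex.neg_re] at h3
    have h4 : Real.exp (-w.re) ≤ Real.exp w.re / 2 := by
      rw [Real.exp_neg, inv_le_comm₀ (by positivity) (by positivity), inv_div]
      have := Real.add_one_le_exp w.re
      rw [div_le_iff₀ (by positivity)]
      nlinarith
    linarith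
  have hpos := Real.exp_pos w.re
  have hne : 0 < ‖Complex.exp w - Complex.exp (-w)‖ := by linarith
  rw [hFun, hs, norm_mul, norm_inv, norm_div, norm_div, Complex.norm_exp]
  have e1 : (w / 2).re = w.re / 2 := by simp
  rw [e1, inv_div, ← div_mul, div_mul_eq_mul_div, ← mul_div_assoc, div_le_iff₀ hne]
  simp only [Complex.norm_ofNat]
  have e2 : Real.exp (-(w.re / 2)) * Real.exp w.re = Real.exp (w.re / 2) := by
    rw [← Real.exp_add]; congr 1; ring
  have hp2 := Real.exp_pos (w.re / 2)
  have hp3 := Real.exp_pos (-(w.re / 2))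
  calc Real.exp (w.re / 2) * (‖w‖ * 2) ≤ Real.exp (w.re / 2) * ((2 * w.re) * 2) := by gcongr
    _ = 8 * (w.re * Real.exp (-(w.re / 2))) * (Real.exp w.re / 2) := by
      rw [← e2]; ring
    _ ≤ _ := by gcongr

/-- Compactness handles Re w ≤ 1, where the only point of the closed sector with Re w = 0 is the
removable one w = 0; decay handles the rest. -/
theorem exists_bound_hFun : ∃ C : ℝ, ∀ w : ℂ, |w.im| ≤ w.re → ‖hFun w‖ ≤ C := by
  let K : Set ℂ := {w | |w.im| ≤ w.re ∧ w.re ≤ 1}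
  have hKc : IsCompact K := by
    refine Metric.isCompact_of_isClosed_isBounded ?_ ?_
    · exact (isClosed_le (continuous_abs.comp Complex.continuous_im) Complex.continuous_re).inter
        (isClosed_le Complex.continuous_re continuous_const)
    · refine (Metric.isBounded_closedBall (x := (0 : ℂ)) (r := 2)).subset fun w hw => ?_
      rw [mem_closedBall_zero_iff]
      have := Complex.norm_le_abs_re_add_abs_im w
      rw [abs_of_nonneg ((abs_nonneg _).trans hw.1)] at this
      linarith [hw.1, hw.2]
  have hc : ContinuousOn hFun K := by
    refine ContinuousOn.mul (by fun_prop) (ContinuousOn.inv₀ continuous_shc.continuousOn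
      fun w hw => shc_ne_zero_of_re ?_)
    rcases ((abs_nonneg _).trans hw.1).eq_or_lt with h | h
    · left
      have h2 := hw.1
      rw [← h] at h2
      exact Complex.ext h.symm (abs_eq_zero.1 (le_antisymm h2 (abs_nonneg _)))
    · exact Or.inr h
  obtain ⟨C, hC⟩ := hKc.exists_bound_of_continuousOn hc
  refine ⟨max C 16, fun w hw => ?_⟩
  rcases le_total w.re 1 with h | h
  · exact (hC w ⟨hw, h⟩).trans (le_max_left _ _)
  · refine (norm_hFun_le_of_one_le hw h).trans (le_trans ?_ (le_max_right _ _))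
    have h1 : w.re * Real.exp (-(w.re / 2)) ≤ 2 := by
      rw [Real.exp_neg, ← div_eq_mul_inv, div_le_iff₀ (Real.exp_pos _)]
      have := Real.add_one_le_exp (w.re / 2)
      linarith
    linarith

/-- For Re w ≤ 1 the phase satisfies |Im w| ≤ 1 < π/2, so e^{-w} has nonnegative real part; for Re w
≥ 1 it has modulus at most 1/2. -/
theorem half_le_norm_one_add_exp {w : ℂ} (hw : |w.im| ≤ w.re) :
    1 / 2 ≤ ‖1 + Complex.exp (-w)‖ := by
  have h0 : 0 ≤ w.re := (abs_nonneg _).trans hw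
  rcases le_total w.re 1 with h | h
  · refine le_trans ?_ (Complex.re_le_norm _)
    have e : (1 + Complex.exp (-w)).re = 1 + Real.exp (-w.re) * Real.cos w.im := by
      simp [Complex.exp_re]
    rw [e]
    have : 0 ≤ Real.cos w.im := by
      refine Real.cos_nonneg_of_mem_Icc (abs_le.1 ?_)
      linarith [Real.pi_gt_three]
    have := mul_nonneg (Real.exp_pos (-w.re)).le this
    linarith
  · have h3 := norm_sub_norm_le (1 : ℂ) (-Complex.exp (-w))
    rw [norm_neg, Complex.norm_exp, Complex.neg_re, norm_one, sub_neg_eq_add] at h3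
    have h4 : Real.exp (-w.re) ≤ 1 / 2 := by
      rw [Real.exp_neg, inv_le_comm₀ (by positivity) (by positivity)]
      have := Real.add_one_le_exp w.re
      norm_num
      linarith
    linarith

/-- The open sector `|Im s| < Re s`. -/
def sector : Set ℂ := {s | |s.im| < s.re}

theorem isOpen_sector : IsOpen sector :=
  isOpen_lt (continuous_abs.comp Complex.continuous_im) Complex.continuous_re

theorem re_pos_of_mem_sector {s : ℂ} (hs : s ∈ sector) : 0 < s.re := (abs_nonneg _).trans_lt hs

theorem abs_im_mul_le {s : ℂ} (hs : s ∈ sector) {x : ℝ} (hx : 0 ≤ x) :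
    |(s * x).im| ≤ (s * x).re := by
  have h : |s.im| < s.re := hs
  simp only [Complex.im_mul_ofReal, Complex.re_mul_ofReal, abs_mul, abs_of_nonneg hx]
  gcongr

theorem tendsto_re_mul {s : ℂ} (hs : 0 < s.re) :
    Tendsto (fun x : ℝ => (s * x).re) atTop atTop := by
  simp only [Complex.re_mul_ofReal]
  exact tendsto_id.const_mul_atTop hs

/-! ### Holomorphic families in the function algebra -/

namespace StandardOscillator

variable {H : Type u} [NormedAddCommGroup H] [InnerProductSpace ℂ H] (S : StandardOscillator H)
  [CompleteSpace H]

set_option linter.unusedSectionVars false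

/-- All members share the limit l at infinity, so the value at r = 0 is constant in the parameter;
elsewhere holomorphy is pointwise, and the uniform bound upgrades it to norm holomorphy. -/
theorem differentiableOn_symAlg {φ : ℂ → ℝ → ℂ} {U : Set ℂ} (hU : IsOpen U) {l : ℂ}
    (hc : ∀ w ∈ U, ContinuousOn (φ w) (Ici 0)) (hl : ∀ w ∈ U, Tendsto (φ w) atTop (𝓝 l))
    (hd : ∀ x, 0 ≤ x → DifferentiableOn ℂ (fun w => φ w x) U) {C : ℝ}
    (hC : ∀ w ∈ U, ∀ x, 0 ≤ x → ‖φ w x‖ ≤ C) :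
    DifferentiableOn ℂ (fun w => S.symAlg (φ w)) U := by
  have hce (w) (hw : w ∈ U) : ContExt (φ w) := ⟨hc w hw, l, hl w hw⟩
  refine differentiableOn_of_eval hU (fun p => ?_) fun w₀ hw₀ => ⟨C, ?_⟩
  · have e (w) (hw : w ∈ U) : S.symAlg (φ w) p = if S.rad p = 0 then l else φ w (S.var p) := by
      rw [(hce w hw).symAlg_apply, (hl w hw).limUnder_eq]
    refine DifferentiableOn.congr ?_ e
    split_ifs with h
    · exact differentiableOn_const l
    · exact hd _ (S.var_nonneg ((S.rad_nonneg p).lt_of_ne' h))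
  · filter_upwards [hU.mem_nhds hw₀] with w hw
    exact (hce w hw).norm_symAlg_le S (hC w hw)

theorem hol_of_differentiableOn {E : Type*} [NormedAddCommGroup E] [NormedSpace ℂ E]
    [CompleteSpace E] {f : ℂ → E} {U : Set ℂ} (hU : IsOpen U) (hf : DifferentiableOn ℂ f U) :
    Hol f U := Hol.of_contDiffOn hU (hf.contDiffOn hU)

/-- The family `e^{-ζA}`. -/
def eAlg (ζ : ℂ) : S.Alg := S.symAlg fun x => Complex.exp (-(ζ * x))

theorem tendsto_exp_neg_mul {ζ : ℂ} (hζ : 0 < ζ.re) :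
    Tendsto (fun x : ℝ => Complex.exp (-(ζ * x))) atTop (𝓝 0) := by
  rw [tendsto_zero_iff_norm_tendsto_zero]
  simp only [Complex.norm_exp, Complex.neg_re]
  exact Real.tendsto_exp_neg_atTop_nhds_zero.comp (tendsto_re_mul hζ)

theorem contExt_exp {ζ : ℂ} (hζ : 0 < ζ.re) : ContExt fun x : ℝ => Complex.exp (-(ζ * x)) :=
  ⟨by fun_prop, 0, tendsto_exp_neg_mul hζ⟩

theorem norm_exp_neg_mul_le {ζ : ℂ} (hζ : 0 < ζ.re) {x : ℝ} (hx : 0 ≤ x) :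
    ‖Complex.exp (-(ζ * x))‖ ≤ 1 := by
  rw [Complex.norm_exp, Real.exp_le_one_iff]
  simp only [Complex.neg_re, Complex.re_mul_ofReal]
  nlinarith

theorem isOpen_re_pos : IsOpen {ζ : ℂ | 0 < ζ.re} := isOpen_lt continuous_const Complex.continuous_re

theorem hol_eAlg : Hol S.eAlg {ζ | 0 < ζ.re} :=
  hol_of_differentiableOn isOpen_re_pos (S.differentiableOn_symAlg isOpen_re_pos (l := 0) (C := 1)
    (fun w _ => by fun_prop) (fun w hw => tendsto_exp_neg_mul hw)
    (fun x _ => by fun_prop) fun w hw x hx => norm_exp_neg_mul_le hw hx)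

/-- The family `e^{sA/2} sA / sinh(sA)`. -/
def hAlg (s : ℂ) : S.Alg := S.symAlg fun x => hFun (s * x)

theorem shc_mul_ne_zero {s : ℂ} (hs : s ∈ sector) {x : ℝ} (hx : 0 ≤ x) : shc (s * x) ≠ 0 := by
  refine shc_ne_zero_of_re ?_
  rcases hx.eq_or_lt with rfl | hx
  · simp
  · right
    rw [Complex.re_mul_ofReal]
    exact mul_pos (re_pos_of_mem_sector hs) hx

theorem continuousOn_hFun_mul {s : ℂ} (hs : s ∈ sector) :
    ContinuousOn (fun x : ℝ => hFun (s * x)) (Ici 0) := by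
  unfold hFun
  refine ContinuousOn.mul (by fun_prop) (ContinuousOn.inv₀
    (continuous_shc.comp (by fun_prop)).continuousOn fun x hx => shc_mul_ne_zero hs hx)

theorem tendsto_hFun_mul {s : ℂ} (hs : s ∈ sector) :
    Tendsto (fun x : ℝ => hFun (s * x)) atTop (𝓝 0) := by
  have hr := tendsto_re_mul (re_pos_of_mem_sector hs)
  have h1 : Tendsto (fun u : ℝ => 8 * (u * Real.exp (-(u / 2)))) atTop (𝓝 0) := by
    have := (Real.tendsto_pow_mul_exp_neg_atTop_nhds_zero 1).comp
      (tendsto_id.atTop_div_const (by norm_num : (0 : ℝ) < 2))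
    have := this.const_mul 16
    rw [mul_zero] at this
    refine this.congr fun u => ?_
    simp only [Function.comp, id]; ring
  refine squeeze_zero_norm' ?_ (h1.comp hr)
  filter_upwards [hr.eventually_ge_atTop 1, eventually_ge_atTop 0] with x hx hx0
  exact norm_hFun_le_of_one_le (abs_im_mul_le hs hx0) hx

theorem contExt_hFun {s : ℂ} (hs : s ∈ sector) : ContExt fun x : ℝ => hFun (s * x) :=
  ⟨continuousOn_hFun_mul hs, 0, tendsto_hFun_mul hs⟩

theorem hol_hAlg : Hol S.hAlg sector := by
  obtain ⟨C, hC⟩ := exists_bound_hFun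
  refine hol_of_differentiableOn isOpen_sector (S.differentiableOn_symAlg isOpen_sector (l := 0)
    (C := C) (fun w hw => continuousOn_hFun_mul hw) (fun w hw => tendsto_hFun_mul hw)
    (fun x hx => ?_) fun w hw x hx => hC _ (abs_im_mul_le hw hx))
  unfold hFun
  refine DifferentiableOn.mul (by fun_prop) (DifferentiableOn.inv
    (differentiable_shc.comp (by fun_prop)).differentiableOn fun s hs => shc_mul_ne_zero hs hx)

/-- The family `tanh(sA/2)`. -/
def tAlg (s : ℂ) : S.Alg :=
  S.symAlg fun x => (1 - Complex.exp (-(s * x))) / (1 + Complex.exp (-(s * x)))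

theorem one_add_exp_ne_zero {s : ℂ} (hs : s ∈ sector) {x : ℝ} (hx : 0 ≤ x) :
    1 + Complex.exp (-(s * x)) ≠ 0 := by
  have := half_le_norm_one_add_exp (abs_im_mul_le hs hx)
  intro h
  rw [h, norm_zero] at this
  linarith

theorem continuousOn_tanh {s : ℂ} (hs : s ∈ sector) : ContinuousOn
    (fun x : ℝ => (1 - Complex.exp (-(s * x))) / (1 + Complex.exp (-(s * x)))) (Ici 0) :=
  ContinuousOn.div (by fun_prop) (by fun_prop) fun x hx => one_add_exp_ne_zero hs hx

theorem tendsto_tanh {s : ℂ} (hs : s ∈ sector) : Tendsto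
    (fun x : ℝ => (1 - Complex.exp (-(s * x))) / (1 + Complex.exp (-(s * x)))) atTop (𝓝 1) := by
  have h := tendsto_exp_neg_mul (re_pos_of_mem_sector hs)
  have := ((tendsto_const_nhds (x := (1 : ℂ))).sub h).div
      ((tendsto_const_nhds (x := (1 : ℂ))).add h) (by simp)
  simp only [sub_zero, add_zero, div_one] at this
  exact this

theorem contExt_tanh {s : ℂ} (hs : s ∈ sector) : ContExt
    fun x : ℝ => (1 - Complex.exp (-(s * x))) / (1 + Complex.exp (-(s * x))) :=
  ⟨continuousOn_tanh hs, 1, tendsto_tanh hs⟩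

theorem hol_tAlg : Hol S.tAlg sector := by
  refine hol_of_differentiableOn isOpen_sector (S.differentiableOn_symAlg isOpen_sector (l := 1)
    -- The numerator is at most 2 and the denominator at least 1/2.
    (C := 4) (fun w hw => continuousOn_tanh hw) (fun w hw => tendsto_tanh hw)
    (fun x hx => DifferentiableOn.div (by fun_prop) (by fun_prop)
      fun s hs => one_add_exp_ne_zero hs hx) fun w hw x hx => ?_)
  have h1 := half_le_norm_one_add_exp (abs_im_mul_le hw hx)
  rw [norm_div, div_le_iff₀ (by linarith)]
  have h2 := norm_sub_le (1 : ℂ) (Complex.exp (-(w * x)))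
  have h3 := norm_exp_neg_mul_le (re_pos_of_mem_sector hw) hx
  rw [norm_one] at h2
  linarith

end StandardOscillator

/-! ### Holomorphic families of operators -/

section Families

/-- The domain of the holomorphic extension of the pair `(Re r, Im r)`. -/
def tubeDomain : Set (ℂ × ℂ) := {p | p.2 ∈ sector ∧ |p.1.im| < p.2.re / 2}

theorem isOpen_tubeDomain : IsOpen tubeDomain :=
  (isOpen_sector.preimage continuous_snd).inter
    (isOpen_lt (Complex.continuous_im.comp continuous_fst).abs
      ((Complex.continuous_re.comp continuous_snd).div_const 2))

variable {V : Type u} [AddCommGroup V] [Module ℝ V] [TopologicalSpace V]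

/-- The complexification of a real linear functional. -/
def liftC {E : Type v} [AddCommGroup E] [Module ℝ E] (L : E →ₗ[ℝ] ℝ) : Complexification E →ₗ[ℂ] ℂ :=
  toC ∘ₗ lift L

theorem liftC_ofReal {E : Type v} [AddCommGroup E] [Module ℝ E] (L : E →ₗ[ℝ] ℝ) (x : E) :
    liftC L (ofReal x) = L x := by
  rw [liftC, LinearMap.comp_apply, lift_ofReal, toC_ofReal]

theorem hol_liftC {E : Type v} [AddCommGroup E] [Module ℝ E] [TopologicalSpace E]
    {L : E →ₗ[ℝ] ℝ} (hL : Continuous L) (U : Set (Complexification E)) : Hol (liftC L) U :=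
  Hol.linear (liftC L) (Continuous.comp (g := toC) (f := lift L) continuous_toC
    (continuous_lift hL)) U

theorem Hol.inv_comp {E : Type v} [AddCommGroup E] [Module ℂ E] [TopologicalSpace E] {f : E → ℂ}
    {U : Set E} (hU : IsOpen U) (hf : Hol f U) (h0 : ∀ x ∈ U, f x ≠ 0) :
    Hol (fun x => (f x)⁻¹) U :=
  Hol.comp (V := {0}ᶜ) (f := fun z : ℂ => z⁻¹) (g := f) hU
    (Hol.of_contDiffOn isOpen_compl_singleton (contDiffOn_inv ℂ)) hf
    (fun x hx => h0 x hx)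

/-- The analytic core, with the topology abstracted: bounded operators act through a Banach space
`B`, real coordinates are replaced by their complex linear extensions, and each operator family by
its holomorphic extension. The two families `Co` and `Si` are needed separately because the
complexification extends real operators, and cos and sin are the real functions behind γ. -/
theorem realAnalyticOn_of_families {V' : Type u} [AddCommGroup V'] [Module ℝ V']
    [TopologicalSpace V'] [ContinuousAdd V] [ContinuousSMul ℝ V]
    {B : Type w} [NormedAddCommGroup B] [NormedSpace ℂ B] (ι : V →ₗ[ℝ] V') (hι : Continuous ι)
    (T : B →ₗ[ℝ] V →ₗ[ℝ] V) (hT : Continuous fun p : B × V => T p.1 p.2)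
    (J : V →ₗ[ℝ] V) (hJ : Continuous J) (om be : V →ₗ[ℝ] V →ₗ[ℝ] ℝ)
    (hom : Continuous fun p : V × V => om p.1 p.2) (hbe : Continuous fun p : V × V => be p.1 p.2)
    {F Th : ℂ → B} (hF : Hol F sector) (hTh : Hol Th sector)
    {Co Si : ℂ × ℂ → B} (hCo : Hol Co tubeDomain) (hSi : Hol Si tubeDomain)
    (f g : ℝ → V → V) (χ : ℝ → ℝ → V → V)
    (hf : ∀ (s : ℝ) b, 0 < s → actC T (F s) (ofReal b) = ofReal (f s b))
    (hg : ∀ (s : ℝ) b, 0 < s → -lift J (actC T (Th s) (ofReal b)) = ofReal (g s b))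
    (hχ : ∀ (r s : ℝ) b, 0 < s → actC T (Co ((r : ℂ), (s : ℂ))) (ofReal b) -
      lift J (actC T (Si ((r : ℂ), (s : ℂ))) (ofReal b)) = ofReal (χ r s b)) :
    RealAnalyticOn (fun q : ℂ × Complexification V × ℂ =>
      (((q.1.re - (1 / 2) * om q.2.1.re (g q.2.2.im q.2.1.im), ι (q.2.1.re - g q.2.2.im q.2.1.im),
        q.2.2.re),
      (q.1.im + (2 * q.2.2.im)⁻¹ * (be (f q.2.2.im q.2.1.im) (f q.2.2.im q.2.1.im) -
          be (f q.2.2.im q.2.1.im) q.2.1.im) -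
        (1 / 2) * (om q.2.1.re q.2.1.im + om q.2.1.im (g q.2.2.im q.2.1.im)),
        ι (χ q.2.2.re q.2.2.im q.2.1.im), q.2.2.im)) : (ℝ × V' × ℝ) × (ℝ × V' × ℝ)))
      {q | 0 < q.2.2.im} := by
  let E := ℂ × Complexification V × ℂ
  let lz1 : E →ₗ[ℝ] ℝ := Complex.reLm ∘ₗ LinearMap.fst ℝ _ _
  let lz2 : E →ₗ[ℝ] ℝ := Complex.imLm ∘ₗ LinearMap.fst ℝ _ _
  let lr : E →ₗ[ℝ] ℝ := Complex.reLm ∘ₗ LinearMap.snd ℝ _ _ ∘ₗ LinearMap.snd ℝ _ _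
  let ls : E →ₗ[ℝ] ℝ := Complex.imLm ∘ₗ LinearMap.snd ℝ _ _ ∘ₗ LinearMap.snd ℝ _ _
  let la : E →ₗ[ℝ] V := reL ∘ₗ LinearMap.fst ℝ _ _ ∘ₗ LinearMap.snd ℝ _ _
  let lb : E →ₗ[ℝ] V := imL ∘ₗ LinearMap.fst ℝ _ _ ∘ₗ LinearMap.snd ℝ _ _
  have cz1 : Continuous lz1 := Complex.continuous_re.comp continuous_fst
  have cz2 : Continuous lz2 := Complex.continuous_im.comp continuous_fst
  have cr : Continuous lr := Complex.continuous_re.comp (continuous_snd.comp continuous_snd)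
  have cs : Continuous ls := Complex.continuous_im.comp (continuous_snd.comp continuous_snd)
  have ca : Continuous la := continuous_re.comp (continuous_fst.comp continuous_snd)
  have cb : Continuous lb := continuous_im.comp (continuous_fst.comp continuous_snd)
  -- Only the complexified coordinates Re r and Im r are restricted; all other variables enter
  -- linearly or bilinearly.
  let W : Set (Complexification E) := {q | (liftC lr q, liftC ls q) ∈ tubeDomain}
  have hcW : Continuous fun q : Complexification E => (liftC lr q, liftC ls q) :=
    (continuous_toC.comp (continuous_lift cr)).prodMk (continuous_toC.comp (continuous_lift cs))
  have hW : IsOpen W := isOpen_tubeDomain.preimage hcW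
  have h1 := hol_liftC cz1 W
  have h2 := hol_liftC cz2 W
  have hr := hol_liftC cr W
  have hs := hol_liftC cs W
  have ha := Hol.linear (lift la) (continuous_lift ca) W
  have hb := Hol.linear (lift lb) (continuous_lift cb) W
  have hact {c : Complexification E → B} (hc : Hol c W) {v : Complexification E → Complexification V}
      (hv : Hol v W) : Hol (fun q => actC T (c q) (v q)) W :=
    Hol.bilinear_comp (actC T) (continuous_actC hT) hW hc hv
  have hlJ {v : Complexification E → Complexification V} (hv : Hol v W) :
      Hol (fun q => lift J (v q)) W :=
    Hol.linear_comp (lift J) (continuous_lift hJ) hW hv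
  have hl2 {b : V →ₗ[ℝ] V →ₗ[ℝ] ℝ} (hb : Continuous fun p : V × V => b p.1 p.2)
      {v w : Complexification E → Complexification V} (hv : Hol v W) (hw : Hol w W) :
      Hol (fun q => toC (lift₂ b (v q) (w q))) W :=
    Hol.linear_comp toC continuous_toC hW
      (Hol.bilinear_comp (lift₂ b) (continuous_lift₂ hb) hW hv hw)
  have hF' : Hol (fun q => F (liftC ls q)) W :=
    Hol.comp (V := sector) (f := F) (g := liftC ls) hW hF hs fun q hq => hq.1
  have hTh' : Hol (fun q => Th (liftC ls q)) W :=
    Hol.comp (V := sector) (f := Th) (g := liftC ls) hW hTh hs fun q hq => hq.1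
  have hCo' : Hol (fun q => Co (liftC lr q, liftC ls q)) W :=
    Hol.comp (V := tubeDomain) (f := Co) (g := fun q => (liftC lr q, liftC ls q)) hW hCo
      (hr.prodMk hs) fun q hq => hq
  have hSi' : Hol (fun q => Si (liftC lr q, liftC ls q)) W :=
    Hol.comp (V := tubeDomain) (f := Si) (g := fun q => (liftC lr q, liftC ls q)) hW hSi
      (hr.prodMk hs) fun q hq => hq
  have hf' := hact hF' hb
  have hg' := (hlJ (hact hTh' hb)).neg hW
  have hχ' := (hact hCo' hb).sub hW (hlJ (hact hSi' hb))
  have h2s : Hol (fun q => (2 * liftC ls q)⁻¹) W := by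
    refine Hol.inv_comp hW (hs.const_smul hW 2) fun q hq => ?_
    refine mul_ne_zero two_ne_zero fun h0 => ?_
    have := re_pos_of_mem_sector hq.1
    simp only at this
    rw [h0] at this
    exact lt_irrefl _ this
  have o1 := h1.sub hW ((hl2 hom ha hg').const_smul hW (1 / 2))
  have o2 := ha.sub hW hg'
  have o3 := (h2.add hW (h2s.mul hW ((hl2 hbe hf' hf').sub hW (hl2 hbe hf' hb)))).sub hW
    (((hl2 hom ha hb).add hW (hl2 hom hb hg')).const_smul hW (1 / 2))
  have hR {u : Complexification E → ℂ} (hu : Hol u W) : Hol (fun q => ofC (u q)) W :=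
    Hol.linear_comp ofC continuous_ofC hW hu
  have hι' {u : Complexification E → Complexification V} (hu : Hol u W) :
      Hol (fun q => lift ι (u q)) W :=
    Hol.linear_comp (lift ι) (continuous_lift hι) hW hu
  have hP {V₁ : Type u} {V₂ : Type u} [AddCommGroup V₁] [Module ℝ V₁] [TopologicalSpace V₁]
      [AddCommGroup V₂] [Module ℝ V₂] [TopologicalSpace V₂]
      {u₁ : Complexification E → Complexification V₁} {u₂ : Complexification E → Complexification V₂}
      (hu₁ : Hol u₁ W) (hu₂ : Hol u₂ W) :
      Hol (fun q => prodMk (u₁ q, u₂ q)) W :=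
    Hol.linear_comp prodMk continuous_prodMk hW (hu₁.prodMk hu₂)
  have hP' {V₁ : Type u} [AddCommGroup V₁] [Module ℝ V₁] [TopologicalSpace V₁]
      {u₁ : Complexification E → Complexification ℝ} {u₂ : Complexification E → Complexification V₁}
      {u₃ : Complexification E → Complexification ℝ}
      (hu₁ : Hol u₁ W) (hu₂ : Hol u₂ W) (hu₃ : Hol u₃ W) :
      Hol (fun q => prodMk (u₁ q, prodMk (u₂ q, u₃ q))) W :=
    Hol.linear_comp prodMk continuous_prodMk hW (hu₁.prodMk
      (Hol.linear_comp prodMk continuous_prodMk hW (hu₂.prodMk hu₃)))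
  have hall := hP (hP' (hR o1) (hι' o2) (hR hr)) (hP' (hR o3) (hι' hχ') (hR hs))
  have hopen : IsOpen {q : E | 0 < q.2.2.im} :=
    isOpen_lt continuous_const (Complex.continuous_im.comp (continuous_snd.comp continuous_snd))
  refine RealAnalyticOn.of_hol hopen hW hall fun q hq => ⟨?_, ?_⟩
  · change (liftC lr (ofReal q), liftC ls (ofReal q)) ∈ tubeDomain
    rw [liftC_ofReal, liftC_ofReal]
    have hq' : 0 < q.2.2.im := hq
    refine ⟨?_, ?_⟩
    · change |((q.2.2.im : ℝ) : ℂ).im| < ((q.2.2.im : ℝ) : ℂ).re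
      simpa using hq'
    · change |((q.2.2.re : ℝ) : ℂ).im| < ((q.2.2.im : ℝ) : ℂ).re / 2
      simpa using hq'
  · have hq' : 0 < ls q := hq
    simp only [liftC_ofReal, lift_ofReal, hf _ _ hq', hg _ _ hq', hχ _ _ _ hq', lift₂_ofReal,
      toC_ofReal, smul_eq_mul]
    have hsub (x y : V) : (ofReal x - ofReal y : Complexification V) = ofReal (x - y) := by
      ext <;> simp
    rw [hsub, lift_ofReal]
    have e1 (x y : ℝ) : ofC ((x : ℂ) - (1 / 2) * y) = ofReal (x - (1 / 2) * y) := by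
      rw [← ofC_ofReal]; push_cast; rfl
    have e2 (x s y z y' z' : ℝ) : ofC ((x : ℂ) + (2 * s : ℂ)⁻¹ * (y - z) - (1 / 2) * (y' + z')) =
        ofReal (x + (2 * s)⁻¹ * (y - z) - (1 / 2) * (y' + z')) := by
      rw [← ofC_ofReal]; push_cast; rfl
    rw [e1, e2, ofC_ofReal, ofC_ofReal]
    simp only [prodMk_ofReal]
    rfl

end Families

/-! ### Continuity from seminorm estimates -/

section Seminorms

set_option linter.unusedSectionVars false

variable {V : Type u} [AddCommGroup V] [Module ℝ V] [TopologicalSpace V] {κ : Type*}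
  {p : SeminormFamily ℝ V κ}

theorem withSeminorms_topology {V : Type u} [AddCommGroup V] [Module ℝ V] (p : SeminormFamily ℝ V κ) :
    @WithSeminorms ℝ V κ _ _ _ p p.moduleFilterBasis.topology :=
  WithSeminorms.mk (topology := p.moduleFilterBasis.topology) rfl

theorem continuous_of_seminorm (hp : WithSeminorms p) (L : V →ₗ[ℝ] V)
    (h : ∀ i v, p i (L v) ≤ p i v) : Continuous L := by
  rw [continuous_iff_continuousAt]
  intro v₀
  rw [ContinuousAt, hp.tendsto_nhds]
  intro i ε hε
  filter_upwards [(hp.tendsto_nhds id v₀).1 tendsto_id i ε hε] with v hv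
  rw [← map_sub]
  exact (h i _).trans_lt hv

theorem continuous_of_norm_le_seminorm {X : Type v} [NormedAddCommGroup X] [Module ℝ X]
    (hp : WithSeminorms p) (L : V →ₗ[ℝ] X) {i : κ} (h : ∀ v, ‖L v‖ ≤ p i v) : Continuous L := by
  rw [continuous_iff_continuousAt]
  intro v₀
  rw [ContinuousAt, tendsto_iff_norm_sub_tendsto_zero, Metric.tendsto_nhds]
  intro ε hε
  filter_upwards [(hp.tendsto_nhds id v₀).1 tendsto_id i ε hε] with v hv
  rw [← map_sub, Real.dist_0_eq_abs, abs_norm]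
  exact (h _).trans_lt hv

theorem continuous_inner_comp {V : Type u} [TopologicalSpace V] {X : Type v} [NormedAddCommGroup X] [InnerProductSpace ℂ X]
    {L M : V → X} (hL : Continuous L) (hM : Continuous M) :
    Continuous fun q : V × V => inner ℂ (L q.2) (M q.1) :=
  (hL.comp continuous_snd).inner (hM.comp continuous_fst)

end Seminorms

/-! ### Self-adjoint elements of the function algebra -/

theorem conj_shc_ofReal (u : ℝ) : (starRingEnd ℂ) (shc u) = shc u := by
  rcases eq_or_ne u 0 with rfl | hu
  · simp [shc_zero]
  · rw [shc_ofReal hu, Complex.conj_ofReal]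

theorem conj_hFun_ofReal (u : ℝ) : (starRingEnd ℂ) (hFun u) = hFun u := by
  have h2 : (starRingEnd ℂ) 2 = 2 := Complex.conj_ofNat 2
  rw [hFun, map_mul, map_inv₀, conj_shc_ofReal, ← Complex.exp_conj, map_div₀, Complex.conj_ofReal,
    h2]

namespace StandardOscillator

variable {H : Type u} [NormedAddCommGroup H] [InnerProductSpace ℂ H] (S : StandardOscillator H)
  [CompleteSpace H]

set_option linter.unusedSectionVars false

theorem star_symAlg {φ ψ : ℝ → ℂ} (hφ : ContExt φ) (h : ∀ x, (starRingEnd ℂ) (φ x) = ψ x) :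
    star (S.symAlg φ) = S.symAlg ψ := by
  have hψ : ContExt ψ := by
    obtain ⟨hc, l, hl⟩ := hφ
    have e : ψ = fun x => (starRingEnd ℂ) (φ x) := funext fun x => (h x).symm
    rw [e]
    exact ⟨Complex.continuous_conj.comp_continuousOn hc, _,
      (Complex.continuous_conj.tendsto l).comp hl⟩
  ext q
  rw [ContinuousMap.star_apply, hφ.symAlg_apply, hψ.symAlg_apply]
  split_ifs with h0
  · obtain ⟨hc, l, hl⟩ := hφ
    have e : ψ = fun x => (starRingEnd ℂ) (φ x) := funext fun x => (h x).symm
    have hl' : Tendsto ψ atTop (𝓝 ((starRingEnd ℂ) l)) := by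
      rw [e]; exact (Complex.continuous_conj.tendsto l).comp hl
    rw [hl.limUnder_eq, hl'.limUnder_eq]; rfl
  · exact h _

theorem star_eAlg {ζ : ℂ} (hζ : 0 < ζ.re) : star (S.eAlg ζ) = S.eAlg ((starRingEnd ℂ) ζ) :=
  S.star_symAlg (contExt_exp hζ) fun x => by
    rw [← Complex.exp_conj, map_neg, map_mul, Complex.conj_ofReal]

theorem mem_sector_ofReal {s : ℝ} (hs : 0 < s) : (s : ℂ) ∈ sector := by
  simpa [sector] using hs

theorem star_hAlg {s : ℝ} (hs : 0 < s) : star (S.hAlg s) = S.hAlg s :=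
  S.star_symAlg (contExt_hFun (mem_sector_ofReal hs)) fun x => by
    rw [← Complex.ofReal_mul, conj_hFun_ofReal]

theorem star_tAlg {s : ℝ} (hs : 0 < s) : star (S.tAlg s) = S.tAlg s :=
  S.star_symAlg (contExt_tanh (mem_sector_ofReal hs)) fun x => by
    rw [map_div₀, map_sub, map_add, map_one, ← Complex.exp_conj, map_neg, map_mul,
      Complex.conj_ofReal, Complex.conj_ofReal]

/-- The action of the real parts of the elements of the function algebra. -/
def realAct : S.Alg →ₗ[ℝ] S.VO →ₗ[ℝ] S.VO :=
  mkAct (fun a v => S.act ((2⁻¹ : ℂ) • (a + star a)) v)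
    (fun a b v => by
      rw [← act_add_left, star_add]
      congr 1
      module)
    (fun r a v => by
      rw [← Complex.coe_smul, ← act_smul_left, star_smul, RCLike.star_def, Complex.conj_ofReal]
      congr 1
      module)
    (fun a v w => S.act_add_right _ v w)
    (fun r a v => by
      simp only [← Complex.coe_smul, act_smul_right])

theorem realAct_apply (a : S.Alg) (v : S.VO) :
    S.realAct a v = S.act ((2⁻¹ : ℂ) • (a + star a)) v := rfl

theorem norm_realPart_le (a : S.Alg) : ‖(2⁻¹ : ℂ) • (a + star a)‖ ≤ ‖a‖ := by
  have h := norm_add_le a (star a)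
  have h2 : ‖star a‖ = ‖a‖ := norm_star a
  rw [norm_smul, norm_inv, Complex.norm_ofNat]
  linarith

/-- For self-adjoint `a` the real part of `a` is `a` and that of `I • a` is 0, so the extended
action preserves real points. -/
theorem actC_realAct_ofReal {a : S.Alg} (ha : star a = a) (v : S.VO) :
    actC S.realAct a (ofReal v) = ofReal (S.act a v) := by
  have h1 : (2⁻¹ : ℂ) • (a + star a) = a := by rw [ha]; module
  have h2 : (2⁻¹ : ℂ) • (Complex.I • a + star (Complex.I • a)) = 0 := by
    rw [star_smul, ha, RCLike.star_def, Complex.conj_I]; module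
  have h3 : S.act 0 v = 0 := by apply S.toH_injective; simp
  have h4 (b : S.Alg) : S.act b 0 = 0 := by apply S.toH_injective; simp
  ext
  · rw [re_actC, realAct_apply, realAct_apply, h1, re_ofReal, im_ofReal, h4, add_zero, re_ofReal]
  · rw [im_actC, realAct_apply, realAct_apply, h1, h2, re_ofReal, im_ofReal, h3, h4, sub_zero,
      im_ofReal]

/-! ### The holomorphic families of the polar decomposition -/

/-- The family `f_s(A)`. -/
def famF (s : ℂ) : S.Alg := S.eAlg (s / 2) * S.hAlg s

/-- The family `cos(rA) f_s(A)`. -/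
def famCos (p : ℂ × ℂ) : S.Alg :=
  ((1 / 2 : ℂ) • (S.eAlg (p.2 / 2 - Complex.I * p.1) + S.eAlg (p.2 / 2 + Complex.I * p.1))) *
    S.hAlg p.2

/-- The family `sin(rA) f_s(A)`. -/
def famSin (p : ℂ × ℂ) : S.Alg :=
  ((-Complex.I / 2 : ℂ) • (S.eAlg (p.2 / 2 - Complex.I * p.1) - S.eAlg (p.2 / 2 + Complex.I * p.1))) *
    S.hAlg p.2

theorem hol_mulAlg {E : Type v} [AddCommGroup E] [Module ℂ E] [TopologicalSpace E] {U : Set E}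
    (hU : IsOpen U) {a b : E → S.Alg} (ha : Hol a U) (hb : Hol b U) :
    Hol (fun x => a x * b x) U :=
  Hol.bilinear_comp (LinearMap.mul ℂ S.Alg) continuous_mul hU ha hb

theorem hol_famF : Hol S.famF sector := by
  have h : Hol (fun s : ℂ => S.eAlg (s / 2)) sector := by
    have := Hol.comp_linear S.hol_eAlg ((2⁻¹ : ℂ) • LinearMap.id)
      (continuous_id.const_smul (2⁻¹ : ℂ)) isOpen_re_pos
    have e : (fun s => S.eAlg (((2⁻¹ : ℂ) • LinearMap.id : ℂ →ₗ[ℂ] ℂ) s)) = fun s => S.eAlg (s / 2) :=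
      funext fun s => congrArg S.eAlg (by simp; ring)
    rw [e] at this
    refine this.mono fun s hs => ?_
    have := re_pos_of_mem_sector hs
    simpa using this
  exact S.hol_mulAlg isOpen_sector h S.hol_hAlg

/-- The tube |Im r| < Re s / 2 is what keeps the real part of s/2 ± ir positive, hence the
exponential bounded. -/
theorem hol_eAlg_comp (c : ℂ) (hc : ‖c‖ ≤ 1) (hc' : c.re = 0) :
    Hol (fun p : ℂ × ℂ => S.eAlg (p.2 / 2 + c * p.1)) tubeDomain := by
  let L : ℂ × ℂ →ₗ[ℂ] ℂ := (2⁻¹ : ℂ) • LinearMap.snd ℂ ℂ ℂ + c • LinearMap.fst ℂ ℂ ℂ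
  have hL : Continuous L := (continuous_snd.const_smul (2⁻¹ : ℂ)).add (continuous_fst.const_smul c)
  have := Hol.comp_linear S.hol_eAlg L hL isOpen_re_pos
  have e : (fun p => S.eAlg (L p)) = fun p => S.eAlg (p.2 / 2 + c * p.1) :=
    funext fun p => congrArg S.eAlg (by simp [L]; ring)
  rw [e] at this
  refine this.mono fun p hp => ?_
  have h1 : |p.1.im| < p.2.re / 2 := hp.2
  have h2 : |c.im| ≤ 1 := (Complex.abs_im_le_norm c).trans hc
  have h3 : |c.im * p.1.im| ≤ |p.1.im| := by
    rw [abs_mul]; exact mul_le_of_le_one_left (abs_nonneg _) h2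
  have h4 := abs_le.1 h3
  have h5 : (L p).re = p.2.re / 2 - c.im * p.1.im := by
    simp [L, hc']; ring
  change 0 < (L p).re
  rw [h5]
  linarith [h4.2]

theorem hol_hAlg_snd : Hol (fun p : ℂ × ℂ => S.hAlg p.2) tubeDomain :=
  (Hol.comp_linear S.hol_hAlg (LinearMap.snd ℂ ℂ ℂ) continuous_snd isOpen_sector).mono
    fun _ hp => hp.1

theorem hol_eAlg_sub : Hol (fun p : ℂ × ℂ => S.eAlg (p.2 / 2 - Complex.I * p.1)) tubeDomain := by
  have := S.hol_eAlg_comp (-Complex.I) (by simp) (by simp)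
  simpa only [neg_mul, ← sub_eq_add_neg] using this

theorem hol_famCos : Hol S.famCos tubeDomain :=
  S.hol_mulAlg isOpen_tubeDomain ((S.hol_eAlg_sub.add isOpen_tubeDomain
    (S.hol_eAlg_comp Complex.I (by simp) (by simp))).const_smul isOpen_tubeDomain _) S.hol_hAlg_snd

theorem hol_famSin : Hol S.famSin tubeDomain :=
  S.hol_mulAlg isOpen_tubeDomain ((S.hol_eAlg_sub.sub isOpen_tubeDomain
    (S.hol_eAlg_comp Complex.I (by simp) (by simp))).const_smul isOpen_tubeDomain _) S.hol_hAlg_snd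

theorem star_famF {s : ℝ} (hs : 0 < s) : star (S.famF s) = S.famF s := by
  rw [famF, star_mul, S.star_hAlg hs, S.star_eAlg (by simpa using hs), mul_comm]
  have : (starRingEnd ℂ) ((s : ℂ) / 2) = (s : ℂ) / 2 := by
    rw [map_div₀, Complex.conj_ofReal, Complex.conj_ofNat]
  rw [this]

theorem star_eAlg_tube {s : ℝ} (hs : 0 < s) (r : ℝ) :
    star (S.eAlg (s / 2 - Complex.I * r)) = S.eAlg (s / 2 + Complex.I * r) ∧
      star (S.eAlg (s / 2 + Complex.I * r)) = S.eAlg (s / 2 - Complex.I * r) := by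
  constructor
  · rw [S.star_eAlg (by simpa using hs)]
    congr 1
    rw [map_sub, map_div₀, map_mul, Complex.conj_ofReal, Complex.conj_ofReal, Complex.conj_ofNat,
      Complex.conj_I]
    ring
  · rw [S.star_eAlg (by simpa using hs)]
    congr 1
    rw [map_add, map_div₀, map_mul, Complex.conj_ofReal, Complex.conj_ofReal, Complex.conj_ofNat,
      Complex.conj_I]
    ring

theorem star_famCos {s : ℝ} (hs : 0 < s) (r : ℝ) :
    star (S.famCos ((r : ℂ), (s : ℂ))) = S.famCos ((r : ℂ), (s : ℂ)) := by
  obtain ⟨h1, h2⟩ := S.star_eAlg_tube hs r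
  rw [famCos, star_mul, S.star_hAlg hs, star_smul, star_add, h1, h2, mul_comm, add_comm]
  congr 2
  rw [RCLike.star_def, map_div₀, map_one, Complex.conj_ofNat]

theorem star_famSin {s : ℝ} (hs : 0 < s) (r : ℝ) :
    star (S.famSin ((r : ℂ), (s : ℂ))) = S.famSin ((r : ℂ), (s : ℂ)) := by
  obtain ⟨h1, h2⟩ := S.star_eAlg_tube hs r
  rw [famSin, star_mul, S.star_hAlg hs, star_smul, star_sub, h1, h2, mul_comm]
  congr 1
  rw [RCLike.star_def, map_div₀, map_neg, Complex.conj_I, Complex.conj_ofNat]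
  module

theorem contExt_exp_hol {ζ : ℂ} (hζ : 0 < ζ.re) : S.IsSym (S.act (S.eAlg ζ))
    (fun x => Complex.exp (-(ζ * x))) := (contExt_exp hζ).isSym S

theorem act_eAlg_hAlg {s : ℝ} (hs : 0 < s) {ζ : ℂ} (hζ : 0 < ζ.re) {T : S.VO → S.VO} {h : ℝ → ℂ}
    (hT : S.IsSym T h)
    (heq : ∀ x : ℝ, hFun (s * x) * Complex.exp (-(ζ * x)) = h x) (v : S.VO) :
    S.act (S.eAlg ζ * S.hAlg s) v = T v := by
  have h1 := (S.contExt_exp_hol hζ).comp ((contExt_hFun (mem_sector_ofReal hs)).isSym S)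
    (contExt_exp hζ).1
  have h2 := h1.eq hT ((contExt_hFun (mem_sector_ofReal hs)).1.mul (contExt_exp hζ).1)
    (fun x _ => heq x) v
  rw [← h2, act_mul]
  rfl

theorem act_famF {s : ℝ} (hs : 0 < s) (v : S.VO) : S.act (S.famF s) v = S.fA s v := by
  refine S.act_eAlg_hAlg hs (by simpa using hs) (S.isSym_fA s) (fun x => ?_) v
  rw [fFun_eq, hFun, mul_right_comm, ← Complex.exp_add,
    show (s : ℂ) * x / 2 + -(s / 2 * x) = 0 by ring, Complex.exp_zero, one_mul]

/-- Combining cosine and sine gives e^{-irA}, which merges with e^{-sA/2} into a single exponential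
e^{-(s/2 + ir)A}. -/
theorem act_famCos_sub {s : ℝ} (hs : 0 < s) (r : ℝ) (v : S.VO) :
    S.act (S.famCos ((r : ℂ), (s : ℂ))) v -
      Complex.I • S.act (S.famSin ((r : ℂ), (s : ℂ))) v = S.γO (-r) (S.fA s v) := by
  have e : S.famCos ((r : ℂ), (s : ℂ)) + (-Complex.I) • S.famSin ((r : ℂ), (s : ℂ)) =
      S.eAlg (s / 2 + Complex.I * r) * S.hAlg s := by
    simp only [famCos, famSin]
    rw [← smul_mul_assoc, ← add_mul, smul_smul]
    congr 1
    have : -Complex.I * (-Complex.I / 2) = -(1 / 2) := by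
      linear_combination (1 / 2) * Complex.I_sq
    rw [this]
    module
  have h := (S.isSym_γO (-r)).comp (S.isSym_fA s) (by fun_prop)
  rw [sub_eq_add_neg, ← neg_smul, ← act_smul_left, ← act_add_left, e]
  refine S.act_eAlg_hAlg hs (by simpa using hs) h (fun x => ?_) v
  rw [fFun_eq, hFun, mul_right_comm, ← Complex.exp_add, mul_comm]
  congr 2
  push_cast
  ring

theorem act_tAlg {s : ℝ} (hs : 0 < s) (v : S.VO) :
    -(Complex.I • S.act (S.tAlg s) v) = S.gA s v := by
  have h := ((contExt_tanh (mem_sector_ofReal hs)).isSym S).const_smul (-Complex.I)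
    (contExt_tanh (mem_sector_ofReal hs)).1
  rw [← neg_smul]
  exact h.eq (S.isSym_gA s) (continuousOn_const.mul (contExt_tanh (mem_sector_ofReal hs)).1)
    (fun x _ => (gFun_eq s x).symm) v

/-- For s > 0 the quadratic term is rewritten through inner products of b and f_s(A)b. The power
series in A disappears, and with it the need for the fine topology. -/
theorem polarInv_of_pos {q : S.GC} (hq : 0 < q.2.2.im) : S.polarInv q =
    ((q.1.re - (1 / 2) * S.om q.2.1.re (S.gA q.2.2.im q.2.1.im), q.2.1.re - S.gA q.2.2.im q.2.1.im,
      q.2.2.re),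
    (q.1.im + (2 * q.2.2.im)⁻¹ * ((inner ℂ (S.toH (S.fA q.2.2.im q.2.1.im))
        (S.toH (S.fA q.2.2.im q.2.1.im))).re -
        (inner ℂ (S.toH q.2.1.im) (S.toH (S.fA q.2.2.im q.2.1.im))).re) -
      (1 / 2) * (S.om q.2.1.re q.2.1.im + S.om q.2.1.im (S.gA q.2.2.im q.2.1.im)),
      S.γO (-q.2.2.re) (S.fA q.2.2.im q.2.1.im), q.2.2.im)) := by
  have h := S.mul_kap_fA (-q.2.2.re) q.2.2.im q.2.1.im
  have h2 : (inner ℂ (S.toH (S.fA q.2.2.im q.2.1.im)) (S.toH (S.fA q.2.2.im q.2.1.im))).re =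
      ‖S.toH (S.fA q.2.2.im q.2.1.im)‖ ^ 2 := inner_self_eq_norm_sq (𝕜 := ℂ) _
  rw [polarInv]
  refine Prod.ext rfl (Prod.ext ?_ rfl)
  simp only
  rw [h2, ← inner_conj_symm (S.toH q.2.1.im), Complex.conj_re]
  have h3 : (2 * q.2.2.im)⁻¹ * (‖S.toH (S.fA q.2.2.im q.2.1.im)‖ ^ 2 -
      (inner ℂ (S.toH (S.fA q.2.2.im q.2.1.im)) (S.toH q.2.1.im)).re) =
      -((1 / 2) * S.kap q.2.2.im (S.γO (-q.2.2.re) (S.fA q.2.2.im q.2.1.im))) := by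
    rw [inv_mul_eq_iff_eq_mul₀ (by positivity)]
    linarith
  rw [h3]
  ring

/-! ### Analyticity on the semigroup -/

/-- The real part of the inner product. -/
def beL : S.VO →ₗ[ℝ] S.VO →ₗ[ℝ] ℝ :=
  LinearMap.mk₂ ℝ (fun x y => (inner ℂ (S.toH y) (S.toH x)).re)
    (fun x y z => by simp)
    (fun c x y => by
      simp only [← Complex.coe_smul, _root_.map_smul, inner_smul_right]; simp)
    (fun x y z => by simp)
    (fun c x y => by
      simp only [← Complex.coe_smul, _root_.map_smul, inner_smul_left]; simp)

/-- The multiplication by the imaginary unit. -/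
def mulI : S.VO →ₗ[ℝ] S.VO := (LinearMap.lsmul ℂ S.VO Complex.I).restrictScalars ℝ

/-- The topology enters in three ways: bounded functions of A and multiplication by i must respect
each seminorm, the norm of H must be continuous for the inner products, and ‖Av‖ must be continuous
for ω_A. The target may carry any coarser topology. -/
theorem realAnalyticOnWrt_polarInv {τ τ' : TopologicalSpace S.VO} (hττ' : τ ≤ τ') {κ : Type*}
    {p : SeminormFamily ℝ S.VO κ} (hp : @WithSeminorms ℝ S.VO κ _ _ _ p τ)
    (hpact : ∀ i (a : S.Alg) v, p i (S.act a v) ≤ ‖a‖ * p i v)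
    (hpI : ∀ i v, p i (Complex.I • v) ≤ p i v)
    (hpH : ∃ i, ∀ v, ‖S.toH v‖ ≤ p i v) (hpA : ∃ i, ∀ v, ‖S.toH (S.AO v)‖ ≤ p i v) :
    RealAnalyticOnWrt (S.topC τ) (S.topPolar τ') S.polarInv S.semigroup := by
  obtain ⟨i, hi⟩ := hpH
  obtain ⟨j, hj⟩ := hpA
  have i1 := @WithSeminorms.topologicalAddGroup ℝ S.VO κ _ _ _ τ p hp
  have i2 := @WithSeminorms.continuousSMul ℝ S.VO κ _ _ _ τ p hp
  have cJ := @continuous_of_seminorm S.VO _ _ τ κ p hp S.mulI hpI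
  have cH := @continuous_of_norm_le_seminorm S.VO _ _ τ κ p H _ _ hp
    (S.toH.restrictScalars ℝ) i hi
  have cA := @continuous_of_norm_le_seminorm S.VO _ _ τ κ p H _ _ hp
    ((S.toH ∘ₗ S.AO).restrictScalars ℝ) j hj
  have cT := @continuous_act_of_seminorm S.Alg S.VO _ _ _ _ τ κ p hp S.realAct fun k =>
    ⟨k, 1, fun b v => by
      rw [one_mul, realAct_apply]
      exact (hpact k _ v).trans
        (mul_le_mul_of_nonneg_right (S.norm_realPart_le b) (apply_nonneg _ _))⟩
  have com := @Continuous.comp _ _ _ (@instTopologicalSpaceProd _ _ τ τ) _ _ _ _ Complex.continuous_im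
    (@continuous_inner_comp S.VO τ H _ _ _ _ cH cA)
  have cbe := @Continuous.comp _ _ _ (@instTopologicalSpaceProd _ _ τ τ) _ _ _ _ Complex.continuous_re
    (@continuous_inner_comp S.VO τ H _ _ _ _ cH cH)
  have hι : @Continuous _ _ τ τ' (LinearMap.id : S.VO →ₗ[ℝ] S.VO) :=
    continuous_id_iff_le.2 hττ'
  have main := @realAnalyticOn_of_families S.VO _ _ τ S.VO _ _ τ' i1.toContinuousAdd i2 S.Alg _ _
    LinearMap.id hι S.realAct cT S.mulI cJ S.omL S.beL com cbe _ _ S.hol_famF S.hol_tAlg _ _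
    S.hol_famCos S.hol_famSin S.fA S.gA (fun r s b => S.γO (-r) (S.fA s b))
    (fun s b hs => by rw [S.actC_realAct_ofReal (S.star_famF hs), S.act_famF hs])
    (fun s b hs => by
      rw [S.actC_realAct_ofReal (S.star_tAlg hs), lift_ofReal, ← S.act_tAlg hs]
      exact ((ofRealL (E := S.VO)).map_neg _).symm)
    (fun r s b hs => by
      rw [S.actC_realAct_ofReal (S.star_famCos hs r), S.actC_realAct_ofReal (S.star_famSin hs r),
        lift_ofReal, ← S.act_famCos_sub hs]
      exact ((ofRealL (E := S.VO)).map_sub _ _).symm)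
  -- `main` concerns the formula with the factor 1/(2s), which is identified with `polarInv` on the
  -- semigroup; the holomorphic extensions are unchanged.
  refine ⟨main.1, fun x hx => ?_⟩
  obtain ⟨W, fC, h1, h2, h3⟩ := main.2 x hx
  refine ⟨W, fC, h1, h2, fun y hy hyW => (h3 y hy hyW).trans ?_⟩
  rw [S.polarInv_of_pos hy]
  rfl

theorem realAnalyticOn_polarInv : RealAnalyticOn S.polarInv S.semigroup :=
  S.realAnalyticOnWrt_polarInv le_rfl S.withSeminorms_q (fun n a v => S.q_act_le a v n)
    (fun n v => by
      have := S.q_smul n Complex.I v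
      rw [Complex.norm_I, one_mul] at this
      exact this.le)
    ⟨0, S.norm_toH_le_q 0⟩ ⟨1, fun v => by
      have := S.le_q 1 1 v
      simp only [Nat.cast_one, one_pow, Nat.factorial_one, div_one, one_mul] at this
      exact this⟩

theorem powSeminorm_apply (k : ℕ) (v : S.VO) : S.powSeminorm k v = ‖S.orb v k‖ := rfl

theorem powSeminorm_act_le (k : ℕ) (a : S.Alg) (v : S.VO) :
    S.powSeminorm k (S.act a v) ≤ ‖a‖ * S.powSeminorm k v := by
  rw [powSeminorm_apply, orb_act, ← S.norm_Phi]
  exact (S.Phi a).le_opNorm _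

theorem powSeminorm_I_smul (k : ℕ) (v : S.VO) :
    S.powSeminorm k (Complex.I • v) = S.powSeminorm k v := by
  rw [powSeminorm_apply, powSeminorm_apply, orb_smul, norm_smul, Complex.norm_I, one_mul]

theorem realAnalyticOn_polarInv_topSmooth :
    RealAnalyticOnWrt (S.topC S.topSmooth) (S.topPolar S.topSmooth) S.polarInv S.semigroup :=
  S.realAnalyticOnWrt_polarInv le_rfl (withSeminorms_topology S.powSeminorm) S.powSeminorm_act_le
    (fun k v => (S.powSeminorm_I_smul k v).le) ⟨0, fun _ => le_rfl⟩ ⟨1, fun _ => le_rfl⟩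

theorem topGraph_le_topNorm : S.topGraph ≤ S.topNorm := by
  have hg := withSeminorms_topology (fun _ : Unit => S.powSeminorm 0 + S.powSeminorm 1)
  have hn := withSeminorms_topology (fun _ : Unit => S.powSeminorm 0)
  rw [← continuous_id_iff_le, @continuous_iff_continuousAt _ _ S.topGraph S.topNorm]
  intro v₀
  refine (@WithSeminorms.tendsto_nhds ℝ S.VO S.VO Unit _ _ _ S.topNorm _ hn id _ v₀).2
    fun i ε hε => ?_
  filter_upwards [(@WithSeminorms.tendsto_nhds ℝ S.VO S.VO Unit _ _ _ S.topGraph _ hg id _ v₀).1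
    tendsto_id i ε hε] with v hv
  exact (le_add_of_nonneg_right (apply_nonneg (S.powSeminorm 1) _)).trans_lt hv

theorem realAnalyticOn_polarInv_topGraph :
    RealAnalyticOnWrt (S.topC S.topGraph) (S.topPolar S.topNorm) S.polarInv S.semigroup :=
  S.realAnalyticOnWrt_polarInv S.topGraph_le_topNorm
    (withSeminorms_topology fun _ : Unit => S.powSeminorm 0 + S.powSeminorm 1)
    (fun _ a v => by
      have h0 := S.powSeminorm_act_le 0 a v
      have h1 := S.powSeminorm_act_le 1 a v
      simp only [add_apply]
      linarith)
    (fun _ v => by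
      simp only [add_apply, powSeminorm_I_smul]
      exact le_rfl)
    ⟨(), fun v => le_add_of_nonneg_right (apply_nonneg (S.powSeminorm 1) v)⟩
    ⟨(), fun v => le_add_of_nonneg_left (apply_nonneg (S.powSeminorm 0) v)⟩

end StandardOscillator

/-! ### Holomorphic curves -/

theorem HasDirDeriv.hasDerivAt {F : Type v} [NormedAddCommGroup F] [NormedSpace ℂ F] {g : ℂ → F}
    {τ z : ℂ} {d : F} {s : ℝ} (h : HasDirDeriv g (τ + s * z) z d) :
    HasDerivAt (fun r : ℝ => g (τ + r * z)) d s := by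
  rw [hasDerivAt_iff_tendsto_slope_zero]
  refine Tendsto.congr (fun t => ?_) h
  rw [show τ + s * z + t • z = τ + (s + t : ℝ) * z by
    rw [Complex.real_smul]; push_cast; ring]

/-- The mean value inequality along the segment from τ to τ + z, applied to the function minus its
expected linear part; continuity of `d` makes the constant small. -/
theorem differentiableOn_of_hasDirDeriv {F : Type v} [NormedAddCommGroup F] [NormedSpace ℂ F]
    {g d : ℂ → F} {U : Set ℂ} (hU : IsOpen U) (hd : ContinuousOn d U)
    (h : ∀ τ ∈ U, ∀ z : ℂ, HasDirDeriv g τ z (z • d τ)) : DifferentiableOn ℂ g U := by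
  intro τ hτ
  refine (HasDerivAt.differentiableAt (f' := d τ) ?_).differentiableWithinAt
  rw [hasDerivAt_iff_isLittleO_nhds_zero, Asymptotics.isLittleO_iff]
  intro ε hε
  have hcont := (hd.continuousAt (hU.mem_nhds hτ))
  obtain ⟨ρ, hρ, hball⟩ := Metric.mem_nhds_iff.1
    (inter_mem (hU.mem_nhds hτ) (hcont (Metric.ball_mem_nhds _ hε)))
  filter_upwards [Metric.ball_mem_nhds (0 : ℂ) hρ] with z hz
  have hmem (s : ℝ) (hs : s ∈ Icc (0 : ℝ) 1) : τ + s * z ∈ Metric.ball τ ρ := by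
    rw [mem_ball_iff_norm, add_sub_cancel_left, norm_mul, Complex.norm_real]
    rw [mem_ball_zero_iff] at hz
    refine lt_of_le_of_lt (mul_le_of_le_one_left (norm_nonneg _) ?_) hz
    rw [Real.norm_eq_abs, abs_of_nonneg hs.1]; exact hs.2
  have hder (s : ℝ) (hs : s ∈ Icc (0 : ℝ) 1) :
      HasDerivAt (fun r : ℝ => g (τ + r * z) - r • (z • d τ)) (z • d (τ + s * z) - z • d τ) s := by
    have h1 := (h _ (hball (hmem s hs)).1 z).hasDerivAt
    have h2 := (hasDerivAt_id s).smul_const (z • d τ)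
    rw [one_smul] at h2
    exact h1.sub h2
  have hle := norm_image_sub_le_of_norm_deriv_le_segment_01'
    (f := fun r : ℝ => g (τ + r * z) - r • (z • d τ)) (C := ε * ‖z‖)
    (fun s hs => (hder s hs).hasDerivWithinAt) (fun s hs => by
      have := (hball (hmem s ⟨hs.1, hs.2.le⟩)).2
      rw [mem_preimage, mem_ball_iff_norm] at this
      rw [← smul_sub, norm_smul, mul_comm]
      gcongr)
  simp only [Complex.ofReal_one, Complex.ofReal_zero, one_mul, zero_mul, add_zero, one_smul,
    zero_smul, sub_zero] at hle
  convert hle using 2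
  abel

/-- Bounded linear images of a holomorphic map along complex affine lines are holomorphic. -/
theorem HolomorphicOn.differentiableOn_line {E : Type u} {F : Type v} [AddCommGroup E] [Module ℂ E]
    [TopologicalSpace E] [ContinuousAdd E] [ContinuousSMul ℂ E] [AddCommGroup F] [Module ℂ F]
    [TopologicalSpace F] [T2Space F] {X : Type w} [NormedAddCommGroup X] [NormedSpace ℂ X]
    {f : E → F} {W : Set E} (hf : HolomorphicOn f W) (L : F →ₗ[ℂ] X) (hL : Continuous L) (x e : E) :
    DifferentiableOn ℂ (fun τ : ℂ => L (f (x + τ • e))) {τ | x + τ • e ∈ W} := by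
  obtain ⟨⟨hW, hsm⟩, hlin⟩ := hf
  obtain ⟨-, df, hdf, hdfc⟩ := hsm 1
  have hline : Continuous fun τ : ℂ => x + τ • e := by fun_prop
  refine differentiableOn_of_hasDirDeriv (d := fun τ => L (df (x + τ • e, e)))
    (hW.preimage hline) ?_ fun τ hτ z => ?_
  · refine hL.comp_continuousOn (ContinuousOn.comp (g := df) (f := fun τ : ℂ => (x + τ • e, e))
      (t := W ×ˢ univ) hdfc (by fun_prop) fun τ hτ => ⟨hτ, mem_univ _⟩)
  · obtain ⟨M, hM⟩ := hlin _ hτ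
    have e1 : z • L (df (x + τ • e, e)) = L (M (z • e)) := by
      rw [tendsto_nhds_unique (hdf _ hτ e) (hM e), map_smul, map_smul]
    rw [e1]
    refine ((hL.tendsto _).comp (hM (z • e))).congr fun t => ?_
    have e2 : x + (τ + t • z) • e = x + τ • e + t • z • e := by
      rw [add_smul, Complex.real_smul, mul_smul, Complex.coe_smul, add_assoc]
    simp only [Function.comp_apply]
    rw [e2, ← Complex.coe_smul, ← Complex.coe_smul, map_smul, map_sub,
      Complex.coe_smul, Complex.coe_smul]

namespace StandardOscillator

variable {H : Type u} [NormedAddCommGroup H] [InnerProductSpace ℂ H] (S : StandardOscillator H)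
  [CompleteSpace H]

set_option linter.unusedSectionVars false

/-! ### The spectrum of an unbounded generator -/

/-- If no spectral values of R lay in (0, ρ), then 1/r would be continuous on the nonzero spectrum,
R would be invertible, and A = R⁻¹ - 1 bounded. -/
theorem exists_rad_lt (hA : ¬ S.IsBoundedGenerator) {ρ : ℝ} (hρ : 0 < ρ) :
    ∃ p, 0 < S.rad p ∧ S.rad p < ρ := by
  by_contra! hcon
  refine hA ?_
  -- This is 1/r for r ≥ ρ and 0 at r = 0, and it is continuous without any case distinction.
  let k : S.Alg := ⟨fun p => ((S.rad p / max (S.rad p) ρ ^ 2 : ℝ) : ℂ),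
    Complex.continuous_ofReal.comp (S.continuous_rad.div
      ((S.continuous_rad.max continuous_const).pow 2)
      fun p => (pow_pos (hρ.trans_le (le_max_right _ _)) 2).ne')⟩
  have hk : S.radAlg * (S.radAlg * k) = S.radAlg := by
    ext p
    change (S.rad p : ℂ) * ((S.rad p : ℂ) * ((S.rad p / max (S.rad p) ρ ^ 2 : ℝ) : ℂ)) = S.rad p
    rcases (S.rad_nonneg p).eq_or_lt with h0 | h0
    · rw [← h0]; simp
    · rw [max_eq_left (hcon p h0)]
      have : S.rad p ≠ 0 := h0.ne'
      have : (S.rad p : ℂ) ≠ 0 := by exact_mod_cast this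
      push_cast
      field_simp
  have hx (x : H) : S.resolvent (S.Phi k x) = x := by
    apply S.resolvent_injective
    have := congrArg (fun a => S.Phi a x) hk
    simp only [map_mul, Phi_radAlg] at this
    exact this
  refine ⟨‖S.Phi k‖ + 1, fun x => ?_⟩
  have h1 := S.A_resolvent (S.Phi k x)
  have h2 : (⟨S.resolvent (S.Phi k x), S.resolvent_mem _⟩ : S.A.domain) = x := Subtype.ext (hx x)
  rw [h2, hx] at h1
  rw [h1]
  refine (norm_sub_le _ _).trans ?_
  rw [add_mul, one_mul]
  gcongr
  exact (S.Phi k).le_opNorm _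

/-- The spectral variable of `A`, truncated at the resolvent value `ρ`. -/
def truncVar (ρ : ℝ) (p : spectrum ℂ S.resolvent) : ℝ := (max (S.rad p) ρ)⁻¹ - 1

theorem continuous_truncVar {ρ : ℝ} (hρ : 0 < ρ) : Continuous (S.truncVar ρ) :=
  ((S.continuous_rad.max continuous_const).inv₀ fun _ => (hρ.trans_le (le_max_right _ _)).ne').sub
    continuous_const

theorem abs_truncVar_le {ρ : ℝ} (hρ : 0 < ρ) (hρ1 : ρ ≤ 1) (p : spectrum ℂ S.resolvent) :
    |S.truncVar ρ p| ≤ ρ⁻¹ := by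
  have h1 : (max (S.rad p) ρ)⁻¹ ≤ ρ⁻¹ := inv_anti₀ hρ (le_max_right _ _)
  have h2 : 1 ≤ (max (S.rad p) ρ)⁻¹ :=
    (one_le_inv₀ (hρ.trans_le (le_max_right _ _))).2 (max_le (S.rad_le_one p) hρ1)
  rw [truncVar, abs_of_nonneg (by linarith)]
  linarith

/-- The vectors that are localized in a bounded part of the spectrum are holomorphic. -/
theorem exists_VO_of_band {ρ : ℝ} (hρ : 0 < ρ) (hρ1 : ρ ≤ 1) {g : S.Alg} (hg : ∀ p, S.rad p < ρ → g p = 0)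
    {h : H} (hgh : S.Phi g h = h) (hg1 : ‖g‖ ≤ 1) :
    ∃ v : S.VO, S.toH v = h ∧ ∀ n, S.q n v ≤ Real.exp (n * ρ⁻¹) * ‖h‖ := by
  let m : S.Alg := ⟨fun p => (S.truncVar ρ p : ℂ),
    Complex.continuous_ofReal.comp (S.continuous_truncVar hρ)⟩
  have hm (p) (hp : ρ ≤ S.rad p) : (S.rad p : ℂ) * (1 + m p) = 1 := by
    change (S.rad p : ℂ) * (1 + (((max (S.rad p) ρ)⁻¹ - 1 : ℝ) : ℂ)) = 1
    rw [max_eq_left hp]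
    have : (S.rad p : ℂ) ≠ 0 := by exact_mod_cast (hρ.trans_le hp).ne'
    push_cast
    field_simp
    ring
  have hmX (p) : ‖m p‖ ≤ ρ⁻¹ := by
    change ‖(((max (S.rad p) ρ)⁻¹ - 1 : ℝ) : ℂ)‖ ≤ _
    rw [Complex.norm_real, Real.norm_eq_abs]
    exact S.abs_truncVar_le hρ hρ1 p
  -- Since `m` equals x on the support of `g`, this is A^k h; the truncation bounds it by ρ^{-k}‖h‖.
  let a (k : ℕ) : H := S.Phi (m ^ k * g) h
  have ha (k : ℕ) : ‖a k‖ ≤ ρ⁻¹ ^ k * ‖h‖ := by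
    refine ((S.Phi _).le_opNorm _).trans ?_
    rw [norm_Phi]
    gcongr
    refine (ContinuousMap.norm_le _ (by positivity)).2 fun p => ?_
    rw [ContinuousMap.mul_apply, ContinuousMap.pow_apply, norm_mul, norm_pow, ← mul_one (ρ⁻¹ ^ k)]
    have := (g.norm_coe_le_norm p).trans hg1
    have := hmX p
    gcongr
  have hterm (n k : ℕ) : (n : ℝ) ^ k / (k.factorial : ℝ) * ‖a k‖ ≤
      (n * ρ⁻¹) ^ k / (k.factorial : ℝ) * ‖h‖ := by
    rw [mul_pow, mul_div_right_comm, mul_assoc]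
    exact mul_le_mul_of_nonneg_left (ha k) (by positivity)
  have hsum (n : ℕ) : HasSum (fun k => (n * ρ⁻¹) ^ k / (k.factorial : ℝ) * ‖h‖)
      (Real.exp (n * ρ⁻¹) * ‖h‖) := by
    refine HasSum.mul_right _ ?_
    rw [Real.exp_eq_exp_ℝ]
    exact NormedSpace.expSeries_div_hasSum_exp _
  have hs (n : ℕ) : Summable fun k => (n : ℝ) ^ k / (k.factorial : ℝ) * ‖a k‖ :=
    Summable.of_nonneg_of_le (fun k => by positivity) (hterm n) (hsum n).summable
  obtain ⟨v, hv⟩ := S.exists_VO_of_seq a (fun k => by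
    have e : S.radAlg * (m ^ k * g + m ^ (k + 1) * g) = m ^ k * g := by
      ext p
      change (S.rad p : ℂ) * (m p ^ k * g p + m p ^ (k + 1) * g p) = m p ^ k * g p
      rcases lt_or_ge (S.rad p) ρ with hp | hp
      · rw [hg p hp]; simp
      · linear_combination (m p ^ k * g p) * hm p hp
    have := congrArg (fun a => S.Phi a h) e
    simp only [map_mul, map_add, Phi_radAlg] at this
    simp only [a, map_mul]
    exact this) hs
  refine ⟨v, ?_, fun n => ?_⟩
  · have := hv 0
    rw [orb_zero] at this
    rw [this]
    simp only [a, pow_zero, one_mul]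
    exact hgh
  · rw [q_eq]
    simp only [hv]
    rw [← (hsum n).tsum_eq]
    exact Summable.tsum_le_tsum (hterm n) (hs n) (hsum n).summable

/-! ### Failure of analyticity for unbounded generators -/

/-- At (0, iv, iσ) the x-component of the inverse is f_σ(A)v. The assumed extension is restricted to
the complex lines through (0, iv, 0) in the direction (0, 0, i); continuity at 0 makes the disc and
the bound 1 uniform over all v that are small in one q_n. -/
theorem exists_curve_of_analytic (h : RealAnalyticOn S.polarInv univ) :
    ∃ (n : ℕ) (ε : ℝ), 0 < ε ∧ ∀ v, S.q n v < ε → ∃ w : ℂ → H,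
      DifferentiableOn ℂ w (Metric.ball 0 ε) ∧
      (∀ σ : ℝ, (σ : ℂ) ∈ Metric.ball (0 : ℂ) ε → w σ = S.toH (S.fA σ v)) ∧
      ∀ τ ∈ Metric.ball (0 : ℂ) ε, ‖w τ‖ ≤ 1 := by
  obtain ⟨W, fC, h0, hf, hfW⟩ := h.2 0 (mem_univ _)
  let pr : S.GO × S.GO →ₗ[ℝ] H := S.toH.restrictScalars ℝ ∘ₗ LinearMap.fst ℝ _ _ ∘ₗ
    LinearMap.snd ℝ _ _ ∘ₗ LinearMap.snd ℝ _ _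
  have hpr : Continuous pr := S.continuous_toH.comp (continuous_fst.comp
    (continuous_snd.comp continuous_snd))
  let L := extend pr
  have hL : Continuous L := continuous_extend hpr
  let e : Complexification S.GC := ofReal (0, 0, Complex.I)
  let ι : S.VO →ₗ[ℝ] Complexification S.GC := ofRealL ∘ₗ LinearMap.inr ℝ ℂ (S.VC × ℂ) ∘ₗ
    LinearMap.inl ℝ S.VC ℂ ∘ₗ ofImagL
  have hι : Continuous ι := continuous_mk (continuous_const.prodMk
    ((continuous_mk continuous_const continuous_id).prodMk continuous_const)) continuous_const
  have hσ (σ : ℝ) (v : S.VO) : ι v + (σ : ℂ) • e =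
      ofReal (0, ofImag v, Complex.I * σ) := by
    rw [Complex.coe_smul]
    have : e = ofRealL (0, 0, Complex.I) := rfl
    rw [this, ← map_smul]
    change ofRealL _ + ofRealL _ = ofRealL _
    rw [← map_add]
    congr 1
    refine Prod.ext ?_ (Prod.ext ?_ ?_)
    · simp
    · simp
      rfl
    · simp [mul_comm]
  have hval (σ : ℝ) (v : S.VO) (hv : ι v + (σ : ℂ) • e ∈ W) :
      L (fC (ι v + (σ : ℂ) • e)) = S.toH (S.fA σ v) := by
    rw [hσ] at hv ⊢
    rw [hfW _ (mem_univ _) hv]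
    simp only [L]
    rw [extend_ofReal]
    change S.toH (S.γO (-(Complex.I * σ).re) (S.fA (Complex.I * σ).im v)) = _
    have e1 : (Complex.I * (σ : ℂ)).re = 0 := by simp
    have e2 : (Complex.I * (σ : ℂ)).im = σ := by simp
    rw [e1, e2, neg_zero, toH_γO, S.map_zero]
  have hW : IsOpen W := hf.1.1
  have hfc : ContinuousOn fC W := hf.1.2 0
  have hι0 : ι 0 + (0 : ℂ) • e = ofReal 0 := by
    rw [map_zero, zero_smul, add_zero]
    exact (map_zero (ofRealL (E := S.GC))).symm
  have hcQ : Continuous fun x : ℂ × S.VO => ι x.2 + x.1 • e :=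
    (hι.comp continuous_snd).add (continuous_fst.smul continuous_const)
  have hL0 : L (fC (ofReal 0)) = 0 := by
    have h1 := hval 0 0
    rw [Complex.ofReal_zero, hι0] at h1
    rw [h1 h0, fA_eq]
    have : S.act (S.symAlg (fFun 0)) 0 = 0 := by apply S.toH_injective; simp
    rw [this, map_zero]
  clear_value ι e L
  have hN : {x : ℂ × S.VO | ι x.2 + x.1 • e ∈ W ∧ ‖L (fC (ι x.2 + x.1 • e))‖ < 1} ∈
      𝓝 ((0 : ℂ), (0 : S.VO)) := by
    have h1 : {y | y ∈ W ∧ ‖L (fC y)‖ < 1} ∈ 𝓝 (ofReal (0 : S.GC)) := by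
      refine inter_mem (hW.mem_nhds h0) ?_
      have := ((hL.comp_continuousOn hfc).continuousAt (hW.mem_nhds h0)).norm
      refine this.eventually (gt_mem_nhds ?_)
      change ‖L (fC (ofReal 0))‖ < 1
      rw [hL0, norm_zero]
      exact one_pos
    exact hcQ.tendsto' (0, 0) (ofReal 0) hι0 h1
  obtain ⟨N₁, hN₁, N₂, hN₂, hNN⟩ := mem_nhds_prod_iff.1 hN
  obtain ⟨ε₁, hε₁, hb₁⟩ := Metric.mem_nhds_iff.1 hN₁
  obtain ⟨s, ε₂, hε₂, hb₂⟩ := (S.withSeminorms_q.mem_nhds_iff _ _).1 hN₂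
  have hball (v : S.VO) (hv : S.q (s.sup id) v < ε₂) : v ∈ N₂ := by
    refine hb₂ ?_
    rw [Seminorm.mem_ball, sub_zero]
    refine Seminorm.finset_sup_apply_lt hε₂ fun i hi => lt_of_le_of_lt ?_ hv
    exact S.q_mono (Finset.le_sup (f := id) hi) v
  have hmem {τ : ℂ} {v : S.VO} (hτ : τ ∈ Metric.ball (0 : ℂ) (min ε₁ ε₂))
      (hv : S.q (s.sup id) v < min ε₁ ε₂) :
      ι v + τ • e ∈ W ∧ ‖L (fC (ι v + τ • e))‖ < 1 := by
    have h1 : (τ, v) ∈ N₁ ×ˢ N₂ :=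
      mk_mem_prod (hb₁ (Metric.ball_subset_ball (min_le_left _ _) hτ))
        (hball v (hv.trans_le (min_le_right _ _)))
    exact hNN h1
  have hd (v : S.VO) := hf.differentiableOn_line L hL (ι v) e
  refine ⟨s.sup id, min ε₁ ε₂, lt_min hε₁ hε₂, fun v hv => ⟨fun τ => L (fC (ι v + τ • e)), ?_, ?_, ?_⟩⟩
  · exact (hd v).mono fun τ hτ => (hmem hτ hv).1
  · exact fun σ hσ => hval σ v (hmem hσ hv).1
  · exact fun τ hτ => (hmem hτ hv).2.le

theorem eqOn_ball_of_real {X : Type*} [NormedAddCommGroup X] [NormedSpace ℂ X] [CompleteSpace X]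
    {F : ℂ → X} {ε : ℝ} (hε : 0 < ε) (hF : DifferentiableOn ℂ F (Metric.ball 0 ε)) {c : X}
    (hc : ∀ σ : ℝ, (σ : ℂ) ∈ Metric.ball (0 : ℂ) ε → F σ = c) : EqOn F (fun _ => c) (Metric.ball 0 ε) := by
  refine (hF.analyticOnNhd Metric.isOpen_ball).eqOn_of_preconnected_of_frequently_eq
    analyticOnNhd_const (convex_ball _ _).isPreconnected (Metric.mem_ball_self hε) ?_
  have h1 : Tendsto (fun σ : ℝ => (σ : ℂ)) (𝓝[≠] 0) (𝓝[≠] 0) := by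
    refine tendsto_nhdsWithin_iff.2 ⟨?_, ?_⟩
    · exact (Complex.continuous_ofReal.tendsto' 0 0 Complex.ofReal_zero).mono_left
        nhdsWithin_le_nhds
    · filter_upwards [self_mem_nhdsWithin] with σ hσ
      simpa using hσ
  refine h1.frequently (Eventually.frequently ?_)
  have h2 : ∀ᶠ σ : ℝ in 𝓝[≠] 0, (σ : ℂ) ∈ Metric.ball (0 : ℂ) ε :=
    (h1.mono_right nhdsWithin_le_nhds).eventually (Metric.ball_mem_nhds _ hε)
  exact h2.mono hc

/-- A vector u localized near a large spectral value x₀ is recovered from its extended curve w by u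
= (sinh(τA)/(τA))w(τ). At τ = iπ/x₀ the multiplier sin(ηx)/(ηx), with η = π/x₀, vanishes at x₀ and
is small on a narrow band around it, while ‖w‖ ≤ 1; this contradicts the prescribed norm of u. -/
theorem not_realAnalyticOn_polarInv (hA : ¬ S.IsBoundedGenerator) :
    ¬ RealAnalyticOn S.polarInv univ := by
  intro han
  obtain ⟨n, ε, hε, hcurve⟩ := S.exists_curve_of_analytic han
  obtain ⟨p₀, hr0, hr1⟩ := S.exists_rad_lt hA (ρ := (1 + Real.pi / ε)⁻¹) (by positivity)
  set r₀ := S.rad p₀ with hr₀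
  -- the spectral value `x₀` and the imaginary time at which `sinc` vanishes on it
  set x₀ := r₀⁻¹ - 1 with hx₀
  have hx₀ε : Real.pi / ε < x₀ := by
    have := (lt_inv_comm₀ hr0 (by positivity)).1 hr1
    linarith
  have hx₀pos : 0 < x₀ := lt_trans (by positivity) hx₀ε
  set η := Real.pi / x₀ with hη
  have hηε : η < ε := by
    rw [hη, div_lt_iff₀ hx₀pos]
    rw [div_lt_iff₀ hε] at hx₀ε
    linarith
  have hη0 : 0 < η := by positivity
  set ρ := r₀ / 2 with hρdef
  have hρ : 0 < ρ := by positivity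
  have hρ1 : ρ ≤ 1 := by have := S.rad_le_one p₀; linarith
  -- The multiplier as a function of r, with x truncated below r = ρ so that it is continuous on all
  -- of ℝ.
  let sn : ℝ → ℂ := fun r => shc (Complex.I * η * (((max r ρ)⁻¹ - 1 : ℝ) : ℂ))
  have hsn : Continuous sn := by
    have h1 : Continuous fun r : ℝ => (max r ρ)⁻¹ - 1 :=
      ((continuous_id.max continuous_const).inv₀
        fun _ => (hρ.trans_le (le_max_right _ _)).ne').sub continuous_const
    exact continuous_shc.comp (continuous_const.mul (Complex.continuous_ofReal.comp h1))
  have hsn0 : sn r₀ = 0 := by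
    have h1 := mul_shc (Complex.I * Real.pi)
    have h2 : Complex.exp (Complex.I * Real.pi) - Complex.exp (-(Complex.I * Real.pi)) = 0 := by
      rw [mul_comm, Complex.exp_neg, Complex.exp_pi_mul_I]; norm_num
    rw [h2, zero_div] at h1
    have h3 : max r₀ ρ = r₀ := max_eq_left (by linarith)
    have h4 : η * x₀ = Real.pi := div_mul_cancel₀ _ hx₀pos.ne'
    change shc (Complex.I * η * (((max r₀ ρ)⁻¹ - 1 : ℝ) : ℂ)) = 0
    rw [h3, ← hx₀, mul_assoc, ← Complex.ofReal_mul, h4]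
    refine (mul_eq_zero.1 h1).resolve_left (mul_ne_zero Complex.I_ne_zero ?_)
    exact_mod_cast Real.pi_ne_zero
  -- A vector of norm c in the band has q_n at most e^{n/ρ}c = ε/2, hence lies in the range of the
  -- hypothesis. The band depends on c only afterwards, through Δ, so the choice is not circular.
  set c := ε / (2 * Real.exp (n * ρ⁻¹)) with hc
  have hc0 : 0 < c := by positivity
  obtain ⟨Δ', hΔ', hball⟩ := Metric.mem_nhds_iff.1 (hsn.continuousAt.preimage_mem_nhds
    (Metric.ball_mem_nhds (sn r₀) (half_pos hc0)))
  set Δ := min Δ' ρ with hΔdef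
  have hΔ : 0 < Δ := lt_min hΔ' hρ
  -- A plateau function for the band: `g` equals 1 on the support of the bump `k`, so every vector
  -- in the range of `S.Phi k` is fixed by `S.Phi g`; the bump has value 1 at p₀, so this range is
  -- nonzero.
  let g : S.Alg := ⟨fun p => ((min 1 (max 0 (2 - 2 * |S.rad p - r₀| / Δ)) : ℝ) : ℂ), by
    have := S.continuous_rad; fun_prop⟩
  let k : S.Alg := ⟨fun p => ((max 0 (1 - 2 * |S.rad p - r₀| / Δ) : ℝ) : ℂ), by
    have := S.continuous_rad; fun_prop⟩
  have hgsupp (p) (hp : Δ ≤ |S.rad p - r₀|) : g p = 0 := by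
    change ((min 1 (max 0 (2 - 2 * |S.rad p - r₀| / Δ)) : ℝ) : ℂ) = 0
    have : 2 ≤ 2 * |S.rad p - r₀| / Δ := by rw [le_div_iff₀ hΔ]; linarith
    rw [max_eq_left (by linarith), min_eq_right zero_le_one, Complex.ofReal_zero]
  have hgρ (p) (hp : S.rad p < ρ) : g p = 0 := by
    refine hgsupp p ?_
    rw [abs_sub_comm]
    refine le_trans ?_ (le_abs_self _)
    have := min_le_right Δ' ρ
    linarith
  have hg1 : ‖g‖ ≤ 1 := by
    refine (ContinuousMap.norm_le _ zero_le_one).2 fun p => ?_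
    change ‖((min 1 (max 0 (2 - 2 * |S.rad p - r₀| / Δ)) : ℝ) : ℂ)‖ ≤ 1
    rw [Complex.norm_real, Real.norm_eq_abs, abs_of_nonneg (le_min zero_le_one (le_max_left _ _))]
    exact min_le_left _ _
  have hgk : g * k = k := by
    ext p
    change ((min 1 (max 0 (2 - 2 * |S.rad p - r₀| / Δ)) : ℝ) : ℂ) *
      ((max 0 (1 - 2 * |S.rad p - r₀| / Δ) : ℝ) : ℂ) =
      ((max 0 (1 - 2 * |S.rad p - r₀| / Δ) : ℝ) : ℂ)
    rcases le_or_gt (2 * |S.rad p - r₀| / Δ) 1 with hp | hp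
    · rw [max_eq_right (by linarith : (0 : ℝ) ≤ 2 - 2 * |S.rad p - r₀| / Δ),
        min_eq_left (by linarith), Complex.ofReal_one, one_mul]
    · rw [max_eq_left (by linarith : (1 : ℝ) - 2 * |S.rad p - r₀| / Δ ≤ 0), Complex.ofReal_zero,
        mul_zero]
  have hk : S.Phi k ≠ 0 := by
    rw [← norm_pos_iff, norm_Phi]
    refine lt_of_lt_of_le ?_ (k.norm_coe_le_norm p₀)
    change 0 < ‖((max 0 (1 - 2 * |S.rad p₀ - r₀| / Δ) : ℝ) : ℂ)‖
    simp [← hr₀]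
  obtain ⟨h, hh⟩ : ∃ h, S.Phi k h ≠ 0 := by
    by_contra! hcon
    exact hk (ContinuousLinearMap.ext hcon)
  have hnorm : 0 < ‖S.Phi k h‖ := norm_pos_iff.2 hh
  set u := ((c / ‖S.Phi k h‖ : ℝ) : ℂ) • S.Phi k h with hu
  have hun : ‖u‖ = c := by
    rw [hu, norm_smul, Complex.norm_real, Real.norm_eq_abs, abs_of_pos (by positivity),
      div_mul_cancel₀ _ hnorm.ne']
  have hgu : S.Phi g u = u := by
    have := congrArg (fun a => S.Phi a h) hgk
    simp only [map_mul] at this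
    rw [hu, map_smul]
    congr 1
  obtain ⟨v, hv, hqv⟩ := S.exists_VO_of_band hρ hρ1 hgρ hgu hg1
  obtain ⟨w, hwd, hwr, hwn⟩ := hcurve v (by
    refine (hqv n).trans_lt ?_
    have h1 : Real.exp (n * ρ⁻¹) * c = ε / 2 := by
      rw [hc]; field_simp
    rw [hun, h1]
    linarith)
  -- Localizing by `g` makes sinh(τA)/(τA) a bounded operator, entire in τ.
  let K : ℂ → S.Alg := fun τ => ⟨fun p => shc (τ * (S.truncVar ρ p : ℂ)) * g p,
    (continuous_shc.comp (continuous_const.mul (Complex.continuous_ofReal.comp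
      (S.continuous_truncVar hρ)))).mul g.continuous⟩
  have hK : DifferentiableOn ℂ K univ := by
    refine differentiableOn_of_eval isOpen_univ (fun p => ?_) fun τ₀ _ => ?_
    · exact ((differentiable_shc.comp (by fun_prop : Differentiable ℂ fun τ : ℂ =>
        τ * (S.truncVar ρ p : ℂ))).mul_const _).differentiableOn
    · obtain ⟨C, hC⟩ := (isCompact_closedBall (0 : ℂ) ((‖τ₀‖ + 1) * ρ⁻¹)).exists_bound_of_continuousOn
        continuous_shc.continuousOn
      have hC0 : 0 ≤ C := (norm_nonneg _).trans (hC 0 (Metric.mem_closedBall_self (by positivity)))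
      refine ⟨C, ?_⟩
      filter_upwards [Metric.ball_mem_nhds τ₀ one_pos] with τ hτ
      refine (ContinuousMap.norm_le _ hC0).2 fun p => ?_
      change ‖shc (τ * (S.truncVar ρ p : ℂ)) * g p‖ ≤ C
      have h1 : ‖τ‖ ≤ ‖τ₀‖ + 1 := by
        have := norm_sub_norm_le τ τ₀
        rw [mem_ball_iff_norm] at hτ
        linarith
      have h2 : ‖shc (τ * (S.truncVar ρ p : ℂ))‖ ≤ C := by
        refine hC _ ?_
        rw [mem_closedBall_zero_iff, norm_mul, Complex.norm_real, Real.norm_eq_abs]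
        have := S.abs_truncVar_le hρ hρ1 p
        gcongr
      rw [norm_mul, ← mul_one C]
      have := (g.norm_coe_le_norm p).trans hg1
      gcongr
  have hF : DifferentiableOn ℂ (fun τ => S.Phi (K τ) (w τ)) (Metric.ball 0 ε) := by
    let Φ : S.Alg →L[ℂ] H →L[ℂ] H :=
      S.Phi.toAlgHom.toLinearMap.mkContinuous 1 fun a => by
        rw [one_mul]; exact (S.norm_Phi a).le
    exact (Φ.differentiable.comp_differentiableOn (hK.mono (subset_univ _))).clm_apply hwd
  have hFr (σ : ℝ) (hσ : (σ : ℂ) ∈ Metric.ball (0 : ℂ) ε) : S.Phi (K σ) (w σ) = u := by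
    have hKs : K σ * S.symAlg (fFun σ) = g := by
      ext p
      change shc (σ * (S.truncVar ρ p : ℂ)) * g p * S.symAlg (fFun σ) p = g p
      rcases lt_or_ge (S.rad p) ρ with hp | hp
      · rw [hgρ p hp]; simp
      · rw [(contExt_fFun σ).symAlg_apply, if_neg (hρ.trans_le hp).ne', fFun_eq, truncVar,
          max_eq_left hp, var, mul_right_comm, mul_inv_cancel₀, one_mul]
        rw [← Complex.ofReal_mul]
        exact shc_ne_zero _
    rw [hwr σ hσ, fA_eq, toH_act, hv, ← mul_apply_eq_comp, ← map_mul, hKs, hgu]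
  have hη' : Complex.I * η ∈ Metric.ball (0 : ℂ) ε := by
    rw [mem_ball_zero_iff, norm_mul, Complex.norm_I, one_mul, Complex.norm_real, Real.norm_eq_abs,
      abs_of_pos hη0]
    exact hηε
  have hfin := eqOn_ball_of_real hε hF hFr hη'
  have hKn : ‖K (Complex.I * η)‖ ≤ c / 2 := by
    refine (ContinuousMap.norm_le _ (by positivity)).2 fun p => ?_
    change ‖sn (S.rad p) * g p‖ ≤ c / 2
    rcases lt_or_ge |S.rad p - r₀| Δ with hp | hp
    · have h1 : S.rad p ∈ Metric.ball r₀ Δ' := by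
        rw [Metric.mem_ball, Real.dist_eq]
        exact hp.trans_le (min_le_left _ _)
      have h2 := hball h1
      rw [mem_preimage, hsn0, mem_ball_zero_iff] at h2
      rw [norm_mul, ← mul_one (c / 2)]
      have := (g.norm_coe_le_norm p).trans hg1
      gcongr
    · rw [hgsupp p hp, mul_zero, norm_zero]
      positivity
  -- The norm of u is c, but it is at most ‖K(iη)‖ ‖w(iη)‖ ≤ c/2.
  have hle : ‖u‖ ≤ c / 2 * 1 := by
    rw [← show S.Phi (K (Complex.I * η)) (w (Complex.I * η)) = u from hfin]
    refine ((S.Phi _).le_opNorm _).trans ?_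
    rw [norm_Phi]
    exact mul_le_mul hKn (hwn _ hη') (norm_nonneg _) (by positivity)
  rw [hun] at hle
  linarith

end StandardOscillator

end OscPolar

end

theorem proposition3p13 {H : Type*} [NormedAddCommGroup H] [InnerProductSpace ℂ H]
    [CompleteSpace H] [Nontrivial H] (S : StandardOscillator H) :
    ∃ φ : S.GC → S.GO × S.GO,
      -- `φ` is the inverse of the polar map `ψ`, on the whole group and on the semigroup
      (Function.LeftInverse φ S.polarMap ∧ Function.RightInverse φ S.polarMap) ∧
      (BijOn S.polarMap (univ ×ˢ S.cone) S.semigroup ∧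
        BijOn φ S.semigroup (univ ×ˢ S.cone)) ∧
      -- explicit form of `φ (z, y, r) = (g, (t, x, s))`
      (∀ (z : ℂ) (y : S.VC) (r : ℂ) (g : S.GO) (t : ℝ) (x : S.VO) (s : ℝ),
        φ (z, y, r) = (g, (t, x, s)) ↔
          s = r.im ∧ x = S.γO (-r.re) (S.fA s y.im) ∧
          S.mulC (S.incl g) (Complex.I * (t : ℂ), 0, 0) =
            S.mulC (S.mulC (z, y, 0) (S.theta y.im r.im)) (0, 0, (r.re : ℂ))) ∧
      -- the whole group: `ψ` is an analytic diffeomorphism with smooth inverse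
      (SmoothOn S.polarMap univ ∧ RealAnalyticOn S.polarMap univ ∧ SmoothOn φ univ) ∧
      (¬ S.IsBoundedGenerator → ¬ RealAnalyticOn φ univ) ∧
      -- the semigroup: `ψ` is a diffeomorphism, analytic in both directions
      (SmoothOn S.polarMap (univ ×ˢ S.cone) ∧ RealAnalyticOn S.polarMap (univ ×ˢ S.cone) ∧
        SmoothOn φ S.semigroup ∧ RealAnalyticOn φ S.semigroup) ∧
      -- coarser topologies on the semigroup
      RealAnalyticOnWrt (S.topC S.topSmooth) (S.topPolar S.topSmooth) φ S.semigroup ∧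
      RealAnalyticOnWrt (S.topC S.topGraph) (S.topPolar S.topNorm) φ S.semigroup := by
  exact ⟨S.polarInv, ⟨S.polarInv_polarMap, S.polarMap_polarInv⟩,
    ⟨S.bijOn_polarMap, S.bijOn_polarInv⟩, S.polarInv_eq_iff,
    ⟨S.smoothOn_polarMap isOpen_univ, S.realAnalyticOn_polarMap, S.smoothOn_polarInv isOpen_univ⟩,
    S.not_realAnalyticOn_polarInv,
    ⟨S.smoothOn_polarMap S.isOpen_cone,
      S.realAnalyticOn_polarMap.mono S.isOpen_cone (subset_univ _),
      S.smoothOn_polarInv S.isOpen_semigroup, S.realAnalyticOn_polarInv⟩,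
    S.realAnalyticOn_polarInv_topSmooth, S.realAnalyticOn_polarInv_topGraph⟩
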